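/- **The model.** Fix a coupling constant $\lambda\in\mathbb{C}\setminus\{0\}$. A renormalised cubic matrix model (Kontsevich model) of spectral dimension below $8$ is given by a non-decreasing function $e$ on $[0,\infty)$ with $e(0)=0$, a positive measure $r(x)\,dx$ on $[0,\infty)$ (point masses allowed) with $\int (1+2e(x))^{-4}r(x)\,dx<\infty$, a constant $c\in\mathbb{C}\setminus(-\infty,-1]$, and renormalisation constants $Z\neq0$ (bounded) and $\nu$ that may depend on a cut-off $\Lambda^2$. Let $\int dt\,\tilde\varrho(t)\,\phi(t):=8\lambda^2\int_0^{\Lambda^2}\phi\big(\sqrt{(1+2e(x))^2+c}\big)\,r(x)\,dx$. Its Kontsevich times are $$\varrho_l=\lim_{\Lambda^2\to\infty}\Big(\frac{\delta_{l,0}}{\sqrt Z}-\frac12\int dt\,\frac{\tilde\varrho(t)}{t^{3+2l}}\Big),\qquad l\ge 0,$$ assumed to exist with $\varrho_0\ne0$. Put $\mathcal G_0(z)=\frac1{2\lambda}\big(\frac z{\sqrt Z}-\lambda\nu+\frac12\int dt\,\frac{\tilde\varrho(t)}{(z+t)t}\big)$ and $\hat K_zf(z)=2\lambda\mathcal G_0(z)f(z)+\lambda\nu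 f(z)+\frac12\int dt\,\tilde\varrho(t)\frac{f(z)-f(t)}{z^2-t^2}$. The correlation functions $\mathcal G_g(z_1,\dots,z_b)$, $g\ge0$, $b\ge1$, $(g,b)\ne(0,1)$, are the symmetric solution of the Schwinger–Dyson equations $$\hat K_{z_1}\mathcal G_g(z_1,J)+\lambda\,\mathcal G_{g-1}(z_1,z_1,J)+\lambda\sum_{\substack{I\uplus I'=J\\h+h'=g}}{}^{\!\!\!\prime}\ \mathcal G_h(z_1,I)\,\mathcal G_{h'}(z_1,I')+(2\lambda)^3\sum_{\zeta\in J}\frac1\zeta\frac{\partial}{\partial\zeta}\frac{\mathcal G_g(z_1,J\setminus\{\zeta\})-\mathcal G_g(\zeta,J\setminus\{\zeta\})}{z_1^2-\zeta^2}=0$$ for $J=\{z_2,\dots,z_b\}$ (as a limit $\Lambda^2\to\infty$; $\mathcal G_{-1}=0$; $\sum'$ omits $(h,I)=(0,\emptyset)$ and $(h,I)=(g,J)$) among rational functions bounded at infinity whose only poles are at $z_i=0$ (and at $z_1=-z_2$ for $(g,b)=(0,2)$), odd in each variable if $2g+b>2$. **The free energies.** Define $$\hat{\mathrm A}^\dagger_z=\sum_{l\ge0}\Big(-\frac{(3+2l)\varrho_{l+1}}{\varrho_0z^3}+\frac{3+2l}{z^{5+2l}}\Big)\frac{\partial}{\partial\varrho_l},\qquad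 \hat{\mathrm A}_{\check z}f(\bullet)=-\sum_{l\ge0}\operatorname*{Res}_{z\to0}\Big[\frac{z^{4+2l}\varrho_l}{3+2l}f(z)\,dz\Big].$$ For $g\ge2$ the free energy $F_g(\varrho)$ is the function of the Kontsevich times, a polynomial in the $\varrho_l$ divided by a power of $\varrho_0$, such that for every model with coupling $\lambda$ $$\mathcal G_g(z)=(2\lambda)^3\hat{\mathrm A}^\dagger_zF_g,\qquad F_g=\frac{1}{(2g-2)(2\lambda)^3}\hat{\mathrm A}_{\check z}\mathcal G_g(\bullet).$$ **Theorem.** The correlation functions exist for every such model, the free energies $F_g$ ($g\ge2$) exist, and, for all $\varrho=(\varrho_0,\varrho_1,\dots)$ with $\varrho_0\ne0$, as formal power series in $V^{-2}$, the stable partition function is $$\mathcal Z^{stable}_V:=\exp\Big(\sum_{g=2}^\infty V^{2-2g}F_g(\varrho)\Big)=\exp\Big(-\frac{(2\lambda)^4}{V^2}\Delta_\varrho+V^{-2}F_2(\varrho)\Big)1,$$ where $$F_2=(2\lambda)^4\Big(-\frac{21\varrho_1^3}{160\varrho_0^5}+\frac{29}{128}\frac{\varrho_1\varrho_2}{\varrho_0^4}-\frac{35}{384}\frac{\varrho_3}{\varrho_0^3}\Big),$$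 \begin{align*} \Delta_\varrho={}&-\Big(-\frac{6\varrho_1^3}{5\varrho_0^3}+\frac{111\varrho_1\varrho_2}{70\varrho_0^2}-\frac{\varrho_3}{2\varrho_0}\Big)\frac{\partial^2}{\partial\varrho_0^2}-\Big(\frac{2\varrho_1^3}{\varrho_0^4}-\frac{1097\varrho_1\varrho_2}{280\varrho_0^3}+\frac{41\varrho_3}{24\varrho_0^2}\Big)\frac{\partial}{\partial\varrho_0}\\ &-\sum_{k\ge1}(3+2k)\Big(\Big(-\frac{2\varrho_1^2}{5\varrho_0^3}+\frac{2\varrho_2}{7\varrho_0^2}\Big)\varrho_{k+1}-\frac{3\mathcal R_{k+2}\varrho_1}{2\varrho_0}+\frac{3\mathcal R_{k+3}}{2}\Big)\frac{\partial^2}{\partial\varrho_k\partial\varrho_0}\\ &+\sum_{k,l\ge1}(3+2k)(3+2l)\Big(\frac{\varrho_1\varrho_{l+1}\varrho_{k+1}}{30\varrho_0^3}+\frac{\varrho_{k+1}\mathcal R_{l+2}}{4\varrho_0}+\frac{\varrho_{l+1}\mathcal R_{k+2}}{4\varrho_0}-\frac{\mathcal R_{k+l+3}}{4}\Big)\frac{\partial^2}{\partial\varrho_k\partial\varrho_l}\\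 &-\sum_{k\ge1}(3+2k)\Big(\Big(\frac{19\varrho_1^2}{60\varrho_0^4}-\frac{25\varrho_2}{84\varrho_0^3}\Big)\varrho_{k+1}+\frac{\varrho_1\mathcal R_{k+2}}{16\varrho_0^2}-\frac{\mathcal R_{k+3}}{16\varrho_0}-\frac{(5+2k)\varrho_1\varrho_{k+2}}{30\varrho_0^3}-\frac{(5+2k)\mathcal R_{k+3}}{2\varrho_0}\Big)\frac{\partial}{\partial\varrho_k}, \end{align*} and, for $m\ge1$, $$\mathcal R_m(\varrho)=-\frac23\sum_{k=1}^m\frac{k\varrho_k}{(3+2k)\varrho_0}\frac{S_{m-k}(\varrho)}{(m-k)!},\qquad S_m(\varrho)=\frac{d^m}{d\tau^m}\Big|_{\tau=0}\Big(\sum_{l\ge0}\frac{\varrho_l}{\varrho_0}\tau^l\Big)^{-1}.$$ -/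

import Mathlib

open Filter Topology MeasureTheory

noncomputable section

/-! ## The renormalised cubic matrix model (Kontsevich model) and its correlation functions -/

/-- The data of the renormalised cubic matrix model with coupling constant `lam` in the large-matrix
limit: the spectral function `e`, the spectral measure `r` (written `r(x) dx` in the continuum; sums
of point masses give finite matrices), the shift `c`, and the renormalisation constants `Z` and `nu`,
which may depend on the cut-off `L = Λ²`. The integrability condition says that the spectral
dimension is below `8` (for `e(x) ∼ x`, `r(x) ∼ x ^ (𝔇 / 2 - 1)`). A model with a finite cut-off is
one with `r` supported on a bounded interval. -/
structure CubicModel (lam : ℂ) where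
  e : ℝ → ℝ
  r : Measure ℝ
  c : ℂ
  Z : ℝ → ℂ
  nu : ℝ → ℂ
  e_zero : e 0 = 0
  e_mono : MonotoneOn e (Set.Ici 0)
  integrable : IntegrableOn (fun x => ((1 + 2 * e x) ^ 4)⁻¹) (Set.Ici 0) r
  /-- `c ∉ (-∞, -1]` -/
  c_mem : 1 + c ∈ Complex.slitPlane
  Z_ne_zero : ∀ L, Z L ≠ 0
  Z_bounded : ∃ B : ℝ, ∀ L, ‖Z L‖ ≤ B

namespace CubicModel

variable {lam : ℂ} (M : CubicModel lam)

/-- The uniformising variable `z(x) = √((1 + 2 e(x))² + c)`. -/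
def pt (x : ℝ) : ℂ := ((1 + 2 * (M.e x : ℂ)) ^ 2 + M.c) ^ (1 / 2 : ℂ)

/-- The integral `∫ dt ϱ̃(t) φ(t)` over the cut, up to the cut-off `L`. In the variable `x` with
`t = z(x)` the measure `ϱ̃(t) dt` is `8 λ² r(x) dx`. -/
def cutIntegral (L : ℝ) (φ : ℂ → ℂ) : ℂ :=
  ∫ x in Set.Icc 0 L, 8 * lam ^ 2 * φ (M.pt x) ∂M.r

/-- `√Z` at cut-off `L`. -/
def sqrtZ (L : ℝ) : ℂ := (M.Z L) ^ (1 / 2 : ℂ)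

/-- The planar 1-point function `𝒢₀(z)` at cut-off `L`. -/
def planar (L : ℝ) (z : ℂ) : ℂ :=
  1 / (2 * lam) *
    (z / M.sqrtZ L - lam * M.nu L + 1 / 2 * M.cutIntegral L (fun t => 1 / ((z + t) * t)))

/-- The integral operator `K̂_z` at cut-off `L`. -/
def khat (L : ℝ) (f : ℂ → ℂ) (z : ℂ) : ℂ :=
  2 * lam * M.planar L z * f z + lam * M.nu L * f z
    + 1 / 2 * M.cutIntegral L (fun t => (f z - f t) / (z ^ 2 - t ^ 2))

/-- The numbers `ρ l` are the renormalised Kontsevich times of the model: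
`ρ_l = lim_{Λ² → ∞} (δ_{l,0} / √Z - 1/2 ∫ dt ϱ̃(t) / t^(3+2l))`. -/
def HasKontsevichTimes (ρ : ℕ → ℂ) : Prop :=
  ∀ l, Tendsto (fun L => (if l = 0 then 1 / M.sqrtZ L else 0)
    - 1 / 2 * M.cutIntegral L (fun t => 1 / t ^ (3 + 2 * l))) atTop (𝓝 (ρ l))

/-- Sets of arguments at which the Schwinger-Dyson equations are imposed: nonzero, off the curve
`{t | t² = u² + c, u ≥ 1}` that carries the integrals (and off its mirror image), with no two
points opposite to one another. -/
def Admissible (s : Finset ℂ) : Prop :=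
  (∀ z ∈ s, z ≠ 0 ∧ ∀ u : ℝ, 1 ≤ u → z ^ 2 ≠ (u : ℂ) ^ 2 + M.c) ∧
    ∀ z ∈ s, ∀ w ∈ s, z ≠ w → z + w ≠ 0

/-- `G g {z₁, …, z_b}` are the genus-`g` correlation functions `𝒢_g(z₁, …, z_b)` of the model with
`b` boundary components, each carrying one argument, for `(g, b) ≠ (0, 1)` and `b ≥ 1`: the solution
of the Schwinger-Dyson equations in the class of rational functions whose only poles are at `z_i = 0`
(and, for `(g, b) = (0, 2)`, at `z₁ = - z₂`), bounded at infinity, and odd in each variable if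
`2 g + b > 2`. They are symmetric in their arguments, so the arguments form a multiset; the planar
1-point function is `planar`, and the values `G 0 {z}` are not used. -/
structure IsCorrelationFamily (G : ℕ → Multiset ℂ → ℂ) : Prop where
  laurent : ∀ g b : ℕ, 1 ≤ b → 2 < 2 * g + b →
    ∃ P : MvPolynomial (Fin b) ℂ, ∀ z : Fin b → ℂ, (∀ i, z i ≠ 0) →
      G g (Finset.univ.val.map z) = MvPolynomial.eval (fun i => (z i)⁻¹) P
  odd : ∀ (g : ℕ) (z : ℂ) (s : Multiset ℂ), 2 < 2 * g + (Multiset.card s + 1) →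
    z ≠ 0 → (∀ w ∈ s, w ≠ 0) → G g ((-z) ::ₘ s) = - G g (z ::ₘ s)
  rational_zero_two : ∃ (m : ℕ) (P : MvPolynomial (Fin 2) ℂ), ∀ z₁ z₂ : ℂ,
    z₁ ≠ 0 → z₂ ≠ 0 → z₁ + z₂ ≠ 0 →
      G 0 {z₁, z₂} * (z₁⁻¹ + z₂⁻¹) ^ m = MvPolynomial.eval ![z₁⁻¹, z₂⁻¹] P
  /-- The equation for `(g, b) = (0, 2)`. -/
  schwinger_dyson_zero_two : ∀ z₁ z₂ : ℂ, z₁ ≠ z₂ → M.Admissible {z₁, z₂} →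
    Tendsto (fun L => M.khat L (fun z => G 0 {z, z₂}) z₁
      + (2 * lam) ^ 3 * (1 / z₂ *
        deriv (fun w => (M.planar L z₁ - M.planar L w) / (z₁ ^ 2 - w ^ 2)) z₂)) atTop (𝓝 0)
  /-- The equation for `2 g + b > 2`, with `b = 1 + #J`. -/
  schwinger_dyson : ∀ (g : ℕ) (z₁ : ℂ) (J : Finset ℂ), 2 < 2 * g + (J.card + 1) → z₁ ∉ J →
    M.Admissible (insert z₁ J) →
    Tendsto (fun L => M.khat L (fun z => G g (z ::ₘ J.val)) z₁
      + lam * (if g = 0 then 0 else G (g - 1) (z₁ ::ₘ z₁ ::ₘ J.val))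
      + lam * (∑ h ∈ Finset.range (g + 1), ∑ I ∈ J.powerset,
          if (h = 0 ∧ I = ∅) ∨ (h = g ∧ I = J) then 0
          else G h (z₁ ::ₘ I.val) * G (g - h) (z₁ ::ₘ (J \ I).val))
      + (2 * lam) ^ 3 * ∑ ζ ∈ J, 1 / ζ *
          deriv (fun w => (G g (z₁ ::ₘ (J.erase ζ).val) - G g (w ::ₘ (J.erase ζ).val))
            / (z₁ ^ 2 - w ^ 2)) ζ) atTop (𝓝 0)

end CubicModel

/-! ## Differential operators in the Kontsevich times -/

/-- The partial derivative `∂ / ∂ρ_l` of a function of the Kontsevich times. -/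
def pd (l : ℕ) (f : (ℕ → ℂ) → ℂ) (ρ : ℕ → ℂ) : ℂ :=
  deriv (fun t => f (Function.update ρ l t)) (ρ l)

/-- The boundary creation operator `Â†_z` on functions of the Kontsevich times. -/
def creationOp (z : ℂ) (f : (ℕ → ℂ) → ℂ) (ρ : ℕ → ℂ) : ℂ :=
  ∑ᶠ l : ℕ, (-((3 + 2 * (l : ℂ)) * ρ (l + 1) / (ρ 0 * z ^ 3))
    + (3 + 2 * (l : ℂ)) / z ^ (5 + 2 * l)) * pd l f ρ

/-- The boundary annihilation operator `Â_ž f = - ∑_l Res_{z → 0} [z^(4+2l) ρ_l / (3+2l) f(z) dz]`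
on Laurent polynomials `f`; the residue is written as an integral over the unit circle. -/
def annihilationOp (ρ : ℕ → ℂ) (f : ℂ → ℂ) : ℂ :=
  - ∑ᶠ l : ℕ, (2 * (Real.pi : ℂ) * Complex.I)⁻¹ *
    ∮ z in C(0, 1), z ^ (4 + 2 * l) * ρ l / (3 + 2 * (l : ℂ)) * f z

/-- `f` is the free energy `F_g` (`g ≥ 2`) at coupling `lam`, as a function of the Kontsevich times:
a Laurent polynomial in `ρ`, with denominator a power of `ρ_0`, such that for every model with
coupling `lam` one has `𝒢_g(z) = (2λ)³ Â†_z F_g` (which fixes `F_g` up to a constant) and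
`F_g = (2g-2)⁻¹ (2λ)⁻³ Â_ž 𝒢_g(•)` at the Kontsevich times of the model. -/
structure IsFreeEnergy (lam : ℂ) (g : ℕ) (f : (ℕ → ℂ) → ℂ) : Prop where
  laurent : ∃ (p : MvPolynomial ℕ ℂ) (n : ℕ), ∀ ρ : ℕ → ℂ, ρ 0 ≠ 0 →
    f ρ = MvPolynomial.eval ρ p / ρ 0 ^ n
  creation : ∀ (M : CubicModel lam) (ρ : ℕ → ℂ), M.HasKontsevichTimes ρ → ρ 0 ≠ 0 →
    ∀ G : ℕ → Multiset ℂ → ℂ, M.IsCorrelationFamily G →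
      ∀ z : ℂ, z ≠ 0 → G g {z} = (2 * lam) ^ 3 * creationOp z f ρ
  annihilation : ∀ (M : CubicModel lam) (ρ : ℕ → ℂ), M.HasKontsevichTimes ρ → ρ 0 ≠ 0 →
    ∀ G : ℕ → Multiset ℂ → ℂ, M.IsCorrelationFamily G →
      f ρ = 1 / ((2 * (g : ℂ) - 2) * (2 * lam) ^ 3) * annihilationOp ρ (fun z => G g {z})

/-- `S_m / m!`: the Taylor coefficients of `(∑_l (ρ_l / ρ_0) τ^l)⁻¹`. -/
def sCoeff (m : ℕ) (ρ : ℕ → ℂ) : ℂ :=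
  PowerSeries.coeff m (PowerSeries.mk (fun l => ρ l / ρ 0))⁻¹

/-- `ℛ_m(ρ)` for `m ≥ 1`. -/
def Rcoeff (m : ℕ) (ρ : ℕ → ℂ) : ℂ :=
  -(2 / 3) * ∑ k ∈ Finset.Icc 1 m, (k : ℂ) * ρ k / ((3 + 2 * (k : ℂ)) * ρ 0) * sCoeff (m - k) ρ

/-- The second-order differential operator `Δ_ρ`. -/
def deltaRho (f : (ℕ → ℂ) → ℂ) (ρ : ℕ → ℂ) : ℂ :=
  -(-(6 * ρ 1 ^ 3 / (5 * ρ 0 ^ 3)) + 111 * ρ 1 * ρ 2 / (70 * ρ 0 ^ 2) - ρ 3 / (2 * ρ 0))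
      * pd 0 (pd 0 f) ρ
  - (2 * ρ 1 ^ 3 / ρ 0 ^ 4 - 1097 * ρ 1 * ρ 2 / (280 * ρ 0 ^ 3) + 41 * ρ 3 / (24 * ρ 0 ^ 2))
      * pd 0 f ρ
  - (∑ᶠ (k : ℕ) (_ : 1 ≤ k), (3 + 2 * (k : ℂ)) *
      ((-(2 * ρ 1 ^ 2 / (5 * ρ 0 ^ 3)) + 2 * ρ 2 / (7 * ρ 0 ^ 2)) * ρ (k + 1)
        - 3 * Rcoeff (k + 2) ρ * ρ 1 / (2 * ρ 0) + 3 * Rcoeff (k + 3) ρ / 2)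
      * pd k (pd 0 f) ρ)
  + (∑ᶠ (k : ℕ) (_ : 1 ≤ k) (l : ℕ) (_ : 1 ≤ l), (3 + 2 * (k : ℂ)) * (3 + 2 * (l : ℂ)) *
      (ρ 1 * ρ (l + 1) * ρ (k + 1) / (30 * ρ 0 ^ 3)
        + ρ (k + 1) * Rcoeff (l + 2) ρ / (4 * ρ 0) + ρ (l + 1) * Rcoeff (k + 2) ρ / (4 * ρ 0)
        - Rcoeff (k + l + 3) ρ / 4)
      * pd k (pd l f) ρ)
  - (∑ᶠ (k : ℕ) (_ : 1 ≤ k), (3 + 2 * (k : ℂ)) *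
      ((19 * ρ 1 ^ 2 / (60 * ρ 0 ^ 4) - 25 * ρ 2 / (84 * ρ 0 ^ 3)) * ρ (k + 1)
        + ρ 1 * Rcoeff (k + 2) ρ / (16 * ρ 0 ^ 2) - Rcoeff (k + 3) ρ / (16 * ρ 0)
        - (5 + 2 * (k : ℂ)) * ρ 1 * ρ (k + 2) / (30 * ρ 0 ^ 3)
        - (5 + 2 * (k : ℂ)) * Rcoeff (k + 3) ρ / (2 * ρ 0))
      * pd k f ρ)

/-- The explicit function `F_2` (without the factor `V⁻²`). -/
def genusTwo (lam : ℂ) (ρ : ℕ → ℂ) : ℂ :=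
  (2 * lam) ^ 4 * (-(21 * ρ 1 ^ 3 / (160 * ρ 0 ^ 5)) + 29 / 128 * (ρ 1 * ρ 2 / ρ 0 ^ 4)
    - 35 / 384 * (ρ 3 / ρ 0 ^ 3))

/-- The operator `-(2λ)⁴ Δ_ρ + F_2`, i.e. the coefficient of `V⁻²` in the exponent. -/
def exponentOp (lam : ℂ) (f : (ℕ → ℂ) → ℂ) (ρ : ℕ → ℂ) : ℂ :=
  -(2 * lam) ^ 4 * deltaRho f ρ + genusTwo lam ρ * f ρ

/-- `exp(V⁻² (-(2λ)⁴ Δ_ρ + F_2)) 1` at `ρ`, as a formal power series in `X = V⁻²`. -/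
def expOperatorOne (lam : ℂ) (ρ : ℕ → ℂ) : PowerSeries ℂ :=
  PowerSeries.mk fun n => 1 / (n.factorial : ℂ) * ((exponentOp lam)^[n] (fun _ => 1)) ρ

/-- The stable partition function `exp(∑_{g ≥ 2} V^(2-2g) F_g(ρ))`, as a formal power series in
`X = V⁻²`: the exponent is `∑_{n ≥ 1} F_{n+1}(ρ) X^n`. -/
def stablePartitionFunction (F : ℕ → (ℕ → ℂ) → ℂ) (ρ : ℕ → ℂ) : PowerSeries ℂ :=
  PowerSeries.subst (PowerSeries.mk fun n => if n = 0 then 0 else F (n + 1) ρ : PowerSeries ℂ)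
    (PowerSeries.exp ℂ)

end

noncomputable section


/-! ## The Airy structure of the Virasoro operators -/

namespace Airy

open MvPolynomial Finset

variable {R : Type*} [CommRing R]

/-! The free energies come from an Airy structure. On polynomials in x_0, x_1, ... let K_n = ∑_k
(ρ_k/ρ_0) ∂_{n+k} (`opK`), and let Q_n (`opQ` with c = 1/8) be the Virasoro operator composed of ∑_j
(2j+1) x_j ∂_{n+j-1}, of ½ ∑_{i+j=n-2} ∂_i ∂_j, and of x_0²/2 for n = 0 and 1/8 for n = 1. The K_n
commute, and the other commutators (`opQ_comm`, `opK_opQ`) are exactly the integrability conditions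
under which K_n Z_{k+1} = -Q_n Z_k can be solved level by level with a Poincaré lemma
(`exists_opK_eq`, `exists_partition`). The logarithm of ∑ Z_k X^k gives polynomials F_k solving the
quadratic system `IsVirasoroSolution`; a monomial of degree b in F_k belongs to the genus g with k =
2g-2+b (`IsVirasoroSolution.hasDeg`).

The dependence on the times is governed by one fact: a change of ρ_l is a shift of x_{l+1}, that is
(2l+3) ∂F_k/∂ρ_l = ∂F_{k+1}/∂x_{l+1} up to constants (`IsVirasoroSolution.pderiv_coefD`). Hence the
one-point functions form a closed form in the times, and homogeneity gives its primitive explicitly.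
This primitive is `freeEnergy`, and `creD_freeEnergy` says that the creation operator maps it to the
one-point function.

Contracting the constraints with the series ℛ expresses (2g-2) F_g by the quadratic terms of lower
level (`two_mul_freeEnergy`). For the coefficients W_n of exp(∑ F_g X^{g-1}) this becomes the linear
recursion (n+1) W_{n+1} = D W_n with a second-order operator D that does not depend on n
(`partSer_recursion`). Moving all derivatives to the right identifies D with -Δ_ρ + F_2 in units 2λ
= 1 (`sum_nab_nab_eq`, `evT_sum_nab_nab`), so W_n = Dⁿ1/n!, which is the claimed formula.

It remains to connect this with the matrix model. On odd powers of 1/z the operator K̂ is triangular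
with diagonal ρ_0 ≠ 0 (`khat_inv_pow`, `eq_zero_of_tendsto_khat`), so the Schwinger-Dyson equations
determine the correlation functions (`unique`). For existence, an argument z is inserted by ∑_k
z^{-3-2k} ∂/∂x_k; the generating series of the Virasoro constraints then turns into the
Schwinger-Dyson equations once the two-point function (2λ)²/(z w (z+w)²) is added
(`IsVirasoroSolution.schwinger_dyson`, `isCorrelationFamily_corrFun`). Finally the free energies are
unique at all times, because the times of finite matrices are Zariski dense
(`eval_eq_zero_of_finiteModel`). -/

theorem derivation_sum_apply {A B ι : Type*} [CommSemiring A] [CommRing B] [Algebra A B]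
    (s : Finset ι) (D : ι → Derivation A B B) (f : B) : (∑ i ∈ s, D i) f = ∑ i ∈ s, D i f := by
  classical
  induction s using Finset.induction_on with
  | empty => simp
  | insert i s hi ih => rw [Finset.sum_insert hi, Finset.sum_insert hi, Derivation.add_apply, ih]

/-- A derivation of a polynomial ring is the combination of the partial derivatives. -/
theorem derivation_eq_sum
    (D : Derivation R (MvPolynomial ℕ R) (MvPolynomial ℕ R)) (f : MvPolynomial ℕ R) {N : ℕ}
    (hN : ∀ i ∈ f.vars, i < N) :
    D f = ∑ i ∈ range N, D (X i) * pderiv i f := by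
  have h : D f = (∑ i ∈ range N, (D (X i)) • pderiv i :
      Derivation R (MvPolynomial ℕ R) (MvPolynomial ℕ R)) f := by
    apply derivation_eq_of_forall_mem_vars
    intro j hj
    rw [derivation_sum_apply, Finset.sum_eq_single j]
    · simp
    · intro b _ hb; simp [pderiv_X_of_ne hb.symm]
    · intro h; exact absurd (Finset.mem_range.2 (hN j hj)) h
  rw [h, derivation_sum_apply]
  simp

theorem exists_vars_lt (f : MvPolynomial ℕ R) : ∃ N : ℕ, ∀ i ∈ f.vars, i < N :=
  ⟨f.vars.sup id + 1, fun _ hi => Nat.lt_succ_of_le (Finset.le_sup (f := id) hi)⟩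

/-- Two derivations that agree on coefficients and variables agree. -/
theorem derivation_ext_C_X {k : Type*} [CommRing k] [Algebra k R]
    {D₁ D₂ : Derivation k (MvPolynomial ℕ R) (MvPolynomial ℕ R)}
    (hC : ∀ r, D₁ (C r) = D₂ (C r)) (hX : ∀ i, D₁ (X i) = D₂ (X i)) (f : MvPolynomial ℕ R) :
    D₁ f = D₂ f := by
  induction f using MvPolynomial.induction_on with
  | C => exact hC _
  | add p q hp hq => rw [map_add, map_add, hp, hq]
  | mul_X p i hp => rw [Derivation.leibniz, Derivation.leibniz, hp, hX]

/-- The derivations `∂ / ∂x_{i-1}`, with the convention that the `0`-th one vanishes. -/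
def shiftD : ℕ → Derivation R (MvPolynomial ℕ R) (MvPolynomial ℕ R)
  | 0 => 0
  | i + 1 => pderiv i

@[simp] theorem shiftD_zero (f : MvPolynomial ℕ R) : shiftD 0 f = 0 := rfl
@[simp] theorem shiftD_succ (i : ℕ) (f : MvPolynomial ℕ R) : shiftD (i + 1) f = pderiv i f := rfl

theorem shiftD_X (i j : ℕ) :
    shiftD i (X j : MvPolynomial ℕ R) = if i = j + 1 then 1 else 0 := by
  cases i with
  | zero => simp
  | succ i =>
    by_cases h : i = j
    · subst h; simp
    · simp [pderiv_X_of_ne (Ne.symm h), h]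

theorem bracket_zero_of_X {D₁ D₂ : Derivation R (MvPolynomial ℕ R) (MvPolynomial ℕ R)}
    (h : ∀ i, D₁ (D₂ (X i)) = D₂ (D₁ (X i))) (f : MvPolynomial ℕ R) : D₁ (D₂ f) = D₂ (D₁ f) := by
  have h' : ⁅D₁, D₂⁆ = 0 := derivation_ext fun i => by
    rw [Derivation.commutator_apply, h i, sub_self]; rfl
  have := congrArg (fun D => D f) h'
  simpa [Derivation.commutator_apply, sub_eq_zero] using this

theorem bracket_of_X {D₁ D₂ D₃ : Derivation R (MvPolynomial ℕ R) (MvPolynomial ℕ R)}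
    (h : ∀ i, D₁ (D₂ (X i)) - D₂ (D₁ (X i)) = D₃ (X i)) (f : MvPolynomial ℕ R) :
    D₁ (D₂ f) - D₂ (D₁ f) = D₃ f := by
  have h' : ⁅D₁, D₂⁆ = D₃ := derivation_ext fun i => by
    rw [Derivation.commutator_apply, h i]
  rw [← h', Derivation.commutator_apply]

theorem shiftD_comm (i j : ℕ) (f : MvPolynomial ℕ R) :
    shiftD i (shiftD j f) = shiftD j (shiftD i f) :=
  bracket_zero_of_X (fun k => by simp only [shiftD_X]; split_ifs <;> simp) f

/-- The linear part `∑_k a_k ∂_{n+k}` of the Virasoro operators. -/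
def opK (a : ℕ → R) (n : ℕ) : Derivation R (MvPolynomial ℕ R) (MvPolynomial ℕ R) :=
  mkDerivation R fun i => if n ≤ i then C (a (i - n)) else 0

/-- The part `∑_j (1+2j) x_j ∂_{n+j-1}` of the Virasoro operators. -/
def opM (n : ℕ) : Derivation R (MvPolynomial ℕ R) (MvPolynomial ℕ R) :=
  mkDerivation R fun i =>
    if n ≤ i + 1 then (2 * ((i + 1 - n : ℕ) : MvPolynomial ℕ R) + 1) * X (i + 1 - n) else 0

/-- The part `∑_{i+j=n-2} ∂_i ∂_j` of the Virasoro operators. -/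
def opS (n : ℕ) (f : MvPolynomial ℕ R) : MvPolynomial ℕ R :=
  ∑ p ∈ antidiagonal n, shiftD p.1 (shiftD p.2 f)

theorem opK_X (a : ℕ → R) (n i : ℕ) :
    opK a n (X i) = if n ≤ i then C (a (i - n)) else 0 := mkDerivation_X _ _ _

theorem opM_X (n i : ℕ) : opM n (X i : MvPolynomial ℕ R) =
    if n ≤ i + 1 then (2 * ((i + 1 - n : ℕ) : MvPolynomial ℕ R) + 1) * X (i + 1 - n) else 0 :=
  mkDerivation_X _ _ _

theorem opK_shiftD (a : ℕ → R) (m i : ℕ) (f : MvPolynomial ℕ R) :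
    opK a m (shiftD i f) = shiftD i (opK a m f) :=
  bracket_zero_of_X (fun k => by simp only [opK_X, shiftD_X]; split_ifs <;> simp) f

theorem opK_opS (a : ℕ → R) (m n : ℕ) (f : MvPolynomial ℕ R) :
    opK a m (opS n f) = opS n (opK a m f) := by
  simp only [opS, map_sum, opK_shiftD]

/-- `shiftD i` differentiates the coefficient (2i-1) x_{i-1} that `opM m` puts in front of
∂_{m+i-2}. The truncated `2 * i - 1` is zero for `i = 0`, in accordance with `shiftD 0 = 0`. -/
theorem opM_shiftD (m i : ℕ) (f : MvPolynomial ℕ R) :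
    opM m (shiftD i f) - shiftD i (opM m f)
      = (-((2 * i - 1 : ℕ) : MvPolynomial ℕ R)) * shiftD (m + i - 1) f := by
  refine bracket_of_X (D₃ := (-((2 * i - 1 : ℕ) : MvPolynomial ℕ R)) • shiftD (m + i - 1))
    (fun k => ?_) f
  rw [Derivation.smul_apply, shiftD_X, shiftD_X, opM_X, smul_eq_mul]
  rcases i with _ | i
  · simp
  have h1 : opM m (if i + 1 = k + 1 then (1 : MvPolynomial ℕ R) else 0) = 0 := by
    split_ifs <;> simp
  rw [h1, show 2 * (i + 1) - 1 = 2 * i + 1 by omega, show m + (i + 1) - 1 = m + i by omega]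
  by_cases hk : m ≤ k + 1
  · rw [if_pos hk]
    have : (2 * ((k + 1 - m : ℕ) : MvPolynomial ℕ R) + 1) = ((2 * (k + 1 - m) + 1 : ℕ) :
      MvPolynomial ℕ R) := by push_cast; ring
    rw [this, Derivation.leibniz, Derivation.map_natCast, shiftD_X]
    by_cases h : m + i = k + 1
    · rw [if_pos h, if_pos (by omega), show k + 1 - m = i by omega]; simp
    · rw [if_neg h, if_neg (by omega)]; simp
  · rw [if_neg hk, if_neg (by omega)]; simp

/-- The bracket with each summand is taken factor by factor; swapping the pair identifies the two
resulting sums, hence the factor 2. -/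
theorem opM_opS (m n : ℕ) (f : MvPolynomial ℕ R) :
    opM m (opS n f) - opS n (opM m f)
      = -2 * ∑ p ∈ antidiagonal n,
        ((2 * p.1 - 1 : ℕ) : MvPolynomial ℕ R) * shiftD (m + p.1 - 1) (shiftD p.2 f) := by
  have h : ∀ p : ℕ × ℕ, opM m (shiftD p.1 (shiftD p.2 f)) - shiftD p.1 (shiftD p.2 (opM m f))
      = -((2 * p.1 - 1 : ℕ) : MvPolynomial ℕ R) * shiftD (m + p.1 - 1) (shiftD p.2 f)
        - ((2 * p.2 - 1 : ℕ) : MvPolynomial ℕ R) * shiftD (m + p.2 - 1) (shiftD p.1 f) := by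
    intro p
    have h1 := opM_shiftD m p.1 (shiftD p.2 f)
    have h2 := congrArg (shiftD p.1) (opM_shiftD m p.2 f)
    rw [Derivation.leibniz, map_sub, Derivation.map_neg, Derivation.map_natCast, neg_zero,
      smul_zero, add_zero, smul_eq_mul, shiftD_comm p.1 (m + p.2 - 1)] at h2
    linear_combination h1 + h2
  rw [opS, opS, map_sum, ← Finset.sum_sub_distrib, Finset.sum_congr rfl fun p _ => h p,
    Finset.sum_sub_distrib]
  have h3 : ∑ p ∈ antidiagonal n, ((2 * p.2 - 1 : ℕ) : MvPolynomial ℕ R) *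
      shiftD (m + p.2 - 1) (shiftD p.1 f) = ∑ p ∈ antidiagonal n,
      ((2 * p.1 - 1 : ℕ) : MvPolynomial ℕ R) * shiftD (m + p.1 - 1) (shiftD p.2 f) :=
    Finset.Nat.sum_antidiagonal_swap (n := n) (f := fun p : ℕ × ℕ =>
      ((2 * p.1 - 1 : ℕ) : MvPolynomial ℕ R) * shiftD (m + p.1 - 1) (shiftD p.2 f))
  rw [h3]
  simp only [neg_mul, Finset.sum_neg_distrib]
  ring

/-- The combinatorial identity behind the commutators of the second-order parts. -/
theorem sum_antidiagonal_weights {V : Type*} [CommRing V] (c : ℕ → ℕ → V)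
    (hc : ∀ i j, c i j = c j i) (m n : ℕ) :
    2 * (∑ p ∈ antidiagonal n, ((2 * p.1 - 1 : ℕ) : V) * c (m + p.1 - 1) p.2
      - ∑ p ∈ antidiagonal m, ((2 * p.1 - 1 : ℕ) : V) * c (n + p.1 - 1) p.2)
      = 2 * (((n : V) - m) * ∑ p ∈ antidiagonal (m + n - 1), c p.1 p.2) := by
  rcases Nat.eq_zero_or_pos (m + n) with h0 | h0
  · obtain ⟨rfl, rfl⟩ : m = 0 ∧ n = 0 := by omega
    simp
  obtain ⟨N, hN⟩ : ∃ N, m + n = N + 1 := ⟨m + n - 1, by omega⟩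
  have e1 : ∑ p ∈ antidiagonal n, ((2 * p.1 - 1 : ℕ) : V) * c (m + p.1 - 1) p.2
      = ∑ i ∈ range n, (2 * (i : V) + 1) * c (m + i) (n - 1 - i) := by
    rw [Finset.Nat.sum_antidiagonal_eq_sum_range_succ_mk, Finset.sum_range_succ']
    simp only [mul_zero, zero_le, Nat.sub_eq_zero_of_le, Nat.cast_zero, zero_mul, add_zero]
    refine Finset.sum_congr rfl fun i hi => ?_
    rw [show 2 * (i + 1) - 1 = 2 * i + 1 by omega, show m + (i + 1) - 1 = m + i by omega,
      show n - (i + 1) = n - 1 - i by omega]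
    push_cast; ring
  have e2 : ∑ p ∈ antidiagonal m, ((2 * p.1 - 1 : ℕ) : V) * c (n + p.1 - 1) p.2
      = ∑ i ∈ range m, (2 * ((m : V) - i) - 1) * c i (N - i) := by
    rw [Finset.Nat.sum_antidiagonal_eq_sum_range_succ_mk, Finset.sum_range_succ']
    simp only [mul_zero, zero_le, Nat.sub_eq_zero_of_le, Nat.cast_zero, zero_mul, add_zero]
    rw [← Finset.sum_range_reflect]
    refine Finset.sum_congr rfl fun i hi => ?_
    rw [Finset.mem_range] at hi
    rw [hc i, show n + (m - 1 - i + 1) - 1 = N - i by omega, show m - (m - 1 - i + 1) = i by omega,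
      show 2 * (m - 1 - i + 1) - 1 = 2 * (m - i) - 1 by omega, Nat.cast_sub (by omega)]
    push_cast [Nat.cast_sub hi.le]; ring
  have e3 : ∑ p ∈ antidiagonal (m + n - 1), c p.1 p.2 = ∑ i ∈ range (N + 1), c i (N - i) := by
    rw [show m + n - 1 = N by omega, Finset.Nat.sum_antidiagonal_eq_sum_range_succ_mk]
  -- Both sums are pieces of one sum over 0 ≤ i ≤ N with the affine weight 2i - 2m + 1: the indices
  -- i < m carry the reversed second sum with a minus sign, the others carry the first one.
  have e4 : ∑ i ∈ range (N + 1), (2 * (i : V) - 2 * m + 1) * c i (N - i)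
      = ∑ i ∈ range n, (2 * (i : V) + 1) * c (m + i) (n - 1 - i)
        - ∑ i ∈ range m, (2 * ((m : V) - i) - 1) * c i (N - i) := by
    rw [← hN, Finset.sum_range_add, add_comm, sub_eq_add_neg, ← Finset.sum_neg_distrib]
    congr 1
    · refine Finset.sum_congr rfl fun i hi => ?_
      rw [Finset.mem_range] at hi
      rw [show N - (m + i) = n - 1 - i by omega]; push_cast; ring
    · refine Finset.sum_congr rfl fun i hi => ?_
      ring
  -- Symmetry of `c` permits the reflection of i to N - i. The mean of the two weights is the
  -- constant n - m, which is the factor on the right.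
  have e5 : ∑ i ∈ range (N + 1), (2 * (i : V) - 2 * m + 1) * c i (N - i)
      = ∑ i ∈ range (N + 1), (2 * ((N : V) - i) - 2 * m + 1) * c i (N - i) := by
    rw [← Finset.sum_range_reflect]
    refine Finset.sum_congr rfl fun i hi => ?_
    rw [Finset.mem_range] at hi
    rw [hc, show N + 1 - 1 - i = N - i by omega, show N - (N - i) = i by omega,
      Nat.cast_sub (by omega)]
  rw [e1, e2, e3, ← e4, two_mul]
  nth_rewrite 2 [e5]
  have hN' : (m : V) + n = N + 1 := by exact_mod_cast congrArg (Nat.cast : ℕ → V) hN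
  rw [← Finset.sum_add_distrib, Finset.mul_sum, Finset.mul_sum]
  refine Finset.sum_congr rfl fun i hi => ?_
  linear_combination (2 * c i (N - i)) * (- hN')

theorem opM_comm_succ (m n : ℕ) (f : MvPolynomial ℕ R) :
    opM (m + 1) (opM (n + 1) f) - opM (n + 1) (opM (m + 1) f)
      = 2 * ((m : MvPolynomial ℕ R) - n) * opM (m + n + 1) f := by
  refine bracket_of_X (D₃ := (2 * ((m : MvPolynomial ℕ R) - n)) • opM (m + n + 1)) (fun i => ?_) f
  have key : ∀ m n : ℕ, opM (m + 1) (opM (n + 1) (X i : MvPolynomial ℕ R))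
      = if m + n ≤ i then (2 * ((i - n : ℕ) : MvPolynomial ℕ R) + 1) *
        ((2 * ((i - (m + n) : ℕ) : MvPolynomial ℕ R) + 1) * X (i - (m + n))) else 0 := by
    intro m n
    rw [opM_X]
    by_cases h : n ≤ i
    · rw [if_pos (by omega), Derivation.leibniz, opM_X,
        show i + 1 - (n + 1) = i - n by omega,
        show (2 * ((i - n : ℕ) : MvPolynomial ℕ R) + 1) = ((2 * (i - n) + 1 : ℕ) :
          MvPolynomial ℕ R) by push_cast; ring, Derivation.map_natCast, smul_zero, add_zero,
        smul_eq_mul]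
      by_cases h2 : m + n ≤ i
      · rw [if_pos h2, if_pos (by omega), show i - n + 1 - (m + 1) = i - (m + n) by omega]
      · rw [if_neg h2, if_neg (by omega), mul_zero]
    · rw [if_neg (by omega), if_neg (by omega), map_zero]
  rw [key, key, Derivation.smul_apply, opM_X, smul_eq_mul, add_comm n m]
  by_cases h : m + n ≤ i
  · rw [if_pos h, if_pos h, if_pos (by omega), show i + 1 - (m + n + 1) = i - (m + n) by omega,
      Nat.cast_sub (show n ≤ i by omega), Nat.cast_sub (show m ≤ i by omega)]
    ring
  · rw [if_neg h, if_neg h, if_neg (by omega)]; ring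

/-- On `X i` with `n = i + 1` only one of the two compositions survives, because `opM (n + 1)` kills
this variable while `opM 0` raises its index first. This boundary defect is the term `X 0 * shiftD
n`; it is compensated later by the inhomogeneity x_0². -/
theorem opM_comm_zero (n : ℕ) (f : MvPolynomial ℕ R) :
    opM 0 (opM (n + 1) f) - opM (n + 1) (opM 0 f)
      = -2 * ((n : MvPolynomial ℕ R) + 1) * opM n f + X 0 * shiftD n f := by
  refine bracket_of_X (D₃ := (-2 * ((n : MvPolynomial ℕ R) + 1)) • opM n
    + (X 0 : MvPolynomial ℕ R) • shiftD n) (fun i => ?_) f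
  have cst : ∀ k : ℕ, (2 * (k : MvPolynomial ℕ R) + 1) = ((2 * k + 1 : ℕ) : MvPolynomial ℕ R) := by
    intro k; push_cast; ring
  simp only [Derivation.add_apply, Derivation.smul_apply, smul_eq_mul, opM_X, shiftD_X]
  rw [if_pos (Nat.zero_le _), cst (i + 1 - 0)]
  simp only [Derivation.leibniz, Derivation.map_natCast, smul_eq_mul, opM_X, Nat.sub_zero]
  rcases Nat.lt_trichotomy n (i + 1) with h | h | h
  · rw [if_pos (by omega), if_pos (by omega), if_pos (by omega), if_neg (by omega),
      show i + 1 - (n + 1) = i - n by omega, cst (i - n)]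
    simp only [Derivation.leibniz, Derivation.map_natCast, smul_eq_mul, opM_X, Nat.sub_zero,
      Nat.zero_le, if_true]
    rw [show i + 1 + 1 - (n + 1) = i - n + 1 by omega, show i + 1 - n = i - n + 1 by omega]
    have : ((i - n : ℕ) : MvPolynomial ℕ R) = i - n := Nat.cast_sub (by omega)
    push_cast [this]; ring
  · rw [if_neg (by omega), if_pos (by omega), if_pos (by omega), if_pos h, h,
      show i + 1 + 1 - (i + 1 + 1) = 0 by omega, show i + 1 - (i + 1) = 0 by omega]
    push_cast; simp; ring
  · rw [if_neg (by omega), if_neg (by omega), if_neg (by omega), if_neg (by omega)]; simp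

theorem opS_X_zero_mul (n : ℕ) (f : MvPolynomial ℕ R) :
    opS (n + 1) (X 0 * f) = X 0 * opS (n + 1) f + 2 * shiftD n f := by
  have h : ∀ i, ∀ g : MvPolynomial ℕ R,
      shiftD i (X 0 * g) = X 0 * shiftD i g + if i = 1 then g else 0 := by
    intro i g
    rw [Derivation.leibniz, shiftD_X, smul_eq_mul, smul_eq_mul]
    split_ifs <;> simp_all
  have h2 : ∀ p : ℕ × ℕ, shiftD p.1 (shiftD p.2 (X 0 * f)) = X 0 * shiftD p.1 (shiftD p.2 f)
      + (if p.1 = 1 then shiftD p.2 f else 0) + (if p.2 = 1 then shiftD p.1 f else 0) := by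
    intro p
    rw [h, map_add, h]
    split_ifs <;> simp
  rw [opS, Finset.sum_congr rfl fun p _ => h2 p, Finset.sum_add_distrib, Finset.sum_add_distrib,
    ← Finset.mul_sum]
  have h3 : ∑ p ∈ antidiagonal (n + 1), (if p.1 = 1 then shiftD p.2 f else 0) = shiftD n f := by
    rw [Finset.sum_eq_single (1, n)]
    · simp
    · rintro ⟨i, j⟩ hij hne
      rw [Finset.HasAntidiagonal.mem_antidiagonal] at hij
      rw [if_neg]
      rintro rfl
      exact hne (by simp at hij ⊢; omega)
    · intro h; exact absurd (by simp [add_comm]) h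
  have h4 : ∑ p ∈ antidiagonal (n + 1), (if p.2 = 1 then shiftD p.1 f else 0) = shiftD n f := by
    rw [← h3]
    exact Finset.Nat.sum_antidiagonal_swap (n := n + 1)
      (f := fun p : ℕ × ℕ => if p.1 = 1 then shiftD p.2 f else 0)
  rw [h3, h4, opS]; ring

theorem derivation_C_mul' (D : Derivation R (MvPolynomial ℕ R) (MvPolynomial ℕ R)) (c : R)
    (f : MvPolynomial ℕ R) : D (C c * f) = C c * D f := by
  rw [C_mul', C_mul', D.map_smul]

theorem C_four_mul (c : R) : (C (4 * c) : MvPolynomial ℕ R) = 4 * C c := by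
  rw [C_mul, map_ofNat]

theorem opS_add (n : ℕ) (f g : MvPolynomial ℕ R) : opS n (f + g) = opS n f + opS n g := by
  simp [opS, Finset.sum_add_distrib]

theorem opS_C_mul (n : ℕ) (c : R) (f : MvPolynomial ℕ R) : opS n (C c * f) = C c * opS n f := by
  simp only [opS, derivation_C_mul', Finset.mul_sum]

theorem opS_zero (f : MvPolynomial ℕ R) : opS 0 f = 0 := by simp [opS]

theorem opS_shiftD (n i : ℕ) (f : MvPolynomial ℕ R) :
    opS n (shiftD i f) = shiftD i (opS n f) := by
  simp only [opS, map_sum]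
  refine Finset.sum_congr rfl fun p _ => ?_
  rw [shiftD_comm p.2 i, shiftD_comm p.1 i]

theorem opS_comm (m n : ℕ) (f : MvPolynomial ℕ R) : opS m (opS n f) = opS n (opS m f) := by
  conv_lhs => rw [opS]
  simp only [← opS_shiftD]
  simp only [opS, map_sum]
  exact Finset.sum_comm

/-- The inhomogeneous part of the Virasoro operators (`c` stands for `1/8`). -/
def inhom (c : R) : ℕ → MvPolynomial ℕ R
  | 0 => 4 * C c * X 0 ^ 2
  | 1 => C c
  | _ => 0

/-- The quadratic part of the Virasoro operators (`c` stands for `1/8`). -/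
def opQ (c : R) (n : ℕ) (f : MvPolynomial ℕ R) : MvPolynomial ℕ R :=
  opM n f + 4 * C c * opS n f + inhom c n * f

/-- For positive indices the inhomogeneities are constants, so only the brackets of `opM` with `opM`
and with `opS` contribute. No central term arises: `m - n` vanishes in the only case in which `inhom
c (m + n + 1)` does not. -/
theorem opQ_comm_succ {c : R} (m n : ℕ) (f : MvPolynomial ℕ R) :
    opQ c (m + 1) (opQ c (n + 1) f) - opQ c (n + 1) (opQ c (m + 1) f)
      = 2 * ((m : MvPolynomial ℕ R) - n) * opQ c (m + n + 1) f := by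
  have hk : ∀ n, ∃ k : R, inhom c (n + 1) = C k := by
    intro n
    rcases n with _ | n
    · exact ⟨c, rfl⟩
    · exact ⟨0, by simp [inhom]⟩
  obtain ⟨k, hk1⟩ := hk m
  obtain ⟨l, hl1⟩ := hk n
  have h4 : (4 : MvPolynomial ℕ R) * C c = C (4 * c) := (C_four_mul c).symm
  have hM := opM_comm_succ m n f
  have hMS := opM_opS (m + 1) (n + 1) f
  have hMS' := opM_opS (n + 1) (m + 1) f
  have hw := sum_antidiagonal_weights (fun i j => shiftD i (shiftD j f))
    (fun i j => shiftD_comm i j f) (m + 1) (n + 1)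
  rw [show m + 1 + (n + 1) - 1 = m + n + 1 by omega] at hw
  have hin : ((m : MvPolynomial ℕ R) - n) * inhom c (m + n + 1) = 0 := by
    by_cases h : m = n
    · simp [h]
    · obtain ⟨q, hq⟩ : ∃ q, m + n = q + 1 := ⟨m + n - 1, by omega⟩
      rw [hq]; simp [inhom]
  have hSS := opS_comm (m + 1) (n + 1) f
  simp only [opQ, hk1, hl1, h4, map_add, opS_add, opS_C_mul, derivation_C_mul']
  rw [show opS (m + n + 1) f = ∑ p ∈ antidiagonal (m + n + 1), shiftD p.1 (shiftD p.2 f) from rfl]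
  push_cast at hw
  linear_combination hM + C (4 * c) * (hMS - hMS') - C (4 * c) * hw
    + C (4 * c) * C (4 * c) * hSS - 2 * f * hin

/-- The term x_0² of `inhom c 0` commutes neither with `opS (n + 1)` nor with `opM 1`. What it
produces has to cancel the boundary term of `opM_comm_zero`, and this works for c = 1/8. -/
theorem opQ_comm_zero {c : R} (hc : 8 * c = 1) (n : ℕ) (f : MvPolynomial ℕ R) :
    opQ c 0 (opQ c (n + 1) f) - opQ c (n + 1) (opQ c 0 f)
      = -2 * ((n : MvPolynomial ℕ R) + 1) * opQ c n f := by
  have hk : ∃ k : R, inhom c (n + 1) = C k := by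
    rcases n with _ | n
    · exact ⟨c, rfl⟩
    · exact ⟨0, by simp [inhom]⟩
  obtain ⟨k, hk⟩ := hk
  have h4 : (4 : MvPolynomial ℕ R) * C c = C (4 * c) := (C_four_mul c).symm
  have h8 : 2 * C (4 * c) = (1 : MvPolynomial ℕ R) := by
    rw [← h4]
    have : (C (8 * c) : MvPolynomial ℕ R) = 1 := by rw [hc, C_1]
    rw [← this, C_mul, map_ofNat]; ring
  have hM := opM_comm_zero n f
  have hMS := opM_opS 0 (n + 1) f
  have hw := sum_antidiagonal_weights (fun i j => shiftD i (shiftD j f))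
    (fun i j => shiftD_comm i j f) 0 (n + 1)
  have hw0 : ∑ p ∈ antidiagonal 0, ((2 * p.1 - 1 : ℕ) : MvPolynomial ℕ R) *
      shiftD (n + 1 + p.1 - 1) (shiftD p.2 f) = 0 := by simp
  rw [hw0, show 0 + (n + 1) - 1 = n by omega, sub_zero] at hw
  rw [show ∑ p ∈ antidiagonal n, shiftD p.1 (shiftD p.2 f) = opS n f from rfl] at hw
  have hXX : opS (n + 1) (X 0 ^ 2 * f) = X 0 ^ 2 * opS (n + 1) f + 4 * X 0 * shiftD n f
      + 2 * (if n = 1 then f else 0) := by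
    rw [pow_two, mul_assoc, opS_X_zero_mul, opS_X_zero_mul, Derivation.leibniz, shiftD_X]
    simp only [smul_eq_mul, zero_add]
    split_ifs <;> ring
  have hMX : opM (n + 1) (X 0 ^ 2 * f) = X 0 ^ 2 * opM (n + 1) f
      + 2 * X 0 ^ 2 * (if n = 0 then f else 0) := by
    rw [pow_two, mul_assoc, Derivation.leibniz, Derivation.leibniz, opM_X]
    rcases n with _ | n
    · simp; ring
    · simp; ring
  have hin : inhom c n * f = C (4 * c) * X 0 ^ 2 * (if n = 0 then f else 0)
      + C c * (if n = 1 then f else 0) := by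
    rw [C_four_mul]
    rcases n with _ | _ | n <;> simp [inhom]
  have hi0 : inhom c 0 = C (4 * c) * X 0 ^ 2 := by rw [C_four_mul]; rfl
  have hcn : (n : MvPolynomial ℕ R) * (if n = 1 then f else 0) = if n = 1 then f else 0 := by
    split_ifs with h <;> simp [h]
  have hcn0 : (n : MvPolynomial ℕ R) * (if n = 0 then f else 0) = 0 := by
    split_ifs with h <;> simp [h]
  simp only [opQ, hk, hi0, h4, map_add, opS_add, opS_C_mul, derivation_C_mul', opS_zero, mul_zero,
    add_zero, mul_assoc, hXX, hMX]
  have h4c : C (4 * c) = 4 * (C c : MvPolynomial ℕ R) := C_four_mul c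
  have hin' := hin
  push_cast at hw
  simp only [mul_add] at hin ⊢
  set P := (if n = 1 then f else 0)
  set P0 := (if n = 0 then f else 0)
  linear_combination hM + C (4 * c) * hMS - C (4 * c) * hw + (2 * (n : MvPolynomial ℕ R) + 2) * hin
    - (X 0 * shiftD n f) * (2 * C (4 * c) + 1) * h8
    + 2 * (C c) * hcn + 2 * C (4 * c) * X 0 ^ 2 * hcn0 - C (4 * c) * P * h8 - P * h4c

end Airy

/-! ### Integrability, the Poincaré lemma and the partition function -/

namespace Airy

open MvPolynomial Finset

variable {R : Type*} [CommRing R]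

theorem opQ_neg (c : R) (n : ℕ) (f : MvPolynomial ℕ R) : opQ c n (-f) = -opQ c n f := by
  have h : opS n (-f) = -opS n f := by simp [opS]
  rw [opQ, opQ, h, map_neg]; ring

theorem opQ_comm {c : R} (hc : 8 * c = 1) (m n : ℕ) (f : MvPolynomial ℕ R) :
    opQ c m (opQ c n f) - opQ c n (opQ c m f)
      = 2 * ((m : MvPolynomial ℕ R) - n) * opQ c (m + n - 1) f := by
  rcases m with _ | m <;> rcases n with _ | n
  · simp
  · rw [opQ_comm_zero hc]
    simp; ring
  · have := opQ_comm_zero hc m f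
    rw [show m + 1 + 0 - 1 = m by omega]
    push_cast
    linear_combination -this
  · rw [opQ_comm_succ, show m + 1 + (n + 1) - 1 = m + n + 1 by omega]
    push_cast; ring

theorem opK_opM (a : ℕ → R) (m n : ℕ) (f : MvPolynomial ℕ R) :
    (opK a m (opM n f) - opM n (opK a m f)) - (opK a n (opM m f) - opM m (opK a n f))
      = 2 * ((m : MvPolynomial ℕ R) - n) * opK a (m + n - 1) f := by
  have h' : ⁅opK a m, opM n⁆ - ⁅opK a n, opM m⁆
      = (2 * ((m : MvPolynomial ℕ R) - n)) • opK a (m + n - 1) := derivation_ext fun i => by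
    have key : ∀ m n : ℕ, ⁅opK a m, opM n⁆ (X i) =
        if m + n ≤ i + 1 then (2 * ((i + 1 - n : ℕ) : MvPolynomial ℕ R) + 1) *
          C (a (i + 1 - (m + n))) else 0 := by
      intro m n
      rw [Derivation.commutator_apply, opM_X, opK_X]
      have h0 : opM n (if m ≤ i then C (a (i - m)) else (0 : MvPolynomial ℕ R)) = 0 := by
        split_ifs <;> simp
      rw [h0, sub_zero]
      by_cases h : n ≤ i + 1
      · rw [if_pos h, show (2 * ((i + 1 - n : ℕ) : MvPolynomial ℕ R) + 1)
          = ((2 * (i + 1 - n) + 1 : ℕ) : MvPolynomial ℕ R) by push_cast; ring,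
          Derivation.leibniz, Derivation.map_natCast, smul_zero, add_zero, smul_eq_mul, opK_X]
        by_cases h2 : m + n ≤ i + 1
        · rw [if_pos h2, if_pos (by omega), show i + 1 - n - m = i + 1 - (m + n) by omega]
        · rw [if_neg h2, if_neg (by omega), mul_zero]
      · rw [if_neg h, if_neg (by omega), map_zero]
    rw [Derivation.sub_apply, key, key, Derivation.smul_apply, opK_X, smul_eq_mul, add_comm n m]
    rcases Nat.eq_zero_or_pos (m + n) with h0 | h0
    · obtain ⟨rfl, rfl⟩ : m = 0 ∧ n = 0 := by omega
      simp
    by_cases h : m + n ≤ i + 1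
    · rw [if_pos h, if_pos h, if_pos (by omega), Nat.cast_sub (by omega), Nat.cast_sub (by omega),
        show i - (m + n - 1) = i + 1 - (m + n) by omega]
      ring
    · rw [if_neg h, if_neg h, if_neg (by omega)]; ring
  have := congrArg (fun D => D f) h'
  simpa [Derivation.commutator_apply] using this

/-- With `opQ_comm` and the commutativity of the `opK a n` this says that L_n = K_n + y Q_n
satisfies [L_m, L_n] = 2(m-n) y L_{m+n-1}. The derivative of x_0² contributes only for m = n = 0 and
cancels in the antisymmetrisation. -/
theorem opK_opQ (a : ℕ → R) (a0 : a 0 = 1) (c : R) (m n : ℕ) (f : MvPolynomial ℕ R) :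
    (opK a m (opQ c n f) - opQ c n (opK a m f)) - (opK a n (opQ c m f) - opQ c m (opK a n f))
      = 2 * ((m : MvPolynomial ℕ R) - n) * opK a (m + n - 1) f := by
  have h1 : ∀ m n, opK a m (opQ c n f) - opQ c n (opK a m f)
      = opK a m (opM n f) - opM n (opK a m f)
        + (if m = 0 ∧ n = 0 then 8 * C c * X 0 * f else 0) := by
    intro m n
    have h4 : opK a m (4 * C c * opS n f) = 4 * C c * opK a m (opS n f) := by
      rw [← C_four_mul, derivation_C_mul']
    have h5 : opK a m (inhom c n * f) = inhom c n * opK a m f +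
        (if m = 0 ∧ n = 0 then 8 * C c * X 0 * f else 0) := by
      rcases n with _ | _ | n
      · rw [inhom, ← C_four_mul, mul_assoc, derivation_C_mul', pow_two, mul_assoc,
          Derivation.leibniz, Derivation.leibniz, opK_X]
        rw [show 8 * C c * X 0 * f = 2 * C (4 * c) * X 0 * f by rw [C_four_mul]; ring]
        generalize (C (4 * c) : MvPolynomial ℕ R) = e
        rcases m with _ | m
        · simp [a0]; ring
        · simp; ring
      · rw [inhom, derivation_C_mul']; simp
      · simp [inhom]
    rw [opQ, opQ, map_add, map_add, h4, h5, opK_opS]; ring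
  rw [h1, h1, ← opK_opM a m n f]
  simp only [and_comm]
  ring

/-- The Euler derivation. -/
def euler : Derivation R (MvPolynomial ℕ R) (MvPolynomial ℕ R) := mkDerivation R X

theorem euler_monomial (m : ℕ →₀ ℕ) (r : R) :
    euler (monomial m r) = (m.degree : MvPolynomial ℕ R) * monomial m r := by
  have h : ∀ i ∈ m.support, monomial (m - Finsupp.single i 1) ((m i : ℕ) : R) • (X i : MvPolynomial ℕ R)
      = ((m i : ℕ) : MvPolynomial ℕ R) * monomial m 1 := by
    intro i hi
    rw [Finsupp.mem_support_iff] at hi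
    rw [X, smul_eq_mul, monomial_mul, mul_one, ← map_natCast (C (σ := ℕ) (R := R)) (m i),
      C_mul_monomial, mul_one]
    congr 2
    ext j
    by_cases hj : i = j
    · subst hj; simp; omega
    · simp [Finsupp.single_eq_of_ne (Ne.symm hj)]
  rw [euler, mkDerivation_monomial, Finsupp.sum, Finset.sum_congr rfl h, ← Finset.sum_mul,
    Finsupp.degree_apply, Nat.cast_sum, smul_eq_C_mul, mul_left_comm, C_mul_monomial, mul_one]

theorem coeff_euler (m : ℕ →₀ ℕ) (f : MvPolynomial ℕ R) :
    coeff m (euler f) = (m.degree : R) * coeff m f := by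
  classical
  induction f using MvPolynomial.induction_on' with
  | monomial d r =>
    rw [euler_monomial, ← map_natCast (C (σ := ℕ) (R := R)), coeff_C_mul, coeff_monomial]
    split_ifs with h
    · rw [h]
    · simp
  | add p q hp hq => rw [map_add, coeff_add, coeff_add, hp, hq]; ring

/-- The coefficient of a monomial of degree d is divided by d; degree zero, where this is
impossible, does not occur in `f`. -/
theorem exists_euler_eq [Algebra ℚ R] (f : MvPolynomial ℕ R) (hf : constantCoeff f = 0) :
    ∃ h : MvPolynomial ℕ R, constantCoeff h = 0 ∧ euler h = f := by
  refine ⟨∑ m ∈ f.support, monomial m (algebraMap ℚ R (1 / (m.degree : ℚ)) * coeff m f), ?_, ?_⟩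
  · rw [map_sum]
    refine Finset.sum_eq_zero fun m hm => ?_
    rw [constantCoeff_monomial]
    split_ifs with h
    · rw [h]; simp
    · rfl
  · rw [map_sum]
    conv_rhs => rw [f.as_sum]
    refine Finset.sum_congr rfl fun m hm => ?_
    have hm0 : (m.degree : ℚ) ≠ 0 := by
      intro h0
      rw [Nat.cast_eq_zero, Finsupp.degree_eq_zero_iff] at h0
      rw [mem_support_iff, h0] at hm
      exact hm hf
    rw [euler_monomial, ← map_natCast (C (σ := ℕ) (R := R)), C_mul_monomial, ← mul_assoc,
      ← map_natCast (algebraMap ℚ R), ← map_mul, mul_one_div_cancel hm0, map_one, one_mul]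

theorem eq_of_add_euler_eq [Algebra ℚ R] {f g : MvPolynomial ℕ R}
    (h : f + euler f = g + euler g) : f = g := by
  ext m
  have := congrArg (coeff m) h
  rw [coeff_add, coeff_add, coeff_euler, coeff_euler] at this
  have hm : ((m.degree : ℚ) + 1) ≠ 0 := by positivity
  have h2 : algebraMap ℚ R ((m.degree : ℚ) + 1) * coeff m f
      = algebraMap ℚ R ((m.degree : ℚ) + 1) * coeff m g := by
    rw [map_add, map_natCast, map_one]; linear_combination this
  calc coeff m f = algebraMap ℚ R (1 / ((m.degree : ℚ) + 1)) *
        (algebraMap ℚ R ((m.degree : ℚ) + 1) * coeff m f) := by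
        rw [← mul_assoc, ← map_mul, one_div_mul_cancel hm, map_one, one_mul]
    _ = _ := by rw [h2, ← mul_assoc, ← map_mul, one_div_mul_cancel hm, map_one, one_mul]

theorem pderiv_eq_zero_of_vars_lt {f : MvPolynomial ℕ R} {N : ℕ} (hN : ∀ i ∈ f.vars, i < N) {i : ℕ}
    (hi : N ≤ i) : pderiv i f = 0 :=
  pderiv_eq_zero_of_notMem_vars fun h => absurd (hN i h) (by omega)

/-- The Poincaré lemma. -/
theorem exists_pderiv_eq [Algebra ℚ R] (θ : ℕ → MvPolynomial ℕ R)
    (hcl : ∀ i j, pderiv i (θ j) = pderiv j (θ i)) {N : ℕ} (hN : ∀ i, N ≤ i → θ i = 0) :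
    ∃ F : MvPolynomial ℕ R, constantCoeff F = 0 ∧ ∀ i, pderiv i F = θ i := by
  obtain ⟨F, hF0, hF⟩ := exists_euler_eq (∑ i ∈ range N, X i * θ i) (by simp)
  refine ⟨F, hF0, fun j => eq_of_add_euler_eq ?_⟩
  -- `F` was chosen with `euler F` equal to ∑ x_i θ_i. Closedness gives (1 + euler)(∂_j F) = ∂_j
  -- (euler F) = (1 + euler) θ_j, and 1 + euler is injective because it multiplies degree d by d +
  -- 1.
  have hcomm : pderiv j (euler F) = pderiv j F + euler (pderiv j F) := by
    have := bracket_of_X (D₁ := pderiv j) (D₂ := euler (R := R)) (D₃ := pderiv j) (fun i => by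
      rw [euler, mkDerivation_X]
      by_cases h : j = i
      · subst h; simp
      · simp [pderiv_X_of_ne (Ne.symm h)]) F
    linear_combination this
  rw [← hcomm, hF, map_sum]
  obtain ⟨N', hN'⟩ := exists_vars_lt (θ j)
  have hE : euler (θ j) = ∑ i ∈ range N, X i * pderiv i (θ j) := by
    rw [derivation_eq_sum euler (θ j) (N := N' + N) (fun i hi => by have := hN' i hi; omega),
      add_comm N' N, Finset.sum_range_add]
    simp only [euler, mkDerivation_X]
    rw [add_eq_left]
    refine Finset.sum_eq_zero fun i _ => ?_
    rw [hcl, hN _ (by omega), map_zero, mul_zero]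
  simp only [Derivation.leibniz, smul_eq_mul, Finset.sum_add_distrib]
  rw [hE, add_comm]
  congr 1
  · by_cases hj : j < N
    · rw [Finset.sum_eq_single j]
      · simp
      · intro i _ hi; simp [pderiv_X_of_ne hi]
      · intro h; exact absurd (Finset.mem_range.2 hj) h
    · rw [hN j (by omega)]
      refine Finset.sum_eq_zero fun i hi => ?_
      rw [Finset.mem_range] at hi
      rw [pderiv_X_of_ne (by omega), mul_zero]
  · exact Finset.sum_congr rfl fun i _ => by rw [hcl]

theorem exists_inverse_series (a : ℕ → R) (a0 : a 0 = 1) :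
    ∃ s : ℕ → R, s 0 = 1 ∧ ∀ n, ∑ p ∈ antidiagonal n, s p.1 * a p.2 = if n = 0 then 1 else 0 := by
  have h := PowerSeries.mul_invOfUnit (PowerSeries.mk a) 1 (by simp [a0])
  refine ⟨fun n => PowerSeries.coeff n (PowerSeries.invOfUnit (PowerSeries.mk a) 1), ?_, fun n => ?_⟩
  · simp
  · have := congrArg (PowerSeries.coeff n) h
    rw [mul_comm, PowerSeries.coeff_mul, PowerSeries.coeff_one] at this
    simpa using this

/-- With the index shift S ∂_n = ∂_{n+1} one has `opK a n` = a(S) ∂_n, so the inverse power series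
of `a` recovers the partial derivatives. The sum is finite because ∂_i f = 0 beyond the variables of
`f`. -/
theorem pderiv_eq_sum_opK {a s : ℕ → R}
    (hs : ∀ n, ∑ p ∈ antidiagonal n, s p.1 * a p.2 = if n = 0 then 1 else 0)
    {f : MvPolynomial ℕ R} {N : ℕ} (hN : ∀ i ∈ f.vars, i < N) (i : ℕ) {L : ℕ} (hL : N ≤ L) :
    pderiv i f = ∑ k ∈ range L, C (s k) * opK a (i + k) f := by
  have h : pderiv i f = (∑ k ∈ range L, s k • opK a (i + k) :
      Derivation R (MvPolynomial ℕ R) (MvPolynomial ℕ R)) f := by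
    apply derivation_eq_of_forall_mem_vars
    intro j hj
    have hjL := hN j hj
    simp only [derivation_sum_apply, Derivation.smul_apply, opK_X, smul_eq_C_mul]
    by_cases hij : i ≤ j
    · have h1 := congrArg (C (σ := ℕ)) (hs (j - i))
      rw [Finset.Nat.sum_antidiagonal_eq_sum_range_succ_mk, map_sum] at h1
      rw [← Finset.sum_subset (Finset.range_subset_range.2 (show j - i + 1 ≤ L by omega))]
      · rw [Finset.sum_congr rfl (fun k hk => ?_), h1]
        · by_cases h : i = j
          · subst h; simp
          · rw [pderiv_X_of_ne (Ne.symm h), if_neg (by omega), map_zero]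
        · rw [Finset.mem_range] at hk
          rw [if_pos (by omega), C_mul, show j - (i + k) = j - i - k by omega]
      · intro k _ hk
        rw [Finset.mem_range] at hk
        rw [if_neg (by omega), mul_zero]
    · rw [pderiv_X_of_ne (by omega), eq_comm]
      exact Finset.sum_eq_zero fun k _ => by rw [if_neg (by omega), mul_zero]
  rw [h, derivation_sum_apply]
  simp [smul_eq_C_mul]

theorem eq_zero_of_triangular {V : Type*} [CommRing V] (s : ℕ → V) (s0 : s 0 = 1) {L : ℕ}
    (u : ℕ → V) {N : ℕ} (hN : ∀ n, N ≤ n → u n = 0)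
    (h : ∀ i, ∑ k ∈ range (L + 1), s k * u (i + k) = 0) (n : ℕ) : u n = 0 := by
  have key : ∀ d n, N ≤ n + d → u n = 0 := by
    intro d
    induction d with
    | zero => intro n hn; exact hN n hn
    | succ d ih =>
      intro n hn
      have := h n
      rw [Finset.sum_range_succ', s0, one_mul, add_zero, Finset.sum_eq_zero (fun k _ => ?_),
        zero_add] at this
      · exact this
      · rw [ih (n + (k + 1)) (by omega), mul_zero]
  exact key N n (by omega)

theorem opK_eq_zero_of_vars_lt (a : ℕ → R) {f : MvPolynomial ℕ R} {N : ℕ}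
    (hN : ∀ i ∈ f.vars, i < N) {n : ℕ} (hn : N ≤ n) : opK a n f = 0 :=
  derivation_eq_zero_of_forall_mem_vars fun i hi => by
    rw [opK_X, if_neg (by have := hN i hi; omega)]

theorem pderiv_eq_zero_of_opK_eq_zero {a : ℕ → R} (a0 : a 0 = 1) {f : MvPolynomial ℕ R}
    (h : ∀ n, opK a n f = 0) (i : ℕ) : pderiv i f = 0 := by
  obtain ⟨s, -, hs⟩ := exists_inverse_series a a0
  obtain ⟨N, hN⟩ := exists_vars_lt f
  rw [pderiv_eq_sum_opK hs hN i le_rfl]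
  exact Finset.sum_eq_zero fun k _ => by rw [h, mul_zero]

/-- The Poincaré lemma for the commuting derivations `opK a n`. -/
theorem exists_opK_eq [Algebra ℚ R] {a : ℕ → R} (a0 : a 0 = 1) (θ : ℕ → MvPolynomial ℕ R)
    (hcl : ∀ m n, opK a m (θ n) = opK a n (θ m)) {N : ℕ} (hN : ∀ i, N ≤ i → θ i = 0) :
    ∃ F : MvPolynomial ℕ R, constantCoeff F = 0 ∧ ∀ n, opK a n F = θ n := by
  obtain ⟨s, s0, hs⟩ := exists_inverse_series a a0
  choose B hB using fun n => exists_vars_lt (θ n)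
  set L := N + (range N).sup B + 1 with hL
  have hBL : ∀ n, ∀ i ∈ (θ n).vars, i < L := by
    intro n i hi
    by_cases hn : n < N
    · have h1 := hB n i hi
      have h2 : B n ≤ (range N).sup B := Finset.le_sup (Finset.mem_range.2 hn)
      omega
    · rw [hN n (by omega)] at hi; simp at hi
  obtain ⟨F, hF0, hF⟩ := exists_pderiv_eq (fun i => ∑ k ∈ range L, C (s k) * θ (i + k))
    (fun i j => by
      have h1 : ∀ i j, pderiv i (∑ k ∈ range L, C (s k) * θ (j + k))
          = ∑ k ∈ range L, ∑ l ∈ range L, C (s k) * C (s l) * opK a (i + l) (θ (j + k)) := by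
        intro i j
        rw [map_sum]
        refine Finset.sum_congr rfl fun k _ => ?_
        rw [derivation_C_mul', pderiv_eq_sum_opK hs (hBL (j + k)) i le_rfl, Finset.mul_sum]
        exact Finset.sum_congr rfl fun l _ => by ring
      rw [h1, h1, Finset.sum_comm]
      refine Finset.sum_congr rfl fun k _ => Finset.sum_congr rfl fun l _ => ?_
      rw [hcl]; ring)
    (N := N) (fun i hi => Finset.sum_eq_zero fun k _ => by rw [hN _ (by omega), mul_zero])
  -- `F` is built from its partial derivatives. The defects `opK a n F - θ n` vanish for large n and
  -- satisfy a unitriangular system with coefficients `s`, so downward induction shows that all of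
  -- them vanish.
  refine ⟨F, hF0, fun n => ?_⟩
  obtain ⟨N', hN'⟩ := exists_vars_lt F
  have key : ∀ n, opK a n F - θ n = 0 := by
    refine eq_zero_of_triangular (fun k => C (s k)) (by simp [s0]) (L := N' + L)
      (fun n => opK a n F - θ n) (N := N' + N) (fun n hn => ?_) (fun i => ?_)
    · rw [opK_eq_zero_of_vars_lt a hN' (by omega), hN n (by omega), sub_zero]
    · simp only [mul_sub, Finset.sum_sub_distrib]
      rw [← pderiv_eq_sum_opK hs hN' i (by omega), hF, sub_eq_zero]
      refine Finset.sum_subset (Finset.range_subset_range.2 (by omega)) fun k _ hk => ?_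
      rw [Finset.mem_range] at hk
      rw [hN _ (by omega), mul_zero]
  exact sub_eq_zero.1 (key n)

/-- Supplies the finiteness required by the Poincaré lemma. In `opS n` one of two indices with sum
at least 2N + 3 exceeds N. -/
theorem opQ_eq_zero_of_vars_lt (c : R) {f : MvPolynomial ℕ R} {N : ℕ}
    (hN : ∀ i ∈ f.vars, i < N) {n : ℕ} (hn : 2 * N + 3 ≤ n) : opQ c n f = 0 := by
  have h1 : opM n f = 0 := derivation_eq_zero_of_forall_mem_vars fun i hi => by
    rw [opM_X, if_neg (by have := hN i hi; omega)]
  have h0 : ∀ i, N + 1 ≤ i → shiftD i f = 0 := by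
    intro i hi
    obtain ⟨j, rfl⟩ : ∃ j, i = j + 1 := ⟨i - 1, by omega⟩
    exact pderiv_eq_zero_of_vars_lt hN (by omega)
  have h2 : opS n f = 0 := Finset.sum_eq_zero fun p hp => by
    rw [Finset.HasAntidiagonal.mem_antidiagonal] at hp
    by_cases h : N + 1 ≤ p.2
    · rw [h0 _ h, map_zero]
    · rw [shiftD_comm, h0 _ (by omega), map_zero]
  obtain ⟨k, rfl⟩ : ∃ k, n = k + 2 := ⟨n - 2, by omega⟩
  rw [opQ, h1, h2, show inhom c (k + 2) = 0 from rfl]; ring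

/-- Existence of the solution of the Virasoro constraints, order by order. -/
theorem exists_partition [Algebra ℚ R] {a : ℕ → R} (a0 : a 0 = 1) {c : R} (hc : 8 * c = 1) :
    ∃ Z : ℕ → MvPolynomial ℕ R, Z 0 = 1 ∧ (∀ k, constantCoeff (Z (k + 1)) = 0) ∧
      ∀ k n, opK a n (Z (k + 1)) = -opQ c n (Z k) := by
  have hstep : ∀ f : MvPolynomial ℕ R,
      (∀ m n, opK a m (opQ c n f) = opK a n (opQ c m f)) →
      ∃ g : MvPolynomial ℕ R, (∀ m n, opK a m (opQ c n g) = opK a n (opQ c m g)) ∧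
        constantCoeff g = 0 ∧ ∀ n, opK a n g = -opQ c n f := by
    intro f hf
    obtain ⟨N, hN⟩ := exists_vars_lt f
    obtain ⟨g, hg0, hg⟩ := exists_opK_eq a0 (fun n => -opQ c n f)
      (fun m n => by rw [map_neg, map_neg, hf]) (N := 2 * N + 3)
      (fun n hn => by rw [opQ_eq_zero_of_vars_lt c hN hn, neg_zero])
    refine ⟨g, fun m n => ?_, hg0, hg⟩
    -- Integrability is inherited by `g`: substituting `opK g = -opQ f` into `opK_opQ` leaves a
    -- commutator of the `opQ` on `f` and a multiple of `opQ c (m + n - 1) f`, which cancel by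
    -- `opQ_comm`.
    have h1 := opK_opQ a a0 c m n g
    have h2 := opQ_comm hc m n f
    rw [hg, hg, hg, opQ_neg, opQ_neg] at h1
    linear_combination h1 + h2
  choose! next hnext using hstep
  have h0 : ∀ m n, opK a m (opQ c n (1 : MvPolynomial ℕ R)) = opK a n (opQ c m 1) := by
    intro m n
    have h1 := opK_opQ a a0 c m n (1 : MvPolynomial ℕ R)
    have hz : ∀ m, opQ c m (0 : MvPolynomial ℕ R) = 0 := fun m => by simp [opQ, opS]
    simp only [Derivation.map_one_eq_zero, hz, sub_zero, mul_zero] at h1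
    exact sub_eq_zero.1 h1
  let Z : ℕ → MvPolynomial ℕ R := fun k => Nat.rec 1 (fun _ f => next f) k
  have hZ : ∀ k, ∀ m n, opK a m (opQ c n (Z k)) = opK a n (opQ c m (Z k)) := by
    intro k
    induction k with
    | zero => exact h0
    | succ k ih => exact (hnext _ ih).1
  exact ⟨Z, rfl, fun k => (hnext _ (hZ k)).2.1, fun k n => (hnext _ (hZ k)).2.2 n⟩

end Airy


/-! ## Logarithms of power series and coefficientwise derivations -/

namespace PowerSeries

open Finset

variable {k V : Type*} [CommRing k] [CommRing V] [Algebra k V]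

/-- A derivation of the coefficient ring acts coefficientwise on power series. -/
def coeffwise (d : Derivation k V V) : Derivation k V⟦X⟧ V⟦X⟧ where
  toFun f := mk fun n => d (coeff n f)
  map_add' f g := by ext n; simp
  map_smul' c f := by
    ext n
    rw [coeff_mk, RingHom.id_apply, ← algebraMap_smul V c f, coeff_smul, smul_eq_mul,
      ← algebraMap_smul V c (mk fun n => d (coeff n f)), coeff_smul, coeff_mk, smul_eq_mul,
      ← Algebra.smul_def, ← Algebra.smul_def, d.map_smul]
  map_one_eq_zero' := by
    ext n
    simp only [LinearMap.coe_mk, AddHom.coe_mk, coeff_mk, coeff_one, map_zero]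
    split_ifs <;> simp
  leibniz' f g := by
    ext n
    simp only [LinearMap.coe_mk, AddHom.coe_mk, coeff_mk, coeff_mul, map_sum, smul_eq_mul, map_add,
      Derivation.leibniz, Finset.sum_add_distrib]
    congr 1
    exact (Finset.Nat.sum_antidiagonal_swap (n := n)
      (f := fun p : ℕ × ℕ => coeff p.1 g * d (coeff p.2 f))).symm ▸ rfl

@[simp] theorem coeff_coeffwise (d : Derivation k V V) (f : V⟦X⟧) (n : ℕ) :
    coeff n (coeffwise d f) = d (coeff n f) :=
  coeff_mk n fun n => d (coeff n f)

theorem derivative_coeffwise (d : Derivation k V V) (f : V⟦X⟧) :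
    d⁄dX V (coeffwise d f) = coeffwise d (d⁄dX V f) := by
  ext n
  rw [coeff_derivative, coeff_coeffwise, coeff_coeffwise, coeff_derivative, Derivation.leibniz]
  have : d ((n : V) + 1) = 0 := by rw [map_add, Derivation.map_natCast, Derivation.map_one_eq_zero, add_zero]
  rw [this, smul_zero, zero_add, smul_eq_mul, mul_comm]

theorem eq_zero_of_natCast_succ_mul [Algebra ℚ V] {x : V} {n : ℕ} (h : x * ((n : V) + 1) = 0) :
    x = 0 := by
  have hn : ((n : ℚ) + 1) ≠ 0 := by positivity
  have h2 : algebraMap ℚ V ((n : ℚ) + 1) = (n : V) + 1 := by simp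
  calc x = x * algebraMap ℚ V (((n : ℚ) + 1) * (1 / ((n : ℚ) + 1))) := by
        rw [mul_one_div_cancel hn, map_one, mul_one]
    _ = 0 := by rw [map_mul, ← mul_assoc, h2, h, zero_mul]

/-- Uniqueness for linear differential equations of first order. -/
theorem eq_zero_of_derivative_eq_mul [Algebra ℚ V] {G A : V⟦X⟧} (h : d⁄dX V G = A * G)
    (h0 : coeff 0 G = 0) : G = 0 := by
  ext n
  induction n using Nat.strong_induction_on with
  | _ n ih =>
    rcases n with _ | n
    · simpa using h0
    · have h1 := congrArg (coeff n) h
      rw [coeff_derivative, coeff_mul, Finset.sum_eq_zero (fun p hp => ?_)] at h1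
      · simpa using eq_zero_of_natCast_succ_mul h1
      · rw [Finset.HasAntidiagonal.mem_antidiagonal] at hp
        rw [ih p.2 (by omega), map_zero, mul_zero]

/-- The chain rule for F = log Z without composing series: G = dZ - Z dF satisfies G' = F' G with
zero initial term, because d commutes with d/dX. -/
theorem coeffwise_eq_mul [Algebra ℚ V] {Z F : V⟦X⟧} (hZ : coeff 0 Z = 1) (hF : coeff 0 F = 0)
    (h : d⁄dX V Z = Z * d⁄dX V F) (d : Derivation k V V) :
    coeffwise d Z = Z * coeffwise d F := by
  refine sub_eq_zero.1 (eq_zero_of_derivative_eq_mul (A := d⁄dX V F) ?_ ?_)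
  · have h1 := congrArg (coeffwise d) h
    rw [← derivative_coeffwise, Derivation.leibniz, smul_eq_mul, smul_eq_mul,
      ← derivative_coeffwise] at h1
    rw [map_sub, Derivation.leibniz, smul_eq_mul, smul_eq_mul, h1, h]
    ring
  · rw [map_sub, coeff_mul]
    simp [hZ, hF, -coeff_zero_eq_constantCoeff]

/-- Z'/Z is integrated termwise. The factor `1 / 0 = 0` makes the constant term of `F` zero. -/
theorem exists_log [Algebra ℚ V] {Z : V⟦X⟧} (hZ : coeff 0 Z = 1) :
    ∃ F : V⟦X⟧, coeff 0 F = 0 ∧ d⁄dX V Z = Z * d⁄dX V F := by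
  have hu : Z * invOfUnit Z 1 = 1 := mul_invOfUnit Z 1 (by simpa using hZ)
  refine ⟨mk fun n => algebraMap ℚ V (1 / (n : ℚ)) * coeff (n - 1) (d⁄dX V Z * invOfUnit Z 1),
    by rw [coeff_mk]; simp, ?_⟩
  have h : d⁄dX V (mk fun n => algebraMap ℚ V (1 / (n : ℚ)) *
      coeff (n - 1) (d⁄dX V Z * invOfUnit Z 1)) = d⁄dX V Z * invOfUnit Z 1 := by
    ext n
    have hn : ((n : ℚ) + 1) ≠ 0 := by positivity
    have h2 : (n : V) + 1 = algebraMap ℚ V ((n : ℚ) + 1) := by simp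
    rw [coeff_derivative, coeff_mk, h2, mul_right_comm, ← map_mul, Nat.cast_succ,
      one_div_mul_cancel hn, map_one, one_mul, Nat.succ_sub_one]
  rw [h, mul_left_comm, hu, mul_one]

end PowerSeries

/-! ### The Virasoro constraints for free energies -/

namespace Airy

open MvPolynomial Finset

variable {R : Type*} [CommRing R]

/-- `F` solves the Virasoro constraints at the level of free energies, order by order in the
Euler characteristic; `y` is the expansion parameter and `c` stands for `1/8`. -/
def IsVirasoroSolution (a : ℕ → R) (y c : R) (F : ℕ → MvPolynomial ℕ R) : Prop :=
  ∀ k n, opK a n (F (k + 1)) + C y * (opM n (F k)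
    + 4 * C c * ∑ p ∈ antidiagonal n, (shiftD p.1 (shiftD p.2 (F k))
      + ∑ q ∈ antidiagonal k, shiftD p.1 (F q.1) * shiftD p.2 (F q.2))
    + if k = 0 then inhom c n else 0) = 0

/-- The constraints on the partition function z are linear of second order. With F = log z a second
derivative of z becomes z (∂_i∂_j F + ∂_i F ∂_j F), and division by the unit z leaves the quadratic
system. -/
theorem exists_isVirasoroSolution [Algebra ℚ R] {a : ℕ → R} (a0 : a 0 = 1) {c : R}
    (hc : 8 * c = 1) :
    ∃ F : ℕ → MvPolynomial ℕ R, F 0 = 0 ∧ (∀ k, constantCoeff (F k) = 0) ∧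
      IsVirasoroSolution a 1 c F := by
  obtain ⟨Z, Z0, Zc, hZ⟩ := exists_partition a0 hc
  set z : PowerSeries (MvPolynomial ℕ R) := PowerSeries.mk Z with hz
  have hz0 : PowerSeries.coeff 0 z = 1 := by rw [hz, PowerSeries.coeff_mk, Z0]
  obtain ⟨F, hF0, hF⟩ := PowerSeries.exists_log hz0
  have hd := PowerSeries.coeffwise_eq_mul (k := R) hz0 hF0 hF
  refine ⟨fun k => PowerSeries.coeff k F, hF0, ?_, ?_⟩
  -- At x = 0 the partition function is 1, hence its logarithm is 0.
  · have h1 : PowerSeries.map (constantCoeff (σ := ℕ) (R := R)) z = 1 := by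
      ext n
      rw [PowerSeries.coeff_map, hz, PowerSeries.coeff_mk, PowerSeries.coeff_one]
      rcases n with _ | n
      · simp [Z0]
      · rw [Zc]; simp
    have hmapd : ∀ f : PowerSeries (MvPolynomial ℕ R),
        PowerSeries.map (constantCoeff (σ := ℕ) (R := R)) (PowerSeries.derivative _ f)
          = PowerSeries.derivative _ (PowerSeries.map (constantCoeff (σ := ℕ) (R := R)) f) := by
      intro f; ext n
      simp [PowerSeries.coeff_derivative]
    have h2 := congrArg (PowerSeries.map (constantCoeff (σ := ℕ) (R := R))) hF
    rw [map_mul, hmapd, hmapd, h1, one_mul, Derivation.map_one_eq_zero] at h2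
    have h3 := PowerSeries.eq_zero_of_derivative_eq_mul (A := 0)
      (G := PowerSeries.map (constantCoeff (σ := ℕ) (R := R)) F) (by rw [← h2, zero_mul])
      (by rw [PowerSeries.coeff_map, hF0, map_zero])
    intro k
    have := congrArg (PowerSeries.coeff k) h3
    simpa using this
  · have hu : IsUnit z := PowerSeries.isUnit_iff_constantCoeff.2 (by
      rw [← PowerSeries.coeff_zero_eq_constantCoeff_apply, hz0]; exact isUnit_one)
    intro k n
    let cw := fun D : Derivation R (MvPolynomial ℕ R) (MvPolynomial ℕ R) => PowerSeries.coeffwise D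
    have h4 : (4 : PowerSeries (MvPolynomial ℕ R)) * PowerSeries.C (C c)
        = PowerSeries.C (4 * C c) := by rw [map_mul, map_ofNat]
    have hlin : cw (opK a n) z + PowerSeries.X * (cw (opM n) z
        + 4 * PowerSeries.C (C c) * ∑ p ∈ antidiagonal n, cw (shiftD p.1) (cw (shiftD p.2) z)
        + PowerSeries.C (inhom c n) * z) = 0 := by
      ext1 k
      rw [map_add, map_zero, PowerSeries.coeff_coeffwise]
      rcases k with _ | k
      · rw [hz0, Derivation.map_one_eq_zero, PowerSeries.coeff_zero_X_mul, add_zero]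
      · rw [PowerSeries.coeff_succ_X_mul, map_add, map_add, PowerSeries.coeff_coeffwise,
          h4, PowerSeries.coeff_C_mul, map_sum, PowerSeries.coeff_C_mul, hz,
          PowerSeries.coeff_mk, PowerSeries.coeff_mk, hZ, opQ]
        simp only [cw, PowerSeries.coeff_coeffwise, PowerSeries.coeff_mk, opS]
        ring
    have hsh : ∀ i j, cw (shiftD i) (cw (shiftD j) z) = z * (cw (shiftD i) (cw (shiftD j) F)
        + cw (shiftD i) F * cw (shiftD j) F) := by
      intro i j
      rw [show cw (shiftD j) z = z * cw (shiftD j) F from hd _, Derivation.leibniz, smul_eq_mul,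
        smul_eq_mul, show cw (shiftD i) z = z * cw (shiftD i) F from hd _]
      ring
    have hF' : cw (opK a n) F + PowerSeries.X * (cw (opM n) F
        + 4 * PowerSeries.C (C c) * ∑ p ∈ antidiagonal n, (cw (shiftD p.1) (cw (shiftD p.2) F)
          + cw (shiftD p.1) F * cw (shiftD p.2) F)
        + PowerSeries.C (inhom c n)) = 0 := by
      refine hu.mul_right_injective.eq_iff.1 ?_
      rw [mul_zero, ← hlin, show cw (opK a n) z = z * cw (opK a n) F from hd _,
        show cw (opM n) z = z * cw (opM n) F from hd _,
        Finset.sum_congr rfl fun (p : ℕ × ℕ) _ => hsh p.1 p.2, ← Finset.mul_sum]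
      ring
    have := congrArg (PowerSeries.coeff (k + 1)) hF'
    rw [map_add, map_zero, PowerSeries.coeff_coeffwise, PowerSeries.coeff_succ_X_mul, map_add,
      map_add, h4, PowerSeries.coeff_C_mul, PowerSeries.coeff_coeffwise, map_sum,
      PowerSeries.coeff_C] at this
    simp only [map_add, cw, PowerSeries.coeff_coeffwise, PowerSeries.coeff_mul] at this
    rw [C_1, one_mul]
    exact this

end Airy


namespace Airy

open MvPolynomial Finset

variable {R : Type*} [CommRing R]

/-! ## Dependence on the parameters -/

section CoefficientDerivations

variable {k : Type*} [CommRing k] [Algebra k R]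

/-- The action of a derivation of the coefficient ring on polynomials. -/
def coefMap (d : Derivation k R R) (f : MvPolynomial ℕ R) : MvPolynomial ℕ R :=
  ∑ m ∈ f.support, monomial m (d (coeff m f))

theorem coeff_coefMap (d : Derivation k R R) (f : MvPolynomial ℕ R) (m : ℕ →₀ ℕ) :
    coeff m (coefMap d f) = d (coeff m f) := by
  classical
  rw [coefMap, coeff_sum]
  simp only [coeff_monomial, Finset.sum_ite_eq']
  split_ifs with h
  · rfl
  · rw [notMem_support_iff.1 h, map_zero]

/-- The action of a derivation of the coefficient ring on polynomials, as a derivation. -/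
def coefD (d : Derivation k R R) : Derivation k (MvPolynomial ℕ R) (MvPolynomial ℕ R) where
  toFun f := coefMap d f
  map_add' f g := by ext m; simp [coeff_coefMap]
  map_smul' c f := by
    ext m
    rw [RingHom.id_apply, coeff_smul, coeff_coefMap, coeff_coefMap, coeff_smul, d.map_smul]
  map_one_eq_zero' := by
    classical
    ext m
    simp only [LinearMap.coe_mk, AddHom.coe_mk, coeff_coefMap, coeff_one, coeff_zero]
    split_ifs <;> simp
  leibniz' f g := by
    classical
    ext m
    simp only [LinearMap.coe_mk, AddHom.coe_mk, smul_eq_mul, coeff_add, coeff_coefMap, coeff_mul,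
      map_sum, Derivation.leibniz, Finset.sum_add_distrib]
    congr 1
    exact Finset.sum_nbij' Prod.swap Prod.swap (by simp [add_comm]) (by simp [add_comm])
      (fun _ _ => rfl) (fun _ _ => rfl) (fun _ _ => rfl)

theorem coeff_coefD (d : Derivation k R R) (f : MvPolynomial ℕ R) (m : ℕ →₀ ℕ) :
    coeff m (coefD d f) = d (coeff m f) := coeff_coefMap d f m

@[simp] theorem coefD_C (d : Derivation k R R) (r : R) : coefD d (C r) = C (d r) := by
  classical
  ext m
  rw [coeff_coefD, coeff_C, coeff_C]
  split_ifs <;> simp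

@[simp] theorem coefD_X (d : Derivation k R R) (i : ℕ) : coefD d (X i) = 0 := by
  classical
  ext m
  rw [coeff_coefD, coeff_X, coeff_zero]
  split_ifs <;> simp

theorem constantCoeff_coefD (d : Derivation k R R) (f : MvPolynomial ℕ R) :
    constantCoeff (coefD d f) = d (constantCoeff f) := coeff_coefD d f 0

theorem coefD_apply_derivation (d : Derivation k R R)
    (D D' : Derivation R (MvPolynomial ℕ R) (MvPolynomial ℕ R))
    (h : ∀ i, coefD d (D (X i)) = D' (X i)) (f : MvPolynomial ℕ R) :
    coefD d (D f) = D (coefD d f) + D' f := by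
  have key : ⁅coefD d, D.restrictScalars k⁆ f = D'.restrictScalars k f := by
    refine derivation_ext_C_X (fun r => ?_) (fun i => ?_) f
    · rw [Derivation.commutator_apply]
      simp [Derivation.restrictScalars_apply]
    · rw [Derivation.commutator_apply]
      simp [Derivation.restrictScalars_apply, h]
  rw [Derivation.commutator_apply] at key
  simp only [Derivation.restrictScalars_apply] at key
  linear_combination key

theorem coefD_shiftD (d : Derivation k R R) (i : ℕ) (f : MvPolynomial ℕ R) :
    coefD d (shiftD i f) = shiftD i (coefD d f) := by
  rw [coefD_apply_derivation d (shiftD i) 0 (fun j => ?_), Derivation.zero_apply, add_zero]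
  rw [shiftD_X]
  split_ifs <;> simp

theorem coefD_opM (d : Derivation k R R) (n : ℕ) (f : MvPolynomial ℕ R) :
    coefD d (opM n f) = opM n (coefD d f) := by
  rw [coefD_apply_derivation d (opM n) 0 (fun j => ?_), Derivation.zero_apply, add_zero]
  rw [opM_X, Derivation.zero_apply]
  split_ifs
  · rw [show (2 * ((j + 1 - n : ℕ) : MvPolynomial ℕ R) + 1)
          = ((2 * (j + 1 - n) + 1 : ℕ) : MvPolynomial ℕ R) by push_cast; ring,
          Derivation.leibniz, Derivation.map_natCast, smul_zero, coefD_X, smul_zero, add_zero]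
  · simp

theorem coefD_opK (d : Derivation k R R) (a : ℕ → R) (n : ℕ) (f : MvPolynomial ℕ R) :
    coefD d (opK a n f) = opK a n (coefD d f) + opK (fun j => d (a j)) n f := by
  refine coefD_apply_derivation d (opK a n) _ (fun j => ?_) f
  rw [opK_X, opK_X]
  split_ifs <;> simp

end CoefficientDerivations

theorem opM_eq_zero_of_pderiv {f : MvPolynomial ℕ R} (h : ∀ i, pderiv i f = 0) (n : ℕ) :
    opM n f = 0 := by
  obtain ⟨N, hN⟩ := exists_vars_lt f
  rw [derivation_eq_sum (opM n) f hN]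
  exact Finset.sum_eq_zero fun i _ => by rw [h, mul_zero]

theorem shiftD_eq_zero_of_pderiv {f : MvPolynomial ℕ R} (h : ∀ i, pderiv i f = 0) (n : ℕ) :
    shiftD n f = 0 := by
  rcases n with _ | n
  · rfl
  · exact h n

/-- Uniqueness for the linearised Virasoro constraints. -/
theorem pderiv_eq_zero_of_linearised {a : ℕ → R} (a0 : a 0 = 1) {y c : R}
    {F Ξ : ℕ → MvPolynomial ℕ R} (h0 : ∀ i, pderiv i (Ξ 0) = 0)
    (h : ∀ k n, opK a n (Ξ (k + 1)) + C y * (opM n (Ξ k)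
      + 4 * C c * ∑ p ∈ antidiagonal n, (shiftD p.1 (shiftD p.2 (Ξ k))
        + ∑ q ∈ antidiagonal k, (shiftD p.1 (Ξ q.1) * shiftD p.2 (F q.2)
          + shiftD p.1 (F q.1) * shiftD p.2 (Ξ q.2)))) = 0) (k i : ℕ) :
    pderiv i (Ξ k) = 0 := by
  induction k using Nat.strong_induction_on generalizing i with
  | _ k ih =>
    rcases k with _ | k
    · exact h0 i
    refine pderiv_eq_zero_of_opK_eq_zero a0 (fun n => ?_) i
    have hs : ∀ q, q ≤ k → ∀ j, shiftD j (Ξ q) = 0 := fun q hq j =>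
      shiftD_eq_zero_of_pderiv (fun i => ih q (by omega) i) j
    have h1 := h k n
    rw [opM_eq_zero_of_pderiv (fun i => ih k (by omega) i), Finset.sum_eq_zero, mul_zero, add_zero,
      mul_zero, add_zero] at h1
    · exact h1
    · intro p _
      rw [hs k le_rfl, map_zero, zero_add]
      refine Finset.sum_eq_zero fun q hq => ?_
      rw [Finset.HasAntidiagonal.mem_antidiagonal] at hq
      rw [hs q.1 (by omega), hs q.2 (by omega), zero_mul, mul_zero, add_zero]

theorem shiftD_C_mul (i : ℕ) (c : R) (f : MvPolynomial ℕ R) :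
    shiftD i (C c * f) = C c * shiftD i f := derivation_C_mul' _ _ _

/-- The equation for level k + 1 is homogeneous: its quadratic terms have levels adding up to k.
Thus the expansion parameter, later 1/ρ_0, enters only through explicit powers. -/
theorem IsVirasoroSolution.scale {a : ℕ → R} {y c : R} {F : ℕ → MvPolynomial ℕ R}
    (hF : IsVirasoroSolution a 1 c F) :
    IsVirasoroSolution a y c (fun k => C (y ^ k) * F k) := by
  intro k n
  have h := hF k n
  have hq : ∀ p : ℕ × ℕ, ∑ q ∈ antidiagonal k, shiftD p.1 (C (y ^ q.1) * F q.1) *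
      shiftD p.2 (C (y ^ q.2) * F q.2)
      = C (y ^ k) * ∑ q ∈ antidiagonal k, shiftD p.1 (F q.1) * shiftD p.2 (F q.2) := by
    intro p
    rw [Finset.mul_sum]
    refine Finset.sum_congr rfl fun q hq => ?_
    rw [Finset.HasAntidiagonal.mem_antidiagonal] at hq
    rw [shiftD_C_mul, shiftD_C_mul, ← hq, pow_add, C_mul]
    ring
  have hi : (if k = 0 then inhom c n else 0) = C (y ^ k) * (if k = 0 then inhom c n else 0) := by
    split_ifs with h
    · simp [h]
    · simp
  have hp : ∀ p : ℕ × ℕ, shiftD p.1 (shiftD p.2 (C (y ^ k) * F k))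
      + ∑ q ∈ antidiagonal k, shiftD p.1 (C (y ^ q.1) * F q.1) * shiftD p.2 (C (y ^ q.2) * F q.2)
      = C (y ^ k) * (shiftD p.1 (shiftD p.2 (F k))
        + ∑ q ∈ antidiagonal k, shiftD p.1 (F q.1) * shiftD p.2 (F q.2)) := by
    intro p
    rw [hq, shiftD_C_mul, shiftD_C_mul, mul_add]
  rw [Finset.sum_congr rfl fun p _ => hp p, ← Finset.mul_sum, derivation_C_mul',
    derivation_C_mul', hi]
  rw [C_1, one_mul] at h
  rw [pow_succ, C_mul]
  linear_combination (C (y ^ k) * C y) * h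

section Variation

variable {k : Type*} [CommRing k] [Algebra k R]

theorem coefD_inhom (d : Derivation k R R) {c : R} (hdc : d c = 0) (n : ℕ) :
    coefD d (inhom c n) = 0 := by
  rcases n with _ | _ | n
  · rw [inhom, ← C_four_mul, Derivation.leibniz, Derivation.leibniz_pow, coefD_X, coefD_C,
      Derivation.leibniz, hdc, show d (4 : R) = 0 from Derivation.map_natCast d 4]
    simp
  · rw [inhom, coefD_C, hdc, C_0]
  · exact map_zero _

theorem coefD_C_mul_of_eq_zero (d : Derivation k R R) {c : R} (hdc : d c = 0)
    (f : MvPolynomial ℕ R) : coefD d (4 * C c * f) = 4 * C c * coefD d f := by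
  rw [← C_four_mul, Derivation.leibniz, coefD_C, Derivation.leibniz, hdc,
    show d (4 : R) = 0 from Derivation.map_natCast d 4]
  simp

theorem coefD_sum (d : Derivation k R R) (F : ℕ → MvPolynomial ℕ R) (j n : ℕ) :
    coefD d (∑ p ∈ antidiagonal n, (shiftD p.1 (shiftD p.2 (F j))
      + ∑ q ∈ antidiagonal j, shiftD p.1 (F q.1) * shiftD p.2 (F q.2)))
    = ∑ p ∈ antidiagonal n, (shiftD p.1 (shiftD p.2 (coefD d (F j)))
      + ∑ q ∈ antidiagonal j, (shiftD p.1 (coefD d (F q.1)) * shiftD p.2 (F q.2)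
          + shiftD p.1 (F q.1) * shiftD p.2 (coefD d (F q.2)))) := by
  rw [map_sum]
  refine Finset.sum_congr rfl fun p _ => ?_
  rw [map_add, map_sum, coefD_shiftD, coefD_shiftD]
  congr 1
  refine Finset.sum_congr rfl fun q _ => ?_
  rw [Derivation.leibniz, coefD_shiftD, coefD_shiftD, smul_eq_mul, smul_eq_mul]
  ring

/-- Derivations that annihilate the coefficients of the constraints annihilate the solution. -/
theorem IsVirasoroSolution.pderiv_coefD_eq_zero {a : ℕ → R} (a0 : a 0 = 1) {c : R}
    {F : ℕ → MvPolynomial ℕ R} (hF : IsVirasoroSolution a 1 c F) (hF0 : F 0 = 0)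
    (d : Derivation k R R) (ha : ∀ j, d (a j) = 0) (hc : d c = 0) (j i : ℕ) :
    pderiv i (coefD d (F j)) = 0 := by
  refine pderiv_eq_zero_of_linearised (Ξ := fun j => coefD d (F j)) (F := F) (y := 1) (c := c) a0
    (by simp [hF0]) (fun j n => ?_) j i
  have h := congrArg (coefD d) (hF j n)
  have hK : opK (fun j => d (a j)) n = 0 := derivation_ext fun i => by
    rw [opK_X]; simp [ha]
  have hi : coefD d (if j = 0 then inhom c n else 0) = 0 := by
    split_ifs
    · exact coefD_inhom d hc n
    · exact map_zero _
  rw [C_1, one_mul, map_add, map_add, map_add, map_zero, coefD_opK, coefD_opM, hK,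
    Derivation.zero_apply, add_zero, coefD_C_mul_of_eq_zero d hc, coefD_sum, hi, add_zero] at h
  rw [C_1, one_mul]
  exact h

/-- Variation of the parameters of the constraints amounts to a shift of the variables. -/
theorem IsVirasoroSolution.pderiv_coefD {a : ℕ → R} (a0 : a 0 = 1) {y c : R}
    {F : ℕ → MvPolynomial ℕ R} (hF : IsVirasoroSolution a y c F) (hF0 : F 0 = 0)
    (d : Derivation k R R) (l : ℕ) (w : R) (ha : ∀ j, d (a j) = (if j = l then y else 0) - w * a j)
    (hy : d y = -w * y) (hc : d c = 0) (j i : ℕ) :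
    (2 * (l : MvPolynomial ℕ R) + 3) * pderiv i (coefD d (F j))
      = pderiv i (pderiv (l + 1) (F (j + 1))) := by
  have hconst : ∀ D : Derivation R (MvPolynomial ℕ R) (MvPolynomial ℕ R), ∀ f,
      D ((2 * (l : MvPolynomial ℕ R) + 3) * f) = (2 * (l : MvPolynomial ℕ R) + 3) * D f := by
    intro D f
    rw [show (2 * (l : MvPolynomial ℕ R) + 3) = ((2 * l + 3 : ℕ) : MvPolynomial ℕ R) by push_cast; ring,
      Derivation.leibniz, Derivation.map_natCast, smul_zero, add_zero, smul_eq_mul]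
  rw [← sub_eq_zero, ← hconst, ← map_sub]
  -- The difference of the two sides solves the linearised constraints. Applying `d` to a constraint
  -- changes the coefficient a_l of ∂_{n+l}, while ∂_{l+1} hits the coefficient (2l+3) x_{l+1} of
  -- the same ∂_{n+l} in `opM n`. The terms with `w` recombine to a multiple of the constraint.
  refine pderiv_eq_zero_of_linearised (Ξ := fun j => (2 * (l : MvPolynomial ℕ R) + 3) *
    coefD d (F j) - pderiv (l + 1) (F (j + 1))) (F := F) (y := y) (c := c) a0 ?_
    (fun j n => ?_) j i
  -- Initial level: the constraint for `F 1` is inhomogeneous only through a polynomial in x_0,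
  -- which ∂_{l+1} annihilates.
  · refine pderiv_eq_zero_of_opK_eq_zero a0 fun n => ?_
    have h := congrArg (shiftD (l + 2)) (hF 0 n)
    have hin : shiftD (l + 2) (inhom c n) = 0 := by
      rcases n with _ | _ | n
      · rw [inhom, ← C_four_mul, shiftD_C_mul, Derivation.leibniz_pow, shiftD_X]; simp
      · rw [inhom]; simp
      · exact map_zero _
    simp only [hF0, map_zero, zero_add, if_true, mul_zero, Finset.Nat.antidiagonal_zero, Finset.sum_singleton,
      Finset.sum_const_zero, shiftD_C_mul, map_add, hin, add_zero] at h
    rw [hF0, map_zero, mul_zero, zero_sub, map_neg, ← shiftD_succ, opK_shiftD, h, neg_zero]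
  · have h1 := congrArg (coefD d) (hF j n)
    have h2 := congrArg (shiftD (l + 2)) (hF (j + 1) n)
    have hK : opK (fun j => d (a j)) n (F (j + 1)) = C y * shiftD (n + l + 1) (F (j + 1))
        - C w * opK a n (F (j + 1)) := by
      have : opK (fun j => d (a j)) n = (C y : MvPolynomial ℕ R) • shiftD (n + l + 1)
          - (C w : MvPolynomial ℕ R) • opK a n := derivation_ext fun i => by
        rw [Derivation.sub_apply, Derivation.smul_apply, Derivation.smul_apply, opK_X, opK_X,
          shiftD_X, smul_eq_mul, smul_eq_mul]
        by_cases h : n ≤ i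
        · rw [if_pos h, if_pos h, ha, map_sub, C_mul]
          congr 1
          by_cases h' : i - n = l
          · rw [if_pos h', if_pos (by omega), mul_one]
          · rw [if_neg h', if_neg (by omega), mul_zero, C_0]
        · rw [if_neg h, if_neg h, if_neg (by omega)]; ring
      rw [this]; rfl
    have hi : coefD d (if j = 0 then inhom c n else 0) = 0 := by
      split_ifs
      · exact coefD_inhom d hc n
      · exact map_zero _
    have hM := opM_shiftD n (l + 2) (F (j + 1))
    rw [show 2 * (l + 2) - 1 = 2 * l + 3 by omega, show n + (l + 2) - 1 = n + l + 1 by omega] at hM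
    have hE := hF j n
    rw [map_add, Derivation.leibniz, map_add, map_add, map_zero, coefD_opK, coefD_opM, hK, coefD_C,
      hy, coefD_C_mul_of_eq_zero d hc, coefD_sum, hi, add_zero, smul_eq_mul, smul_eq_mul, map_mul,
      map_neg] at h1
    rw [if_neg (by omega), add_zero, map_add, shiftD_C_mul, map_add, map_zero, ← opK_shiftD,
      ← C_four_mul, shiftD_C_mul, C_four_mul, map_sum] at h2
    have hsum : ∀ p : ℕ × ℕ, shiftD (l + 2) (shiftD p.1 (shiftD p.2 (F (j + 1)))
          + ∑ q ∈ antidiagonal (j + 1), shiftD p.1 (F q.1) * shiftD p.2 (F q.2))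
        = shiftD p.1 (shiftD p.2 (shiftD (l + 2) (F (j + 1))))
          + ∑ q ∈ antidiagonal j, (shiftD p.1 (shiftD (l + 2) (F (q.1 + 1))) * shiftD p.2 (F q.2)
            + shiftD p.1 (F q.1) * shiftD p.2 (shiftD (l + 2) (F (q.2 + 1)))) := by
      intro p
      rw [map_add, map_sum, shiftD_comm (l + 2), shiftD_comm (l + 2)]
      congr 1
      simp only [Derivation.leibniz, smul_eq_mul]
      rw [Finset.sum_add_distrib, Finset.sum_add_distrib, Finset.Nat.sum_antidiagonal_succ',
        Finset.Nat.sum_antidiagonal_succ, hF0]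
      simp only [map_zero, mul_zero, zero_add]
      rw [add_comm]
      congr 1
      · exact Finset.sum_congr rfl fun q _ => by rw [shiftD_comm (l + 2)]; ring
      · exact Finset.sum_congr rfl fun q _ => by rw [shiftD_comm (l + 2)]
    rw [Finset.sum_congr rfl fun p _ => hsum p] at h2
    have hlin : ∑ p ∈ antidiagonal n, (shiftD p.1 (shiftD p.2 ((2 * (l : MvPolynomial ℕ R) + 3) *
          coefD d (F j) - pderiv (l + 1) (F (j + 1))))
        + ∑ q ∈ antidiagonal j, (shiftD p.1 ((2 * (l : MvPolynomial ℕ R) + 3) *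
          coefD d (F q.1) - pderiv (l + 1) (F (q.1 + 1))) * shiftD p.2 (F q.2)
          + shiftD p.1 (F q.1) * shiftD p.2 ((2 * (l : MvPolynomial ℕ R) + 3) *
          coefD d (F q.2) - pderiv (l + 1) (F (q.2 + 1)))))
        = (2 * (l : MvPolynomial ℕ R) + 3) *
          ∑ p ∈ antidiagonal n, (shiftD p.1 (shiftD p.2 (coefD d (F j)))
      + ∑ q ∈ antidiagonal j, (shiftD p.1 (coefD d (F q.1)) * shiftD p.2 (F q.2)
          + shiftD p.1 (F q.1) * shiftD p.2 (coefD d (F q.2))))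
        - ∑ p ∈ antidiagonal n, (shiftD p.1 (shiftD p.2 (shiftD (l + 2) (F (j + 1))))
          + ∑ q ∈ antidiagonal j, (shiftD p.1 (shiftD (l + 2) (F (q.1 + 1))) * shiftD p.2 (F q.2)
            + shiftD p.1 (F q.1) * shiftD p.2 (shiftD (l + 2) (F (q.2 + 1))))) := by
      rw [Finset.mul_sum, ← Finset.sum_sub_distrib]
      refine Finset.sum_congr rfl fun p _ => ?_
      rw [mul_add, add_sub_add_comm, Finset.mul_sum, ← Finset.sum_sub_distrib, map_sub, map_sub,
        hconst, hconst]
      congr 1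
      refine Finset.sum_congr rfl fun q _ => ?_
      rw [map_sub, map_sub, hconst, hconst]
      simp only [shiftD_succ]
      ring
    rw [hlin, map_sub, map_sub, hconst, hconst]
    have e : ∀ f : MvPolynomial ℕ R, pderiv (l + 1) f = shiftD (l + 2) f := fun _ => rfl
    simp only [e]
    push_cast at hM
    linear_combination (2 * (l : MvPolynomial ℕ R) + 3) * h1 - h2
      + (2 * (l : MvPolynomial ℕ R) + 3) * C w * hE - C y * hM

end Variation

end Airy


namespace Airy

open MvPolynomial Finset

variable {R : Type*} [CommRing R]

/-! ## The degrees that occur -/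

/-- All monomials of `f` have degree at most `r` and of the same parity as `r`. -/
def HasDeg (r : ℤ) (f : MvPolynomial ℕ R) : Prop :=
  ∀ m, coeff m f ≠ 0 → ∃ h : ℕ, r = 2 * h + m.degree

theorem HasDeg.zero (r : ℤ) : HasDeg r (0 : MvPolynomial ℕ R) := fun m hm => absurd (coeff_zero m) hm

theorem HasDeg.add {r : ℤ} {f g : MvPolynomial ℕ R} (hf : HasDeg r f) (hg : HasDeg r g) :
    HasDeg r (f + g) := by
  intro m hm
  by_cases h : coeff m f = 0
  · exact hg m fun h' => hm (by rw [coeff_add, h, h', add_zero])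
  · exact hf m h

theorem HasDeg.sum {ι : Type*} {r : ℤ} (s : Finset ι) {f : ι → MvPolynomial ℕ R}
    (hf : ∀ i ∈ s, HasDeg r (f i)) : HasDeg r (∑ i ∈ s, f i) := by
  intro m hm
  rw [coeff_sum] at hm
  obtain ⟨i, hi, h⟩ := Finset.exists_ne_zero_of_sum_ne_zero hm
  exact hf i hi m h

theorem HasDeg.mul {r s : ℤ} {f g : MvPolynomial ℕ R} (hf : HasDeg r f) (hg : HasDeg s g) :
    HasDeg (r + s) (f * g) := by
  classical
  intro m hm
  rw [coeff_mul] at hm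
  obtain ⟨p, hp, h⟩ := Finset.exists_ne_zero_of_sum_ne_zero hm
  rw [Finset.HasAntidiagonal.mem_antidiagonal] at hp
  obtain ⟨h1, e1⟩ := hf p.1 (left_ne_zero_of_mul h)
  obtain ⟨h2, e2⟩ := hg p.2 (right_ne_zero_of_mul h)
  refine ⟨h1 + h2, ?_⟩
  rw [e1, e2, ← hp, map_add]; push_cast; ring

theorem HasDeg.C (r : R) : HasDeg 0 (MvPolynomial.C r) := by
  classical
  intro m hm
  rw [coeff_C] at hm
  refine ⟨0, ?_⟩
  split_ifs at hm with h
  · simp [← h]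
  · exact absurd rfl hm

theorem HasDeg.natCast (n : ℕ) : HasDeg 0 (n : MvPolynomial ℕ R) := by
  rw [← map_natCast MvPolynomial.C]; exact HasDeg.C _

theorem HasDeg.X (i : ℕ) : HasDeg 1 (MvPolynomial.X i : MvPolynomial ℕ R) := by
  classical
  intro m hm
  rw [coeff_X] at hm
  refine ⟨0, ?_⟩
  split_ifs at hm with h
  · simp [← h]
  · exact absurd rfl hm

theorem HasDeg.add_two {r : ℤ} {f : MvPolynomial ℕ R} (hf : HasDeg r f) : HasDeg (r + 2) f := by
  intro m hm
  obtain ⟨h, e⟩ := hf m hm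
  exact ⟨h + 1, by rw [e]; push_cast; ring⟩

theorem HasDeg.pderiv {r : ℤ} {f : MvPolynomial ℕ R} (hf : HasDeg r f) (i : ℕ) :
    HasDeg (r - 1) (MvPolynomial.pderiv i f) := by
  intro m hm
  rw [coeff_pderiv] at hm
  obtain ⟨h, e⟩ := hf _ (left_ne_zero_of_mul hm)
  refine ⟨h, ?_⟩
  rw [e, map_add, Finsupp.degree_single]; push_cast; ring

theorem HasDeg.shiftD {r : ℤ} {f : MvPolynomial ℕ R} (hf : HasDeg r f) (i : ℕ) :
    HasDeg (r - 1) (Airy.shiftD i f) := by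
  rcases i with _ | i
  · exact HasDeg.zero _
  · exact hf.pderiv i

theorem HasDeg.derivation {r : ℤ} {f : MvPolynomial ℕ R} (hf : HasDeg r f) {s : ℤ}
    (D : Derivation R (MvPolynomial ℕ R) (MvPolynomial ℕ R)) (hD : ∀ i, HasDeg s (D (MvPolynomial.X i))) :
    HasDeg (r + s - 1) (D f) := by
  obtain ⟨N, hN⟩ := exists_vars_lt f
  rw [derivation_eq_sum D f hN, show r + s - 1 = s + (r - 1) by ring]
  exact HasDeg.sum _ fun i _ => (hD i).mul (hf.pderiv i)

theorem HasDeg.opM {r : ℤ} {f : MvPolynomial ℕ R} (hf : HasDeg r f) (n : ℕ) :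
    HasDeg r (Airy.opM n f) := by
  have := hf.derivation (s := 1) (Airy.opM n) fun i => by
    rw [opM_X]
    split_ifs
    · rw [show (2 * ((i + 1 - n : ℕ) : MvPolynomial ℕ R) + 1)
          = ((2 * (i + 1 - n) + 1 : ℕ) : MvPolynomial ℕ R) by push_cast; ring]
      exact (HasDeg.natCast _).mul (HasDeg.X _)
    · exact HasDeg.zero _
  simpa using this

theorem HasDeg.of_pderiv [Algebra ℚ R] {r : ℤ} {f : MvPolynomial ℕ R} (h0 : constantCoeff f = 0)
    (h : ∀ i, HasDeg (r - 1) (MvPolynomial.pderiv i f)) : HasDeg r f := by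
  intro m hm
  have hm0 : m ≠ 0 := by rintro rfl; exact hm h0
  obtain ⟨i, hi⟩ : ∃ i, m i ≠ 0 := by
    by_contra! hcon; exact hm0 (Finsupp.ext hcon)
  have e : m - Finsupp.single i 1 + Finsupp.single i 1 = m := by
    ext j
    by_cases hj : i = j
    · subst hj; simp; omega
    · simp [Finsupp.single_eq_of_ne (Ne.symm hj)]
  obtain ⟨k, hk⟩ := h i (m - Finsupp.single i 1) (by
    rw [coeff_pderiv, e]
    intro h'
    exact hm (PowerSeries.eq_zero_of_natCast_succ_mul h'))
  refine ⟨k, ?_⟩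
  have := congrArg Finsupp.degree e
  rw [map_add, Finsupp.degree_single] at this
  rw [← this]; push_cast; linarith

/-- Level k stands for 2g - 2 + b with b the degree, and the witness `h` in `HasDeg` is the genus.
`opM` preserves the degree, a pair of derivatives on one factor lowers it by two and so raises the
genus by one, and in products the genera add. -/
theorem IsVirasoroSolution.hasDeg [Algebra ℚ R] {a : ℕ → R} (a0 : a 0 = 1) {y c : R}
    {F : ℕ → MvPolynomial ℕ R} (hF : IsVirasoroSolution a y c F) (hF0 : F 0 = 0)
    (hFc : ∀ k, constantCoeff (F k) = 0) (k : ℕ) : HasDeg (k + 2) (F k) := by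
  induction k using Nat.strong_induction_on with
  | _ k ih =>
    rcases k with _ | k
    · rw [hF0]; exact HasDeg.zero _
    have hK : ∀ n, HasDeg (k + 2) (opK a n (F (k + 1))) := by
      intro n
      have h := hF k n
      rw [add_eq_zero_iff_eq_neg] at h
      rw [h, ← neg_one_mul, ← map_one MvPolynomial.C, ← map_neg, ← mul_assoc, ← map_mul,
        ← zero_add ((k : ℤ) + 2)]
      refine (HasDeg.C _).mul (HasDeg.add (HasDeg.add ((ih k (by omega)).opM n) ?_) ?_)
      · rw [← C_four_mul, ← zero_add ((k : ℤ) + 2)]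
        refine (HasDeg.C _).mul (HasDeg.sum _ fun p _ => HasDeg.add ?_ (HasDeg.sum _ fun q hq => ?_))
        · have := (((ih k (by omega)).shiftD p.2).shiftD p.1).add_two
          rwa [show ((k : ℤ) + 2 - 1 - 1 + 2) = k + 2 by ring] at this
        · rw [Finset.HasAntidiagonal.mem_antidiagonal] at hq
          have := ((ih q.1 (by omega)).shiftD p.1).mul ((ih q.2 (by omega)).shiftD p.2)
          rwa [show (q.1 : ℤ) + 2 - 1 + (q.2 + 2 - 1) = k + 2 by rw [← hq]; push_cast; ring] at this
      · split_ifs with hk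
        · subst hk
          rcases n with _ | _ | n
          · rw [inhom, ← C_four_mul, pow_two]
            exact (HasDeg.C _).mul ((HasDeg.X 0).mul (HasDeg.X 0))
          · exact (HasDeg.C _).add_two
          · exact HasDeg.zero _
        · exact HasDeg.zero _
    refine HasDeg.of_pderiv (hFc _) fun i => ?_
    obtain ⟨s, -, hs⟩ := exists_inverse_series a a0
    obtain ⟨N, hN⟩ := exists_vars_lt (F (k + 1))
    rw [pderiv_eq_sum_opK hs hN i le_rfl]
    refine HasDeg.sum _ fun j _ => ?_
    have := (HasDeg.C (s j)).mul (hK (i + j))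
    rwa [show (0 : ℤ) + (k + 2) = ((k + 1 : ℕ) : ℤ) + 2 - 1 by push_cast; ring] at this

theorem HasDeg.constantCoeff_eq_zero {r : ℤ} {f : MvPolynomial ℕ R} (hf : HasDeg r f)
    (h : ∀ k : ℕ, r ≠ 2 * k) : constantCoeff f = 0 := by
  by_contra h0
  obtain ⟨k, hk⟩ := hf 0 h0
  exact h k (by simpa using hk)

end Airy

/-! ## The ring of functions of the Kontsevich times -/

namespace Kontsevich

open MvPolynomial Finset Airy

/-- The polynomial ring in `1/ρ_0` (the variable `0`) and in `ρ_k/ρ_0` (the variables `k ≥ 1`). -/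
abbrev TimeRing := MvPolynomial ℕ ℂ

/-- The element `1/ρ_0`. -/
def invT : TimeRing := X 0

/-- The elements `ρ_k/ρ_0`. -/
def ratT (k : ℕ) : TimeRing := if k = 0 then 1 else X k

/-- The derivation `∂/∂ρ_l`. -/
def derT (l : ℕ) : Derivation ℂ TimeRing TimeRing := mkDerivation ℂ fun k =>
  if k = 0 then (if l = 0 then -X 0 ^ 2 else 0)
  else (if k = l then X 0 else 0) - (if l = 0 then X 0 * X k else 0)

theorem ratT_zero : ratT 0 = 1 := rfl

/-- This has the form δ y - w a required in `IsVirasoroSolution.pderiv_coefD`, with y = 1/ρ_0 and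
with w = 1/ρ_0 for l = 0 and w = 0 otherwise. The quotient by ρ_0 keeps the leading coefficient
equal to 1. -/
theorem derT_ratT (l k : ℕ) :
    derT l (ratT k) = (if k = l then invT else 0) - (if l = 0 then invT else 0) * ratT k := by
  rw [ratT, invT]
  by_cases hk : k = 0
  · subst hk
    by_cases hl : l = 0
    · subst hl; simp
    · simp [hl, Ne.symm hl]
  · rw [if_neg hk, derT, mkDerivation_X, if_neg hk]
    split_ifs <;> simp

theorem derT_invT (l : ℕ) : derT l invT = -(if l = 0 then invT else 0) * invT := by
  rw [derT, invT, mkDerivation_X, if_pos rfl]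
  split_ifs <;> ring

theorem exists_base : ∃ F : ℕ → MvPolynomial ℕ TimeRing, F 0 = 0 ∧
    (∀ k, constantCoeff (F k) = 0) ∧ IsVirasoroSolution ratT 1 (C (1 / 8) : TimeRing) F :=
  exists_isVirasoroSolution ratT_zero (by
    rw [← map_ofNat C 8, ← C_mul]; norm_num)

/-- The solution of the Virasoro constraints with expansion parameter `1`. -/
def baseSol : ℕ → MvPolynomial ℕ TimeRing := Classical.choose exists_base

theorem baseSol_zero : baseSol 0 = 0 := (Classical.choose_spec exists_base).1
theorem constantCoeff_baseSol (k : ℕ) : constantCoeff (baseSol k) = 0 :=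
  (Classical.choose_spec exists_base).2.1 k
theorem isVirasoroSolution_baseSol : IsVirasoroSolution ratT 1 (C (1 / 8) : TimeRing) baseSol :=
  (Classical.choose_spec exists_base).2.2

/-- The solution of the Virasoro constraints with expansion parameter `1/ρ_0`. -/
def sol (k : ℕ) : MvPolynomial ℕ TimeRing := C (invT ^ k) * baseSol k

theorem sol_zero : sol 0 = 0 := by rw [sol, baseSol_zero, mul_zero]
theorem constantCoeff_sol (k : ℕ) : constantCoeff (sol k) = 0 := by
  rw [sol, map_mul, constantCoeff_baseSol, mul_zero]
theorem isVirasoroSolution_sol : IsVirasoroSolution ratT invT (C (1 / 8) : TimeRing) sol :=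
  isVirasoroSolution_baseSol.scale

theorem hasDeg_sol (k : ℕ) : HasDeg (k + 2) (sol k) :=
  isVirasoroSolution_sol.hasDeg ratT_zero sol_zero constantCoeff_sol k

/-- The first derivatives at the origin (with shifted index). -/
def cor₁ (k i : ℕ) : TimeRing := constantCoeff (shiftD i (sol k))

/-- The second derivatives at the origin (with shifted indices). -/
def cor₂ (k i j : ℕ) : TimeRing := constantCoeff (shiftD i (shiftD j (sol k)))

@[simp] theorem cor₁_zero_right (k : ℕ) : cor₁ k 0 = 0 := by simp [cor₁]

theorem cor₂_comm (k i j : ℕ) : cor₂ k i j = cor₂ k j i := by rw [cor₂, shiftD_comm, cor₂]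

/-- One-point functions of genus g live at the odd level 2g - 1. -/
theorem cor₁_even (k i : ℕ) : cor₁ (2 * k) i = 0 :=
  ((hasDeg_sol (2 * k)).shiftD i).constantCoeff_eq_zero fun h hh => by push_cast at hh; omega

/-- A derivative in ρ_l acts as one more derivative in x_{l+1}, one level higher. Since `cor₂` is
symmetric in its indices, the one-point functions form a closed form in the times. -/
theorem derT_cor₁ (k l i : ℕ) :
    (2 * (l : TimeRing) + 3) * derT l (cor₁ k i) = cor₂ (k + 1) (l + 2) i := by
  rcases i with _ | i
  · rw [cor₁_zero_right, map_zero, mul_zero, cor₂_comm, cor₂, shiftD_zero, map_zero]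
  have h := isVirasoroSolution_sol.pderiv_coefD ratT_zero sol_zero (derT l) l
    (if l = 0 then invT else 0) (derT_ratT l) (derT_invT l) (derivation_C _ _) k i
  have h' := congrArg constantCoeff h
  have e : (2 * (l : MvPolynomial ℕ TimeRing) + 3) = C (2 * (l : TimeRing) + 3) := by
    rw [map_add, map_mul, map_ofNat, map_ofNat, map_natCast]
  rw [← shiftD_succ i, ← shiftD_succ i, ← coefD_shiftD, e, map_mul, constantCoeff_C,
    constantCoeff_coefD] at h'
  rw [cor₂_comm]
  exact h'

/-- The derivation `∑_l ρ_l/ρ_0 ∂/∂ρ_l`. -/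
def eulerT : Derivation ℂ TimeRing TimeRing := mkDerivation ℂ fun k => if k = 0 then -X 0 ^ 2 else 0

theorem eulerT_ratT (k : ℕ) : eulerT (ratT k) = 0 := by
  rw [ratT]
  split_ifs with h
  · exact Derivation.map_one_eq_zero _
  · rw [eulerT, mkDerivation_X, if_neg h]

theorem eulerT_eq_sum {f : TimeRing} {N : ℕ} (hN : ∀ i ∈ f.vars, i < N) (hN0 : 0 < N) :
    eulerT f = ∑ l ∈ range N, ratT l * derT l f := by
  have h : eulerT f = (∑ l ∈ range N, ratT l • derT l : Derivation ℂ TimeRing TimeRing) f := by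
    apply derivation_eq_of_forall_mem_vars
    intro j hj
    have hjN := hN j hj
    rw [derivation_sum_apply, eulerT, mkDerivation_X]
    simp only [Derivation.smul_apply, smul_eq_mul]
    by_cases hj0 : j = 0
    · subst hj0
      rw [if_pos rfl, Finset.sum_eq_single 0]
      · rw [show (X 0 : TimeRing) = invT from rfl, derT_invT, ratT_zero, if_pos rfl]; ring
      · intro l _ hl
        rw [show (X 0 : TimeRing) = invT from rfl, derT_invT, if_neg hl]; ring
      · intro h; exact absurd (Finset.mem_range.2 hN0) h
    · have hX : (X j : TimeRing) = ratT j := by rw [ratT, if_neg hj0]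
      rw [if_neg hj0, hX]
      simp only [derT_ratT, mul_sub, Finset.sum_sub_distrib, mul_ite, mul_zero, ite_mul, zero_mul,
        Finset.sum_ite_eq, Finset.sum_ite_eq', Finset.mem_range]
      rw [if_pos hjN, if_pos hN0, ratT_zero]; ring
  rw [h, derivation_sum_apply]
  simp

/-- `baseSol` sees only the ratios ρ_j/ρ_0, which `eulerT` kills, so the factor 1/ρ_0^k of `sol k`
makes it homogeneous of degree -k in the times. -/
theorem eulerT_cor₁ (k i : ℕ) : eulerT (cor₁ k i) = -(k : TimeRing) * invT * cor₁ k i := by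
  rcases i with _ | i
  · simp
  have h := isVirasoroSolution_baseSol.pderiv_coefD_eq_zero ratT_zero baseSol_zero eulerT
    eulerT_ratT (derivation_C _ _) k i
  rw [← shiftD_succ, ← coefD_shiftD] at h
  have h' := congrArg constantCoeff h
  rw [constantCoeff_coefD, map_zero] at h'
  rw [cor₁, sol, shiftD_C_mul, map_mul, constantCoeff_C, Derivation.leibniz, h', smul_zero,
    zero_add, smul_eq_mul, Derivation.leibniz_pow]
  have : eulerT invT = -invT ^ 2 := by rw [eulerT, invT, mkDerivation_X, if_pos rfl]
  rw [this]
  rcases k with _ | k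
  · simp
  · rw [Nat.add_sub_cancel, nsmul_eq_mul, smul_eq_mul]; ring

end Kontsevich

/-! ### The free energies and the creation operators -/

namespace Kontsevich

open MvPolynomial Finset Airy

/-- The coefficients of the inverse of the series `∑_l (ρ_l/ρ_0) τ^l`. -/
def invS (n : ℕ) : TimeRing := PowerSeries.coeff n (PowerSeries.invOfUnit (PowerSeries.mk ratT) 1)

theorem invS_mul : (PowerSeries.mk invS) * PowerSeries.mk ratT = 1 := by
  have h := PowerSeries.mul_invOfUnit (PowerSeries.mk ratT) 1 (by simp [ratT_zero])
  rw [mul_comm, ← h]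
  congr 1
  ext1 n
  rw [PowerSeries.coeff_mk, invS]

/-- The functions `ℛ_m` in terms of the ring of functions of the Kontsevich times. -/
def serR (m : ℕ) : TimeRing :=
  ∑ p ∈ antidiagonal m, C (1 / (2 * (p.1 : ℂ) + 3)) * ratT p.1 * invS p.2

theorem serR_mul (m : ℕ) : ∑ p ∈ antidiagonal m, serR p.1 * ratT p.2
    = C (1 / (2 * (m : ℂ) + 3)) * ratT m := by
  have h : (PowerSeries.mk serR) = (PowerSeries.mk fun l : ℕ => C (1 / (2 * (l : ℂ) + 3)) * ratT l)
      * PowerSeries.mk invS := by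
    ext1 n
    rw [PowerSeries.coeff_mul]
    simp [serR]
  have h2 : (PowerSeries.mk serR) * PowerSeries.mk ratT
      = PowerSeries.mk fun l : ℕ => C (1 / (2 * (l : ℂ) + 3)) * ratT l := by
    rw [h, mul_assoc, invS_mul, mul_one]
  have h3 := congrArg (PowerSeries.coeff m) h2
  rw [PowerSeries.coeff_mul] at h3
  simpa using h3

/-- Rewrites the derivation that defines the free energy in terms of the operators whose values on
the solution are prescribed by the constraints. `serR_mul` is precisely the comparison of the
coefficients of ∂_{m+1}. -/
theorem sum_ratT_pderiv_eq {f : MvPolynomial ℕ TimeRing} {N : ℕ} (hN : ∀ i ∈ f.vars, i < N) :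
    ∑ l ∈ range N, C (C (1 / (2 * (l : ℂ) + 3)) * ratT l) * pderiv (l + 1) f
      = ∑ n ∈ range N, C (serR n) * opK ratT (n + 1) f := by
  have h : (∑ l ∈ range N, (C (1 / (2 * (l : ℂ) + 3)) * ratT l) • pderiv (l + 1) :
      Derivation TimeRing (MvPolynomial ℕ TimeRing) (MvPolynomial ℕ TimeRing)) f
      = (∑ n ∈ range N, serR n • opK ratT (n + 1) :
      Derivation TimeRing (MvPolynomial ℕ TimeRing) (MvPolynomial ℕ TimeRing)) f := by
    apply derivation_eq_of_forall_mem_vars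
    intro j hj
    have hjN := hN j hj
    rw [derivation_sum_apply, derivation_sum_apply]
    simp only [Derivation.smul_apply, opK_X, smul_eq_C_mul]
    rcases j with _ | j
    · rw [Finset.sum_eq_zero, Finset.sum_eq_zero]
      · intro n _; rw [if_neg (by omega), mul_zero]
      · intro l _; rw [pderiv_X_of_ne (by omega), mul_zero]
    · rw [Finset.sum_eq_single j (fun l _ hl => by rw [pderiv_X_of_ne (by omega), mul_zero])
        (fun h => absurd (Finset.mem_range.2 (by omega)) h), pderiv_X_self, mul_one, ← serR_mul,
        Finset.Nat.sum_antidiagonal_eq_sum_range_succ_mk, map_sum,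
        ← Finset.sum_subset (Finset.range_subset_range.2 (show j + 1 ≤ N by omega))]
      · refine Finset.sum_congr rfl fun n hn => ?_
        rw [Finset.mem_range] at hn
        rw [if_pos (by omega), C_mul, Nat.add_sub_add_right]
      · intro n _ hn
        rw [Finset.mem_range] at hn
        rw [if_neg (by omega), mul_zero]
  rw [derivation_sum_apply, derivation_sum_apply] at h
  simpa [smul_eq_C_mul] using h

/-- The quadratic terms of the Virasoro constraints at the origin. -/
def quadT (k n : ℕ) : TimeRing :=
  ∑ p ∈ antidiagonal n, (cor₂ k p.1 p.2 + ∑ q ∈ antidiagonal k, cor₁ q.1 p.1 * cor₁ q.2 p.2)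

theorem constantCoeff_opM (n : ℕ) (f : MvPolynomial ℕ TimeRing) : constantCoeff (opM n f) = 0 := by
  obtain ⟨N, hN⟩ := exists_vars_lt f
  rw [derivation_eq_sum (opM n) f hN, map_sum]
  refine Finset.sum_eq_zero fun i _ => ?_
  rw [map_mul, opM_X]
  split_ifs <;> simp

/-- At the origin `opM` drops out, since its coefficients are linear forms in the variables. -/
theorem constantCoeff_opK_sol (k n : ℕ) : constantCoeff (opK ratT n (sol (k + 1)))
    + invT * (C (1 / 2) * quadT k n + if k = 0 ∧ n = 1 then C (1 / 8) else 0) = 0 := by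
  have h := congrArg constantCoeff (isVirasoroSolution_sol k n)
  have h4 : (4 : TimeRing) * C (1 / 8) = C (1 / 2) := by
    rw [← map_ofNat C 4, ← C_mul]; norm_num
  have hi : constantCoeff (if k = 0 then inhom (C (1 / 8) : TimeRing) n else 0)
      = if k = 0 ∧ n = 1 then C (1 / 8) else 0 := by
    by_cases hk : k = 0
    · rcases n with _ | _ | n
      · simp [inhom, hk]
      · simp only [inhom, hk, if_true, zero_add, and_self, constantCoeff_C]
      · simp [inhom, hk]
    · simp [hk]
  rw [map_add, map_mul, constantCoeff_C, map_add, map_add, constantCoeff_opM, zero_add, map_mul, hi,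
    map_mul, constantCoeff_C, map_ofNat, h4, map_sum, map_zero] at h
  simp only [map_add, map_sum, map_mul] at h
  exact h

theorem constantCoeff_opK_sol' {k n : ℕ} (hk : k ≠ 0) : constantCoeff (opK ratT n (sol (k + 1)))
    = -(invT * (C (1 / 2) * quadT k n)) := by
  have := constantCoeff_opK_sol k n
  rw [if_neg (fun h => hk h.1), add_zero] at this
  exact add_eq_zero_iff_eq_neg.1 this

/-- A bound for the variables of the solution. -/
def varBound (k : ℕ) : ℕ := Classical.choose (exists_vars_lt (baseSol k))

theorem lt_varBound {k i : ℕ} (hi : i ∈ (baseSol k).vars) : i < varBound k :=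
  Classical.choose_spec (exists_vars_lt (baseSol k)) i hi

theorem lt_varBound' {k i : ℕ} (hi : i ∈ (sol k).vars) : i < varBound k := by
  classical
  rw [sol] at hi
  have := vars_mul _ _ hi
  rw [vars_C, Finset.empty_union] at this
  exact lt_varBound this

theorem cor₁_eq_zero {k i : ℕ} (h : varBound k < i) : cor₁ k i = 0 := by
  rcases i with _ | i
  · exact cor₁_zero_right k
  · rw [cor₁, shiftD_succ, pderiv_eq_zero_of_vars_lt (fun i => lt_varBound') (by omega), map_zero]

/-- The free energy of genus `g ≥ 2`, normalised by `2λ = 1`. -/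
def freeEnergy (g : ℕ) : TimeRing :=
  C (-1 / (2 * (g : ℂ) - 2)) * invT ^ (2 * g - 2) * ∑ l ∈ range (varBound (2 * g - 1)),
    C (1 / (2 * (l : ℂ) + 3)) * ratT l * constantCoeff (pderiv (l + 1) (baseSol (2 * g - 1)))

/-- `freeEnergy g` is built from `baseSol` with the power 2g - 2 of 1/ρ_0; one more factor 1/ρ_0
converts `baseSol (2 * g - 1)` into `sol (2 * g - 1)`. -/
theorem invT_mul_freeEnergy {g : ℕ} (hg : 2 ≤ g) {N : ℕ} (hN : varBound (2 * g - 1) ≤ N) :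
    C (2 * (g : ℂ) - 2) * (invT * freeEnergy g)
      = -∑ l ∈ range N, C (1 / (2 * (l : ℂ) + 3)) * ratT l * cor₁ (2 * g - 1) (l + 2) := by
  have hg0 : (2 * (g : ℂ) - 2) ≠ 0 := by
    have : (2 : ℂ) * g ≠ 2 * 1 := by
      intro h
      have := mul_left_cancel₀ two_ne_zero h
      have : g = 1 := by exact_mod_cast this
      omega
    rw [mul_one] at this
    exact sub_ne_zero.2 this
  have h1 : ∀ l, cor₁ (2 * g - 1) (l + 2) = invT ^ (2 * g - 1) *
      constantCoeff (pderiv (l + 1) (baseSol (2 * g - 1))) := by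
    intro l
    rw [cor₁, sol, shiftD_C_mul, map_mul, constantCoeff_C]; rfl
  rw [← Finset.sum_subset (Finset.range_subset_range.2 hN)]
  · simp only [h1]
    have hC : C (2 * (g : ℂ) - 2) * C (-1 / (2 * (g : ℂ) - 2)) = (-1 : TimeRing) := by
      rw [← C_mul, mul_div_cancel₀ _ hg0]; simp
    rw [freeEnergy, show 2 * g - 1 = 2 * g - 2 + 1 by omega, pow_succ, Finset.mul_sum,
      Finset.mul_sum, Finset.mul_sum, ← Finset.sum_neg_distrib]
    refine Finset.sum_congr rfl fun l _ => ?_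
    linear_combination (invT ^ (2 * g - 2) * invT * C (1 / (2 * (l : ℂ) + 3)) * ratT l *
      constantCoeff (pderiv (l + 1) (baseSol (2 * g - 2 + 1)))) * hC
  · intro l _ hl
    rw [Finset.mem_range] at hl
    rw [cor₁_eq_zero (by omega), mul_zero]

theorem invT_ne_zero : invT ≠ 0 := X_ne_zero 0

/-- A homogeneous closed form has the contraction with the Euler field as its primitive. By symmetry
of `cor₂` the derivative in ρ_m can be exchanged with those in ρ_l, which builds the Euler field on
`cor₁ (2g-1) (m+2)`; its eigenvalue 2g - 1 minus 1 from the explicit ρ_m gives the factor 2g - 2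
that is cancelled. -/
theorem derT_freeEnergy {g : ℕ} (hg : 2 ≤ g) (m : ℕ) :
    (2 * (m : TimeRing) + 3) * derT m (freeEnergy g) = cor₁ (2 * g - 1) (m + 2) := by
  obtain ⟨N', hN'⟩ := exists_vars_lt (cor₁ (2 * g - 1) (m + 2))
  set N := varBound (2 * g - 1) + N' + m + 1 with hN
  have h := invT_mul_freeEnergy hg (N := N) (by omega)
  have hd := congrArg (derT m) h
  have hc : ∀ r : ℂ, ∀ f : TimeRing, derT m (C r * f) = C r * derT m f := fun r f =>
    derivation_C_mul' _ _ _
  have hinv : ∀ l : ℕ, C (1 / (2 * (l : ℂ) + 3)) * (2 * (l : TimeRing) + 3) = 1 := by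
    intro l
    have hl : (2 * (l : ℂ) + 3) ≠ 0 := by
      have : ((2 * l + 3 : ℕ) : ℂ) ≠ 0 := Nat.cast_ne_zero.2 (by omega)
      push_cast at this; exact this
    rw [show (2 * (l : TimeRing) + 3) = C (2 * (l : ℂ) + 3) by
      rw [map_add, map_mul, map_ofNat, map_ofNat, map_natCast], ← C_mul, one_div_mul_cancel hl, C_1]
  have hsym : ∀ l : ℕ, C (1 / (2 * (l : ℂ) + 3)) * derT m (cor₁ (2 * g - 1) (l + 2))
      * (2 * (m : TimeRing) + 3) = derT l (cor₁ (2 * g - 1) (m + 2)) := by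
    intro l
    have h1 := derT_cor₁ (2 * g - 1) m (l + 2)
    have h2 := derT_cor₁ (2 * g - 1) l (m + 2)
    rw [cor₂_comm, ← h2] at h1
    linear_combination C (1 / (2 * (l : ℂ) + 3)) * h1
      + derT l (cor₁ (2 * g - 1) (m + 2)) * hinv l
  have hterm : ∀ l ∈ range N, derT m (C (1 / (2 * (l : ℂ) + 3)) * ratT l * cor₁ (2 * g - 1) (l + 2))
      * (2 * (m : TimeRing) + 3)
      = (if l = m then invT * cor₁ (2 * g - 1) (m + 2) else 0)
        - (if m = 0 then invT else 0) * (2 * (m : TimeRing) + 3) *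
          (C (1 / (2 * (l : ℂ) + 3)) * ratT l * cor₁ (2 * g - 1) (l + 2))
        + ratT l * derT l (cor₁ (2 * g - 1) (m + 2)) := by
    intro l _
    rw [mul_assoc, hc, Derivation.leibniz, derT_ratT, smul_eq_mul, smul_eq_mul, ← hsym l]
    by_cases hl : l = m
    · subst hl
      rw [if_pos rfl, if_pos rfl]
      linear_combination (invT * cor₁ (2 * g - 1) (l + 2)) * hinv l
    · rw [if_neg hl, if_neg hl]; ring
  have hsum := Finset.sum_congr rfl hterm
  rw [← Finset.sum_mul, Finset.sum_add_distrib, Finset.sum_sub_distrib, Finset.sum_ite_eq',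
    if_pos (Finset.mem_range.2 (by omega)), ← Finset.mul_sum,
    ← eulerT_eq_sum (fun i hi => by have := hN' i hi; omega) (by omega), eulerT_cor₁] at hsum
  rw [hc, Derivation.leibniz, derT_invT, smul_eq_mul, smul_eq_mul, map_neg, map_sum] at hd
  have hgg : (C (2 * (g : ℂ) - 2) : TimeRing) = 2 * (g : TimeRing) - 2 := by
    rw [map_sub, map_mul, map_ofNat, map_natCast]
  have hg1 : ((2 * g - 1 : ℕ) : TimeRing) = 2 * (g : TimeRing) - 1 := by
    rw [Nat.cast_sub (by omega)]; push_cast; ring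
  rw [hg1] at hsum
  rw [hgg] at hd h
  have hne : (2 * (g : TimeRing) - 2) * invT ≠ 0 := by
    refine mul_ne_zero ?_ invT_ne_zero
    rw [← Nat.cast_ofNat, ← Nat.cast_mul, ← Nat.cast_sub (by omega)]
    exact Nat.cast_ne_zero.2 (by omega)
  refine mul_left_cancel₀ hne ?_
  linear_combination (2 * (m : TimeRing) + 3) * hd - hsum
    + ((if m = 0 then invT else 0) * (2 * (m : TimeRing) + 3)) * h

/-- The defining sum of the free energy is the contraction of the linear parts of the constraints
with `serR`. Replacing these by the quadratic parts gives a recursion. -/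
theorem two_mul_freeEnergy {g : ℕ} (hg : 2 ≤ g) {N : ℕ} (hN : varBound (2 * g - 1) ≤ N) :
    C (2 * (g : ℂ) - 2) * freeEnergy g
      = C (1 / 2) * ∑ n ∈ range N, serR n * quadT (2 * g - 2) (n + 1) := by
  refine mul_left_cancel₀ invT_ne_zero ?_
  rw [mul_left_comm, invT_mul_freeEnergy hg hN]
  have h := congrArg constantCoeff (sum_ratT_pderiv_eq (f := sol (2 * g - 1)) (N := N)
    (fun i hi => lt_of_lt_of_le (lt_varBound' hi) hN))
  rw [map_sum, map_sum] at h
  simp only [map_mul (constantCoeff (R := TimeRing) (σ := ℕ)), constantCoeff_C] at h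
  have h2 : ∀ n, constantCoeff (opK ratT (n + 1) (sol (2 * g - 1)))
      = -(invT * (C (1 / 2) * quadT (2 * g - 2) (n + 1))) := by
    intro n
    rw [show 2 * g - 1 = 2 * g - 2 + 1 by omega, constantCoeff_opK_sol' (by omega)]
  simp only [h2] at h
  rw [show (∑ l ∈ range N, C (1 / (2 * (l : ℂ) + 3)) * ratT l * cor₁ (2 * g - 1) (l + 2))
    = ∑ x ∈ range N, C (1 / (2 * (x : ℂ) + 3)) * ratT x *
      constantCoeff (pderiv (x + 1) (sol (2 * g - 1))) from rfl, h, Finset.mul_sum, Finset.mul_sum,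
      ← Finset.sum_neg_distrib]
  exact Finset.sum_congr rfl fun n _ => by ring

/-- The coefficients of the boundary creation operator (with shifted index). -/
def creD : ℕ → Derivation ℂ TimeRing TimeRing
  | 0 => 0
  | 1 => mkDerivation ℂ fun k => if k = 0 then 3 * ratT 1 * invT ^ 2
      else 3 * ratT 1 * invT * X k - (2 * (k : TimeRing) + 3) * invT * ratT (k + 1)
  | l + 2 => (2 * (l : TimeRing) + 3) • derT l

theorem creD_one_eq_sum {f : TimeRing} {N : ℕ} (hN : ∀ i ∈ f.vars, i < N) (hN0 : 0 < N) :
    creD 1 f = -∑ l ∈ range N, (2 * (l : TimeRing) + 3) * ratT (l + 1) * derT l f := by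
  have h : creD 1 f = (-∑ l ∈ range N, ((2 * (l : TimeRing) + 3) * ratT (l + 1)) • derT l :
      Derivation ℂ TimeRing TimeRing) f := by
    apply derivation_eq_of_forall_mem_vars
    intro j hj
    have hjN := hN j hj
    rw [Derivation.neg_apply, derivation_sum_apply, creD, mkDerivation_X]
    simp only [Derivation.smul_apply, smul_eq_mul]
    by_cases hj0 : j = 0
    · subst hj0
      rw [if_pos rfl, Finset.sum_eq_single 0]
      · rw [show (X 0 : TimeRing) = invT from rfl, derT_invT, if_pos rfl]; push_cast; ring
      · intro l _ hl
        rw [show (X 0 : TimeRing) = invT from rfl, derT_invT, if_neg hl]; ring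
      · intro h; exact absurd (Finset.mem_range.2 hN0) h
    · have hX : (X j : TimeRing) = ratT j := by rw [ratT, if_neg hj0]
      rw [if_neg hj0, hX]
      simp only [derT_ratT, mul_sub, Finset.sum_sub_distrib, mul_ite, mul_zero, ite_mul, zero_mul,
        Finset.sum_ite_eq, Finset.sum_ite_eq', Finset.mem_range]
      rw [if_pos hjN, if_pos hN0]; push_cast; ring
  rw [h, Derivation.neg_apply, derivation_sum_apply]
  simp

/-- For index 1 the derivative in x_0 is needed, which no ρ_l produces. The constraint with n = 0
has no quadratic terms and expresses ∂_0 on the solution as -∑ (ρ_{l+1}/ρ_0) ∂_{l+1}; this is the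
origin of the term with z^{-3} in Â†. -/
theorem creD_freeEnergy {g : ℕ} (hg : 2 ≤ g) (i : ℕ) :
    creD i (freeEnergy g) = cor₁ (2 * g - 1) i := by
  rcases i with _ | _ | i
  · rw [cor₁_zero_right]; rfl
  · obtain ⟨N', hN'⟩ := exists_vars_lt (freeEnergy g)
    set N := varBound (2 * g - 1) + N' + 1 with hN
    rw [zero_add, creD_one_eq_sum (N := N) (fun i hi => by have := hN' i hi; omega) (by omega)]
    obtain ⟨k, hk⟩ : ∃ k, 2 * g - 1 = k + 1 := ⟨2 * g - 2, by omega⟩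
    have h := constantCoeff_opK_sol' (k := k) (n := 0) (by omega)
    rw [← hk, derivation_eq_sum (opK ratT 0) (sol (2 * g - 1)) (N := N + 1)
      (fun i hi => by have := lt_varBound' hi; omega), Finset.sum_range_succ', map_add, map_sum] at h
    have hq : quadT k 0 = 0 := by simp [quadT, cor₂]
    simp only [opK_X, Nat.zero_le, if_true, Nat.sub_zero, map_mul, constantCoeff_C] at h
    rw [hq, mul_zero, mul_zero, neg_zero, ratT_zero, one_mul] at h
    rw [cor₁, shiftD_succ]
    rw [← neg_eq_of_add_eq_zero_right h]
    congr 1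
    refine Finset.sum_congr rfl fun l _ => ?_
    have := derT_freeEnergy hg l
    rw [cor₁, shiftD_succ] at this
    rw [← this]; ring
  · rw [← derT_freeEnergy hg]; rfl

/-- Iterating the creation operator, with the derivation of index `1` to the right. -/
theorem creD_cor₁ {k : ℕ} (hk : k ≠ 0) {i j : ℕ} (hij : 2 ≤ i ∨ i = 1 ∧ j = 1) :
    creD i (cor₁ k j) = cor₂ (k + 1) i j := by
  rcases i with _ | _ | i
  · omega
  · obtain rfl : j = 1 := by omega
    rw [zero_add]
    obtain ⟨N', hN'⟩ := exists_vars_lt (cor₁ k 1)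
    obtain ⟨N'', hN''⟩ := exists_vars_lt (shiftD 1 (sol (k + 1)))
    set N := N'' + N' + 1 with hN
    rw [creD_one_eq_sum (N := N) (fun i hi => by have := hN' i hi; omega) (by omega)]
    have h := congrArg (fun f => constantCoeff (shiftD 1 f)) (isVirasoroSolution_sol k 0)
    -- Differentiating the constraint n = 0 in x_0 yields no extra term, because the bracket of `opM
    -- 0` with `shiftD 1` is a multiple of `shiftD 0 = 0`. For a second index j ≥ 2 the bracket is
    -- (up to sign) (2j-1) `shiftD (j - 1)`, hence the restriction on the order of the indices.
    have h1 := congrArg constantCoeff (opM_shiftD 0 1 (sol k))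
    simp only [map_add, if_neg hk, add_zero, ← opK_shiftD, shiftD_C_mul, map_mul,
      constantCoeff_C, Finset.Nat.antidiagonal_zero, Finset.sum_singleton, shiftD_zero,
      Finset.sum_const_zero, map_zero, mul_zero] at h
    simp only [map_sub, constantCoeff_opM, zero_sub, Nat.zero_add, Nat.sub_self, shiftD_zero,
      mul_zero, map_zero, neg_eq_zero] at h1
    rw [h1, mul_zero, add_zero, derivation_eq_sum (opK ratT 0) _ (N := N + 1)
      (fun i hi => by have := hN'' i hi; omega), Finset.sum_range_succ',
      map_add, map_sum] at h
    simp only [opK_X, Nat.zero_le, if_true, Nat.sub_zero, map_mul, constantCoeff_C] at h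
    rw [ratT_zero, one_mul] at h
    rw [cor₂, shiftD_succ]
    rw [← neg_eq_of_add_eq_zero_right h]
    congr 1
    refine Finset.sum_congr rfl fun l _ => ?_
    have := derT_cor₁ k l 1
    rw [cor₂, shiftD_succ] at this
    rw [← this]; ring
  · rw [← derT_cor₁]; rfl

end Kontsevich

/-! ### The exponential series and its linear recursion -/

namespace Kontsevich

open MvPolynomial Finset Airy

/-- The generating series `∑_{g ≥ 2} F_g X^(g-1)`, normalised by `2λ = 1`. -/
def freeSer : PowerSeries TimeRing :=
  PowerSeries.mk fun n => if n = 0 then 0 else freeEnergy (n + 1)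

/-- The stable partition function, normalised by `2λ = 1`. -/
def partSer : PowerSeries TimeRing := PowerSeries.subst freeSer (PowerSeries.exp TimeRing)

/-- All that is used about exp(f): its constant term and its logarithmic derivative, which together
determine it. -/
theorem exp_subst_spec {V : Type*} [CommRing V] [Algebra ℚ V] {f : PowerSeries V}
    (hf : PowerSeries.coeff 0 f = 0) :
    PowerSeries.coeff 0 (PowerSeries.subst f (PowerSeries.exp V)) = 1 ∧
    PowerSeries.derivative V (PowerSeries.subst f (PowerSeries.exp V))
      = PowerSeries.subst f (PowerSeries.exp V) * PowerSeries.derivative V f := by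
  have hs : PowerSeries.HasSubst f := PowerSeries.HasSubst.of_constantCoeff_zero' (by
    rw [← PowerSeries.coeff_zero_eq_constantCoeff_apply, hf])
  constructor
  · rw [PowerSeries.coeff_zero_eq_constantCoeff_apply]
    change MvPowerSeries.constantCoeff (PowerSeries.subst f (PowerSeries.exp V)) = 1
    rw [PowerSeries.constantCoeff_subst hs, finsum_eq_single _ 0]
    · simp
    · intro d hd
      rw [map_pow, show MvPowerSeries.constantCoeff f = 0 from
        (PowerSeries.coeff_zero_eq_constantCoeff_apply f).symm.trans hf, zero_pow hd, smul_zero]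
  · rw [PowerSeries.derivative_subst hs, PowerSeries.derivative_exp]

theorem sum_antidiagonal_odd {V : Type*} [AddCommMonoid V] (f : ℕ → ℕ → V) (n : ℕ)
    (h1 : ∀ i j, f (2 * i) j = 0) :
    ∑ q ∈ antidiagonal (2 * n + 2), f q.1 q.2
      = ∑ q ∈ antidiagonal n, f (2 * q.1 + 1) (2 * q.2 + 1) := by
  symm
  refine Finset.sum_of_injOn (fun q => (2 * q.1 + 1, 2 * q.2 + 1)) ?_ ?_ ?_ (fun _ _ => rfl)
  · rintro ⟨a, b⟩ _ ⟨c, d⟩ _ h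
    simp only [Prod.mk.injEq] at h ⊢
    omega
  · rintro ⟨a, b⟩ h
    simp only [Finset.mem_coe, Finset.HasAntidiagonal.mem_antidiagonal] at h ⊢
    omega
  · rintro ⟨a, b⟩ h hn
    rw [Finset.HasAntidiagonal.mem_antidiagonal] at h
    rcases Nat.even_or_odd' a with ⟨c, rfl | rfl⟩
    · exact h1 c b
    · refine absurd ?_ hn
      refine ⟨(c, n - c), ?_, ?_⟩
      · simp only [Finset.mem_coe, Finset.HasAntidiagonal.mem_antidiagonal]
        simp only at h
        omega
      · simp only [Prod.mk.injEq, true_and]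
        simp only at h
        omega

/-- The creation operator, conjugated with the contribution of genus one. -/
def nab (i : ℕ) (f : TimeRing) : TimeRing := creD i f + cor₁ 1 i * f

/-- On the series W = exp(∑_{g≥2} F_g X^{g-1}) the operator `nab i` multiplies by the full one-point
series, the summand `cor₁ 1 i` supplying genus one. A second application adds the product rule term
`cor₂`; `j ≤ i` is the order in which `creD_cor₁` is available. -/
theorem nab_nab_partSer (n i j : ℕ) (hij : j ≤ i) :
    nab i (nab j (PowerSeries.coeff n partSer)) = PowerSeries.coeff n (partSer *
      ((PowerSeries.mk fun n => cor₂ (2 * n + 2) i j) +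
      (PowerSeries.mk fun n => cor₁ (2 * n + 1) i) * PowerSeries.mk fun n => cor₁ (2 * n + 1) j)) := by
  have hΦ0 : PowerSeries.coeff 0 freeSer = 0 := by simp [freeSer]
  obtain ⟨hW0, hW⟩ := exp_subst_spec hΦ0
  have hD : ∀ i, PowerSeries.coeffwise (creD i) partSer = partSer *
      PowerSeries.coeffwise (creD i) freeSer := fun i =>
    PowerSeries.coeffwise_eq_mul hW0 hΦ0 hW (creD i)
  have hU : ∀ i, PowerSeries.coeffwise (creD i) freeSer
      = (PowerSeries.mk fun n => cor₁ (2 * n + 1) i) - PowerSeries.C (cor₁ 1 i) := by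
    intro i
    ext1 n
    rw [PowerSeries.coeff_coeffwise, freeSer, PowerSeries.coeff_mk, map_sub, PowerSeries.coeff_mk,
      PowerSeries.coeff_C]
    rcases n with _ | n
    · simp
    · rw [if_neg (by omega), if_neg (by omega), creD_freeEnergy (by omega), sub_zero]
      congr 1
  have hnab : ∀ i (G : PowerSeries TimeRing), nab i (PowerSeries.coeff n G)
      = PowerSeries.coeff n (PowerSeries.coeffwise (creD i) G + PowerSeries.C (cor₁ 1 i) * G) := by
    intro i G
    rw [map_add, PowerSeries.coeff_coeffwise, PowerSeries.coeff_C_mul, nab]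
  rcases Nat.eq_zero_or_pos j with rfl | hj
  · have e1 : (PowerSeries.mk fun n => cor₂ (2 * n + 2) i 0) = 0 := by
      ext1 n; simp [cor₂]
    have e2 : (PowerSeries.mk fun n => cor₁ (2 * n + 1) 0) = 0 := by
      ext1 n; simp
    rw [e1, e2]
    simp [nab, creD]
  rw [hnab, hnab, hD, hU, Derivation.map_add, Derivation.leibniz, Derivation.leibniz]
  have hC : PowerSeries.coeffwise (creD i) (PowerSeries.mk fun n => cor₁ (2 * n + 1) j)
      = PowerSeries.mk fun n => cor₂ (2 * n + 2) i j := by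
    ext1 n
    rw [PowerSeries.coeff_coeffwise, PowerSeries.coeff_mk, PowerSeries.coeff_mk,
      creD_cor₁ (by omega) (by omega)]
  rw [map_sub, hD, hU, hC]
  simp only [smul_eq_mul]
  congr 1
  ring

theorem quadT_eq_sum_coeff (k n : ℕ) : quadT (2 * k + 2) n
    = ∑ p ∈ antidiagonal n, PowerSeries.coeff k ((PowerSeries.mk fun n => cor₂ (2 * n + 2) p.1 p.2) +
      (PowerSeries.mk fun n => cor₁ (2 * n + 1) p.1) * PowerSeries.mk fun n => cor₁ (2 * n + 1) p.2) := by
  refine Finset.sum_congr rfl fun p _ => ?_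
  rw [map_add, PowerSeries.coeff_mk, PowerSeries.coeff_mul,
    sum_antidiagonal_odd (fun a b => cor₁ a p.1 * cor₁ b p.2) k
      (fun a b => by rw [cor₁_even, zero_mul])]
  simp

/-- The recursion for the coefficients of the stable partition function. -/
theorem partSer_recursion (n : ℕ) : ∃ N₀, ∀ N, N₀ ≤ N →
    ((n : TimeRing) + 1) * PowerSeries.coeff (n + 1) partSer
      = C (1 / 4) * ∑ m ∈ range N, serR m * ∑ p ∈ antidiagonal (m + 1),
        nab (max p.1 p.2) (nab (min p.1 p.2) (PowerSeries.coeff n partSer)) := by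
  refine ⟨∑ k ∈ range (n + 1), varBound (2 * k + 3), fun N hN => ?_⟩
  have hΦ0 : PowerSeries.coeff 0 freeSer = 0 := by simp [freeSer]
  have h := congrArg (PowerSeries.coeff n) (exp_subst_spec hΦ0).2
  rw [← partSer, PowerSeries.coeff_derivative, PowerSeries.coeff_mul, mul_comm] at h
  rw [h]
  have hq : ∀ q ∈ antidiagonal n, PowerSeries.coeff q.2 (PowerSeries.derivative TimeRing freeSer)
      = C (1 / 4) * ∑ m ∈ range N, serR m * ∑ p ∈ antidiagonal (m + 1), PowerSeries.coeff q.2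
        ((PowerSeries.mk fun n => cor₂ (2 * n + 2) p.1 p.2) +
      (PowerSeries.mk fun n => cor₁ (2 * n + 1) p.1) *
        PowerSeries.mk fun n => cor₁ (2 * n + 1) p.2) := by
    intro q hq
    rw [Finset.HasAntidiagonal.mem_antidiagonal] at hq
    have hb : varBound (2 * (q.2 + 2) - 1) ≤ N := by
      refine le_trans ?_ hN
      have := Finset.single_le_sum (f := fun k => varBound (2 * k + 3)) (s := range (n + 1))
        (fun _ _ => Nat.zero_le _) (Finset.mem_range.2 (show q.2 < n + 1 by omega))
      rwa [show 2 * (q.2 + 2) - 1 = 2 * q.2 + 3 by omega]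
    have h2 := two_mul_freeEnergy (g := q.2 + 2) (by omega) hb
    rw [show 2 * (q.2 + 2) - 2 = 2 * q.2 + 2 by omega] at h2
    simp only [quadT_eq_sum_coeff] at h2
    rw [PowerSeries.coeff_derivative, freeSer, PowerSeries.coeff_mk, if_neg (by omega)]
    -- The derivative of the exponent carries (g-1) F_g, while `two_mul_freeEnergy` gives (2g-2) F_g
    -- with a factor 1/2; together this is 1/4.
    have hc : (C (1 / 4) : TimeRing) = C (1 / 2) * C (1 / 2) := by rw [← C_mul]; norm_num
    have hc2 : (C (1 / 2) * C (2 * ((q.2 + 2 : ℕ) : ℂ) - 2) : TimeRing) = (q.2 : TimeRing) + 1 := by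
      rw [← C_mul, ← map_natCast C, ← map_one C, ← C_add]
      congr 1; push_cast; ring
    rw [hc, mul_assoc, ← h2, ← mul_assoc, hc2, mul_comm]
  rw [Finset.sum_congr rfl fun q hq' => by rw [hq q hq']]
  have hnn : ∀ p : ℕ × ℕ, nab (max p.1 p.2) (nab (min p.1 p.2) (PowerSeries.coeff n partSer))
      = ∑ q ∈ antidiagonal n, PowerSeries.coeff q.1 partSer * PowerSeries.coeff q.2
        ((PowerSeries.mk fun n => cor₂ (2 * n + 2) p.1 p.2) +
      (PowerSeries.mk fun n => cor₁ (2 * n + 1) p.1) *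
        PowerSeries.mk fun n => cor₁ (2 * n + 1) p.2) := by
    intro p
    rw [nab_nab_partSer n _ _ (min_le_max), ← PowerSeries.coeff_mul]
    rcases le_total p.1 p.2 with hp | hp
    · rw [max_eq_right hp, min_eq_left hp, mul_comm (PowerSeries.mk fun n => cor₁ (2 * n + 1) p.2)]
      simp only [cor₂_comm _ p.2 p.1]
    · rw [max_eq_left hp, min_eq_right hp]
  simp only [hnn, Finset.mul_sum]
  rw [Finset.sum_comm]
  refine Finset.sum_congr rfl fun m _ => ?_
  rw [Finset.sum_comm]
  exact Finset.sum_congr rfl fun p _ => Finset.sum_congr rfl fun q _ => by ring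

end Kontsevich


/-! ### Normal ordering of the recursion operator -/

namespace Kontsevich

open MvPolynomial Finset Airy

theorem sum_range_antidiagonal {V : Type*} [CommRing V] (r : ℕ → V) (T : ℕ → ℕ → V) {M N : ℕ}
    (hT : ∀ i j, M ≤ i ∨ M ≤ j → T i j = 0) (hN : 2 * M ≤ N) :
    ∑ m ∈ Finset.range N, r m * ∑ p ∈ antidiagonal m, T p.1 p.2
      = ∑ i ∈ Finset.range M, ∑ j ∈ Finset.range M, r (i + j) * T i j := by
  rw [← Finset.sum_product']
  simp only [Finset.mul_sum]
  rw [Finset.sum_sigma']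
  symm
  refine Finset.sum_of_injOn (fun p => ⟨p.1 + p.2, p⟩) ?_ ?_ ?_ ?_
  · rintro ⟨a, b⟩ _ ⟨c, d⟩ _ h
    simp only [Sigma.mk.injEq, heq_eq_eq] at h
    exact h.2
  · rintro ⟨a, b⟩ h
    simp only [Finset.coe_product, Finset.coe_range, Set.mem_prod, Set.mem_Iio] at h
    simp only [Finset.coe_sigma, Set.mem_sigma_iff, Finset.coe_range, Set.mem_Iio, Finset.mem_coe,
      Finset.HasAntidiagonal.mem_antidiagonal, and_true]
    omega
  · rintro ⟨m, ⟨a, b⟩⟩ h hn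
    simp only [Finset.mem_sigma, Finset.mem_range, Finset.HasAntidiagonal.mem_antidiagonal] at h
    obtain ⟨h1, rfl⟩ := h
    rw [hT, mul_zero]
    by_contra hcon
    refine hn ⟨(a, b), ?_, rfl⟩
    change ¬(M ≤ a ∨ M ≤ b) at hcon
    simp only [Finset.coe_product, Finset.coe_range, Set.mem_prod, Set.mem_Iio]
    omega
  · rintro ⟨a, b⟩ h
    rfl

theorem derT_comm (k l : ℕ) (f : TimeRing) : derT k (derT l f) = derT l (derT k f) := by
  have h : ⁅derT k, derT l⁆ = 0 := by
    refine MvPolynomial.derivation_ext fun i => ?_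
    rw [Derivation.commutator_apply]
    rcases i with _ | i
    · rw [show (X 0 : TimeRing) = invT from rfl, derT_invT, derT_invT]
      by_cases hk : k = 0 <;> by_cases hl : l = 0 <;> simp [hk, hl, derT_invT]
    · have hX : (X (i + 1) : TimeRing) = ratT (i + 1) := by simp [ratT]
      rw [hX, derT_ratT, derT_ratT]
      by_cases hk : k = 0 <;> by_cases hl : l = 0 <;> by_cases hik : i + 1 = k <;>
        by_cases hil : i + 1 = l <;> first | omega |
        (simp [hk, hl, hik, hil, derT_invT, derT_ratT] <;> split_ifs <;> simp [derT_invT, hk, hl])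
  have h2 := congrArg (fun D : Derivation ℂ TimeRing TimeRing => D f) h
  simp only [Derivation.commutator_apply, Derivation.zero_apply] at h2
  exact sub_eq_zero.1 h2

theorem derT_eq_zero {f : TimeRing} {K : ℕ} (hK : ∀ i ∈ f.vars, i < K) {k : ℕ} (hk : K ≤ k + 1) :
    derT (k + 1) f = 0 := by
  refine derivation_eq_zero_of_forall_mem_vars fun i hi => ?_
  have := hK i hi
  rw [derT, mkDerivation_X]
  simp only [Nat.succ_ne_zero, if_false, sub_zero]
  rw [if_neg (show i ≠ k + 1 by omega)]
  simp

/-- These are the values that `creD (i + 1)` would take on F_1 = -(1/24) log ρ_0, which is not an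
element of `TimeRing`. They are obtained from the constraints at level 1, whose only inhomogeneity
at the origin is the constant 1/8 at n = 1. -/
theorem cor₁_one (i : ℕ) : cor₁ 1 (i + 1) = if i = 0 then C (1 / 8) * invT * ratT 1
    else if i = 1 then -(C (1 / 8) * invT) else 0 := by
  obtain ⟨s, s0, hs⟩ := exists_inverse_series ratT ratT_zero
  obtain ⟨N, hN⟩ := exists_vars_lt (sol 1)
  have hK : ∀ n, constantCoeff (opK ratT n (sol 1)) = if n = 1 then -(C (1 / 8) * invT) else 0 := by
    intro n
    have h := constantCoeff_opK_sol 0 n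
    have hq : quadT 0 n = 0 := by simp [quadT, cor₂, cor₁, sol_zero]
    rw [hq, mul_zero, zero_add, zero_add] at h
    split_ifs with hn
    · rw [if_pos ⟨rfl, hn⟩] at h
      linear_combination h
    · rw [if_neg (fun h => hn h.2), mul_zero, add_zero] at h
      exact h
  have hs1 : s 1 = -ratT 1 := by
    have := hs 1
    rw [Finset.Nat.sum_antidiagonal_eq_sum_range_succ_mk, Finset.sum_range_succ,
      Finset.sum_range_one, s0, if_neg one_ne_zero] at this
    simp only [Nat.sub_zero, Nat.sub_self, ratT_zero] at this
    linear_combination this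
  rw [cor₁, shiftD_succ, pderiv_eq_sum_opK hs hN i (le_max_left N 2), map_sum]
  simp only [map_mul, constantCoeff_C, hK]
  rcases i with _ | _ | i
  · rw [Finset.sum_eq_single 1]
    · simp [hs1]; ring
    · intro b _ hb
      rw [if_neg (by omega), mul_zero]
    · intro h; exact absurd (Finset.mem_range.2 (by omega)) h
  · rw [Finset.sum_eq_single 0]
    · simp [s0]
    · intro b _ hb
      rw [if_neg (by omega), mul_zero]
    · intro h; exact absurd (Finset.mem_range.2 (by omega)) h
  · rw [if_neg (by omega), if_neg (by omega)]
    exact Finset.sum_eq_zero fun b _ => by rw [if_neg (by omega), mul_zero]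

theorem C_neg_three : (C (-3) : TimeRing) = -3 := by rw [map_neg, map_ofNat]

theorem nab_zero (f : TimeRing) : nab 0 f = 0 := by simp [nab, creD]

theorem nab_two (f : TimeRing) : nab 2 f = 3 * derT 0 f - C (1 / 8) * invT * f := by
  rw [nab, cor₁_one, if_neg one_ne_zero, if_pos rfl, creD]
  simp; ring

theorem nab_add_three (k : ℕ) (f : TimeRing) :
    nab (k + 3) f = (2 * (k : TimeRing) + 5) * derT (k + 1) f := by
  rw [nab, cor₁_one, if_neg (by omega), if_neg (by omega), zero_mul, add_zero, creD,
    Derivation.smul_apply, smul_eq_mul]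
  push_cast; ring

theorem nab_one {f : TimeRing} {K : ℕ} (hK : ∀ k, K ≤ k → derT (k + 1) f = 0) :
    nab 1 f = -3 * ratT 1 * derT 0 f
      - ∑ k ∈ range K, (2 * (k : TimeRing) + 5) * ratT (k + 2) * derT (k + 1) f
      + C (1 / 8) * invT * ratT 1 * f := by
  obtain ⟨N, hN⟩ := exists_vars_lt f
  rw [nab, cor₁_one, if_pos rfl, creD_one_eq_sum (N := K + N + 1)
    (fun i hi => by have := hN i hi; omega) (by omega), Finset.sum_range_succ',
    ← Finset.sum_subset (Finset.range_subset_range.2 (Nat.le_add_right K N))]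
  · have : ∀ k : ℕ, (2 * ((k + 1 : ℕ) : TimeRing) + 3) = 2 * (k : TimeRing) + 5 := fun k => by
      push_cast; ring
    simp only [this, Nat.cast_zero, zero_add, add_assoc, Nat.reduceAdd]
    ring
  · intro k _ hk
    rw [hK k (by simpa using hk), mul_zero]

theorem derT_C_mul (l : ℕ) (r : ℂ) (f : TimeRing) : derT l (C r * f) = C r * derT l f :=
  derivation_C_mul' _ _ _

theorem derT_natCast_mul (l k : ℕ) (f : TimeRing) :
    derT l ((2 * (k : TimeRing) + 5) * f) = (2 * (k : TimeRing) + 5) * derT l f := by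
  have : (2 * (k : TimeRing) + 5) = C (2 * (k : ℂ) + 5) := by
    rw [map_add, map_mul, map_ofNat, map_ofNat, map_natCast]
  rw [this, derT_C_mul]

theorem derT_zero_nab_one {f : TimeRing} {K : ℕ} (hK : ∀ i ∈ f.vars, i < K) :
    derT 0 (nab 1 f) = -3 * ratT 1 * derT 0 (derT 0 f) + 3 * invT * ratT 1 * derT 0 f
      - ∑ k ∈ range K, (2 * (k : TimeRing) + 5) * ratT (k + 2) * derT (k + 1) (derT 0 f)
      + invT * ∑ k ∈ range K, (2 * (k : TimeRing) + 5) * ratT (k + 2) * derT (k + 1) f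
      - 2 * C (1 / 8) * invT ^ 2 * ratT 1 * f + C (1 / 8) * invT * ratT 1 * derT 0 f := by
  rw [nab_one (K := K) fun k hk => derT_eq_zero hK (by omega), C_neg_three.symm, map_add, map_sub, map_sum, mul_assoc,
    derT_C_mul, mul_assoc, mul_assoc, derT_C_mul]
  have : ∀ k ∈ range K, derT 0 ((2 * (k : TimeRing) + 5) * ratT (k + 2) * derT (k + 1) f)
      = (2 * (k : TimeRing) + 5) * ratT (k + 2) * derT (k + 1) (derT 0 f)
        - invT * ((2 * (k : TimeRing) + 5) * ratT (k + 2) * derT (k + 1) f) := by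
    intro k _
    rw [mul_assoc, derT_natCast_mul, Derivation.leibniz, derT_ratT, if_neg (by omega), if_pos rfl,
      derT_comm 0]
    simp only [smul_eq_mul]
    ring
  rw [Finset.sum_congr rfl this, Finset.sum_sub_distrib, ← Finset.mul_sum]
  simp only [Derivation.leibniz, derT_ratT, derT_invT, smul_eq_mul, if_true]
  rw [if_neg one_ne_zero, C_neg_three]
  ring

/-- Besides the second derivatives, ∂/∂ρ_{l+1} hits the coefficients of `nab 1`: the ratio ρ_1/ρ_0
for l = 0, and ρ_{k+2}/ρ_0 for k + 1 = l. -/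
theorem derT_succ_nab_one {f : TimeRing} {K : ℕ} (hK : ∀ i ∈ f.vars, i < K) (l : ℕ) :
    derT (l + 1) (nab 1 f) = -3 * (if l = 0 then invT else 0) * derT 0 f
      - 3 * ratT 1 * derT (l + 1) (derT 0 f)
      - (∑ k ∈ range K, if k + 1 = l then (2 * (k : TimeRing) + 5) * invT * derT (k + 1) f else 0)
      - ∑ k ∈ range K, (2 * (k : TimeRing) + 5) * ratT (k + 2) * derT (l + 1) (derT (k + 1) f)
      + C (1 / 8) * invT * (if l = 0 then invT else 0) * f
      + C (1 / 8) * invT * ratT 1 * derT (l + 1) f := by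
  rw [nab_one (K := K) fun k hk => derT_eq_zero hK (by omega), C_neg_three.symm, map_add, map_sub, map_sum, mul_assoc,
    derT_C_mul, mul_assoc, mul_assoc, derT_C_mul]
  have : ∀ k ∈ range K, derT (l + 1) ((2 * (k : TimeRing) + 5) * ratT (k + 2) * derT (k + 1) f)
      = (if k + 1 = l then (2 * (k : TimeRing) + 5) * invT * derT (k + 1) f else 0)
        + (2 * (k : TimeRing) + 5) * ratT (k + 2) * derT (l + 1) (derT (k + 1) f) := by
    intro k _
    rw [mul_assoc, derT_natCast_mul, Derivation.leibniz, derT_ratT, if_neg (Nat.succ_ne_zero l)]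
    simp only [smul_eq_mul]
    by_cases h : k + 1 = l
    · rw [if_pos h, if_pos (by omega)]; ring
    · rw [if_neg h, if_neg (by omega)]; ring
  rw [Finset.sum_congr rfl this, Finset.sum_add_distrib]
  simp only [Derivation.leibniz, derT_ratT, derT_invT, smul_eq_mul, if_neg (Nat.succ_ne_zero l)]
  rw [C_neg_three]
  by_cases h : l = 0
  · rw [if_pos h, if_pos (by omega)]; ring
  · rw [if_neg h, if_neg (by omega)]; ring

theorem sum_mul_derT_nab_one {f : TimeRing} {K : ℕ} (hK : ∀ i ∈ f.vars, i < K) (hK0 : 0 < K)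
    (c : ℕ → TimeRing) :
    ∑ l ∈ range K, c l * derT (l + 1) (nab 1 f) = -3 * invT * c 0 * derT 0 f
      - 3 * ratT 1 * (∑ l ∈ range K, c l * derT (l + 1) (derT 0 f))
      - invT * (∑ l ∈ range K, c (l + 1) * (2 * (l : TimeRing) + 5) * derT (l + 1) f)
      - (∑ l ∈ range K, ∑ k ∈ range K, c l * (2 * (k : TimeRing) + 5) * ratT (k + 2) *
          derT (l + 1) (derT (k + 1) f))
      + C (1 / 8) * invT ^ 2 * c 0 * f
      + C (1 / 8) * invT * ratT 1 * ∑ l ∈ range K, c l * derT (l + 1) f := by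
  obtain ⟨K, rfl⟩ : ∃ K', K = K' + 1 := ⟨K - 1, by omega⟩
  have h1 : ∑ l ∈ range (K + 1), c l * (∑ k ∈ range (K + 1),
      if k + 1 = l then (2 * (k : TimeRing) + 5) * invT * derT (k + 1) f else 0)
      = invT * (∑ l ∈ range (K + 1), c (l + 1) * (2 * (l : TimeRing) + 5) * derT (l + 1) f) := by
    -- The condition k + 1 = l shifts the index by one. The boundary term on the right vanishes
    -- because `f` does not depend on ρ_{K+1}.
    rw [Finset.sum_range_succ', Finset.sum_eq_zero (s := range (K + 1))
      (fun k _ => if_neg (Nat.succ_ne_zero k)), mul_zero, add_zero, Finset.sum_range_succ _ K,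
      derT_eq_zero hK le_rfl, mul_zero, add_zero, Finset.mul_sum]
    refine Finset.sum_congr rfl fun l hl => ?_
    rw [Finset.mem_range] at hl
    rw [Finset.sum_eq_single l, if_pos rfl]
    · ring
    · intro b _ hb; rw [if_neg (by omega)]
    · intro h; exact absurd (Finset.mem_range.2 (by omega)) h
  have h2 : ∀ g : TimeRing, ∑ l ∈ range (K + 1), c l * ((if l = 0 then invT else 0) * g)
      = c 0 * invT * g := by
    intro g
    rw [Finset.sum_eq_single 0, if_pos rfl]
    · ring
    · intro b _ hb; rw [if_neg hb]; ring
    · intro h; exact absurd (Finset.mem_range.2 (by omega)) h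
  have h3 : ∀ l ∈ range (K + 1), c l * derT (l + 1) (nab 1 f) =
      -3 * (c l * ((if l = 0 then invT else 0) * derT 0 f))
      - 3 * ratT 1 * (c l * derT (l + 1) (derT 0 f))
      - c l * (∑ k ∈ range (K + 1),
        if k + 1 = l then (2 * (k : TimeRing) + 5) * invT * derT (k + 1) f else 0)
      - (∑ k ∈ range (K + 1), c l * (2 * (k : TimeRing) + 5) * ratT (k + 2) *
          derT (l + 1) (derT (k + 1) f))
      + C (1 / 8) * invT * (c l * ((if l = 0 then invT else 0) * f))
      + C (1 / 8) * invT * ratT 1 * (c l * derT (l + 1) f) := by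
    intro l _
    have : ∑ k ∈ range (K + 1), c l * (2 * (k : TimeRing) + 5) * ratT (k + 2) *
          derT (l + 1) (derT (k + 1) f) = c l * ∑ k ∈ range (K + 1),
          (2 * (k : TimeRing) + 5) * ratT (k + 2) * derT (l + 1) (derT (k + 1) f) := by
      rw [Finset.mul_sum]
      exact Finset.sum_congr rfl fun k _ => by ring
    rw [derT_succ_nab_one hK, this]
    ring
  rw [Finset.sum_congr rfl h3]
  simp only [Finset.sum_add_distrib, Finset.sum_sub_distrib, ← Finset.mul_sum]
  rw [h1, h2, h2]
  ring

theorem derT_nab_eq_zero {f : TimeRing} {K : ℕ} (hK : ∀ i ∈ f.vars, i < K) (hK0 : 0 < K)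
    {l : ℕ} (hl : K ≤ l) (j : ℕ) : derT (l + 1) (nab j f) = 0 := by
  have h0 : derT (l + 1) f = 0 := derT_eq_zero hK (by omega)
  have h1 : ∀ k, derT (l + 1) (derT k f) = 0 := fun k => by rw [derT_comm, h0, map_zero]
  rcases j with _ | _ | _ | j
  · rw [nab_zero, map_zero]
  · rw [zero_add, derT_succ_nab_one hK, h1, h0]
    simp only [h1]
    rw [Finset.sum_eq_zero (s := range K)]
    · simp [show l ≠ 0 by omega]
    · intro k hk
      rw [Finset.mem_range] at hk
      split_ifs with hkl
      · rw [derT_eq_zero hK (by omega), mul_zero]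
      · rfl
  · rw [zero_add, nab_two, map_sub, mul_assoc, derT_C_mul, ← map_ofNat C 3, derT_C_mul, h1,
      Derivation.leibniz, h0, derT_invT]
    simp
  · rw [nab_add_three, derT_natCast_mul, h1, mul_zero]

theorem nab_nab_eq_zero {f : TimeRing} {K : ℕ} (hK : ∀ i ∈ f.vars, i < K) (hK0 : 0 < K)
    {i j : ℕ} (hi : K + 3 ≤ i) : nab i (nab j f) = 0 := by
  obtain ⟨l, rfl⟩ : ∃ l, i = l + 3 := ⟨i - 3, by omega⟩
  rw [nab_add_three, derT_nab_eq_zero hK hK0 (by omega), mul_zero]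

end Kontsevich

namespace Kontsevich

open MvPolynomial Finset Airy

theorem sum_nab_nab {f : TimeRing} {K N : ℕ} (hK : ∀ i ∈ f.vars, i < K) (hK0 : 0 < K)
    (hN : 2 * K + 6 ≤ N) :
    ∑ m ∈ range N, serR m * ∑ p ∈ antidiagonal (m + 1), nab (max p.1 p.2) (nab (min p.1 p.2) f)
      = serR 1 * nab 1 (nab 1 f) + 2 * serR 2 * nab 2 (nab 1 f) + serR 3 * nab 2 (nab 2 f)
        + 2 * (∑ k ∈ range K, serR (k + 3) * nab (k + 3) (nab 1 f))
        + 2 * (∑ k ∈ range K, serR (k + 4) * nab (k + 3) (nab 2 f))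
        + ∑ k ∈ range K, ∑ l ∈ range K, serR (k + l + 5) * nab (k + 3) (nab (l + 3) f) := by
  -- Shifting m by one adds a term for m = 0, which vanishes since `nab 0 = 0`; the truncation in `m
  -- - 1` is therefore harmless.
  have h := sum_range_antidiagonal (fun m => serR (m - 1))
    (fun i j => nab (max i j) (nab (min i j) f)) (M := K + 3) (N := N + 1) (by
      intro i j hij
      exact nab_nab_eq_zero hK hK0 (by rcases hij with h | h <;> simp [h])) (by omega)
  rw [Finset.sum_range_succ'] at h
  simp only [Finset.Nat.antidiagonal_zero, Finset.sum_singleton, max_self, nab_zero, mul_zero,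
    add_zero, Nat.add_sub_cancel] at h
  rw [h]
  -- From index 3 on `nab` is a derivative with a constant coefficient, so the order is irrelevant.
  -- Only the indices 1 and 2 need normal ordering.
  have hsym : ∀ k l, nab (max (k + 3) (l + 3)) (nab (min (k + 3) (l + 3)) f)
      = nab (k + 3) (nab (l + 3) f) := by
    intro k l
    rcases le_total k l with hkl | hkl
    · rw [max_eq_right (by omega), min_eq_left (by omega), nab_add_three, nab_add_three,
        nab_add_three, nab_add_three, derT_natCast_mul, derT_natCast_mul, derT_comm]
      ring
    · rw [max_eq_left (by omega), min_eq_right (by omega)]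
  have h3 : ∀ g : ℕ → TimeRing, ∑ i ∈ range (K + 3), g i
      = (∑ i ∈ range K, g (i + 3)) + g 2 + g 1 + g 0 := by
    intro g
    rw [Finset.sum_range_succ', Finset.sum_range_succ', Finset.sum_range_succ']
  rw [h3]
  simp only [h3, Finset.sum_add_distrib, hsym]
  have e1 : ∀ k l, k + 3 + (l + 3) - 1 = k + l + 5 := fun k l => by omega
  have e2 : ∀ k, k + 3 + 2 - 1 = k + 4 := fun k => by omega
  have e3 : ∀ k, k + 3 + 1 - 1 = k + 3 := fun k => by omega
  have e4 : ∀ k, 2 + (k + 3) - 1 = k + 4 := fun k => by omega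
  have e5 : ∀ k, 1 + (k + 3) - 1 = k + 3 := fun k => by omega
  have m1 : ∀ k, max (k + 3) 2 = k + 3 := fun k => by omega
  have m2 : ∀ k, max (k + 3) 1 = k + 3 := fun k => by omega
  have m3 : ∀ k, max 2 (k + 3) = k + 3 := fun k => by omega
  have m4 : ∀ k, max 1 (k + 3) = k + 3 := fun k => by omega
  have n1 : ∀ k, min (k + 3) 2 = 2 := fun k => by omega
  have n2 : ∀ k, min (k + 3) 1 = 1 := fun k => by omega
  have n3 : ∀ k, min 2 (k + 3) = 2 := fun k => by omega
  have n4 : ∀ k, min 1 (k + 3) = 1 := fun k => by omega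
  simp only [e1, e2, e3, e4, e5, m1, m2, m3, m4, n1, n2, n3, n4, Nat.min_zero, Nat.zero_min,
    nab_zero, Nat.reduceAdd, Nat.reduceSub, max_self, min_self, show max 2 1 = 2 from rfl,
    show min 2 1 = 1 from rfl, show max 1 2 = 2 from rfl, show min 1 2 = 1 from rfl, mul_zero,
    add_zero]
  have hz : ∀ i, nab i (0 : TimeRing) = 0 := fun i => by simp [nab]
  simp only [hz, mul_zero, Finset.sum_const_zero, add_zero]
  ring

/-- The recursion operator for the stable partition function in normal order. -/
theorem sum_nab_nab_eq {f : TimeRing} {K N : ℕ} (hK : ∀ i ∈ f.vars, i < K) (hK0 : 0 < K)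
    (hN : 2 * K + 6 ≤ N) :
    ∑ m ∈ range N, serR m * ∑ p ∈ antidiagonal (m + 1), nab (max p.1 p.2) (nab (min p.1 p.2) f)
      = serR 1 * (9 * ratT 1 ^ 2 * derT 0 (derT 0 f)
          + (15 * ratT 2 - (9 + 6 * C (1 / 8)) * ratT 1 ^ 2) * invT * derT 0 f
          + 6 * ratT 1 *
            (∑ k ∈ range K, (2 * (k : TimeRing) + 5) * ratT (k + 2) * derT (k + 1) (derT 0 f))
          - (3 + 2 * C (1 / 8)) * ratT 1 * invT *
            (∑ k ∈ range K, (2 * (k : TimeRing) + 5) * ratT (k + 2) * derT (k + 1) f)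
          + invT * (∑ k ∈ range K, (2 * ((k + 1 : ℕ) : TimeRing) + 5) * ratT (k + 1 + 2) *
            (2 * (k : TimeRing) + 5) * derT (k + 1) f)
          + (∑ k ∈ range K, ∑ l ∈ range K, (2 * (k : TimeRing) + 5) * ratT (k + 2) *
            (2 * (l : TimeRing) + 5) * ratT (l + 2) * derT (k + 1) (derT (l + 1) f))
          + invT ^ 2 * C (1 / 8) * ((6 + C (1 / 8)) * ratT 1 ^ 2 - 5 * ratT 2) * f)
        + serR 2 * (-18 * ratT 1 * derT 0 (derT 0 f)
          + (18 + 12 * C (1 / 8)) * ratT 1 * invT * derT 0 f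
          - 6 * (∑ k ∈ range K, (2 * (k : TimeRing) + 5) * ratT (k + 2) * derT (k + 1) (derT 0 f))
          + (6 + 2 * C (1 / 8)) * invT *
            (∑ k ∈ range K, (2 * (k : TimeRing) + 5) * ratT (k + 2) * derT (k + 1) f)
          - invT ^ 2 * C (1 / 8) * (12 + 2 * C (1 / 8)) * ratT 1 * f)
        + serR 3 * (9 * derT 0 (derT 0 f) - (30 + 6 * C (1 / 8)) * invT * derT 0 f
          + invT ^ 2 * C (1 / 8) * (13 + C (1 / 8)) * f)
        + 2 * (C (1 / 8) * invT * ratT 1 *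
            (∑ k ∈ range K, serR (k + 3) * (2 * (k : TimeRing) + 5) * derT (k + 1) f)
          - 3 * ratT 1 *
            (∑ k ∈ range K, serR (k + 3) * (2 * (k : TimeRing) + 5) * derT (k + 1) (derT 0 f))
          - invT * (∑ k ∈ range K, serR (k + 1 + 3) * (2 * ((k + 1 : ℕ) : TimeRing) + 5) *
            (2 * (k : TimeRing) + 5) * derT (k + 1) f)
          - (∑ k ∈ range K, ∑ l ∈ range K, serR (k + 3) * (2 * (k : TimeRing) + 5) *
            (2 * (l : TimeRing) + 5) * ratT (l + 2) * derT (k + 1) (derT (l + 1) f)))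
        + 2 * (3 * (∑ k ∈ range K, serR (k + 4) * (2 * (k : TimeRing) + 5) *
            derT (k + 1) (derT 0 f))
          - C (1 / 8) * invT *
            (∑ k ∈ range K, serR (k + 4) * (2 * (k : TimeRing) + 5) * derT (k + 1) f))
        + ∑ k ∈ range K, ∑ l ∈ range K, serR (k + l + 5) * ((2 * (k : TimeRing) + 5) *
          ((2 * (l : TimeRing) + 5) * derT (k + 1) (derT (l + 1) f))) := by
  have hg := fun j => fun k (hk : K ≤ k) => derT_nab_eq_zero hK hK0 hk j
  rw [sum_nab_nab hK hK0 hN, nab_one (hg 1), nab_two, nab_two (nab 2 f), derT_zero_nab_one hK,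
    sum_mul_derT_nab_one hK hK0 fun k => (2 * (k : TimeRing) + 5) * ratT (k + 2)]
  simp only [nab_add_three (_ : ℕ) (nab 1 f), ← mul_assoc (serR _)]
  rw [sum_mul_derT_nab_one hK hK0 fun k => serR (k + 3) * (2 * (k : TimeRing) + 5)]
  have h2 : ∀ k, derT k (nab 2 f) = 3 * derT k (derT 0 f)
      - C (1 / 8) * (invT * derT k f - (if k = 0 then invT else 0) * invT * f) := by
    intro k
    rw [nab_two, map_sub, mul_assoc, derT_C_mul, ← map_ofNat C 3, derT_C_mul, Derivation.leibniz,
      derT_invT, smul_eq_mul, smul_eq_mul]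
    ring
  have h9 : ∑ k ∈ range K, serR (k + 4) * nab (k + 3) (nab 2 f)
      = 3 * (∑ k ∈ range K, serR (k + 4) * (2 * (k : TimeRing) + 5) * derT (k + 1) (derT 0 f))
        - C (1 / 8) * invT *
          (∑ k ∈ range K, serR (k + 4) * (2 * (k : TimeRing) + 5) * derT (k + 1) f) := by
    rw [Finset.mul_sum, Finset.mul_sum, ← Finset.sum_sub_distrib]
    refine Finset.sum_congr rfl fun k _ => ?_
    rw [nab_add_three, h2, if_neg (Nat.succ_ne_zero k)]
    ring
  rw [h9]
  simp only [nab_add_three, h2, derT_natCast_mul, if_true]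
  rw [nab_one (K := K) fun k hk => derT_eq_zero hK (by omega), nab_two]
  simp only [Nat.cast_zero, mul_zero, zero_add]
  ring_nf

end Kontsevich

/-! ### Evaluation at complex times -/

namespace Kontsevich

open MvPolynomial Finset Airy

/-- Evaluation of an element of the ring of functions of the Kontsevich times. -/
def evT (ρ : ℕ → ℂ) : TimeRing →+* ℂ :=
  MvPolynomial.eval fun k => if k = 0 then (ρ 0)⁻¹ else ρ k / ρ 0

theorem evT_C (ρ : ℕ → ℂ) (r : ℂ) : evT ρ (C r) = r := eval_C r

theorem evT_invT (ρ : ℕ → ℂ) : evT ρ invT = (ρ 0)⁻¹ := by simp [evT, invT]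

theorem evT_ratT {ρ : ℕ → ℂ} (h : ρ 0 ≠ 0) (k : ℕ) : evT ρ (ratT k) = ρ k / ρ 0 := by
  rw [ratT]
  split_ifs with hk
  · rw [hk, map_one, div_self h]
  · rw [evT, eval_X, if_neg hk]

theorem hasDerivAt_evT {ρ : ℕ → ℂ} (h : ρ 0 ≠ 0) (l : ℕ) (p : TimeRing) :
    HasDerivAt (fun t => evT (Function.update ρ l t) p) (evT ρ (derT l p)) (ρ l) := by
  induction p using MvPolynomial.induction_on with
  | C r =>
    simp only [evT_C]
    rw [show derT l (C r) = 0 from derivation_C _ _, map_zero]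
    exact hasDerivAt_const _ _
  | add p q hp hq =>
    simp only [map_add]
    exact hp.add hq
  | mul_X p k hp =>
    have hX : HasDerivAt (fun t => evT (Function.update ρ l t) (X k)) (evT ρ (derT l (X k)))
        (ρ l) := by
      rcases k with _ | k
      · have e : evT ρ (derT l (X 0)) = if l = 0 then -((ρ 0) ^ 2)⁻¹ else 0 := by
          rw [show (X 0 : TimeRing) = invT from rfl, derT_invT]
          split_ifs
          · rw [map_mul, map_neg, evT_invT, pow_two, mul_inv, neg_mul]
          · simp
        rw [e]
        have e2 : (fun t => evT (Function.update ρ l t) (X 0)) = fun t => (Function.update ρ l t 0)⁻¹ := by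
          funext t; exact evT_invT _
        rw [e2]
        by_cases hl : l = 0
        · subst hl
          simp only [Function.update_self, if_true]
          exact hasDerivAt_inv h
        · rw [if_neg hl]
          simp only [Function.update_of_ne (Ne.symm hl)]
          exact hasDerivAt_const _ _
      · have hX : (X (k + 1) : TimeRing) = ratT (k + 1) := by simp [ratT]
        have e2 : (fun t => evT (Function.update ρ l t) (X (k + 1)))
            = fun t => Function.update ρ l t (k + 1) / Function.update ρ l t 0 := by
          funext t
          simp [evT]
        rw [e2, hX, derT_ratT, map_sub, map_mul, evT_ratT h]
        by_cases hl : l = 0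
        · subst hl
          simp only [Function.update_self, if_true,
            Function.update_of_ne (Nat.succ_ne_zero k), if_neg (Nat.succ_ne_zero k)]
          have := (hasDerivAt_inv h).const_mul (ρ (k + 1))
          refine this.congr_deriv ?_
          rw [map_zero, evT_invT]; field_simp; ring
        · simp only [if_neg hl, Function.update_of_ne (Ne.symm hl)]
          by_cases hk : k + 1 = l
          · subst hk
            simp only [Function.update_self, if_true]
            have := (hasDerivAt_id (ρ (k + 1))).div_const (ρ 0)
            refine this.congr_deriv ?_
            rw [map_zero, evT_invT]; ring
          · rw [if_neg hk]
            simp only [Function.update_of_ne hk]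
            rw [map_zero, zero_mul, sub_zero]
            exact hasDerivAt_const _ _
    have := hp.mul hX
    simp only [Function.update_eq_self] at this
    rw [Derivation.leibniz]
    simp only [map_add, map_mul, smul_eq_mul]
    refine this.congr_deriv ?_
    ring

/-- The function `f` of the Kontsevich times is given by the element `p` where `ρ_0 ≠ 0`. -/
def IsTimeFun (f : (ℕ → ℂ) → ℂ) (p : TimeRing) : Prop := ∀ ρ, ρ 0 ≠ 0 → f ρ = evT ρ p

theorem IsTimeFun.pd {f : (ℕ → ℂ) → ℂ} {p : TimeRing} (hf : IsTimeFun f p) (l : ℕ) :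
    IsTimeFun (pd l f) (derT l p) := by
  intro ρ h
  refine ((hasDerivAt_evT h l p).congr_of_eventuallyEq ?_).deriv
  -- For l = 0 the two functions agree only near ρ_0, where the varied time stays nonzero; for other
  -- l they agree everywhere.
  by_cases hl : l = 0
  · subst hl
    filter_upwards [eventually_ne_nhds h] with t ht
    exact hf _ (by rwa [Function.update_self])
  · exact Eventually.of_forall fun t => hf _ (by rwa [Function.update_of_ne (Ne.symm hl)])

theorem evT_invS {ρ : ℕ → ℂ} (h : ρ 0 ≠ 0) (m : ℕ) : sCoeff m ρ = evT ρ (invS m) := by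
  have h1 : PowerSeries.map (evT ρ) (PowerSeries.mk ratT) = PowerSeries.mk fun l => ρ l / ρ 0 := by
    ext1 n
    rw [PowerSeries.coeff_map, PowerSeries.coeff_mk, PowerSeries.coeff_mk, evT_ratT h]
  have h2 := congrArg (PowerSeries.map (evT ρ)) invS_mul
  rw [map_mul, h1, map_one] at h2
  rw [sCoeff, ← (PowerSeries.eq_inv_iff_mul_eq_one (by simp [h])).2 h2, PowerSeries.coeff_map,
    PowerSeries.coeff_mk]

/-- 1/(2k+3) = 1/3 - (2/3) k/(2k+3), and the constant 1/3 contributes nothing for m ≥ 1, because a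
series times its inverse has no coefficient of positive degree. It does contribute at m = 0, hence
the hypothesis. -/
theorem evT_serR {ρ : ℕ → ℂ} (h : ρ 0 ≠ 0) {m : ℕ} (hm : 1 ≤ m) : Rcoeff m ρ = evT ρ (serR m) := by
  have h1 := congrArg (PowerSeries.coeff m) invS_mul
  rw [mul_comm, PowerSeries.coeff_mul, PowerSeries.coeff_one, if_neg (by omega)] at h1
  have h2 := congrArg (evT ρ) h1
  simp only [map_sum, map_mul, PowerSeries.coeff_mk, map_zero, evT_ratT h, ← evT_invS h] at h2
  rw [Rcoeff, serR]
  simp only [map_sum, map_mul, evT_C, evT_ratT h, ← evT_invS h]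
  rw [Finset.Nat.sum_antidiagonal_eq_sum_range_succ (fun a b => ρ a / ρ 0 * sCoeff b ρ)] at h2
  rw [Finset.Nat.sum_antidiagonal_eq_sum_range_succ
    (fun a b => 1 / (2 * (a : ℂ) + 3) * (ρ a / ρ 0) * sCoeff b ρ)]
  have h3 : ∑ k ∈ Finset.Icc 1 m, (k : ℂ) * ρ k / ((3 + 2 * (k : ℂ)) * ρ 0) * sCoeff (m - k) ρ
      = ∑ k ∈ range (m + 1), (k : ℂ) * ρ k / ((3 + 2 * (k : ℂ)) * ρ 0) * sCoeff (m - k) ρ := by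
    refine Finset.sum_subset ?_ ?_
    · intro k hk; rw [Finset.mem_Icc] at hk; rw [Finset.mem_range]; omega
    · intro k hk hk'
      rw [Finset.mem_range] at hk; rw [Finset.mem_Icc] at hk'
      obtain rfl : k = 0 := by omega
      simp
  rw [h3]
  have h4 : ∀ k ∈ range (m + 1), 1 / (2 * (k : ℂ) + 3) * (ρ k / ρ 0) * sCoeff (m - k) ρ
      = -(2 / 3) * ((k : ℂ) * ρ k / ((3 + 2 * (k : ℂ)) * ρ 0) * sCoeff (m - k) ρ)
        + 1 / 3 * (ρ k / ρ 0 * sCoeff (m - k) ρ) := by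
    intro k _
    have hk : (2 * (k : ℂ) + 3) ≠ 0 := by
      have : ((2 * k + 3 : ℕ) : ℂ) ≠ 0 := Nat.cast_ne_zero.2 (by omega)
      push_cast at this; exact this
    have hk' : (3 + 2 * (k : ℂ)) ≠ 0 := by rwa [add_comm]
    field_simp
    ring
  rw [Finset.sum_congr rfl h4, Finset.sum_add_distrib, ← Finset.mul_sum, ← Finset.mul_sum, h2]
  ring

theorem serR_zero : serR 0 = C (1 / 3) := by
  have := serR_mul 0
  simp only [Finset.Nat.antidiagonal_zero, Finset.sum_singleton, ratT_zero, mul_one] at this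
  rw [this]; simp

theorem serR_succ (m : ℕ) : serR (m + 1) = C (1 / (2 * ((m + 1 : ℕ) : ℂ) + 3)) * ratT (m + 1)
    - ∑ k ∈ range (m + 1), serR k * ratT (m + 1 - k) := by
  have := serR_mul (m + 1)
  rw [Finset.Nat.sum_antidiagonal_eq_sum_range_succ_mk, Finset.sum_range_succ] at this
  simp only [Nat.sub_self, ratT_zero, mul_one] at this
  linear_combination this

theorem finsum_one_le {g : ℕ → ℂ} {K : ℕ} (hg : ∀ k, K ≤ k → g (k + 1) = 0) :
    ∑ᶠ (k : ℕ) (_ : 1 ≤ k), g k = ∑ k ∈ range K, g (k + 1) := by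
  have h1 : ∀ k, ∑ᶠ (_ : 1 ≤ k), g k = if 1 ≤ k then g k else 0 := fun k => finsum_eq_if
  simp only [h1]
  rw [finsum_eq_sum_of_support_subset (s := range (K + 1)), Finset.sum_range_succ']
  · simp
  · intro k hk
    rw [Function.mem_support] at hk
    rw [Finset.coe_range, Set.mem_Iio]
    by_contra hcon
    obtain ⟨j, rfl⟩ : ∃ j, k = j + 1 := ⟨k - 1, by omega⟩
    exact hk (by rw [hg j (by omega), ite_self])

end Kontsevich

/-! ### The recursion operator as `-Δ_ρ + F_2` -/

namespace Kontsevich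

open MvPolynomial Finset Airy

theorem serR_one : serR 1 = C (-(2 / 15)) * ratT 1 := by
  rw [serR_succ, Finset.sum_range_one, serR_zero, ← sub_mul, ← C_sub]
  norm_num

theorem serR_two : serR 2 = C (-(4 / 21)) * ratT 2 + C (2 / 15) * ratT 1 ^ 2 := by
  rw [serR_succ, Finset.sum_range_succ, Finset.sum_range_one, serR_zero, serR_one]
  have e1 : (C (1 / (2 * ((1 + 1 : ℕ) : ℂ) + 3)) : TimeRing) = C (-(4 / 21)) + C (1 / 3) := by
    rw [← C_add]; norm_num
  have e2 : (C (2 / 15) : TimeRing) = -C (-(2 / 15)) := by rw [← C_neg]; norm_num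
  rw [e1, e2]
  simp only [Nat.reduceAdd, Nat.sub_zero, Nat.reduceSub]
  ring

theorem serR_three : serR 3 = C (-(2 / 9)) * ratT 3 + C (34 / 105) * ratT 1 * ratT 2
    - C (2 / 15) * ratT 1 ^ 3 := by
  rw [serR_succ, Finset.sum_range_succ, Finset.sum_range_succ, Finset.sum_range_one, serR_zero,
    serR_one, serR_two]
  have e1 : (C (1 / (2 * ((2 + 1 : ℕ) : ℂ) + 3)) : TimeRing) = C (-(2 / 9)) + C (1 / 3) := by
    rw [← C_add]; norm_num
  have e2 : (C (34 / 105) : TimeRing) = -C (-(2 / 15)) - C (-(4 / 21)) := by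
    rw [← C_neg, ← C_sub]; norm_num
  rw [e1, e2]
  simp only [Nat.reduceAdd, Nat.sub_zero, Nat.reduceSub]
  ring

/-- The recursion operator for the stable partition function is `-Δ_ρ + F_2`. -/
theorem evT_sum_nab_nab {f : (ℕ → ℂ) → ℂ} {p : TimeRing} (hf : IsTimeFun f p) {ρ : ℕ → ℂ}
    (h : ρ 0 ≠ 0) {K N : ℕ} (hK : ∀ i ∈ p.vars, i < K) (hK0 : 0 < K) (hN : 2 * K + 6 ≤ N) :
    1 / 4 * evT ρ (∑ m ∈ range N, serR m * ∑ q ∈ antidiagonal (m + 1),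
        nab (max q.1 q.2) (nab (min q.1 q.2) p))
      = -deltaRho f ρ + (-(21 * ρ 1 ^ 3 / (160 * ρ 0 ^ 5)) + 29 / 128 * (ρ 1 * ρ 2 / ρ 0 ^ 4)
        - 35 / 384 * (ρ 3 / ρ 0 ^ 3)) * f ρ := by
  have hd1 : ∀ k, pd k f ρ = evT ρ (derT k p) := fun k => hf.pd k ρ h
  have hd2 : ∀ k l, pd k (pd l f) ρ = evT ρ (derT k (derT l p)) := fun k l => (hf.pd l).pd k ρ h
  have hz1 : ∀ k, K ≤ k → derT (k + 1) p = 0 := fun k hk => derT_eq_zero hK (by omega)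
  have hz2 : ∀ k l, K ≤ l → derT k (derT (l + 1) p) = 0 := fun k l hl => by rw [hz1 l hl, map_zero]
  have hz3 : ∀ k l, K ≤ k → derT (k + 1) (derT l p) = 0 := fun k l hk => by
    rw [derT_comm, hz2 _ _ hk]
  have hR : ∀ m, Rcoeff (m + 1) ρ = evT ρ (serR (m + 1)) := fun m => evT_serR h (by omega)
  have hR' : ∀ m, Rcoeff (m + 1 + 2) ρ = evT ρ (serR (m + 3)) := fun m => evT_serR h (by omega)
  have hR4 : ∀ m, Rcoeff (m + 1 + 3) ρ = evT ρ (serR (m + 4)) := fun m => evT_serR h (by omega)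
  have hR5 : ∀ k l, Rcoeff (k + 1 + (l + 1) + 3) ρ = evT ρ (serR (k + l + 5)) := fun k l => by
    rw [show k + 1 + (l + 1) + 3 = k + l + 5 by omega]
    exact evT_serR h (by omega)
  -- Writing ρ_m = a_m ρ_0 separates ratios from the scale. Each sum over k or over k, l becomes an
  -- opaque constant, after which the claim is an identity between rational functions of finitely
  -- many symbols.
  obtain ⟨a, ha⟩ : ∃ a : ℕ → ℂ, ∀ m, ρ m = a m * ρ 0 :=
    ⟨fun m => ρ m / ρ 0, fun m => (div_mul_cancel₀ _ h).symm⟩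
  have hay : ∀ m, ρ m / ρ 0 = a m := fun m => by rw [ha m, mul_div_cancel_right₀ _ h]
  obtain ⟨S1, hS1⟩ : ∃ S, S = ∑ k ∈ range K, (2 * (k : ℂ) + 5) * a (k + 2) *
    evT ρ (derT (k + 1) (derT 0 p)) := ⟨_, rfl⟩
  obtain ⟨S2, hS2⟩ : ∃ S, S = ∑ k ∈ range K, (2 * (k : ℂ) + 5) * a (k + 2) *
    evT ρ (derT (k + 1) p) := ⟨_, rfl⟩
  obtain ⟨S3, hS3⟩ : ∃ S, S = ∑ k ∈ range K, (2 * ((k + 1 : ℕ) : ℂ) + 5) * a (k + 1 + 2) *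
    (2 * (k : ℂ) + 5) * evT ρ (derT (k + 1) p) := ⟨_, rfl⟩
  obtain ⟨S4, hS4⟩ : ∃ S, S = ∑ k ∈ range K, ∑ l ∈ range K, (2 * (k : ℂ) + 5) * a (k + 2) *
    (2 * (l : ℂ) + 5) * a (l + 2) * evT ρ (derT (k + 1) (derT (l + 1) p)) := ⟨_, rfl⟩
  obtain ⟨S5, hS5⟩ : ∃ S, S = ∑ k ∈ range K, evT ρ (serR (k + 3)) * (2 * (k : ℂ) + 5) *
    evT ρ (derT (k + 1) (derT 0 p)) := ⟨_, rfl⟩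
  obtain ⟨S6, hS6⟩ : ∃ S, S = ∑ k ∈ range K, evT ρ (serR (k + 3)) * (2 * (k : ℂ) + 5) *
    evT ρ (derT (k + 1) p) := ⟨_, rfl⟩
  obtain ⟨S7, hS7⟩ : ∃ S, S = ∑ k ∈ range K, evT ρ (serR (k + 1 + 3)) *
    (2 * ((k + 1 : ℕ) : ℂ) + 5) * (2 * (k : ℂ) + 5) * evT ρ (derT (k + 1) p) := ⟨_, rfl⟩
  obtain ⟨S8, hS8⟩ : ∃ S, S = ∑ k ∈ range K, ∑ l ∈ range K, evT ρ (serR (k + 3)) *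
    (2 * (k : ℂ) + 5) * (2 * (l : ℂ) + 5) * a (l + 2) * evT ρ (derT (k + 1) (derT (l + 1) p)) :=
    ⟨_, rfl⟩
  obtain ⟨S9, hS9⟩ : ∃ S, S = ∑ k ∈ range K, evT ρ (serR (k + 4)) * (2 * (k : ℂ) + 5) *
    evT ρ (derT (k + 1) (derT 0 p)) := ⟨_, rfl⟩
  obtain ⟨S10, hS10⟩ : ∃ S, S = ∑ k ∈ range K, evT ρ (serR (k + 4)) * (2 * (k : ℂ) + 5) *
    evT ρ (derT (k + 1) p) := ⟨_, rfl⟩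
  obtain ⟨S11, hS11⟩ : ∃ S, S = ∑ k ∈ range K, ∑ l ∈ range K, evT ρ (serR (k + l + 5)) *
    ((2 * (k : ℂ) + 5) * ((2 * (l : ℂ) + 5) * evT ρ (derT (k + 1) (derT (l + 1) p)))) :=
    ⟨_, rfl⟩
  -- The two mixed terms with ρ_{k+1} ℛ_{l+2} and ρ_{l+1} ℛ_{k+2} are the same sum by symmetry of
  -- second derivatives.
  have hS8' : S8 = ∑ k ∈ range K, ∑ l ∈ range K, evT ρ (serR (l + 3)) *
      (2 * (l : ℂ) + 5) * (2 * (k : ℂ) + 5) * a (k + 2) *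
      evT ρ (derT (k + 1) (derT (l + 1) p)) := by
    rw [hS8, Finset.sum_comm]
    exact Finset.sum_congr rfl fun k _ => Finset.sum_congr rfl fun l _ => by rw [derT_comm]
  have hQ : ∑ k ∈ range K, (3 + 2 * ((k + 1 : ℕ) : ℂ)) *
      ((-(2 * ρ 1 ^ 2 / (5 * ρ 0 ^ 3)) + 2 * ρ 2 / (7 * ρ 0 ^ 2)) * ρ (k + 1 + 1)
        - 3 * Rcoeff (k + 1 + 2) ρ * ρ 1 / (2 * ρ 0) + 3 * Rcoeff (k + 1 + 3) ρ / 2)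
      * evT ρ (derT (k + 1) (derT 0 p))
      = (-(2 / 5) * a 1 ^ 2 + 2 / 7 * a 2) * S1 - 3 / 2 * a 1 * S5 + 3 / 2 * S9 := by
    rw [hS1, hS5, hS9, Finset.mul_sum, Finset.mul_sum, Finset.mul_sum, ← Finset.sum_sub_distrib,
      ← Finset.sum_add_distrib]
    refine Finset.sum_congr rfl fun k _ => ?_
    rw [hR', hR4, ha 1, ha 2, ha (k + 1 + 1)]
    push_cast
    field_simp
    ring
  have hB : ∑ k ∈ range K, ∑ l ∈ range K, (3 + 2 * ((k + 1 : ℕ) : ℂ)) *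
      (3 + 2 * ((l + 1 : ℕ) : ℂ)) *
      (ρ 1 * ρ (l + 1 + 1) * ρ (k + 1 + 1) / (30 * ρ 0 ^ 3)
        + ρ (k + 1 + 1) * Rcoeff (l + 1 + 2) ρ / (4 * ρ 0)
        + ρ (l + 1 + 1) * Rcoeff (k + 1 + 2) ρ / (4 * ρ 0)
        - Rcoeff (k + 1 + (l + 1) + 3) ρ / 4)
      * evT ρ (derT (k + 1) (derT (l + 1) p))
      = a 1 / 30 * S4 + 1 / 4 * S8 + 1 / 4 * S8 - 1 / 4 * S11 := by
    nth_rw 1 [hS8']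
    rw [hS4, hS8, hS11]
    simp only [Finset.mul_sum, ← Finset.sum_sub_distrib, ← Finset.sum_add_distrib]
    refine Finset.sum_congr rfl fun k _ => Finset.sum_congr rfl fun l _ => ?_
    rw [hR', hR', hR5, ha 1, ha (l + 1 + 1), ha (k + 1 + 1)]
    push_cast
    field_simp
    ring
  have hP : ∑ k ∈ range K, (3 + 2 * ((k + 1 : ℕ) : ℂ)) *
      ((19 * ρ 1 ^ 2 / (60 * ρ 0 ^ 4) - 25 * ρ 2 / (84 * ρ 0 ^ 3)) * ρ (k + 1 + 1)
        + ρ 1 * Rcoeff (k + 1 + 2) ρ / (16 * ρ 0 ^ 2) - Rcoeff (k + 1 + 3) ρ / (16 * ρ 0)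
        - (5 + 2 * ((k + 1 : ℕ) : ℂ)) * ρ 1 * ρ (k + 1 + 2) / (30 * ρ 0 ^ 3)
        - (5 + 2 * ((k + 1 : ℕ) : ℂ)) * Rcoeff (k + 1 + 3) ρ / (2 * ρ 0))
      * evT ρ (derT (k + 1) p)
      = (ρ 0)⁻¹ * ((19 / 60 * a 1 ^ 2 - 25 / 84 * a 2) * S2 + a 1 / 16 * S6 - 1 / 16 * S10
        - a 1 / 30 * S3 - 1 / 2 * S7) := by
    rw [hS2, hS3, hS6, hS7, hS10]
    simp only [Finset.mul_sum, ← Finset.sum_sub_distrib, ← Finset.sum_add_distrib]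
    refine Finset.sum_congr rfl fun k _ => ?_
    rw [hR', hR4, ha 1, ha 2, ha (k + 1 + 1), ha (k + 1 + 2)]
    push_cast
    field_simp
    ring
  rw [sum_nab_nab_eq hK hK0 hN, deltaRho, hf ρ h]
  simp only [hd1, hd2]
  rw [finsum_one_le (K := K) (fun k hk => by rw [hz3 k 0 hk, map_zero, mul_zero]),
    finsum_one_le (K := K) (fun k hk => by simp [hz3 k _ hk]),
    finsum_one_le (K := K) (fun k hk => by rw [hz1 k hk, map_zero, mul_zero])]
  have hin : ∀ k ∈ range K, ∑ᶠ (l : ℕ) (_ : 1 ≤ l), (3 + 2 * ((k + 1 : ℕ) : ℂ)) * (3 + 2 * (l : ℂ)) *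
      (ρ 1 * ρ (l + 1) * ρ (k + 1 + 1) / (30 * ρ 0 ^ 3)
        + ρ (k + 1 + 1) * Rcoeff (l + 2) ρ / (4 * ρ 0) + ρ (l + 1) * Rcoeff (k + 1 + 2) ρ / (4 * ρ 0)
        - Rcoeff (k + 1 + l + 3) ρ / 4)
      * evT ρ (derT (k + 1) (derT l p)) = ∑ l ∈ range K, (3 + 2 * ((k + 1 : ℕ) : ℂ)) *
      (3 + 2 * ((l + 1 : ℕ) : ℂ)) *
      (ρ 1 * ρ (l + 1 + 1) * ρ (k + 1 + 1) / (30 * ρ 0 ^ 3)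
        + ρ (k + 1 + 1) * Rcoeff (l + 1 + 2) ρ / (4 * ρ 0)
        + ρ (l + 1 + 1) * Rcoeff (k + 1 + 2) ρ / (4 * ρ 0)
        - Rcoeff (k + 1 + (l + 1) + 3) ρ / 4)
      * evT ρ (derT (k + 1) (derT (l + 1) p)) := fun k _ =>
    finsum_one_le (K := K) (fun l hl => by rw [hz2 (k + 1) l hl, map_zero, mul_zero])
  rw [Finset.sum_congr rfl hin, hQ, hB, hP, serR_one, serR_two, serR_three]
  simp only [map_add, map_sub, map_mul, map_sum, map_pow, map_ofNat, map_natCast, evT_C, evT_invT,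
    evT_ratT h, map_neg, hay]
  rw [← hS1, ← hS2, ← hS3, ← hS4, ← hS5, ← hS6, ← hS7, ← hS8, ← hS9, ← hS10, ← hS11, ha 1, ha 2,
    ha 3]
  field_simp
  ring

end Kontsevich

/-! ### The exponential of the operator -/

namespace Kontsevich

open MvPolynomial Finset Airy

theorem nab_C_mul (i : ℕ) (c : ℂ) (f : TimeRing) : nab i (C c * f) = C c * nab i f := by
  rw [nab, nab, derivation_C_mul' (creD i)]
  ring

theorem coeff_zero_partSer : PowerSeries.coeff 0 partSer = 1 :=
  (exp_subst_spec (by simp [freeSer])).1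

/-- Each application of the exponent is one step of `partSer_recursion`, which supplies the factor n
+ 1 of the factorial; restoring the coupling costs (2λ)⁴ per step. -/
theorem exponentOp_iterate (lam : ℂ) (n : ℕ) :
    IsTimeFun ((exponentOp lam)^[n] fun _ => 1)
      (C ((n.factorial : ℂ) * (2 * lam) ^ (4 * n)) * PowerSeries.coeff n partSer) := by
  induction n with
  | zero =>
    intro ρ _
    simp [coeff_zero_partSer]
  | succ n ih =>
    intro ρ h
    set p := C ((n.factorial : ℂ) * (2 * lam) ^ (4 * n)) * PowerSeries.coeff n partSer with hp
    obtain ⟨K, hK⟩ := exists_vars_lt p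
    obtain ⟨N₀, hN₀⟩ := partSer_recursion n
    have h1 := evT_sum_nab_nab ih h (K := K + 1) (N := N₀ + (2 * (K + 1) + 6))
      (fun i hi => by have := hK i hi; omega) (by omega) (by omega)
    have h2 := congrArg (evT ρ) (hN₀ (N₀ + (2 * (K + 1) + 6)) (by omega))
    rw [Function.iterate_succ_apply', exponentOp, genusTwo]
    have h3 : ∀ i j, nab i (nab j p) = C ((n.factorial : ℂ) * (2 * lam) ^ (4 * n)) *
        nab i (nab j (PowerSeries.coeff n partSer)) := fun i j => by
      rw [hp, nab_C_mul, nab_C_mul]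
    simp only [h3] at h1
    simp only [← Finset.mul_sum, mul_left_comm (serR _) (C _) _] at h1
    rw [map_mul, map_mul, evT_C] at h2
    rw [map_mul, evT_C] at h1 ⊢
    rw [map_add, map_natCast, map_one] at h2
    have h4 := h1.symm
    rw [Nat.factorial_succ]
    push_cast
    linear_combination (2 * lam) ^ 4 * h4 - ((n.factorial : ℂ) * (2 * lam) ^ (4 * (n + 1))) * h2

/-- The free energies in terms of the Kontsevich times. -/
def freeEnergyFun (lam : ℂ) (g : ℕ) (ρ : ℕ → ℂ) : ℂ :=
  (2 * lam) ^ (4 * (g - 1)) * evT ρ (freeEnergy g)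

/-- The coupling rescales X by (2λ)⁴. Both series have constant term 1 and the same logarithmic
derivative, so they agree by uniqueness for first-order equations. -/
theorem stablePartitionFunction_eq {lam : ℂ} {F : ℕ → (ℕ → ℂ) → ℂ} {ρ : ℕ → ℂ} (h : ρ 0 ≠ 0)
    (hF : ∀ g, 2 ≤ g → F g ρ = freeEnergyFun lam g ρ) :
    stablePartitionFunction F ρ = expOperatorOne lam ρ := by
  set t := (2 * lam) ^ 4 with ht
  set f : PowerSeries ℂ := PowerSeries.mk fun n => if n = 0 then 0 else F (n + 1) ρ with hf
  have hfn : ∀ n, PowerSeries.coeff n f = t ^ n * evT ρ (PowerSeries.coeff n freeSer) := by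
    intro n
    rw [hf, freeSer, PowerSeries.coeff_mk, PowerSeries.coeff_mk]
    split_ifs with hn
    · simp
    · rw [hF _ (by omega), freeEnergyFun, ht, Nat.add_sub_cancel, pow_mul]
  obtain ⟨hW0, hW⟩ := exp_subst_spec (f := f) (by rw [hfn]; simp [freeSer])
  set W : PowerSeries ℂ := PowerSeries.mk fun n => t ^ n * evT ρ (PowerSeries.coeff n partSer) with hWd
  have hW2 : PowerSeries.derivative ℂ W = W * PowerSeries.derivative ℂ f := by
    ext1 n
    have h0 := congrArg (fun s => evT ρ (PowerSeries.coeff n s))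
      (exp_subst_spec (f := freeSer) (by simp [freeSer])).2
    rw [← partSer] at h0
    simp only [PowerSeries.coeff_derivative, PowerSeries.coeff_mul, map_sum, map_mul, map_add,
      map_natCast, map_one] at h0
    rw [PowerSeries.coeff_derivative, PowerSeries.coeff_mul, hWd, PowerSeries.coeff_mk, mul_assoc, h0,
      Finset.mul_sum]
    refine Finset.sum_congr rfl fun q hq => ?_
    rw [Finset.HasAntidiagonal.mem_antidiagonal] at hq
    rw [PowerSeries.coeff_mk, PowerSeries.coeff_derivative, hfn, ← hq]
    ring
  have hG := PowerSeries.eq_zero_of_derivative_eq_mul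
    (G := PowerSeries.subst f (PowerSeries.exp ℂ) - W) (A := PowerSeries.derivative ℂ f)
    (by rw [map_sub, hW, hW2]; ring) (by
      rw [map_sub, hW0, hWd, PowerSeries.coeff_mk, coeff_zero_partSer]; simp)
  rw [stablePartitionFunction, ← hf, sub_eq_zero.1 hG, expOperatorOne, hWd]
  ext1 n
  rw [PowerSeries.coeff_mk, PowerSeries.coeff_mk, exponentOp_iterate lam n ρ h, map_mul, evT_C, ht]
  have : (n.factorial : ℂ) ≠ 0 := Nat.cast_ne_zero.2 n.factorial_ne_zero
  rw [one_div, mul_assoc (n.factorial : ℂ), inv_mul_cancel_left₀ this, ← pow_mul]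

end Kontsevich


/-! ## Integrals over the cut -/

namespace CubicModel

variable {lam : ℂ} (M : CubicModel lam)

/-- The curve that carries the integrals, together with its mirror image. -/
def cut : Set ℂ := {t | ∃ u : ℝ, 1 ≤ u ∧ t ^ 2 = (u : ℂ) ^ 2 + M.c}

/-- The substitution s = u⁻² compactifies [1, ∞) to [0, 1]. The rescaled distance is continuous
there, equals 1 at s = 0, and has no zero at s > 0 by assumption, so its minimum is positive. -/
theorem exists_norm_sq_sub_ge {z : ℂ} (hz : ∀ u : ℝ, 1 ≤ u → z ^ 2 ≠ (u : ℂ) ^ 2 + M.c) :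
    ∃ δ : ℝ, 0 < δ ∧ ∀ u : ℝ, 1 ≤ u → δ * u ^ 2 ≤ ‖z ^ 2 - ((u : ℂ) ^ 2 + M.c)‖ := by
  have hcont : Continuous fun s : ℝ => ‖(s : ℂ) * z ^ 2 - 1 - M.c * s‖ := by fun_prop
  obtain ⟨s₀, hs₀, hmin⟩ := (isCompact_Icc (a := (0 : ℝ)) (b := 1)).exists_isMinOn
    ⟨0, by simp⟩ hcont.continuousOn
  have key : ∀ u : ℝ, 1 ≤ u → ‖(((u ^ 2)⁻¹ : ℝ) : ℂ) * z ^ 2 - 1 - M.c * ((u ^ 2)⁻¹ : ℝ)‖ * u ^ 2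
      = ‖z ^ 2 - ((u : ℂ) ^ 2 + M.c)‖ := by
    intro u hu
    have hu0 : (u : ℂ) ≠ 0 := by exact_mod_cast (by linarith : u ≠ 0)
    have : ‖((u ^ 2 : ℝ) : ℂ)‖ = u ^ 2 := by
      rw [Complex.norm_real, Real.norm_of_nonneg (by positivity)]
    rw [← congrArg (fun r => ‖(((u ^ 2)⁻¹ : ℝ) : ℂ) * z ^ 2 - 1 - M.c * ((u ^ 2)⁻¹ : ℝ)‖ * r) this,
      ← norm_mul]
    congr 1
    push_cast
    field_simp
    ring
  refine ⟨‖(s₀ : ℂ) * z ^ 2 - 1 - M.c * s₀‖, ?_, fun u hu => ?_⟩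
  · rw [norm_pos_iff]
    intro h0
    rcases hs₀.1.eq_or_lt with h | h
    · rw [← h] at h0; simp at h0
    · set u := Real.sqrt (s₀⁻¹) with hu
      have hu1 : 1 ≤ u := by
        rw [hu, Real.one_le_sqrt]
        exact (one_le_inv₀ h).2 hs₀.2
      have hu2 : (u ^ 2)⁻¹ = s₀ := by
        rw [hu, Real.sq_sqrt (by positivity), inv_inv]
      have := key u hu1
      rw [hu2, h0, norm_zero, zero_mul] at this
      exact hz u hu1 (sub_eq_zero.1 (norm_eq_zero.1 this.symm))
  · rw [← key u hu]
    refine mul_le_mul_of_nonneg_right (hmin ?_) (by positivity)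
    exact ⟨by positivity, inv_le_one_of_one_le₀ (by nlinarith)⟩

theorem sq_add_c_ne_zero {u : ℝ} (hu : 1 ≤ u) : (0 : ℂ) ^ 2 ≠ (u : ℂ) ^ 2 + M.c := by
  intro h
  have hc := M.c_mem
  have h1 : 1 + M.c = ((1 - u ^ 2 : ℝ) : ℂ) := by
    push_cast
    linear_combination -h
  rw [h1, Complex.ofReal_mem_slitPlane] at hc
  nlinarith

theorem one_le_e {x : ℝ} (hx : 0 ≤ x) : 1 ≤ 1 + 2 * M.e x := by
  have := M.e_mono (Set.mem_Ici.2 le_rfl) (Set.mem_Ici.2 hx) hx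
  rw [M.e_zero] at this
  linarith

theorem pt_sq (x : ℝ) : M.pt x ^ 2 = ((1 + 2 * M.e x : ℝ) : ℂ) ^ 2 + M.c := by
  rw [pt, one_div, Complex.cpow_ofNat_inv_pow]
  push_cast
  rfl

theorem pt_mem_cut {x : ℝ} (hx : 0 ≤ x) : M.pt x ∈ M.cut := ⟨_, M.one_le_e hx, M.pt_sq x⟩

theorem ne_zero_of_mem_cut {t : ℂ} (ht : t ∈ M.cut) : t ≠ 0 := by
  rintro rfl
  obtain ⟨u, hu, h⟩ := ht
  exact M.sq_add_c_ne_zero hu h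

theorem exists_isCompact (L : ℝ) : ∃ K : Set ℂ, IsCompact K ∧ K ⊆ M.cut ∧
    ∀ x ∈ Set.Icc 0 L, M.pt x ∈ K := by
  have hc : Continuous fun u : ℝ => (u : ℂ) ^ 2 + M.c := by fun_prop
  have hK := (isCompact_Icc (a := (1 : ℝ)) (b := 1 + 2 * M.e L)).image hc
  -- The preimage under squaring contains both square roots, so no continuity of a branch is needed;
  -- it is bounded since its squares are.
  refine ⟨(fun t : ℂ => t ^ 2) ⁻¹' ((fun u : ℝ => (u : ℂ) ^ 2 + M.c) '' Set.Icc 1 (1 + 2 * M.e L)),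
    ?_, ?_, ?_⟩
  · refine Metric.isCompact_of_isClosed_isBounded (hK.isClosed.preimage (by fun_prop)) ?_
    obtain ⟨B, hB⟩ := hK.isBounded.exists_norm_le
    rw [isBounded_iff_forall_norm_le]
    refine ⟨B + 1, fun t ht => ?_⟩
    have := hB _ ht
    rw [norm_pow] at this
    nlinarith [norm_nonneg t, sq_nonneg (‖t‖ - 1)]
  · rintro t ⟨u, hu, h⟩
    exact ⟨u, hu.1, h.symm⟩
  · intro x hx
    refine ⟨1 + 2 * M.e x, ⟨M.one_le_e hx.1, ?_⟩, (M.pt_sq x).symm⟩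
    have := M.e_mono (Set.mem_Ici.2 hx.1) (Set.mem_Ici.2 (hx.1.trans hx.2)) hx.2
    linarith

/-- On [0, L] the integrable function (1+2e)⁻⁴ is bounded below by its value at L, as `e` is
monotone. -/
theorem measure_Icc_lt_top (L : ℝ) : M.r (Set.Icc 0 L) < ⊤ := by
  have h1 : IntegrableOn (fun x => ((1 + 2 * M.e x) ^ 4)⁻¹) (Set.Icc 0 L) M.r :=
    M.integrable.mono_set Set.Icc_subset_Ici_self
  rcases lt_or_ge L 0 with hL | hL
  · rw [Set.Icc_eq_empty (by linarith), measure_empty]; exact ENNReal.zero_lt_top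
  have hpos : ∀ x, 0 ≤ x → 0 < (1 + 2 * M.e x) ^ 4 := fun x hx => by
    have := M.one_le_e hx
    positivity
  have h2 := Integrable.measure_norm_ge_lt_top h1 (ε := ((1 + 2 * M.e L) ^ 4)⁻¹)
    (inv_pos.2 (hpos L hL))
  refine lt_of_le_of_lt ?_ h2
  rw [Measure.restrict_apply' measurableSet_Icc]
  refine measure_mono fun x hx => ⟨?_, hx⟩
  have h3 := M.one_le_e hx.1
  have h4 := M.e_mono (Set.mem_Ici.2 hx.1) (Set.mem_Ici.2 (hx.1.trans hx.2)) hx.2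
  rw [Set.mem_ofPred_eq, norm_inv, Real.norm_of_nonneg (hpos x hx.1).le]
  exact inv_anti₀ (hpos x hx.1) (pow_le_pow_left₀ (by linarith) (by linarith) 4)

theorem aemeasurable_pt (L : ℝ) : AEMeasurable M.pt (M.r.restrict (Set.Icc 0 L)) := by
  have h : AEMeasurable M.e (M.r.restrict (Set.Icc 0 L)) :=
    aemeasurable_restrict_of_monotoneOn measurableSet_Icc
      (M.e_mono.mono Set.Icc_subset_Ici_self)
  unfold pt
  fun_prop

open Classical in
theorem integrableOn {φ : ℂ → ℂ} (hφ : ContinuousOn φ M.cut) (L : ℝ) :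
    IntegrableOn (fun x => φ (M.pt x)) (Set.Icc 0 L) M.r := by
  obtain ⟨K, hK, hKc, hKp⟩ := M.exists_isCompact L
  obtain ⟨B, hB⟩ := hK.exists_bound_of_continuousOn (hφ.mono hKc)
  -- `φ` is controlled on the cut only; replacing it by 0 off the compact set K makes it measurable
  -- without changing the integrand.
  have hm : Measurable (K.piecewise φ 0) :=
    (hφ.mono hKc).measurable_piecewise continuousOn_const hK.measurableSet
  have : IsFiniteMeasure (M.r.restrict (Set.Icc 0 L)) :=
    ⟨by rw [Measure.restrict_apply_univ]; exact M.measure_Icc_lt_top L⟩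
  refine Integrable.of_bound (C := B) ?_ ?_
  · refine ((hm.comp_aemeasurable (M.aemeasurable_pt L)).congr ?_).aestronglyMeasurable
    filter_upwards [ae_restrict_mem measurableSet_Icc] with x hx
    exact Set.piecewise_eq_of_mem _ _ _ (hKp x hx)
  · filter_upwards [ae_restrict_mem measurableSet_Icc] with x hx
    exact hB _ (hKp x hx)

theorem cutIntegral_congr {φ ψ : ℂ → ℂ} (h : Set.EqOn φ ψ M.cut) (L : ℝ) :
    M.cutIntegral L φ = M.cutIntegral L ψ :=
  setIntegral_congr_fun measurableSet_Icc fun x hx => by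
    simp only [h (M.pt_mem_cut hx.1)]

theorem cutIntegral_add {φ ψ : ℂ → ℂ} (hφ : ContinuousOn φ M.cut) (hψ : ContinuousOn ψ M.cut)
    (L : ℝ) : M.cutIntegral L (fun t => φ t + ψ t) = M.cutIntegral L φ + M.cutIntegral L ψ := by
  unfold cutIntegral
  rw [← integral_add ((M.integrableOn hφ L).const_mul _) ((M.integrableOn hψ L).const_mul _)]
  simp only [mul_add]

theorem cutIntegral_const_mul (a : ℂ) (φ : ℂ → ℂ) (L : ℝ) :
    M.cutIntegral L (fun t => a * φ t) = a * M.cutIntegral L φ := by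
  unfold cutIntegral
  rw [← integral_const_mul]
  simp only [mul_left_comm]

theorem cutIntegral_neg (φ : ℂ → ℂ) (L : ℝ) :
    M.cutIntegral L (fun t => -φ t) = -M.cutIntegral L φ := by
  have := M.cutIntegral_const_mul (-1) φ L
  simpa using this

theorem cutIntegral_sub {φ ψ : ℂ → ℂ} (hφ : ContinuousOn φ M.cut) (hψ : ContinuousOn ψ M.cut)
    (L : ℝ) : M.cutIntegral L (fun t => φ t - ψ t) = M.cutIntegral L φ - M.cutIntegral L ψ := by
  simp only [sub_eq_add_neg]
  rw [← cutIntegral_neg]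
  exact M.cutIntegral_add hφ hψ.neg L

theorem cutIntegral_sum {ι : Type*} (s : Finset ι) {φ : ι → ℂ → ℂ}
    (hφ : ∀ i ∈ s, ContinuousOn (φ i) M.cut) (L : ℝ) :
    M.cutIntegral L (fun t => ∑ i ∈ s, φ i t) = ∑ i ∈ s, M.cutIntegral L (φ i) := by
  unfold cutIntegral
  rw [← integral_finsetSum _ fun i hi => (M.integrableOn (hφ i hi) L).const_mul _]
  simp only [Finset.mul_sum]

theorem sum_const_mul_cutIntegral {ι : Type*} (s : Finset ι) (c : ι → ℂ) {φ : ι → ℂ → ℂ}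
    (hφ : ∀ i ∈ s, ContinuousOn (φ i) M.cut) (L : ℝ) :
    ∑ i ∈ s, c i * M.cutIntegral L (φ i) = M.cutIntegral L (fun t => ∑ i ∈ s, c i * φ i t) := by
  simp only [← cutIntegral_const_mul]
  exact (M.cutIntegral_sum s (φ := fun i t => c i * φ i t)
    (fun i hi => continuousOn_const.mul (hφ i hi)) L).symm

/-- A point off the cut and its mirror image. -/
def OffCut (z : ℂ) : Prop := ∀ u : ℝ, 1 ≤ u → z ^ 2 ≠ (u : ℂ) ^ 2 + M.c

variable {M}

theorem OffCut.sq_sub_ne_zero {z t : ℂ} (hz : M.OffCut z) (ht : t ∈ M.cut) : z ^ 2 - t ^ 2 ≠ 0 := by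
  obtain ⟨u, hu, h⟩ := ht
  rw [h]
  exact sub_ne_zero.2 (hz u hu)

theorem OffCut.add_ne_zero {z t : ℂ} (hz : M.OffCut z) (ht : t ∈ M.cut) : z + t ≠ 0 := by
  intro h
  apply hz.sq_sub_ne_zero ht
  linear_combination (z - t) * h

theorem OffCut.neg {z : ℂ} (hz : M.OffCut z) : M.OffCut (-z) := fun u hu => by
  rw [neg_sq]; exact hz u hu

variable (M)

/-- The Kontsevich times at a finite cut-off. -/
def time (L : ℝ) (l : ℕ) : ℂ := (if l = 0 then 1 / M.sqrtZ L else 0)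
    - 1 / 2 * M.cutIntegral L (fun t => 1 / t ^ (3 + 2 * l))

theorem two_lam_planar (hlam : lam ≠ 0) (L : ℝ) (z : ℂ) : 2 * lam * M.planar L z =
    z / M.sqrtZ L - lam * M.nu L + 1 / 2 * M.cutIntegral L (fun t => 1 / ((z + t) * t)) := by
  rw [planar]
  field_simp

/-- The terms with ν cancel, and the integrals in 𝒢₀ and in K̂ combine into the divided difference
of z f(z). In particular only the even function z f(z) matters when f is odd. -/
theorem khat_eq (hlam : lam ≠ 0) (L : ℝ) {f : ℂ → ℂ} (hf : ContinuousOn f M.cut) {z : ℂ}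
    (hz : M.OffCut z) : M.khat L f z = z * f z / M.sqrtZ L +
      1 / 2 * M.cutIntegral L (fun t => (z * f z - t * f t) / (t * (z ^ 2 - t ^ 2))) := by
  have h1 : ContinuousOn (fun t : ℂ => 1 / ((z + t) * t)) M.cut :=
    continuousOn_const.div (by fun_prop) fun t ht =>
      mul_ne_zero (hz.add_ne_zero ht) (M.ne_zero_of_mem_cut ht)
  have h2 : ContinuousOn (fun t : ℂ => (f z - f t) / (z ^ 2 - t ^ 2)) M.cut :=
    (continuousOn_const.sub hf).div (by fun_prop) fun t ht => hz.sq_sub_ne_zero ht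
  rw [khat, two_lam_planar M hlam]
  have h3 : M.cutIntegral L (fun t => (z * f z - t * f t) / (t * (z ^ 2 - t ^ 2)))
      = f z * M.cutIntegral L (fun t => 1 / ((z + t) * t))
        + M.cutIntegral L (fun t => (f z - f t) / (z ^ 2 - t ^ 2)) := by
    rw [← cutIntegral_const_mul, ← M.cutIntegral_add
      (show ContinuousOn (fun t : ℂ => f z * (1 / ((z + t) * t))) M.cut from
        continuousOn_const.mul h1) h2]
    refine M.cutIntegral_congr (fun t ht => ?_) L
    have e1 := M.ne_zero_of_mem_cut ht
    have e2 := hz.add_ne_zero ht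
    have e3 := hz.sq_sub_ne_zero ht
    field_simp
    ring
  rw [h3]
  ring

end CubicModel


/-! ### The operator K̂ on odd Laurent polynomials -/

namespace CubicModel

variable {lam : ℂ} (M : CubicModel lam)

theorem khat_congr (L : ℝ) {f g : ℂ → ℂ} (h : Set.EqOn f g M.cut) {z : ℂ} (hz : f z = g z) :
    M.khat L f z = M.khat L g z := by
  rw [khat, khat, hz]
  congr 2
  exact M.cutIntegral_congr (fun t ht => by simp only [h ht]) L

theorem continuousOn_khat {f : ℂ → ℂ} (hf : ContinuousOn f M.cut) {z : ℂ} (hz : M.OffCut z) :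
    ContinuousOn (fun t : ℂ => (f z - f t) / (z ^ 2 - t ^ 2)) M.cut :=
  (continuousOn_const.sub hf).div (by fun_prop) fun t ht => hz.sq_sub_ne_zero ht

theorem khat_sub (L : ℝ) {f g : ℂ → ℂ} (hf : ContinuousOn f M.cut) (hg : ContinuousOn g M.cut)
    {z : ℂ} (hz : M.OffCut z) :
    M.khat L (fun z => f z - g z) z = M.khat L f z - M.khat L g z := by
  rw [khat, khat, khat]
  have h := M.cutIntegral_sub (M.continuousOn_khat hf hz) (M.continuousOn_khat hg hz) L
  have h2 : M.cutIntegral L (fun t => (f z - g z - (f t - g t)) / (z ^ 2 - t ^ 2))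
      = M.cutIntegral L (fun t => (f z - f t) / (z ^ 2 - t ^ 2) - (g z - g t) / (z ^ 2 - t ^ 2)) := by
    congr 1
    funext t
    ring
  rw [h2, h]
  ring

theorem khat_sum {ι : Type*} (s : Finset ι) (L : ℝ) (c : ι → ℂ) {f : ι → ℂ → ℂ}
    (hf : ∀ i ∈ s, ContinuousOn (f i) M.cut) {z : ℂ} (hz : M.OffCut z) :
    M.khat L (fun z => ∑ i ∈ s, c i * f i z) z = ∑ i ∈ s, c i * M.khat L (f i) z := by
  simp only [khat]
  have h : M.cutIntegral L (fun t => (∑ i ∈ s, c i * f i z - ∑ i ∈ s, c i * f i t) / (z ^ 2 - t ^ 2))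
      = ∑ i ∈ s, c i * M.cutIntegral L (fun t => (f i z - f i t) / (z ^ 2 - t ^ 2)) := by
    rw [M.sum_const_mul_cutIntegral s c fun i hi => M.continuousOn_khat (hf i hi) hz]
    congr 1
    funext t
    rw [← Finset.sum_sub_distrib, Finset.sum_div]
    exact Finset.sum_congr rfl fun i _ => by ring
  rw [h, Finset.mul_sum, Finset.mul_sum, Finset.mul_sum, ← Finset.sum_add_distrib,
    ← Finset.sum_add_distrib]
  exact Finset.sum_congr rfl fun i _ => by ring

theorem continuousOn_inv_pow (n : ℕ) : ContinuousOn (fun t : ℂ => t⁻¹ ^ n) M.cut :=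
  (continuousOn_inv₀.mono fun _ ht => M.ne_zero_of_mem_cut ht).pow n

/-- The operator `K̂` on odd powers of `1/z`. -/
theorem khat_inv_pow (hlam : lam ≠ 0) (L : ℝ) (n : ℕ) {z : ℂ} (hz : M.OffCut z) (hz0 : z ≠ 0) :
    M.khat L (fun z => z⁻¹ ^ (2 * n + 1)) z = (if n = 0 then 1 / M.sqrtZ L else 0)
      + ∑ j ∈ Finset.range n, M.time L j * z⁻¹ ^ (2 * (n - j)) := by
  rw [M.khat_eq hlam L (M.continuousOn_inv_pow _) hz]
  have h1 : ∀ w : ℂ, w ≠ 0 → w * w⁻¹ ^ (2 * n + 1) = (w⁻¹ ^ 2) ^ n := fun w hw => by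
    rw [pow_succ, ← pow_mul]; field_simp
  -- z f(z) is a power of z⁻², so its divided difference is a geometric sum in z⁻² and t⁻², whose
  -- integrals are the Kontsevich times.
  have h2 : M.cutIntegral L (fun t => (z * z⁻¹ ^ (2 * n + 1) - t * t⁻¹ ^ (2 * n + 1))
        / (t * (z ^ 2 - t ^ 2)))
      = ∑ j ∈ Finset.range n, -(z⁻¹ ^ (2 * (n - j))) * M.cutIntegral L (fun t => 1 / t ^ (3 + 2 * j)) := by
    rw [M.sum_const_mul_cutIntegral _ _ (φ := fun j t => 1 / t ^ (3 + 2 * j)) fun j _ =>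
      continuousOn_const.div (by fun_prop) fun t ht => pow_ne_zero _ (M.ne_zero_of_mem_cut ht)]
    refine M.cutIntegral_congr (fun t ht => ?_) L
    have ht0 := M.ne_zero_of_mem_cut ht
    have hzt := hz.sq_sub_ne_zero ht
    rw [h1 z hz0, h1 t ht0, ← Commute.geom_sum₂_mul (Commute.all (z⁻¹ ^ 2) (t⁻¹ ^ 2)) n,
      ← Finset.sum_range_reflect, Finset.sum_mul, Finset.sum_div]
    refine Finset.sum_congr rfl fun j hj => ?_
    rw [Finset.mem_range] at hj
    obtain ⟨m, rfl⟩ : ∃ m, n = j + m + 1 := ⟨n - j - 1, by omega⟩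
    rw [show j + m + 1 - 1 - j = m by omega, show j + m + 1 - 1 - m = j by omega,
      show j + m + 1 - j = m + 1 by omega]
    simp only [inv_pow, ← pow_mul]
    field_simp
    ring
  rw [h2, Finset.mul_sum, h1 z hz0]
  have h3 : ∀ j ∈ Finset.range n, M.time L j * z⁻¹ ^ (2 * (n - j))
      = (if j = 0 then z⁻¹ ^ (2 * n) / M.sqrtZ L else 0)
        + 1 / 2 * (-(z⁻¹ ^ (2 * (n - j))) * M.cutIntegral L (fun t => 1 / t ^ (3 + 2 * j))) := by
    intro j _
    rw [time]
    by_cases hj : j = 0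
    · subst hj; rw [if_pos rfl, if_pos rfl, Nat.sub_zero]; ring
    · rw [if_neg hj, if_neg hj]; ring
  rw [Finset.sum_congr rfl h3, Finset.sum_add_distrib, ← add_assoc]
  congr 1
  rcases n with _ | n
  · simp
  · rw [if_neg (Nat.succ_ne_zero n), zero_add, Finset.sum_ite_eq' (Finset.range (n + 1)) 0
      (fun _ => z⁻¹ ^ (2 * (n + 1)) / M.sqrtZ L), if_pos (by simp), ← pow_mul]

theorem khat_odd (hlam : lam ≠ 0) (L : ℝ) (N : ℕ) (c : ℕ → ℂ) {z : ℂ} (hz : M.OffCut z)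
    (hz0 : z ≠ 0) : M.khat L (fun z => ∑ n ∈ Finset.range N, c n * z⁻¹ ^ (2 * n + 1)) z
      = ∑ n ∈ Finset.range N, c n * ((if n = 0 then 1 / M.sqrtZ L else 0)
        + ∑ j ∈ Finset.range n, M.time L j * z⁻¹ ^ (2 * (n - j))) := by
  rw [M.khat_sum _ L c (fun _ _ => M.continuousOn_inv_pow _) hz]
  exact Finset.sum_congr rfl fun n _ => by rw [M.khat_inv_pow hlam L n hz hz0]

/-- Starting with z⁻³ the factor 1/√Z is absorbed in the time of index 0, so the limit exists
although √Z itself need not converge. -/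
theorem tendsto_khat_odd (hlam : lam ≠ 0) {ρ : ℕ → ℂ} (hρ : M.HasKontsevichTimes ρ) (N : ℕ)
    (c : ℕ → ℂ) {z : ℂ} (hz : M.OffCut z) (hz0 : z ≠ 0) :
    Tendsto (fun L => M.khat L (fun z => ∑ n ∈ Finset.range N, c n * z⁻¹ ^ (2 * n + 3)) z) atTop
      (𝓝 (∑ n ∈ Finset.range N, c n * ∑ j ∈ Finset.range (n + 1), ρ j * z⁻¹ ^ (2 * (n + 1 - j)))) := by
  have h : ∀ L, M.khat L (fun z => ∑ n ∈ Finset.range N, c n * z⁻¹ ^ (2 * n + 3)) z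
      = ∑ n ∈ Finset.range N, c n * ∑ j ∈ Finset.range (n + 1),
        M.time L j * z⁻¹ ^ (2 * (n + 1 - j)) := by
    intro L
    rw [M.khat_sum _ L c (fun _ _ => M.continuousOn_inv_pow _) hz]
    refine Finset.sum_congr rfl fun n _ => ?_
    have := M.khat_inv_pow hlam L (n + 1) hz hz0
    rw [if_neg (Nat.succ_ne_zero n), zero_add] at this
    rw [← this]; rfl
  simp only [h]
  exact tendsto_finsetSum _ fun n _ => tendsto_const_nhds.mul
    (tendsto_finsetSum _ fun j _ => (hρ j).mul tendsto_const_nhds)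

end CubicModel


/-! ### Injectivity of K̂ and oddness near the origin -/

namespace Polynomial

theorem eval_eq_sum_odd {R : Polynomial ℂ} (hR : ∀ n, R.coeff (2 * n) = 0) (u : ℂ) :
    R.eval u = ∑ n ∈ Finset.range (R.natDegree + 1), R.coeff (2 * n + 1) * u ^ (2 * n + 1) := by
  have h : ∀ (g : ℕ → ℂ) (N : ℕ), (∀ n, g (2 * n) = 0) →
      ∑ i ∈ Finset.range (2 * N), g i = ∑ n ∈ Finset.range N, g (2 * n + 1) := by
    intro g N hg
    induction N with
    | zero => simp
    | succ N ih =>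
      rw [show 2 * (N + 1) = 2 * N + 1 + 1 by ring, Finset.sum_range_succ, Finset.sum_range_succ, ih,
        hg, add_zero, Finset.sum_range_succ]
  rw [Polynomial.eval_eq_sum_range' (n := 2 * (R.natDegree + 1)) (by omega)]
  exact h (fun i => R.coeff i * u ^ i) _ fun n => by rw [hR, zero_mul]

theorem coeff_even_eq_zero {R : Polynomial ℂ} (h : R.comp (-X) = -R) (n : ℕ) :
    R.coeff (2 * n) = 0 := by
  have h2 := congrArg (fun p : Polynomial ℂ => p.coeff (2 * n)) h
  rw [show (-X : Polynomial ℂ) = C (-1) * X by simp] at h2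
  simp only [coeff_neg, comp_C_mul_X_coeff] at h2
  rw [pow_mul, neg_one_sq, one_pow, mul_one] at h2
  have : (2 : ℂ) * R.coeff (2 * n) = 0 := by linear_combination h2
  simpa using this

end Polynomial

namespace CubicModel

variable {lam : ℂ} (M : CubicModel lam)

theorem sqrtZ_sq (L : ℝ) : M.sqrtZ L ^ 2 = M.Z L := by
  rw [sqrtZ, one_div, Complex.cpow_ofNat_inv_pow]

theorem sqrtZ_ne_zero (L : ℝ) : M.sqrtZ L ≠ 0 := fun h => M.Z_ne_zero L (by
  rw [← sqrtZ_sq, h]; simp)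

/-- This is where boundedness of Z enters: it excludes that z⁻¹ is annihilated by K̂ in the limit.
-/
theorem eq_zero_of_tendsto_div_sqrtZ {c : ℂ} (h : Tendsto (fun L => c / M.sqrtZ L) atTop (𝓝 0)) :
    c = 0 := by
  obtain ⟨B, hB⟩ := M.Z_bounded
  have h1 : ∀ L, ‖M.sqrtZ L‖ ≤ B + 1 := fun L => by
    have := hB L
    rw [← sqrtZ_sq, norm_pow] at this
    nlinarith [norm_nonneg (M.sqrtZ L), sq_nonneg (‖M.sqrtZ L‖ - 1)]
  have h2 : Tendsto (fun L => ‖c / M.sqrtZ L‖ * (B + 1)) atTop (𝓝 0) := by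
    simpa using h.norm.mul_const (B + 1)
  have h3 : ‖c‖ ≤ 0 := ge_of_tendsto h2 (Eventually.of_forall fun L => by
    have h4 := norm_pos_iff.2 (M.sqrtZ_ne_zero L)
    rw [norm_div, div_mul_eq_mul_div, le_div_iff₀ h4]
    exact mul_le_mul_of_nonneg_left (h1 L) (norm_nonneg _))
  exact norm_le_zero_iff.1 h3

/-- The operator `K̂` is injective on odd Laurent polynomials. -/
theorem eq_zero_of_tendsto_khat (hlam : lam ≠ 0) {ρ : ℕ → ℂ} (hρ : M.HasKontsevichTimes ρ)
    (h0 : ρ 0 ≠ 0) {S : Set ℂ} (hS : S.Infinite) (hS0 : ∀ z ∈ S, z ≠ 0 ∧ M.OffCut z) {N : ℕ}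
    {c : ℕ → ℂ} (h : ∀ z ∈ S, Tendsto
      (fun L => M.khat L (fun z => ∑ n ∈ Finset.range N, c n * z⁻¹ ^ (2 * n + 1)) z) atTop (𝓝 0)) :
    ∀ n < N, c n = 0 := by
  classical
  rcases N with _ | N
  · intro n hn; omega
  -- Only the coefficient of z⁻¹ meets 1/√Z. Its contribution does not depend on z, hence neither
  -- does the limit of the remaining terms, a polynomial in 1/z evaluated at infinitely many points.
  have hlim : ∀ z ∈ S, Tendsto (fun L => c 0 / M.sqrtZ L) atTop
      (𝓝 (-∑ n ∈ Finset.range (N + 1), c n * ∑ j ∈ Finset.range n, ρ j * z⁻¹ ^ (2 * (n - j)))) := by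
    intro z hz
    have h1 : Tendsto (fun L => ∑ n ∈ Finset.range (N + 1), c n * ∑ j ∈ Finset.range n,
        M.time L j * z⁻¹ ^ (2 * (n - j))) atTop
      (𝓝 (∑ n ∈ Finset.range (N + 1), c n * ∑ j ∈ Finset.range n, ρ j * z⁻¹ ^ (2 * (n - j)))) :=
      tendsto_finsetSum _ fun n _ => tendsto_const_nhds.mul
        (tendsto_finsetSum _ fun j _ => (hρ j).mul tendsto_const_nhds)
    have h2 := (h z hz).sub h1
    rw [zero_sub] at h2
    refine h2.congr fun L => ?_
    rw [M.khat_odd hlam L _ c (hS0 z hz).2 (hS0 z hz).1]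
    simp only [mul_add, Finset.sum_add_distrib, add_sub_cancel_right, mul_ite, mul_zero]
    rw [Finset.sum_ite_eq' (Finset.range (N + 1)) 0 (fun n => c n * (1 / M.sqrtZ L)),
      if_pos (by simp)]
    ring
  obtain ⟨z₀, hz₀⟩ := hS.nonempty
  set Q : Polynomial ℂ := ∑ n ∈ Finset.range (N + 1), ∑ j ∈ Finset.range n,
    Polynomial.C (c n * ρ j) * Polynomial.X ^ (2 * (n - j)) with hQ
  have hQe : ∀ u, Q.eval u = ∑ n ∈ Finset.range (N + 1), c n * ∑ j ∈ Finset.range n,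
      ρ j * u ^ (2 * (n - j)) := by
    intro u
    simp only [hQ, Polynomial.eval_finsetSum, Polynomial.eval_mul, Polynomial.eval_C,
      Polynomial.eval_pow, Polynomial.eval_X, Finset.mul_sum, mul_assoc]
  have hQc : Q = Polynomial.C (Q.eval z₀⁻¹) := by
    refine Polynomial.eq_of_infinite_eval_eq _ _ (Set.Infinite.mono ?_
      (hS.image (inv_injective.injOn)))
    rintro _ ⟨z, hz, rfl⟩
    have := tendsto_nhds_unique (hlim z hz) (hlim z₀ hz₀)
    rw [Set.mem_ofPred_eq, Polynomial.eval_C, hQe, hQe]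
    exact neg_injective this
  -- If all higher c_n vanish, the coefficient of z^{-2m} is c_m ρ_0; since the polynomial is
  -- constant, c_m = 0. This is used from the top downwards.
  have hcoef : ∀ m, 1 ≤ m → m < N + 1 → (∀ n, m < n → n < N + 1 → c n = 0) → c m = 0 := by
    intro m hm hmN hn
    have h1 := congrArg (fun p : Polynomial ℂ => p.coeff (2 * m)) hQc
    simp only [Polynomial.coeff_C, if_neg (show ¬2 * m = 0 by omega)] at h1
    rw [hQ, Polynomial.finsetSum_coeff, Finset.sum_eq_single m, Polynomial.finsetSum_coeff,
      Finset.sum_eq_single 0] at h1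
    · rw [Nat.sub_zero, Polynomial.coeff_C_mul_X_pow, if_pos rfl] at h1
      exact (mul_eq_zero.1 h1).resolve_right h0
    · intro j hj hj0
      rw [Finset.mem_range] at hj
      rw [Polynomial.coeff_C_mul_X_pow, if_neg (by omega)]
    · intro hcon
      exact absurd (Finset.mem_range.2 (by omega)) hcon
    · intro n hnN hnm
      rw [Finset.mem_range] at hnN
      rw [Polynomial.finsetSum_coeff]
      refine Finset.sum_eq_zero fun j hj => ?_
      rw [Finset.mem_range] at hj
      rw [Polynomial.coeff_C_mul_X_pow]
      rcases lt_or_gt_of_ne hnm with hlt | hgt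
      · rw [if_neg (by omega)]
      · rw [hn n hgt hnN, zero_mul, ite_self]
    · intro hcon
      exact absurd (Finset.mem_range.2 hmN) hcon
  have hpos : ∀ k m, 1 ≤ m → m < N + 1 → N + 1 ≤ m + k → c m = 0 := by
    intro k
    induction k with
    | zero => intro m _ _ _; omega
    | succ k ih => intro m hm hmN hk; exact hcoef m hm hmN fun n hn hnN => ih n (by omega) hnN (by omega)
  intro n hn
  rcases Nat.eq_zero_or_pos n with rfl | hn0
  · refine M.eq_zero_of_tendsto_div_sqrtZ ?_
    have := hlim z₀ hz₀
    rwa [Finset.sum_eq_zero, neg_zero] at this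
    intro n hn
    rcases Nat.eq_zero_or_pos n with rfl | hn0
    · simp
    · rw [hpos (N + 1) n hn0 (Finset.mem_range.1 hn) (by omega), zero_mul]
  · exact hpos (N + 1) n hn0 hn (by omega)

/-- On the cut |t|² ≥ κ u², and |z² - t²| ≥ (κ/2) u² for small z. As |t| ≥ √κ too, the integrand is
of order u⁻⁴, uniformly in the cut-off by spectral dimension below 8. -/
theorem exists_cutIntegral_bound : ∃ ε C : ℝ, 0 < ε ∧ 0 ≤ C ∧ ∀ z : ℂ, ‖z‖ < ε → M.OffCut z ∧
    ∀ L, ‖M.cutIntegral L (fun t => 1 / (t ^ 3 * (z ^ 2 - t ^ 2)))‖ ≤ C := by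
  obtain ⟨κ, hκ, hκu⟩ := M.exists_norm_sq_sub_ge (z := 0) fun u hu => M.sq_add_c_ne_zero hu
  have hκ' : ∀ u : ℝ, 1 ≤ u → κ * u ^ 2 ≤ ‖(u : ℂ) ^ 2 + M.c‖ := fun u hu => by
    have := hκu u hu
    rwa [zero_pow two_ne_zero, zero_sub, norm_neg] at this
  set I := ∫ x in Set.Ici 0, ((1 + 2 * M.e x) ^ 4)⁻¹ ∂M.r with hI
  have hI0 : 0 ≤ I := setIntegral_nonneg measurableSet_Ici fun x hx => by
    have := M.one_le_e hx
    positivity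
  set C := ‖8 * lam ^ 2‖ * (2 / (κ ^ 2 * Real.sqrt κ)) with hC
  have hz2 : ∀ z : ℂ, ‖z‖ < Real.sqrt (κ / 2) → ∀ u : ℝ, 1 ≤ u →
      κ / 2 * u ^ 2 ≤ ‖z ^ 2 - ((u : ℂ) ^ 2 + M.c)‖ := by
    intro z hz u hu
    have h1 : ‖z‖ ^ 2 ≤ κ / 2 := by
      have := pow_le_pow_left₀ (norm_nonneg z) hz.le 2
      rwa [Real.sq_sqrt (by positivity)] at this
    have h2 := norm_sub_norm_le ((u : ℂ) ^ 2 + M.c) (z ^ 2)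
    rw [norm_sub_rev, norm_pow] at h2
    have := hκ' u hu
    have hu2 : 1 ≤ u ^ 2 := by nlinarith
    have := mul_le_mul_of_nonneg_left hu2 (half_pos hκ).le
    linarith
  refine ⟨Real.sqrt (κ / 2), C * I, Real.sqrt_pos.2 (by positivity), by positivity,
    fun z hz => ⟨fun u hu heq => ?_, fun L => ?_⟩⟩
  · have := hz2 z hz u hu
    rw [heq, sub_self, norm_zero] at this
    have : 0 < κ / 2 * u ^ 2 := by positivity
    linarith
  · rw [cutIntegral]
    refine (norm_integral_le_of_norm_le (g := fun x => C * ((1 + 2 * M.e x) ^ 4)⁻¹)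
      ((M.integrable.mono_set Set.Icc_subset_Ici_self).const_mul C) ?_).trans ?_
    · filter_upwards [ae_restrict_mem measurableSet_Icc] with x hx
      set u := 1 + 2 * M.e x with hu
      have hu1 : 1 ≤ u := M.one_le_e hx.1
      have ht := M.pt_sq x
      rw [← hu] at ht
      have h1 : κ * u ^ 2 ≤ ‖M.pt x‖ ^ 2 := by rw [← norm_pow, ht]; exact hκ' u hu1
      have h2 : κ / 2 * u ^ 2 ≤ ‖z ^ 2 - M.pt x ^ 2‖ := by rw [ht]; exact hz2 z hz u hu1
      have h3 : Real.sqrt κ ≤ ‖M.pt x‖ := by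
        rw [Real.sqrt_le_left (norm_nonneg _)]
        have hu2 : 1 ≤ u ^ 2 := by nlinarith
        have := mul_le_mul_of_nonneg_left hu2 hκ.le
        linarith
      rw [norm_mul (8 * lam ^ 2), norm_div, norm_one, norm_mul (M.pt x ^ 3), norm_pow (M.pt x), hC,
        mul_assoc]
      refine mul_le_mul_of_nonneg_left ?_ (norm_nonneg _)
      have h4 : (κ * u ^ 2 * Real.sqrt κ) * (κ / 2 * u ^ 2) ≤ ‖M.pt x‖ ^ 3 * ‖z ^ 2 - M.pt x ^ 2‖ := by
        rw [pow_succ ‖M.pt x‖ 2]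
        gcongr
      have hpos : 0 < (κ * u ^ 2 * Real.sqrt κ) * (κ / 2 * u ^ 2) := by
        have := Real.sqrt_pos.2 hκ
        positivity
      refine (one_div_le_one_div_of_le hpos h4).trans (le_of_eq ?_)
      have := Real.sqrt_pos.2 hκ
      field_simp
    · rw [integral_const_mul]
      refine mul_le_mul_of_nonneg_left ?_ (by positivity)
      refine setIntegral_mono_set M.integrable ?_ Set.Icc_subset_Ici_self.eventuallyLE
      filter_upwards [ae_restrict_mem measurableSet_Ici] with x hx
      have := M.one_le_e hx
      simp only [Pi.zero_apply]
      positivity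

/-- Functions annihilated by `K̂` are odd near the origin. -/
theorem exists_odd_of_tendsto_khat (hlam : lam ≠ 0) {ρ : ℕ → ℂ} (hρ : M.HasKontsevichTimes ρ)
    (h0 : ρ 0 ≠ 0) : ∃ ε : ℝ, 0 < ε ∧ ∀ z : ℂ, ‖z‖ < ε → z ≠ 0 → M.OffCut z ∧
    ∀ f : ℂ → ℂ, ContinuousOn f M.cut → Tendsto (fun L => M.khat L f z) atTop (𝓝 0) →
      Tendsto (fun L => M.khat L f (-z)) atTop (𝓝 0) → f z + f (-z) = 0 := by
  obtain ⟨ε, C, hε, hC, hb⟩ := M.exists_cutIntegral_bound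
  have hρ0 : 0 < ‖ρ 0‖ := norm_pos_iff.2 h0
  refine ⟨min ε (min 1 (‖ρ 0‖ / (C + 1))), by positivity, fun z hz hz0 => ?_⟩
  obtain ⟨hoff, hbd⟩ := hb z (hz.trans_le (min_le_left _ _))
  refine ⟨hoff, fun f hf h1 h2 => ?_⟩
  by_contra hne
  -- In the difference the unknown f(t) drops out, and 1/(t(z²-t²)) = z²/(t³(z²-t²)) - 1/t³ isolates
  -- the time of index 0. The last factor stays away from zero for small z because its limit is
  -- close to ρ_0.
  have hA : ∀ L, M.khat L f z - M.khat L f (-z) = z * (f z + f (-z)) * (M.time L 0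
      + 1 / 2 * (z ^ 2 * M.cutIntegral L (fun t => 1 / (t ^ 3 * (z ^ 2 - t ^ 2))))) := by
    intro L
    have c1 : ContinuousOn (fun t => (z * f z - t * f t) / (t * (z ^ 2 - t ^ 2))) M.cut :=
      (continuousOn_const.sub (continuousOn_id.mul hf)).div (by fun_prop) fun t ht =>
        mul_ne_zero (M.ne_zero_of_mem_cut ht) (hoff.sq_sub_ne_zero ht)
    have c2 : ContinuousOn (fun t => (-z * f (-z) - t * f t) / (t * ((-z) ^ 2 - t ^ 2))) M.cut :=
      (continuousOn_const.sub (continuousOn_id.mul hf)).div (by fun_prop) fun t ht =>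
        mul_ne_zero (M.ne_zero_of_mem_cut ht) (hoff.neg.sq_sub_ne_zero ht)
    have c3 : ContinuousOn (fun t : ℂ => 1 / t ^ (3 + 2 * 0)) M.cut :=
      continuousOn_const.div (by fun_prop) fun t ht => pow_ne_zero _ (M.ne_zero_of_mem_cut ht)
    have c4 : ContinuousOn (fun t : ℂ => z ^ 2 * (1 / (t ^ 3 * (z ^ 2 - t ^ 2)))) M.cut :=
      continuousOn_const.mul (continuousOn_const.div (by fun_prop) fun t ht =>
        mul_ne_zero (pow_ne_zero _ (M.ne_zero_of_mem_cut ht)) (hoff.sq_sub_ne_zero ht))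
    have e1 : M.cutIntegral L (fun t => (z * f z - t * f t) / (t * (z ^ 2 - t ^ 2)))
        - M.cutIntegral L (fun t => (-z * f (-z) - t * f t) / (t * ((-z) ^ 2 - t ^ 2)))
        = z * (f z + f (-z)) * (M.cutIntegral L (fun t => z ^ 2 * (1 / (t ^ 3 * (z ^ 2 - t ^ 2))))
          - M.cutIntegral L (fun t => 1 / t ^ (3 + 2 * 0))) := by
      rw [← M.cutIntegral_sub c1 c2, ← M.cutIntegral_sub c4 c3, ← cutIntegral_const_mul]
      refine M.cutIntegral_congr (fun t ht => ?_) L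
      have e1 := M.ne_zero_of_mem_cut ht
      have e3 := hoff.sq_sub_ne_zero ht
      rw [neg_sq]
      field_simp
      ring
    rw [M.khat_eq hlam L hf hoff, M.khat_eq hlam L hf hoff.neg, time, if_pos rfl,
      ← M.cutIntegral_const_mul (z ^ 2)]
    linear_combination 1 / 2 * e1
  have hA0 : Tendsto (fun L => M.time L 0
      + 1 / 2 * (z ^ 2 * M.cutIntegral L (fun t => 1 / (t ^ 3 * (z ^ 2 - t ^ 2))))) atTop (𝓝 0) := by
    have h3 := (h1.sub h2).const_mul (z * (f z + f (-z)))⁻¹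
    rw [sub_zero, mul_zero] at h3
    refine h3.congr fun L => ?_
    rw [hA, inv_mul_cancel_left₀ (mul_ne_zero hz0 hne)]
  have h4 : Tendsto (fun L => ‖M.time L 0‖ - ‖M.time L 0
      + 1 / 2 * (z ^ 2 * M.cutIntegral L (fun t => 1 / (t ^ 3 * (z ^ 2 - t ^ 2))))‖) atTop
      (𝓝 (‖ρ 0‖ - ‖(0 : ℂ)‖)) := (hρ 0).norm.sub hA0.norm
  rw [norm_zero, sub_zero] at h4
  have h5 : ‖ρ 0‖ ≤ 1 / 2 * (‖z‖ ^ 2 * C) := le_of_tendsto h4 (Eventually.of_forall fun L => by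
    have h6 := norm_sub_le (M.time L 0
      + 1 / 2 * (z ^ 2 * M.cutIntegral L (fun t => 1 / (t ^ 3 * (z ^ 2 - t ^ 2)))))
      (1 / 2 * (z ^ 2 * M.cutIntegral L (fun t => 1 / (t ^ 3 * (z ^ 2 - t ^ 2)))))
    rw [add_sub_cancel_right] at h6
    have h7 : ‖1 / 2 * (z ^ 2 * M.cutIntegral L (fun t => 1 / (t ^ 3 * (z ^ 2 - t ^ 2))))‖
        ≤ 1 / 2 * (‖z‖ ^ 2 * C) := by
      rw [norm_mul, norm_mul, norm_pow, show ‖(1 / 2 : ℂ)‖ = 1 / 2 by simp]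
      gcongr
      exact hbd L
    linarith)
  have hz1 : ‖z‖ < 1 := hz.trans_le ((min_le_right _ _).trans (min_le_left _ _))
  have hz2 : ‖z‖ < ‖ρ 0‖ / (C + 1) := hz.trans_le ((min_le_right _ _).trans (min_le_right _ _))
  rw [lt_div_iff₀ (by linarith)] at hz2
  have hz3 : ‖z‖ ^ 2 ≤ ‖z‖ := by nlinarith [norm_nonneg z]
  nlinarith [norm_nonneg z, mul_le_mul_of_nonneg_right hz3 hC]

end CubicModel


theorem MvPolynomial.exists_polynomial_eval {σ : Type*} (g : σ → Polynomial ℂ) (P : MvPolynomial σ ℂ) :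
    ∃ R : Polynomial ℂ, ∀ u, R.eval u = MvPolynomial.eval (fun i => (g i).eval u) P := by
  induction P using MvPolynomial.induction_on with
  | C a => exact ⟨Polynomial.C a, fun u => by simp⟩
  | add p q hp hq =>
    obtain ⟨R, hR⟩ := hp
    obtain ⟨S, hS⟩ := hq
    exact ⟨R + S, fun u => by simp [hR, hS]⟩
  | mul_X p i hp =>
    obtain ⟨R, hR⟩ := hp
    exact ⟨R * g i, fun u => by simp [hR]⟩

/-! ### Uniqueness of the planar two-point function -/

namespace CubicModel

variable {lam : ℂ} {M : CubicModel lam}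

/-- Inverses of large real numbers. -/
def InvReal (r : ℝ) (z : ℂ) : Prop := ∃ x : ℝ, r < x ∧ z = (x : ℂ)⁻¹

theorem infinite_invReal (r : ℝ) : {z | InvReal r z}.Infinite := by
  have h : ((fun x : ℝ => (x : ℂ)⁻¹) '' Set.Ioi r).Infinite :=
    (Set.Ioi_infinite r).image fun x _ y _ hxy => Complex.ofReal_injective (inv_injective hxy)
  refine h.mono ?_
  rintro _ ⟨x, hx, rfl⟩
  exact ⟨x, hx, rfl⟩

theorem InvReal.ne_zero {r : ℝ} (hr : 0 < r) {z : ℂ} (hz : InvReal r z) : z ≠ 0 := by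
  obtain ⟨x, hx, rfl⟩ := hz
  exact inv_ne_zero (Complex.ofReal_ne_zero.2 (by linarith))

theorem InvReal.add_ne_zero {r : ℝ} (hr : 0 < r) {z w : ℂ} (hz : InvReal r z) (hw : InvReal r w) :
    z + w ≠ 0 := by
  obtain ⟨x, hx, rfl⟩ := hz
  obtain ⟨y, hy, rfl⟩ := hw
  rw [← Complex.ofReal_inv, ← Complex.ofReal_inv, ← Complex.ofReal_add, Complex.ofReal_ne_zero]
  have h1 : 0 < x⁻¹ := inv_pos.2 (by linarith)
  have h2 : 0 < y⁻¹ := inv_pos.2 (by linarith)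
  linarith

theorem exists_invReal_offCut (M : CubicModel lam) : ∃ r : ℝ, 0 < r ∧ ∀ z, InvReal r z → M.OffCut z := by
  obtain ⟨ε, C, hε, hC, hb⟩ := M.exists_cutIntegral_bound
  refine ⟨ε⁻¹, inv_pos.2 hε, ?_⟩
  rintro _ ⟨x, hx, rfl⟩
  refine (hb _ ?_).1
  have hx0 : 0 < x := (inv_pos.2 hε).trans hx
  rw [norm_inv, Complex.norm_real, Real.norm_of_nonneg hx0.le]
  exact inv_lt_of_inv_lt₀ hε hx

/-- Small positive reals are never opposite to one another and avoid the cut. They provide enough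
points at which equations can be imposed to determine Laurent polynomials. -/
theorem admissible_of_invReal {r : ℝ} (hr : 0 < r) (h : ∀ z, InvReal r z → M.OffCut z)
    {s : Finset ℂ} (hs : ∀ z ∈ s, InvReal r z) : M.Admissible s :=
  ⟨fun z hz => ⟨(hs z hz).ne_zero hr, h z (hs z hz)⟩,
    fun z hz w hw _ => (hs z hz).add_ne_zero hr (hs w hw)⟩

theorem admissible_pair {z w : ℂ} (hz : z ≠ 0) (hw : w ≠ 0) (hz' : M.OffCut z) (hw' : M.OffCut w)
    (h : z + w ≠ 0) : M.Admissible {z, w} := by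
  constructor
  · intro x hx
    rw [Finset.mem_insert, Finset.mem_singleton] at hx
    rcases hx with rfl | rfl
    exacts [⟨hz, hz'⟩, ⟨hw, hw'⟩]
  · intro x hx y hy hxy
    rw [Finset.mem_insert, Finset.mem_singleton] at hx hy
    rcases hx with rfl | rfl <;> rcases hy with rfl | rfl
    · exact absurd rfl hxy
    · exact h
    · rwa [add_comm]
    · exact absurd rfl hxy

namespace IsCorrelationFamily

variable {G G' : ℕ → Multiset ℂ → ℂ}

theorem exists_polynomial_zero_two (hG : M.IsCorrelationFamily G) {w : ℂ} (hw : w ≠ 0) :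
    ∃ (m : ℕ) (q : Polynomial ℂ), ∀ z, z ≠ 0 → z + w ≠ 0 →
      G 0 {z, w} * (z⁻¹ + w⁻¹) ^ m = q.eval z⁻¹ := by
  obtain ⟨m, P, hP⟩ := hG.rational_zero_two
  obtain ⟨q, hq⟩ := P.exists_polynomial_eval ![Polynomial.X, Polynomial.C w⁻¹]
  refine ⟨m, q, fun z hz hzw => ?_⟩
  rw [hP z w hz hw hzw, hq]
  congr 2
  funext i
  fin_cases i <;> simp

theorem inv_add_inv_ne_zero {z w : ℂ} (hz : z ≠ 0) (hw : w ≠ 0) (h : z + w ≠ 0) :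
    z⁻¹ + w⁻¹ ≠ 0 := by
  intro h'
  apply h
  field_simp at h'
  linear_combination h'

theorem continuousOn_zero_two (hG : M.IsCorrelationFamily G) {w : ℂ} (hw : w ≠ 0)
    (hw' : M.OffCut w) : ContinuousOn (fun z => G 0 {z, w}) M.cut := by
  obtain ⟨m, q, hq⟩ := hG.exists_polynomial_zero_two hw
  have hadd : ∀ t ∈ M.cut, t + w ≠ 0 := fun t ht => by
    rw [add_comm]; exact hw'.add_ne_zero ht
  have hinv : ContinuousOn (fun t : ℂ => t⁻¹) M.cut :=
    continuousOn_inv₀.mono fun _ ht => M.ne_zero_of_mem_cut ht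
  have h : ContinuousOn (fun t : ℂ => q.eval t⁻¹ / (t⁻¹ + w⁻¹) ^ m) M.cut :=
    (q.continuous.comp_continuousOn hinv).div ((hinv.add continuousOn_const).pow m) fun t ht =>
      pow_ne_zero _ (inv_add_inv_ne_zero (M.ne_zero_of_mem_cut ht) hw (hadd t ht))
  refine h.congr fun t ht => ?_
  have ht0 := M.ne_zero_of_mem_cut ht
  rw [eq_div_iff (pow_ne_zero _ (inv_add_inv_ne_zero ht0 hw (hadd t ht)))]
  exact hq t ht0 (hadd t ht)

/-- A pole at z = -w is allowed, so injectivity of K̂ on Laurent polynomials does not apply at once.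
The difference of two solutions is odd near the origin, hence a pole at -w would force one at w,
where none is permitted; what remains is an odd Laurent polynomial annihilated by K̂. -/
theorem zero_two_eq_of_offCut (hlam : lam ≠ 0) {ρ : ℕ → ℂ} (hρ : M.HasKontsevichTimes ρ)
    (h0 : ρ 0 ≠ 0) (hG : M.IsCorrelationFamily G) (hG' : M.IsCorrelationFamily G') {w : ℂ}
    (hw : w ≠ 0) (hw' : M.OffCut w) {z : ℂ} (hz : z ≠ 0) (hzw : z + w ≠ 0) :
    G 0 {z, w} = G' 0 {z, w} := by
  obtain ⟨ε, hε, hodd⟩ := M.exists_odd_of_tendsto_khat hlam hρ h0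
  obtain ⟨m, q, hq⟩ := hG.exists_polynomial_zero_two hw
  obtain ⟨m', q', hq'⟩ := hG'.exists_polynomial_zero_two hw
  have hc := hG.continuousOn_zero_two hw hw'
  have hc' := hG'.continuousOn_zero_two hw hw'
  set f : ℂ → ℂ := fun z => G 0 {z, w} - G' 0 {z, w} with hf
  have hfc : ContinuousOn f M.cut := hc.sub hc'
  have hten : ∀ z, z ≠ 0 → M.OffCut z → z ≠ w → z + w ≠ 0 →
      Tendsto (fun L => M.khat L f z) atTop (𝓝 0) := by
    intro z hz0 hz hne hadd
    have := (hG.schwinger_dyson_zero_two z w hne (admissible_pair hz0 hw hz hw' hadd)).sub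
      (hG'.schwinger_dyson_zero_two z w hne (admissible_pair hz0 hw hz hw' hadd))
    rw [sub_zero] at this
    refine this.congr fun L => ?_
    rw [add_sub_add_right_eq_sub]
    exact (M.khat_sub L hc hc' hz).symm
  have hm : ∀ z, z ≠ 0 → z + w ≠ 0 → f z * (z⁻¹ + w⁻¹) ^ (m + m')
      = (q * (Polynomial.X + Polynomial.C w⁻¹) ^ m'
        - q' * (Polynomial.X + Polynomial.C w⁻¹) ^ m).eval z⁻¹ := by
    intro z hz hzw
    simp only [Polynomial.eval_sub, Polynomial.eval_mul, Polynomial.eval_pow, Polynomial.eval_add,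
      Polynomial.eval_X, Polynomial.eval_C]
    rw [← hq z hz hzw, ← hq' z hz hzw, hf, pow_add]
    ring
  set n := m + m' with hn
  set p := q * (Polynomial.X + Polynomial.C w⁻¹) ^ m'
        - q' * (Polynomial.X + Polynomial.C w⁻¹) ^ m with hp
  have hinf : {u : ℂ | ∃ x : ℝ, ε⁻¹ + ‖w⁻¹‖ < x ∧ u = x}.Infinite := by
    have h : ((fun x : ℝ => (x : ℂ)) '' Set.Ioi (ε⁻¹ + ‖w⁻¹‖)).Infinite :=
      (Set.Ioi_infinite _).image Complex.ofReal_injective.injOn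
    refine h.mono ?_
    rintro _ ⟨x, hx, rfl⟩
    exact ⟨x, hx, rfl⟩
  have hgood : ∀ x : ℝ, ε⁻¹ + ‖w⁻¹‖ < x → (x : ℂ)⁻¹ ≠ 0 ∧ ‖(x : ℂ)⁻¹‖ < ε ∧ (x : ℂ)⁻¹ ≠ w ∧
      -(x : ℂ)⁻¹ ≠ w := by
    intro x hx
    have he := inv_pos.2 hε
    have hx0 : 0 < x := by have := norm_nonneg w⁻¹; linarith
    have hnx : ‖(x : ℂ)‖ = x := by rw [Complex.norm_real, Real.norm_of_nonneg hx0.le]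
    refine ⟨inv_ne_zero (Complex.ofReal_ne_zero.2 hx0.ne'), ?_, ?_, ?_⟩
    · rw [norm_inv, hnx]
      exact inv_lt_of_inv_lt₀ hε (by have := norm_nonneg w⁻¹; linarith)
    · rintro rfl
      rw [inv_inv, hnx] at hx
      linarith
    · rintro rfl
      rw [inv_neg, inv_inv, norm_neg, hnx] at hx
      linarith
  -- Oddness cleared of denominators in the variable u = 1/z. The two denominators are coprime, so
  -- (u + 1/w)^n divides p.
  have hid : p * (Polynomial.C w⁻¹ - Polynomial.X) ^ n
      + p.comp (-Polynomial.X) * (Polynomial.X + Polynomial.C w⁻¹) ^ n = 0 := by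
    refine Polynomial.eq_of_infinite_eval_eq _ _ (hinf.mono ?_)
    rintro _ ⟨x, hx, rfl⟩
    obtain ⟨hx0, hxε, hxw, hxw'⟩ := hgood x hx
    obtain ⟨hoff, ho⟩ := hodd _ hxε hx0
    have hadd : (x : ℂ)⁻¹ + w ≠ 0 := fun h => hxw' (neg_eq_of_add_eq_zero_right h)
    have hadd' : -(x : ℂ)⁻¹ + w ≠ 0 := fun h => hxw (by linear_combination -h)
    have h1 := ho f hfc (hten _ hx0 hoff hxw hadd)
      (hten _ (neg_ne_zero.2 hx0) hoff.neg hxw' hadd')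
    have h2 := hm _ hx0 hadd
    have h3 := hm _ (neg_ne_zero.2 hx0) hadd'
    rw [inv_inv] at h2
    rw [inv_neg, inv_inv] at h3
    simp only [Set.mem_ofPred_eq, Polynomial.eval_add, Polynomial.eval_mul, Polynomial.eval_pow,
      Polynomial.eval_sub, Polynomial.eval_X, Polynomial.eval_C, Polynomial.eval_comp,
      Polynomial.eval_neg, Polynomial.eval_zero]
    rw [← h2, ← h3, sub_eq_add_neg (w⁻¹), add_comm (w⁻¹)]
    linear_combination (((x : ℂ) + w⁻¹) ^ n * (-(x : ℂ) + w⁻¹) ^ n) * h1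
  have hcop : IsCoprime ((Polynomial.X + Polynomial.C w⁻¹) ^ n)
      ((Polynomial.C w⁻¹ - Polynomial.X) ^ n) := by
    refine IsCoprime.pow ⟨Polynomial.C (w / 2), Polynomial.C (w / 2), ?_⟩
    have : (Polynomial.C (w / 2) * Polynomial.C w⁻¹ : Polynomial ℂ) = Polynomial.C (1 / 2) := by
      rw [← Polynomial.C_mul]; congr 1; field_simp
    have h2 : (Polynomial.C (1 / 2) + Polynomial.C (1 / 2) : Polynomial ℂ) = 1 := by
      rw [← Polynomial.C_add]; norm_num
    linear_combination 2 * this + h2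
  obtain ⟨R, hR⟩ : (Polynomial.X + Polynomial.C w⁻¹) ^ n ∣ p :=
    hcop.dvd_of_dvd_mul_right ⟨-p.comp (-Polynomial.X), by linear_combination hid⟩
  have hRodd : R.comp (-Polynomial.X) = -R := by
    have e : p.comp (-Polynomial.X) = (Polynomial.C w⁻¹ - Polynomial.X) ^ n * R.comp (-Polynomial.X) := by
      rw [hR, Polynomial.mul_comp, Polynomial.pow_comp, Polynomial.add_comp, Polynomial.X_comp,
        Polynomial.C_comp]
      ring
    have hne1 : (Polynomial.X + Polynomial.C w⁻¹ : Polynomial ℂ) ≠ 0 := Polynomial.X_add_C_ne_zero _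
    have hne2 : (Polynomial.C w⁻¹ - Polynomial.X : Polynomial ℂ) ≠ 0 := by
      rw [← neg_sub]; exact neg_ne_zero.2 (Polynomial.X_sub_C_ne_zero _)
    refine mul_left_cancel₀ (mul_ne_zero (pow_ne_zero n hne1) (pow_ne_zero n hne2)) ?_
    rw [e, hR] at hid
    linear_combination hid
  have hfR : ∀ z, z ≠ 0 → z + w ≠ 0 → f z = R.eval z⁻¹ := by
    intro z hz hzw
    have h1 := hm z hz hzw
    rw [hR, Polynomial.eval_mul, Polynomial.eval_pow, Polynomial.eval_add, Polynomial.eval_X,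
      Polynomial.eval_C, mul_comm] at h1
    exact mul_left_cancel₀ (pow_ne_zero _ (inv_add_inv_ne_zero hz hw hzw)) h1
  have hRc := fun n => Polynomial.coeff_even_eq_zero hRodd n
  have hzero := M.eq_zero_of_tendsto_khat hlam hρ h0
    (S := {z | ∃ x : ℝ, ε⁻¹ + ‖w⁻¹‖ < x ∧ z = (x : ℂ)⁻¹})
    (infinite_invReal _) (by
      rintro _ ⟨x, hx, rfl⟩
      exact ⟨(hgood x hx).1, (hodd _ (hgood x hx).2.1 (hgood x hx).1).1⟩)
    (N := R.natDegree + 1) (c := fun n => R.coeff (2 * n + 1)) (by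
      rintro _ ⟨x, hx, rfl⟩
      obtain ⟨hx0, hxε, hxw, hxw'⟩ := hgood x hx
      have hadd : (x : ℂ)⁻¹ + w ≠ 0 := fun h => hxw' (neg_eq_of_add_eq_zero_right h)
      refine (hten _ hx0 (hodd _ hxε hx0).1 hxw hadd).congr fun L => ?_
      refine M.khat_congr L (fun t ht => ?_) ?_
      · rw [hfR t (M.ne_zero_of_mem_cut ht) (by rw [add_comm]; exact hw'.add_ne_zero ht)]
        exact Polynomial.eval_eq_sum_odd hRc _
      · rw [hfR _ hx0 hadd]
        exact Polynomial.eval_eq_sum_odd hRc _)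
  have hfz := hfR z hz hzw
  rw [Polynomial.eval_eq_sum_odd hRc, Finset.sum_eq_zero fun n hn => by
    rw [hzero n (Finset.mem_range.1 hn), zero_mul]] at hfz
  exact sub_eq_zero.1 hfz

/-- The previous lemma excludes w on the cut; rationality in both variables extends the equality
from a Zariski dense set. -/
theorem zero_two_eq (hlam : lam ≠ 0) {ρ : ℕ → ℂ} (hρ : M.HasKontsevichTimes ρ)
    (h0 : ρ 0 ≠ 0) (hG : M.IsCorrelationFamily G) (hG' : M.IsCorrelationFamily G') {z w : ℂ}
    (hz : z ≠ 0) (hw : w ≠ 0) (hzw : z + w ≠ 0) : G 0 {z, w} = G' 0 {z, w} := by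
  obtain ⟨r, hr, hoff⟩ := M.exists_invReal_offCut
  obtain ⟨m, P, hP⟩ := hG.rational_zero_two
  obtain ⟨m', P', hP'⟩ := hG'.rational_zero_two
  have h : P * (MvPolynomial.X 0 + MvPolynomial.X 1) ^ m'
      = P' * (MvPolynomial.X 0 + MvPolynomial.X 1) ^ m := by
    refine MvPolynomial.funext_set (fun _ => {z | InvReal r z⁻¹}) (fun _ => ?_) fun x hx => ?_
    · refine ((infinite_invReal r).image inv_injective.injOn).mono ?_
      rintro _ ⟨z, hz, rfl⟩
      rw [Set.mem_ofPred_eq, inv_inv]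
      exact hz
    · have hx0 : InvReal r (x 0)⁻¹ := hx 0 (Set.mem_univ _)
      have hx1 : InvReal r (x 1)⁻¹ := hx 1 (Set.mem_univ _)
      have h1 := hP _ _ (hx0.ne_zero hr) (hx1.ne_zero hr) (hx0.add_ne_zero hr hx1)
      have h2 := hP' _ _ (hx0.ne_zero hr) (hx1.ne_zero hr) (hx0.add_ne_zero hr hx1)
      have h3 := zero_two_eq_of_offCut hlam hρ h0 hG hG' (hx1.ne_zero hr) (hoff _ hx1)
        (hx0.ne_zero hr) (hx0.add_ne_zero hr hx1)
      have e : ![(x 0)⁻¹⁻¹, (x 1)⁻¹⁻¹] = x := by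
        funext i; fin_cases i <;> simp
      rw [e, inv_inv, inv_inv] at h1 h2
      simp only [map_mul, map_pow, map_add, MvPolynomial.eval_X]
      rw [← h1, ← h2, h3]
      ring
  have h4 := congrArg (MvPolynomial.eval ![z⁻¹, w⁻¹]) h
  simp only [map_mul, map_pow, map_add, MvPolynomial.eval_X, Matrix.cons_val_zero,
    Matrix.cons_val_one] at h4
  rw [← hP z w hz hw hzw, ← hP' z w hz hw hzw] at h4
  have hne := inv_add_inv_ne_zero hz hw hzw
  refine mul_right_cancel₀ (pow_ne_zero (m + m') hne) ?_
  rw [pow_add]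
  linear_combination h4

end IsCorrelationFamily

end CubicModel


/-! ### Uniqueness of the correlation functions -/

namespace CubicModel

variable {lam : ℂ} {M : CubicModel lam}

theorem exists_eq_univ_map {b : ℕ} {s : Multiset ℂ} (hs : Multiset.card s = b) :
    ∃ z : Fin b → ℂ, s = Finset.univ.val.map z := by
  subst hs
  refine ⟨fun i => s.toList.get (i.cast (by simp)), ?_⟩
  rw [Fin.univ_val_map]
  conv_lhs => rw [← Multiset.coe_toList s]
  congr 1
  refine List.ext_get (by simp) fun n h1 h2 => ?_
  simp

theorem univ_map_eq_cons {n : ℕ} (z : Fin (n + 1) → ℂ) : (Finset.univ.val.map z : Multiset ℂ)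
    = z 0 ::ₘ Finset.univ.val.map fun i : Fin n => z i.succ := by
  rw [Fin.univ_val_map, Fin.univ_val_map, List.ofFn_succ]
  rfl

namespace IsCorrelationFamily

variable {G G' : ℕ → Multiset ℂ → ℂ}

/-- With the other arguments frozen, a stable correlation function is an odd polynomial in 1/z, the
class on which K̂ is injective. -/
theorem exists_polynomial (hG : M.IsCorrelationFamily G) {g : ℕ} {s : Multiset ℂ}
    (hgs : 2 < 2 * g + (Multiset.card s + 1)) (hs : ∀ z ∈ s, z ≠ 0) :
    ∃ R : Polynomial ℂ, (∀ n, R.coeff (2 * n) = 0) ∧ ∀ z, z ≠ 0 → G g (z ::ₘ s) = R.eval z⁻¹ := by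
  obtain ⟨w, hw⟩ := exists_eq_univ_map (s := s) rfl
  obtain ⟨P, hP⟩ := hG.laurent g (Multiset.card s + 1) (by omega) hgs
  obtain ⟨R, hR⟩ := P.exists_polynomial_eval
    (Fin.cons Polynomial.X fun i => Polynomial.C (w i)⁻¹)
  have hRe : ∀ z, z ≠ 0 → G g (z ::ₘ s) = R.eval z⁻¹ := by
    intro z hz
    have h1 := hP (Fin.cons z w) (by
      intro i
      refine Fin.cases ?_ (fun i => ?_) i
      · exact hz
      · rw [Fin.cons_succ]
        refine hs _ ?_
        rw [hw]
        exact Multiset.mem_map_of_mem _ (Finset.mem_univ i))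
    rw [univ_map_eq_cons] at h1
    simp only [Fin.cons_zero, Fin.cons_succ, ← hw] at h1
    rw [h1, hR]
    congr 2
    funext i
    refine Fin.cases ?_ (fun i => ?_) i <;> simp
  refine ⟨R, Polynomial.coeff_even_eq_zero ?_, hRe⟩
  refine Polynomial.eq_of_infinite_eval_eq _ _ ((infinite_invReal 1).mono fun u hu => ?_)
  have hu0 := inv_ne_zero (hu.ne_zero one_pos)
  have h1 := hG.odd g u⁻¹ s hgs hu0 hs
  rw [hRe _ hu0, hRe _ (neg_ne_zero.2 hu0), inv_neg, inv_inv] at h1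
  simpa [Polynomial.eval_comp] using h1

theorem continuousOn (hG : M.IsCorrelationFamily G) {g : ℕ} {s : Multiset ℂ}
    (hgs : 2 < 2 * g + (Multiset.card s + 1)) (hs : ∀ z ∈ s, z ≠ 0) :
    ContinuousOn (fun z => G g (z ::ₘ s)) M.cut := by
  obtain ⟨R, -, hR⟩ := hG.exists_polynomial hgs hs
  have h : ContinuousOn (fun t : ℂ => R.eval t⁻¹) M.cut :=
    R.continuous.comp_continuousOn (continuousOn_inv₀.mono fun _ ht => M.ne_zero_of_mem_cut ht)
  exact h.congr fun t ht => hR t (M.ne_zero_of_mem_cut ht)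

/-- The equation determines the correlation functions with a first argument by the remaining terms
of the equation. -/
theorem cons_eq_of_forall_lt (hlam : lam ≠ 0) {ρ : ℕ → ℂ} (hρ : M.HasKontsevichTimes ρ)
    (h0 : ρ 0 ≠ 0) (hG : M.IsCorrelationFamily G) (hG' : M.IsCorrelationFamily G') {g : ℕ}
    {J : Finset ℂ} (hgJ : 2 < 2 * g + (J.card + 1)) {r : ℝ} (hr : 0 < r)
    (hoff : ∀ z, InvReal r z → M.OffCut z) (hJ : ∀ z ∈ J, InvReal r z)
    (hE : ∀ (h : ℕ) (s : Multiset ℂ), (∀ z ∈ s, z ≠ 0) → 1 ≤ Multiset.card s →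
      2 * h + Multiset.card s < 2 * g + (J.card + 1) →
      2 < 2 * h + Multiset.card s ∨ (h = 0 ∧ Multiset.card s = 2 ∧ s.sum ≠ 0) → G h s = G' h s)
    {z : ℂ} (hz : z ≠ 0) : G g (z ::ₘ J.val) = G' g (z ::ₘ J.val) := by
  have hJ0 : ∀ w ∈ J, w ≠ 0 := fun w hw => (hJ w hw).ne_zero hr
  have hJ0' : ∀ w ∈ J.val, w ≠ 0 := hJ0
  obtain ⟨R, hRc, hR⟩ := hG.exists_polynomial (s := J.val) hgJ hJ0'
  obtain ⟨R', hRc', hR'⟩ := hG'.exists_polynomial (s := J.val) hgJ hJ0'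
  have hc := hG.continuousOn (s := J.val) hgJ hJ0'
  have hc' := hG'.continuousOn (s := J.val) hgJ hJ0'
  have hcs : ∀ n, (R - R').coeff (2 * n) = 0 := fun n => by
    rw [Polynomial.coeff_sub, hRc, hRc', sub_zero]
  have hten : ∀ z, InvReal r z → z ∉ J → Tendsto
      (fun L => M.khat L (fun z => G g (z ::ₘ J.val) - G' g (z ::ₘ J.val)) z) atTop (𝓝 0) := by
    intro z hz hzJ
    have hz0 := hz.ne_zero hr
    have hins : ∀ w ∈ insert z J, InvReal r w := fun w hw => by
      rcases Finset.mem_insert.1 hw with rfl | hw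
      exacts [hz, hJ w hw]
    have hadm := admissible_of_invReal hr hoff hins
    have h1 := hG.schwinger_dyson g z J hgJ hzJ hadm
    have h2 := hG'.schwinger_dyson g z J hgJ hzJ hadm
    have hpair : ∀ w ∈ J, z + w ≠ 0 := fun w hw => hz.add_ne_zero hr (hJ w hw)
    have hsub : ∀ (h : ℕ) (I : Finset ℂ), I ⊆ J → 2 * h + (I.card + 1) < 2 * g + (J.card + 1) →
        ¬(h = 0 ∧ I = ∅) → G h (z ::ₘ I.val) = G' h (z ::ₘ I.val) := by
      intro h I hI hlt hne
      refine hE h _ ?_ ?_ ?_ ?_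
      · intro w hw
        rcases Multiset.mem_cons.1 hw with rfl | hw
        exacts [hz0, hJ0 w (hI hw)]
      · rw [Multiset.card_cons]; omega
      · rw [Multiset.card_cons]; exact hlt
      · rw [Multiset.card_cons]
        by_cases hI1 : h = 0 ∧ I.card = 1
        · right
          obtain ⟨w, rfl⟩ := Finset.card_eq_one.1 hI1.2
          refine ⟨hI1.1, by rw [Finset.card_val, hI1.2], ?_⟩
          simpa using hpair w (hI (Finset.mem_singleton_self w))
        · left
          have : ¬(h = 0 ∧ I.card = 0) := fun hh => hne ⟨hh.1, Finset.card_eq_zero.1 hh.2⟩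
          rw [Finset.card_val]
          omega
    have e1 : (if g = 0 then 0 else G (g - 1) (z ::ₘ z ::ₘ J.val))
        = if g = 0 then 0 else G' (g - 1) (z ::ₘ z ::ₘ J.val) := by
      split_ifs with hg
      · rfl
      · refine hE _ _ ?_ ?_ ?_ ?_
        · intro w hw
          rcases Multiset.mem_cons.1 hw with rfl | hw
          · exact hz0
          · rcases Multiset.mem_cons.1 hw with rfl | hw
            exacts [hz0, hJ0 w hw]
        · simp
        · simp only [Multiset.card_cons, Finset.card_val]; omega
        · simp only [Multiset.card_cons, Finset.card_val]
          by_cases hgJ1 : g = 1 ∧ J.card = 0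
          · right
            obtain rfl := Finset.card_eq_zero.1 hgJ1.2
            refine ⟨by omega, by simp, ?_⟩
            simpa using hz.add_ne_zero hr hz
          · left; omega
    have e2 : (∑ h ∈ Finset.range (g + 1), ∑ I ∈ J.powerset,
          if (h = 0 ∧ I = ∅) ∨ (h = g ∧ I = J) then 0
          else G h (z ::ₘ I.val) * G (g - h) (z ::ₘ (J \ I).val))
        = ∑ h ∈ Finset.range (g + 1), ∑ I ∈ J.powerset,
          if (h = 0 ∧ I = ∅) ∨ (h = g ∧ I = J) then 0
          else G' h (z ::ₘ I.val) * G' (g - h) (z ::ₘ (J \ I).val) := by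
      refine Finset.sum_congr rfl fun h hh => Finset.sum_congr rfl fun I hI => ?_
      rw [Finset.mem_range] at hh
      rw [Finset.mem_powerset] at hI
      split_ifs with hex
      · rfl
      · rw [not_or] at hex
        have hcard := Finset.card_sdiff_add_card_eq_card hI
        have hle := Finset.card_le_card hI
        have h3 : ¬(h = g ∧ I.card = J.card) := fun hc =>
          hex.2 ⟨hc.1, Finset.eq_of_subset_of_card_le hI hc.2.ge⟩
        have h4 : ¬(h = 0 ∧ I.card = 0) := fun hc => hex.1 ⟨hc.1, Finset.card_eq_zero.1 hc.2⟩
        rw [hsub h I hI (by omega) hex.1, hsub (g - h) (J \ I) Finset.sdiff_subset (by omega) ?_]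
        rintro ⟨ha, hb⟩
        rw [hb, Finset.card_empty] at hcard
        omega
    have e3 : (∑ ζ ∈ J, 1 / ζ *
          deriv (fun w => (G g (z ::ₘ (J.erase ζ).val) - G g (w ::ₘ (J.erase ζ).val))
            / (z ^ 2 - w ^ 2)) ζ)
        = ∑ ζ ∈ J, 1 / ζ *
          deriv (fun w => (G' g (z ::ₘ (J.erase ζ).val) - G' g (w ::ₘ (J.erase ζ).val))
            / (z ^ 2 - w ^ 2)) ζ := by
      refine Finset.sum_congr rfl fun ζ hζ => ?_
      congr 1
      have hcard := Finset.card_erase_add_one hζ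
      -- The derivative at ζ needs equality on a neighbourhood. The two-point functions agree only
      -- where the sum of the arguments is nonzero, which is an open condition.
      have hev : ∀ᶠ w in 𝓝 ζ, w ≠ 0 ∧ ∀ v ∈ J.erase ζ, w + v ≠ 0 := by
        refine (eventually_ne_nhds (hJ0 ζ hζ)).and ?_
        rw [Filter.eventually_all_finset]
        intro v hv
        have : ζ + v ≠ 0 := (hJ ζ hζ).add_ne_zero hr (hJ v (Finset.mem_of_mem_erase hv))
        exact (continuous_id.add continuous_const).continuousAt.eventually_ne this
      have hw : ∀ w, w ≠ 0 → (∀ v ∈ J.erase ζ, w + v ≠ 0) →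
          G g (w ::ₘ (J.erase ζ).val) = G' g (w ::ₘ (J.erase ζ).val) := by
        intro w hw0 hwv
        refine hE _ _ ?_ ?_ ?_ ?_
        · intro v hv
          rcases Multiset.mem_cons.1 hv with rfl | hv
          exacts [hw0, hJ0 v (Finset.mem_of_mem_erase hv)]
        · simp
        · simp only [Multiset.card_cons, Finset.card_val]; omega
        · simp only [Multiset.card_cons, Finset.card_val]
          by_cases hg1 : g = 0 ∧ (J.erase ζ).card = 1
          · right
            obtain ⟨v, hv⟩ := Finset.card_eq_one.1 hg1.2
            rw [hv]
            refine ⟨hg1.1, by simp, ?_⟩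
            simpa using hwv v (by rw [hv]; exact Finset.mem_singleton_self v)
          · left; omega
      refine Filter.EventuallyEq.deriv_eq ?_
      filter_upwards [hev] with w hw'
      rw [hw w hw'.1 hw'.2, hw z hz0 fun v hv => hpair v (Finset.mem_of_mem_erase hv)]
    rw [e1, e2, e3] at h1
    have h3 := h1.sub h2
    rw [sub_zero] at h3
    refine h3.congr fun L => ?_
    rw [add_sub_add_right_eq_sub, add_sub_add_right_eq_sub, add_sub_add_right_eq_sub]
    exact (M.khat_sub L hc hc' (hoff z hz)).symm
  have hzero := M.eq_zero_of_tendsto_khat hlam hρ h0 (S := {z | InvReal r z} \ J)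
    ((infinite_invReal r).sdiff J.finite_toSet) (fun z hz => ⟨hz.1.ne_zero hr, hoff z hz.1⟩)
    (N := (R - R').natDegree + 1) (c := fun n => (R - R').coeff (2 * n + 1)) (by
      rintro z ⟨hz, hzJ⟩
      refine (hten z hz hzJ).congr fun L => ?_
      refine M.khat_congr L (fun t ht => ?_) ?_
      · rw [hR t (M.ne_zero_of_mem_cut ht), hR' t (M.ne_zero_of_mem_cut ht), ← Polynomial.eval_sub]
        exact Polynomial.eval_eq_sum_odd hcs _
      · rw [hR z (hz.ne_zero hr), hR' z (hz.ne_zero hr), ← Polynomial.eval_sub]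
        exact Polynomial.eval_eq_sum_odd hcs _)
  have hfz := Polynomial.eval_eq_sum_odd hcs z⁻¹
  rw [Finset.sum_eq_zero fun n hn => by
    rw [hzero n (Finset.mem_range.1 hn), zero_mul], Polynomial.eval_sub, ← hR z hz, ← hR' z hz] at hfz
  exact sub_eq_zero.1 hfz

/-- The correlation functions are unique. -/
theorem unique (hlam : lam ≠ 0) {ρ : ℕ → ℂ} (hρ : M.HasKontsevichTimes ρ)
    (h0 : ρ 0 ≠ 0) (hG : M.IsCorrelationFamily G) (hG' : M.IsCorrelationFamily G') (g : ℕ)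
    (s : Multiset ℂ) (hs : ∀ z ∈ s, z ≠ 0) (hs1 : 1 ≤ Multiset.card s)
    (hgs : 2 < 2 * g + Multiset.card s) : G g s = G' g s := by
  obtain ⟨r, hr, hoff⟩ := M.exists_invReal_offCut
  suffices h : ∀ n g s, 2 * g + Multiset.card s = n → (∀ z ∈ s, z ≠ 0) → 1 ≤ Multiset.card s →
      2 < 2 * g + Multiset.card s → G g s = G' g s from h _ g s rfl hs hs1 hgs
  intro n
  induction n using Nat.strong_induction_on with
  | _ n ih =>
    intro g s hn hs hs1 hgs
    obtain ⟨b, hb⟩ : ∃ b, Multiset.card s = b + 1 := ⟨Multiset.card s - 1, by omega⟩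
    have key : ∀ (z : ℂ) (J : Finset ℂ), z ≠ 0 → J.card = b → (∀ w ∈ J, InvReal r w) →
        G g (z ::ₘ J.val) = G' g (z ::ₘ J.val) := by
      intro z J hz hJc hJ
      refine cons_eq_of_forall_lt hlam hρ h0 hG hG' (by omega) hr hoff hJ ?_ hz
      rintro h t ht ht1 hlt (h2 | ⟨rfl, h2, hsum⟩)
      · exact ih _ (by omega) h t rfl ht ht1 h2
      · obtain ⟨x, y, rfl⟩ := Multiset.card_eq_two.1 h2
        exact zero_two_eq hlam hρ h0 hG hG' (ht x (by simp)) (ht y (by simp)) (by simpa using hsum)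
    obtain ⟨P, hP⟩ := hG.laurent g (b + 1) (by omega) (by omega)
    obtain ⟨P', hP'⟩ := hG'.laurent g (b + 1) (by omega) (by omega)
    have hPP : P = P' := by
      -- The i-th inverse argument is taken from the residue class of i modulo b + 1, up to a common
      -- shift. Each class is infinite and different coordinates never coincide, so the arguments
      -- form a `Finset` as the equations require.
      refine MvPolynomial.funext_set
        (fun i => {x : ℂ | ∃ k : ℕ, x = ((r + 1 + ((b + 1) * k + i : ℕ) : ℝ) : ℂ)}) (fun i => ?_)
        fun x hx => ?_
      · have hinj : Function.Injective fun k : ℕ => ((r + 1 + ((b + 1) * k + i : ℕ) : ℝ) : ℂ) := by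
          intro k l hkl
          have h1 := Complex.ofReal_injective hkl
          have h2 : (((b + 1) * k + i : ℕ) : ℝ) = (((b + 1) * l + i : ℕ) : ℝ) := by linarith
          have h3 : (b + 1) * k + (i : ℕ) = (b + 1) * l + i := by exact_mod_cast h2
          exact Nat.eq_of_mul_eq_mul_left (Nat.succ_pos b) (Nat.add_right_cancel h3)
        refine (Set.infinite_range_of_injective hinj).mono ?_
        rintro _ ⟨k, rfl⟩
        exact ⟨k, rfl⟩
      · have hx1 : ∀ i, ∃ k : ℕ, x i = ((r + 1 + ((b + 1) * k + i : ℕ) : ℝ) : ℂ) := fun i =>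
          hx i (Set.mem_univ i)
        have hxI : ∀ i, InvReal r (x i)⁻¹ := fun i => by
          obtain ⟨k, hk⟩ := hx1 i
          refine ⟨_, ?_, by rw [hk]⟩
          have : (0 : ℝ) ≤ (((b + 1) * k + i : ℕ) : ℝ) := Nat.cast_nonneg _
          linarith
        have hxinj : Function.Injective fun i => (x i)⁻¹ := by
          intro i j hij
          obtain ⟨k, hk⟩ := hx1 i
          obtain ⟨l, hl⟩ := hx1 j
          have h1 : x i = x j := inv_injective hij
          rw [hk, hl] at h1
          have h1 := Complex.ofReal_injective h1
          have h2 : (((b + 1) * k + i : ℕ) : ℝ) = (((b + 1) * l + j : ℕ) : ℝ) := by linarith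
          have h3 : (b + 1) * k + (i : ℕ) = (b + 1) * l + j := by exact_mod_cast h2
          have h4 := congrArg (· % (b + 1)) h3
          simp only [Nat.mul_add_mod, Nat.mod_eq_of_lt i.is_lt, Nat.mod_eq_of_lt j.is_lt] at h4
          exact Fin.ext h4
        have h1 := hP (fun i => (x i)⁻¹) fun i => (hxI i).ne_zero hr
        have h2 := hP' (fun i => (x i)⁻¹) fun i => (hxI i).ne_zero hr
        simp only [inv_inv] at h1 h2
        rw [← h1, ← h2, univ_map_eq_cons]
        exact key _ (Finset.univ.map ⟨fun i : Fin b => (x i.succ)⁻¹,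
          hxinj.comp (Fin.succ_injective b)⟩) ((hxI 0).ne_zero hr) (by simp) (by
            intro w hw
            obtain ⟨i, -, rfl⟩ := Finset.mem_map.1 hw
            exact hxI i.succ)
    obtain ⟨z, rfl⟩ := exists_eq_univ_map hb
    have hz : ∀ i, z i ≠ 0 := fun i => hs _ (Multiset.mem_map_of_mem _ (Finset.mem_univ i))
    rw [hP z hz, hP' z hz, hPP]

end IsCorrelationFamily

end CubicModel


namespace Airy

open MvPolynomial Finset

/-! ## Change of rings -/

section Map

variable {R S : Type*} [CommRing R] [CommRing S] (φ : R →+* S)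

theorem map_derivation {D : Derivation R (MvPolynomial ℕ R) (MvPolynomial ℕ R)}
    {E : Derivation S (MvPolynomial ℕ S) (MvPolynomial ℕ S)}
    (h : ∀ i, MvPolynomial.map φ (D (X i)) = E (X i)) (f : MvPolynomial ℕ R) :
    MvPolynomial.map φ (D f) = E (MvPolynomial.map φ f) := by
  induction f using MvPolynomial.induction_on with
  | C r =>
    rw [show D (C r) = 0 from derivation_C _ _, map_C, show E (C (φ r)) = 0 from derivation_C _ _,
      map_zero]
  | add p q hp hq => simp only [map_add, hp, hq]
  | mul_X p i hp =>
    rw [Derivation.leibniz, map_mul, Derivation.leibniz, map_X, ← hp, ← h]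
    simp [map_X]

theorem map_shiftD (i : ℕ) (f : MvPolynomial ℕ R) :
    MvPolynomial.map φ (shiftD i f) = shiftD i (MvPolynomial.map φ f) :=
  map_derivation φ (fun k => by rw [shiftD_X, shiftD_X]; split_ifs <;> simp) f

theorem map_opK (a : ℕ → R) (n : ℕ) (f : MvPolynomial ℕ R) :
    MvPolynomial.map φ (opK a n f) = opK (fun k => φ (a k)) n (MvPolynomial.map φ f) :=
  map_derivation φ (fun k => by rw [opK_X, opK_X]; split_ifs <;> simp) f

theorem map_opM (n : ℕ) (f : MvPolynomial ℕ R) :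
    MvPolynomial.map φ (opM n f) = opM n (MvPolynomial.map φ f) :=
  map_derivation φ (fun k => by rw [opM_X, opM_X]; split_ifs <;> simp [map_X]) f

theorem IsVirasoroSolution.map {a : ℕ → R} {y c : R} {F : ℕ → MvPolynomial ℕ R}
    (hF : IsVirasoroSolution a y c F) :
    IsVirasoroSolution (fun k => φ (a k)) (φ y) (φ c) fun k => MvPolynomial.map φ (F k) := by
  intro k n
  have h := congrArg (MvPolynomial.map φ) (hF k n)
  have hin : MvPolynomial.map φ (inhom c n) = inhom (φ c) n := by
    rcases n with _ | _ | n <;> simp [inhom, map_X]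
  simp only [map_add, map_mul, map_sum, map_opK, map_opM, map_shiftD, map_C, map_ofNat, map_zero,
    apply_ite (MvPolynomial.map φ), hin] at h
  exact h

theorem HasDeg.map {r : ℤ} {f : MvPolynomial ℕ R} (hf : HasDeg r f) :
    HasDeg r (MvPolynomial.map φ f) := by
  intro m hm
  rw [coeff_map] at hm
  exact hf m fun h => hm (by rw [h, map_zero])

end Map

/-! ## The insertion of an argument -/

/-- The derivation `∑_k z^(-3-2k) ∂/∂x_k`. -/
def ins (z : ℂ) : Derivation ℂ (MvPolynomial ℕ ℂ) (MvPolynomial ℕ ℂ) :=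
  mkDerivation ℂ fun k => C (z⁻¹ ^ (2 * k + 3))

theorem ins_X (z : ℂ) (k : ℕ) : ins z (X k) = C (z⁻¹ ^ (2 * k + 3)) := mkDerivation_X _ _ _

theorem ins_comm (z w : ℂ) (f : MvPolynomial ℕ ℂ) : ins z (ins w f) = ins w (ins z f) :=
  bracket_zero_of_X (fun k => by simp only [ins_X]; simp) f

theorem ins_pderiv (z : ℂ) (k : ℕ) (f : MvPolynomial ℕ ℂ) :
    ins z (pderiv k f) = pderiv k (ins z f) :=
  bracket_zero_of_X (fun j => by
    simp only [ins_X, pderiv_X, Pi.single_apply]; split_ifs <;> simp) f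

theorem ins_eq_sum {f : MvPolynomial ℕ ℂ} {N : ℕ} (hN : ∀ i ∈ f.vars, i < N) (z : ℂ) :
    ins z f = ∑ k ∈ range N, C (z⁻¹ ^ (2 * k + 3)) * pderiv k f := by
  rw [derivation_eq_sum (ins z) f hN]
  simp only [ins_X]

theorem ins_neg (z : ℂ) (f : MvPolynomial ℕ ℂ) : ins (-z) f = -ins z f := by
  obtain ⟨N, hN⟩ := exists_vars_lt f
  rw [ins_eq_sum hN, ins_eq_sum hN, ← Finset.sum_neg_distrib]
  refine Finset.sum_congr rfl fun k _ => ?_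
  rw [inv_neg, Odd.neg_pow ⟨k + 1, by ring⟩, C_neg, neg_mul]

instance : LeftCommutative fun (z : ℂ) (f : MvPolynomial ℕ ℂ) => ins z f := ⟨ins_comm⟩

/-- The insertion of several arguments. -/
def insM (s : Multiset ℂ) (f : MvPolynomial ℕ ℂ) : MvPolynomial ℕ ℂ :=
  s.foldr (fun z f => ins z f) f

@[simp] theorem insM_zero (f : MvPolynomial ℕ ℂ) : insM 0 f = f := Multiset.foldr_zero _ _

@[simp] theorem insM_cons (z : ℂ) (s : Multiset ℂ) (f : MvPolynomial ℕ ℂ) :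
    insM (z ::ₘ s) f = ins z (insM s f) := Multiset.foldr_cons _ _ _ _

theorem insM_ins (z : ℂ) (s : Multiset ℂ) (f : MvPolynomial ℕ ℂ) :
    insM s (ins z f) = ins z (insM s f) := by
  induction s using Multiset.induction_on with
  | empty => simp
  | cons w s ih => rw [insM_cons, insM_cons, ih, ins_comm]

theorem insM_add (s : Multiset ℂ) (f h : MvPolynomial ℕ ℂ) :
    insM s (f + h) = insM s f + insM s h := by
  induction s using Multiset.induction_on with
  | empty => simp
  | cons w s ih => rw [insM_cons, insM_cons, insM_cons, ih, map_add]

@[simp] theorem insM_map_zero (s : Multiset ℂ) : insM s 0 = 0 := by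
  induction s using Multiset.induction_on with
  | empty => simp
  | cons w s ih => rw [insM_cons, ih, map_zero]

theorem insM_C_mul (s : Multiset ℂ) (r : ℂ) (f : MvPolynomial ℕ ℂ) :
    insM s (C r * f) = C r * insM s f := by
  induction s using Multiset.induction_on with
  | empty => simp
  | cons w s ih => rw [insM_cons, insM_cons, ih, derivation_C_mul']

theorem insM_sum {ι : Type*} (s : Multiset ℂ) (t : Finset ι) (f : ι → MvPolynomial ℕ ℂ) :
    insM s (∑ i ∈ t, f i) = ∑ i ∈ t, insM s (f i) := by
  classical
  induction t using Finset.induction_on with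
  | empty => simp
  | insert i t hi ih => rw [Finset.sum_insert hi, Finset.sum_insert hi, insM_add, ih]

theorem HasDeg.insM {r : ℤ} {f : MvPolynomial ℕ ℂ} (hf : HasDeg r f) (s : Multiset ℂ) :
    HasDeg (r - Multiset.card s) (Airy.insM s f) := by
  induction s using Multiset.induction_on with
  | empty => simpa using hf
  | cons w s ih =>
    rw [insM_cons, Multiset.card_cons]
    have := ih.derivation (s := 0) (ins w) fun i => by rw [ins_X]; exact HasDeg.C _
    rwa [show r - Multiset.card s + 0 - 1 = r - ((Multiset.card s + 1 : ℕ) : ℤ) by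
      push_cast; ring] at this

/-- The Leibniz rule for several derivations; it produces the sum over the splittings of the
arguments in the Schwinger-Dyson equations. -/
theorem insM_mul (J : Finset ℂ) (f h : MvPolynomial ℕ ℂ) :
    insM J.val (f * h) = ∑ I ∈ J.powerset, insM I.val f * insM (J \ I).val h := by
  classical
  induction J using Finset.induction_on generalizing f h with
  | empty => simp
  | insert z J hz ih =>
    rw [Finset.insert_val_of_notMem hz, insM_cons, ih, map_sum, Finset.sum_powerset_insert hz,
      ← Finset.sum_add_distrib]
    refine Finset.sum_congr rfl fun I hI => ?_
    rw [Finset.mem_powerset] at hI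
    have hzI : z ∉ I := fun h => hz (hI h)
    have hzI' : z ∉ J \ I := fun h => hz (Finset.mem_sdiff.1 h).1
    rw [Finset.insert_sdiff_of_notMem _ hzI, Finset.insert_val_of_notMem hzI',
      Finset.insert_val_of_notMem hzI, insM_cons, insM_cons, Finset.insert_sdiff_insert,
      Finset.sdiff_insert_of_notMem hz, Derivation.leibniz, smul_eq_mul, smul_eq_mul]
    ring

theorem insM_laurent (b : ℕ) (f : MvPolynomial ℕ ℂ) : ∃ P : MvPolynomial (Fin b) ℂ,
    ∀ z : Fin b → ℂ, constantCoeff (insM (Finset.univ.val.map z) f)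
      = MvPolynomial.eval (fun i => (z i)⁻¹) P := by
  induction b generalizing f with
  | zero => exact ⟨C (constantCoeff f), fun z => by simp⟩
  | succ b ih =>
    obtain ⟨N, hN⟩ := exists_vars_lt f
    choose P hP using fun k => ih (pderiv k f)
    refine ⟨∑ k ∈ range N, X 0 ^ (2 * k + 3) * rename Fin.succ (P k), fun z => ?_⟩
    rw [CubicModel.univ_map_eq_cons, insM_cons, ← insM_ins, ins_eq_sum hN, insM_sum, map_sum,
      map_sum]
    refine Finset.sum_congr rfl fun k _ => ?_
    rw [insM_C_mul, map_mul, constantCoeff_C, hP, map_mul, map_pow, eval_X, eval_rename]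
    rfl

/-! ## The insertion of an argument as a generating series -/

theorem ins_eq_sum_shiftD {f : MvPolynomial ℕ ℂ} {N : ℕ} (hN : ∀ i ∈ f.vars, i < N) (z : ℂ) :
    ins z f = ∑ i ∈ range (N + 1), C (z⁻¹ ^ (2 * i + 1)) * shiftD i f := by
  rw [ins_eq_sum hN, Finset.sum_range_succ', shiftD_zero, mul_zero, add_zero]
  rfl

theorem shiftD_eq_zero_of_lt {f : MvPolynomial ℕ ℂ} {N : ℕ} (hN : ∀ i ∈ f.vars, i < N) {i : ℕ}
    (hi : N + 1 ≤ i) : shiftD i f = 0 := by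
  obtain ⟨j, rfl⟩ : ∃ j, i = j + 1 := ⟨i - 1, by omega⟩
  exact pderiv_eq_zero_of_vars_lt hN (by omega)

/-- The product of the insertions is the generating function of the quadratic terms of the
constraints: the index m goes with z^{-2m-2}. -/
theorem ins_mul_ins_eq_sum {f h : MvPolynomial ℕ ℂ} {N K : ℕ} (hf : ∀ i ∈ f.vars, i < N)
    (hh : ∀ i ∈ h.vars, i < N) (hK : 2 * (N + 1) ≤ K) (z : ℂ) :
    ins z f * ins z h = ∑ m ∈ range K, C (z⁻¹ ^ (2 * m + 2)) *
      ∑ p ∈ antidiagonal m, shiftD p.1 f * shiftD p.2 h := by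
  rw [Kontsevich.sum_range_antidiagonal (fun m => C (z⁻¹ ^ (2 * m + 2)))
    (fun i j => shiftD i f * shiftD j h) (fun i j hij => by
      rcases hij with hi | hj
      · rw [shiftD_eq_zero_of_lt hf hi, zero_mul]
      · rw [shiftD_eq_zero_of_lt hh hj, mul_zero]) hK,
    ins_eq_sum_shiftD hf, ins_eq_sum_shiftD hh, Finset.sum_mul_sum]
  refine Finset.sum_congr rfl fun i _ => Finset.sum_congr rfl fun j _ => ?_
  rw [show z⁻¹ ^ (2 * (i + j) + 2) = z⁻¹ ^ (2 * i + 1) * z⁻¹ ^ (2 * j + 1) by ring, C_mul]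
  ring

theorem ins_ins_eq_sum {f : MvPolynomial ℕ ℂ} {N K : ℕ} (hf : ∀ i ∈ f.vars, i < N)
    (hK : 2 * (N + 1) ≤ K) (z : ℂ) :
    ins z (ins z f) = ∑ m ∈ range K, C (z⁻¹ ^ (2 * m + 2)) *
      ∑ p ∈ antidiagonal m, shiftD p.1 (shiftD p.2 f) := by
  rw [Kontsevich.sum_range_antidiagonal (fun m => C (z⁻¹ ^ (2 * m + 2)))
    (fun i j => shiftD i (shiftD j f)) (fun i j hij => by
      rcases hij with hi | hj
      · rw [shiftD_comm, shiftD_eq_zero_of_lt hf hi, map_zero]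
      · rw [shiftD_eq_zero_of_lt hf hj, map_zero]) hK]
  have h2 : ∀ j, ins z (shiftD j f) = ∑ i ∈ range (N + 1), C (z⁻¹ ^ (2 * i + 1)) *
      shiftD i (shiftD j f) := by
    intro j
    rcases j with _ | j
    · simp
    · have := congrArg (pderiv j) (ins_eq_sum_shiftD hf z)
      rw [shiftD_succ, ins_pderiv, this, map_sum]
      refine Finset.sum_congr rfl fun i _ => ?_
      rw [pderiv_C_mul, ← shiftD_succ j, ← shiftD_succ j, shiftD_comm]
  rw [ins_eq_sum_shiftD hf z, map_sum, Finset.sum_comm]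
  refine Finset.sum_congr rfl fun j _ => ?_
  rw [derivation_C_mul', h2, Finset.mul_sum]
  refine Finset.sum_congr rfl fun i _ => ?_
  rw [show z⁻¹ ^ (2 * (i + j) + 2) = z⁻¹ ^ (2 * i + 1) * z⁻¹ ^ (2 * j + 1) by ring, C_mul]
  ring

end Airy


namespace Airy

open MvPolynomial Finset

/-! ## The Virasoro constraints as loop equations -/

/-- The generating derivation `∑_m z^(-2-2m) opM m`. -/
def opMz (z : ℂ) : Derivation ℂ (MvPolynomial ℕ ℂ) (MvPolynomial ℕ ℂ) :=
  mkDerivation ℂ fun i => ∑ m ∈ range (i + 2), C (z⁻¹ ^ (2 * m + 2)) *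
    ((2 * ((i + 1 - m : ℕ) : MvPolynomial ℕ ℂ) + 1) * X (i + 1 - m))

/-- The derivation that `opMz z` becomes when it meets an insertion at `w`. -/
def insK (z w : ℂ) : Derivation ℂ (MvPolynomial ℕ ℂ) (MvPolynomial ℕ ℂ) :=
  mkDerivation ℂ fun i => C (∑ m ∈ range (i + 2), z⁻¹ ^ (2 * m + 2) *
    ((2 * ((i + 1 - m : ℕ) : ℂ) + 1) * w⁻¹ ^ (2 * (i + 1 - m) + 3)))

theorem opMz_X (z : ℂ) (i : ℕ) : opMz z (X i) = ∑ m ∈ range (i + 2), C (z⁻¹ ^ (2 * m + 2)) *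
    ((2 * ((i + 1 - m : ℕ) : MvPolynomial ℕ ℂ) + 1) * X (i + 1 - m)) := mkDerivation_X _ _ _

theorem insK_X (z w : ℂ) (i : ℕ) : insK z w (X i) = C (∑ m ∈ range (i + 2), z⁻¹ ^ (2 * m + 2) *
    ((2 * ((i + 1 - m : ℕ) : ℂ) + 1) * w⁻¹ ^ (2 * (i + 1 - m) + 3))) := mkDerivation_X _ _ _

theorem sum_opM {f : MvPolynomial ℕ ℂ} {N K : ℕ} (hf : ∀ i ∈ f.vars, i < N) (hK : N + 1 ≤ K)
    (z : ℂ) : ∑ m ∈ range K, C (z⁻¹ ^ (2 * m + 2)) * opM m f = opMz z f := by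
  have h : (∑ m ∈ range K, (C (z⁻¹ ^ (2 * m + 2)) : MvPolynomial ℕ ℂ) •
      (opM m : Derivation ℂ (MvPolynomial ℕ ℂ) (MvPolynomial ℕ ℂ))) f = opMz z f := by
    apply derivation_eq_of_forall_mem_vars
    intro i hi
    rw [derivation_sum_apply, opMz_X]
    rw [← Finset.sum_subset (Finset.range_mono (show i + 2 ≤ K by have := hf i hi; omega))]
    · refine Finset.sum_congr rfl fun m hm => ?_
      rw [Finset.mem_range] at hm
      rw [Derivation.smul_apply, opM_X, if_pos (by omega), smul_eq_mul]
    · intro m _ hm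
      rw [Finset.mem_range] at hm
      rw [Derivation.smul_apply, opM_X, if_neg (by omega), smul_zero]
  rw [← h, derivation_sum_apply]
  rfl

theorem ins_opMz (z w : ℂ) (f : MvPolynomial ℕ ℂ) :
    ins w (opMz z f) = opMz z (ins w f) + insK z w f := by
  rw [← sub_eq_iff_eq_add']
  refine bracket_of_X (fun i => ?_) f
  rw [opMz_X, insK_X, ins_X, map_sum, map_sum,
    show opMz z (C (w⁻¹ ^ (2 * i + 3))) = 0 from derivation_C _ _, sub_zero]
  refine Finset.sum_congr rfl fun m _ => ?_
  have h : (2 * ((i + 1 - m : ℕ) : MvPolynomial ℕ ℂ) + 1) = C (2 * ((i + 1 - m : ℕ) : ℂ) + 1) := by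
    rw [C_add, C_mul, C_1, map_natCast, map_ofNat]
  rw [derivation_C_mul', h, derivation_C_mul', ins_X, C_mul, C_mul]

theorem ins_insK (z w v : ℂ) (f : MvPolynomial ℕ ℂ) :
    ins v (insK z w f) = insK z w (ins v f) :=
  bracket_zero_of_X (fun i => by
    rw [insK_X, ins_X]
    exact (derivation_C _ _).trans (derivation_C _ _).symm) f

/-- `opMz z` has linear coefficients, so a bracket with one insertion has constant coefficients and
commutes with all the others: each argument meets it at most once. -/
theorem insM_opMz (z : ℂ) (J : Finset ℂ) (f : MvPolynomial ℕ ℂ) :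
    insM J.val (opMz z f) = opMz z (insM J.val f)
      + ∑ w ∈ J, insK z w (insM (J.erase w).val f) := by
  induction J using Finset.induction_on with
  | empty => simp
  | insert v J hv ih =>
    have e : ∑ w ∈ insert v J, insK z w (insM ((insert v J).erase w).val f)
        = insK z v (insM J.val f) + ∑ w ∈ J, ins v (insK z w (insM (J.erase w).val f)) := by
      rw [Finset.sum_insert hv, Finset.erase_insert hv]
      refine congrArg (insK z v (insM J.val f) + ·) (Finset.sum_congr rfl fun w hw => ?_)
      have hvw : v ≠ w := fun h => hv (h ▸ hw)
      rw [Finset.erase_insert_of_ne hvw, Finset.insert_val_of_notMem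
        (fun h => hv (Finset.mem_of_mem_erase h)), insM_cons, ins_insK]
    rw [e, Finset.insert_val_of_notMem hv, insM_cons v J.val (opMz z f), insM_cons v J.val f, ih,
      (ins v).map_add, ins_opMz, map_sum, add_assoc]

theorem constantCoeff_derivation {D : Derivation ℂ (MvPolynomial ℕ ℂ) (MvPolynomial ℕ ℂ)}
    {f : MvPolynomial ℕ ℂ} {N : ℕ} (hf : ∀ i ∈ f.vars, i < N) :
    constantCoeff (D f) = ∑ i ∈ range N, constantCoeff (D (X i)) * constantCoeff (pderiv i f) := by
  rw [derivation_eq_sum D f hf, map_sum]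
  exact Finset.sum_congr rfl fun i _ => map_mul _ _ _

theorem constantCoeff_opMz (z : ℂ) (f : MvPolynomial ℕ ℂ) : constantCoeff (opMz z f) = 0 := by
  obtain ⟨N, hN⟩ := exists_vars_lt f
  rw [constantCoeff_derivation hN]
  refine Finset.sum_eq_zero fun i _ => ?_
  rw [opMz_X, map_sum, Finset.sum_eq_zero, zero_mul]
  intro m _
  simp

/-- The Virasoro constraints summed to a generating series. -/
theorem IsVirasoroSolution.sum_opK {a : ℕ → ℂ} {y : ℂ} {F : ℕ → MvPolynomial ℕ ℂ}
    (hF : IsVirasoroSolution a y (1 / 8) F) (k : ℕ) (z : ℂ) :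
    ∃ K₀, ∀ K, K₀ ≤ K → ∑ m ∈ range K, C (z⁻¹ ^ (2 * m + 2)) * opK a m (F (k + 1))
      + C y * (opMz z (F k) + C (1 / 2) * (ins z (ins z (F k))
        + ∑ q ∈ antidiagonal k, ins z (F q.1) * ins z (F q.2))
        + if k = 0 then C (1 / 2 * z⁻¹ ^ 2) * X 0 ^ 2 + C (1 / 8 * z⁻¹ ^ 4) else 0) = 0 := by
  obtain ⟨N, hN⟩ : ∃ N : ℕ, ∀ j ≤ k, ∀ i ∈ (F j).vars, i < N := by
    choose N hN using fun j => exists_vars_lt (F j)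
    refine ⟨(range (k + 1)).sup N, fun j hj i hi => (hN j i hi).trans_le ?_⟩
    exact Finset.le_sup (f := N) (Finset.mem_range.2 (by omega))
  refine ⟨2 * (N + 1), fun K hK => ?_⟩
  have h4 : (4 * C (1 / 8) : MvPolynomial ℕ ℂ) = C (1 / 2) := by
    rw [← C_four_mul]; norm_num
  have hinh : (if k = 0 then C (1 / 2 * z⁻¹ ^ 2) * X 0 ^ 2 + C (1 / 8 * z⁻¹ ^ 4) else 0 :
      MvPolynomial ℕ ℂ) = ∑ m ∈ range K, C (z⁻¹ ^ (2 * m + 2)) * if k = 0 then inhom (1 / 8) m else 0 := by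
    split_ifs with hk
    · obtain ⟨K', rfl⟩ : ∃ K', K = K' + 2 := ⟨K - 2, by omega⟩
      rw [Finset.sum_range_succ', Finset.sum_range_succ', Finset.sum_eq_zero]
      · rw [inhom, inhom, h4, C_mul, C_mul]
        ring
      · intro m _
        rw [show inhom (1 / 8 : ℂ) (m + 1 + 1) = 0 from rfl, mul_zero]
    · simp
  have hq : (∑ q ∈ antidiagonal k, ins z (F q.1) * ins z (F q.2))
      = ∑ m ∈ range K, C (z⁻¹ ^ (2 * m + 2)) * ∑ p ∈ antidiagonal m, ∑ q ∈ antidiagonal k,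
        shiftD p.1 (F q.1) * shiftD p.2 (F q.2) := by
    simp only [Finset.sum_comm (s := antidiagonal _) (t := antidiagonal k), Finset.mul_sum (s := antidiagonal k)]
    rw [Finset.sum_comm]
    refine Finset.sum_congr rfl fun q hq => ?_
    rw [Finset.HasAntidiagonal.mem_antidiagonal] at hq
    exact ins_mul_ins_eq_sum (hN _ (by omega)) (hN _ (by omega)) hK z
  rw [hinh, hq, ins_ins_eq_sum (hN k le_rfl) hK, ← sum_opM (hN k le_rfl) (by omega : N + 1 ≤ K),
    ← Finset.sum_add_distrib, Finset.mul_sum, ← Finset.sum_add_distrib, ← Finset.sum_add_distrib,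
    Finset.mul_sum, ← Finset.sum_add_distrib]
  refine Finset.sum_eq_zero fun m _ => ?_
  have h := hF k m
  rw [h4, Finset.sum_add_distrib] at h
  linear_combination C (z⁻¹ ^ (2 * m + 2)) * h

/-- The correlation functions of a solution of the Virasoro constraints. -/
def corF (F : ℕ → MvPolynomial ℕ ℂ) (g : ℕ) (s : Multiset ℂ) : ℂ :=
  constantCoeff (insM s (F (2 * g + Multiset.card s - 2)))

/-- Passes from levels to genera by q = 2h + b - 2. The parity conditions remove the other levels,
and A 0 = B 0 = 0 takes care of the unstable cases, in which the subtraction is truncated. -/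
theorem sum_antidiagonal_genus {A B : ℕ → ℂ} {g i j k : ℕ} (hk : k + 2 = 2 * g + i + j)
    (hA0 : A 0 = 0) (hB0 : B 0 = 0) (hA : ∀ q, A q ≠ 0 → ∃ h : ℕ, q + 1 = 2 * h + i)
    (hB : ∀ q, B q ≠ 0 → ∃ h : ℕ, q + 1 = 2 * h + j) :
    ∑ q ∈ antidiagonal k, A q.1 * B q.2
      = ∑ h ∈ range (g + 1), A (2 * h + (i + 1) - 2) * B (2 * (g - h) + (j + 1) - 2) := by
  symm
  refine Finset.sum_bij_ne_zero (fun h _ _ => (2 * h + (i + 1) - 2, 2 * (g - h) + (j + 1) - 2)) ?_ ?_ ?_ ?_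
  · intro h hh hne
    rw [Finset.mem_range] at hh
    rw [Finset.HasAntidiagonal.mem_antidiagonal]
    have h1 : 2 * h + (i + 1) - 2 ≠ 0 := fun e => hne (by rw [e, hA0, zero_mul])
    have h2 : 2 * (g - h) + (j + 1) - 2 ≠ 0 := fun e => hne (by rw [e, hB0, mul_zero])
    simp only
    omega
  · intro h hh hne h' hh' hne' e
    rw [Finset.mem_range] at hh hh'
    have h1 : 2 * h + (i + 1) - 2 ≠ 0 := fun e => hne (by rw [e, hA0, zero_mul])
    have h1' : 2 * h' + (i + 1) - 2 ≠ 0 := fun e => hne' (by rw [e, hA0, zero_mul])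
    have := (Prod.mk.inj e).1
    omega
  · intro q hq hne
    rw [Finset.HasAntidiagonal.mem_antidiagonal] at hq
    obtain ⟨h, hh⟩ := hA q.1 (left_ne_zero_of_mul hne)
    obtain ⟨h', hh'⟩ := hB q.2 (right_ne_zero_of_mul hne)
    have e1 : 2 * h + (i + 1) - 2 = q.1 := by omega
    have e2 : 2 * (g - h) + (j + 1) - 2 = q.2 := by omega
    refine ⟨h, Finset.mem_range.2 (by omega), by rw [e1, e2]; exact hne, ?_⟩
    rw [e1, e2]
  · intro h _ _
    rfl

theorem HasDeg.exists_genus {k : ℕ} {f : MvPolynomial ℕ ℂ} (hf : HasDeg (k + 2) f) {s : Multiset ℂ}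
    {i : ℕ} (hs : Multiset.card s = i + 1) (h : constantCoeff (Airy.insM s f) ≠ 0) :
    ∃ h : ℕ, k + 1 = 2 * h + i := by
  by_contra hne
  push Not at hne
  refine h ((hf.insM s).constantCoeff_eq_zero fun n hn => hne n ?_)
  rw [hs] at hn
  push_cast at hn
  omega

/-- The loop equation for the constant coefficients. -/
theorem IsVirasoroSolution.loop {a : ℕ → ℂ} {y : ℂ} {F : ℕ → MvPolynomial ℕ ℂ}
    (hF : IsVirasoroSolution a y (1 / 8) F) (hF0 : F 0 = 0) (hd : ∀ k : ℕ, HasDeg (k + 2) (F k))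
    {g k : ℕ} (z : ℂ) (J : Finset ℂ) (hk : k + 2 = 2 * g + J.card) :
    ∃ K₀, ∀ K, K₀ ≤ K →
      ∑ m ∈ range K, z⁻¹ ^ (2 * m + 2) * constantCoeff (insM J.val (opK a m (F (k + 1))))
      + y * (∑ w ∈ J, constantCoeff (insK z w (insM (J.erase w).val (F k)))
        + 1 / 2 * ((if g = 0 then 0 else corF F (g - 1) (z ::ₘ z ::ₘ J.val))
        + ∑ h ∈ range (g + 1), ∑ I ∈ J.powerset,
          corF F h (z ::ₘ I.val) * corF F (g - h) (z ::ₘ (J \ I).val))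
        + if k = 0 then 1 / 2 * z⁻¹ ^ 2 * constantCoeff (insM J.val (X 0 ^ 2))
          + constantCoeff (insM J.val (C (1 / 8 * z⁻¹ ^ 4))) else 0) = 0 := by
  obtain ⟨K₀, hK₀⟩ := hF.sum_opK k z
  refine ⟨K₀, fun K hK => ?_⟩
  have h := hK₀ K hK
  have h1 : constantCoeff (insM J.val (ins z (ins z (F k))))
      = if g = 0 then 0 else corF F (g - 1) (z ::ₘ z ::ₘ J.val) := by
    rw [insM_ins, insM_ins, ← insM_cons, ← insM_cons]
    split_ifs with hg
    · refine ((hd k).insM _).constantCoeff_eq_zero fun n hn => ?_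
      rw [Multiset.card_cons, Multiset.card_cons, Finset.card_val] at hn
      subst hg
      push_cast at hn
      omega
    · rw [corF, Multiset.card_cons, Multiset.card_cons, Finset.card_val,
        show 2 * (g - 1) + (J.card + 1 + 1) - 2 = k by omega]
  have h2 : constantCoeff (insM J.val (∑ q ∈ antidiagonal k, ins z (F q.1) * ins z (F q.2)))
      = ∑ h ∈ range (g + 1), ∑ I ∈ J.powerset,
          corF F h (z ::ₘ I.val) * corF F (g - h) (z ::ₘ (J \ I).val) := by
    rw [insM_sum, map_sum]
    simp only [insM_mul, map_sum, map_mul]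
    rw [Finset.sum_comm, Finset.sum_comm (s := range (g + 1))]
    refine Finset.sum_congr rfl fun I hI => ?_
    rw [Finset.mem_powerset] at hI
    have hc := Finset.card_sdiff_add_card_eq_card hI
    rw [sum_antidiagonal_genus (A := fun q => constantCoeff (insM I.val (ins z (F q))))
      (B := fun q => constantCoeff (insM (J \ I).val (ins z (F q)))) (g := g) (i := I.card)
      (j := (J \ I).card) (by omega) (by simp [hF0]) (by simp [hF0]) (fun q hq => by
        rw [insM_ins, ← insM_cons] at hq
        exact (hd q).exists_genus (by rw [Multiset.card_cons, Finset.card_val]) hq) (fun q hq => by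
        rw [insM_ins, ← insM_cons] at hq
        exact (hd q).exists_genus (by rw [Multiset.card_cons, Finset.card_val]) hq)]
    refine Finset.sum_congr rfl fun h _ => ?_
    rw [insM_ins, insM_ins, ← insM_cons, ← insM_cons, corF, corF, Multiset.card_cons,
      Multiset.card_cons, Finset.card_val, Finset.card_val]
  have h3 : constantCoeff (insM J.val (if k = 0 then C (1 / 2 * z⁻¹ ^ 2) * X 0 ^ 2
      + C (1 / 8 * z⁻¹ ^ 4) else 0)) = if k = 0 then 1 / 2 * z⁻¹ ^ 2 * constantCoeff
        (insM J.val (X 0 ^ 2)) + constantCoeff (insM J.val (C (1 / 8 * z⁻¹ ^ 4))) else 0 := by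
    split_ifs
    · rw [insM_add, insM_C_mul, map_add, map_mul, constantCoeff_C]
    · simp
  rw [← h3]
  generalize (if k = 0 then C (1 / 2 * z⁻¹ ^ 2) * X 0 ^ 2 + C (1 / 8 * z⁻¹ ^ 4) else 0 :
    MvPolynomial ℕ ℂ) = Y at h ⊢
  replace h := congrArg (fun f => constantCoeff (insM J.val f)) h
  simp only [insM_add, insM_C_mul, insM_sum J.val (range K), map_add, map_mul, map_sum (s := range K), constantCoeff_C,
    insM_map_zero, map_zero] at h
  rw [h1, h2, insM_opMz, map_add, constantCoeff_opMz, zero_add, map_sum] at h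
  exact h

end Airy


namespace Airy

open MvPolynomial Finset

/-! ## The planar two-point function and the derivative terms -/

/-- An arithmetic-geometric sum; the induction uses that passing from n to n + 1 multiplies the sum
by p and adds one term. -/
theorem sq_sub_mul_sum_odd {R : Type*} [CommRing R] (p q : R) (n : ℕ) :
    (q - p) ^ 2 * ∑ m ∈ range (n + 1), p ^ m * ((2 * ((n - m : ℕ) : R) + 1) * q ^ (n - m))
      = (2 * n + 1) * q ^ (n + 1) * (q - p) - 2 * p * q ^ (n + 1) + p ^ (n + 1) * (q + p) := by
  induction n with
  | zero => simp; ring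
  | succ n ih =>
    rw [Finset.sum_range_succ']
    simp only [Nat.add_sub_add_right, Nat.sub_zero]
    have : ∑ m ∈ range (n + 1), p ^ (m + 1) * ((2 * ((n - m : ℕ) : R) + 1) * q ^ (n - m))
        = p * ∑ m ∈ range (n + 1), p ^ m * ((2 * ((n - m : ℕ) : R) + 1) * q ^ (n - m)) := by
      rw [Finset.mul_sum]
      exact Finset.sum_congr rfl fun m _ => by ring
    rw [this, mul_add]
    push_cast
    linear_combination p * ih

theorem hasDerivAt_divided_difference {h : ℂ → ℂ} {h' z w : ℂ} (hh : HasDerivAt h h' w)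
    (hzw : z ^ 2 - w ^ 2 ≠ 0) : HasDerivAt (fun w => (h z - h w) / (z ^ 2 - w ^ 2))
      ((-h' * (z ^ 2 - w ^ 2) + (h z - h w) * (2 * w)) / (z ^ 2 - w ^ 2) ^ 2) w := by
  have h2 : HasDerivAt (fun w : ℂ => z ^ 2 - w ^ 2) (-(2 * w)) w := by
    simpa using (hasDerivAt_pow 2 w).const_sub (z ^ 2)
  exact ((hh.const_sub (h z)).div h2 hzw).congr_deriv (by ring)

theorem hasDerivAt_inv_pow (n : ℕ) {w : ℂ} (hw : w ≠ 0) :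
    HasDerivAt (fun w : ℂ => w⁻¹ ^ n) (-n * w⁻¹ ^ (n + 1)) w := by
  have := (hasDerivAt_inv hw).pow n
  refine this.congr_deriv ?_
  rcases n with _ | n
  · simp
  · rw [Nat.add_sub_cancel, ← inv_pow]
    ring

/-- The bracket of `opMz z` with an insertion at w is the derivative term of the Schwinger-Dyson
equation plus the product with the planar two-point function 1/(z w (z+w)²). With u = 1/z and v =
1/w it follows from `sq_sub_mul_sum_odd` at u², v². -/
theorem insertion_kernel_eq (i : ℕ) {z w : ℂ} (hz : z ≠ 0) (hw : w ≠ 0) (hzw : z ^ 2 - w ^ 2 ≠ 0) :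
    1 / w * ((-(-((2 * i + 3 : ℕ) : ℂ) * w⁻¹ ^ (2 * i + 3 + 1)) * (z ^ 2 - w ^ 2)
        + (z⁻¹ ^ (2 * i + 3) - w⁻¹ ^ (2 * i + 3)) * (2 * w)) / (z ^ 2 - w ^ 2) ^ 2)
      + (z * w * (z + w) ^ 2)⁻¹ * z⁻¹ ^ (2 * i + 3)
      = ∑ m ∈ range (i + 2), z⁻¹ ^ (2 * m + 2) *
        ((2 * ((i + 1 - m : ℕ) : ℂ) + 1) * w⁻¹ ^ (2 * (i + 1 - m) + 3)) := by
  obtain ⟨u, rfl⟩ : ∃ u, z = u⁻¹ := ⟨z⁻¹, (inv_inv z).symm⟩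
  obtain ⟨v, rfl⟩ : ∃ v, w = v⁻¹ := ⟨w⁻¹, (inv_inv w).symm⟩
  have hu : u ≠ 0 := fun h => hz (by rw [h, inv_zero])
  have hv : v ≠ 0 := fun h => hw (by rw [h, inv_zero])
  have e1 : u⁻¹ ^ 2 - v⁻¹ ^ 2 = (v - u) * (v + u) / (u ^ 2 * v ^ 2) := by field_simp; ring
  have e2 : u⁻¹ + v⁻¹ = (v + u) / (u * v) := by field_simp
  have h12 : v - u ≠ 0 ∧ v + u ≠ 0 := by
    constructor <;> (intro h; apply hzw; rw [e1, h]; simp)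
  obtain ⟨h1, h2⟩ := h12
  have hS := sq_sub_mul_sum_odd (u ^ 2) (v ^ 2) (i + 1)
  set S := ∑ m ∈ range (i + 1 + 1), (u ^ 2) ^ m * ((2 * ((i + 1 - m : ℕ) : ℂ) + 1)
    * (v ^ 2) ^ (i + 1 - m))
  have hsum : ∑ m ∈ range (i + 2), (u⁻¹)⁻¹ ^ (2 * m + 2) *
        ((2 * ((i + 1 - m : ℕ) : ℂ) + 1) * (v⁻¹)⁻¹ ^ (2 * (i + 1 - m) + 3)) = u ^ 2 * v ^ 3 * S := by
    rw [Finset.mul_sum]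
    refine Finset.sum_congr rfl fun m _ => ?_
    rw [inv_inv, inv_inv, pow_add, pow_add v, pow_mul, pow_mul]
    ring
  have hS' : S = ((2 * ((i + 1 : ℕ) : ℂ) + 1) * (v ^ 2) ^ (i + 1 + 1) * (v ^ 2 - u ^ 2)
      - 2 * u ^ 2 * (v ^ 2) ^ (i + 1 + 1) + (u ^ 2) ^ (i + 1 + 1) * (v ^ 2 + u ^ 2))
      / ((v - u) ^ 2 * (v + u) ^ 2) := by
    rw [eq_div_iff (by positivity), ← hS]
    ring
  rw [hsum, hS', e1, e2, inv_inv, inv_inv, ← pow_mul, ← pow_mul]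
  push_cast
  have hU : u ^ (2 * (i + 1 + 1)) = u ^ (2 * i) * u ^ 4 := by ring
  have hU' : u ^ (2 * i + 3) = u ^ (2 * i) * u ^ 3 := by ring
  have hV : v ^ (2 * (i + 1 + 1)) = v ^ (2 * i) * v ^ 4 := by ring
  have hV' : v ^ (2 * i + 3) = v ^ (2 * i) * v ^ 3 := by ring
  have hV'' : v ^ (2 * i + 3 + 1) = v ^ (2 * i) * v ^ 4 := by ring
  rw [hU, hU', hV, hV', hV'']
  generalize u ^ (2 * i) = U
  generalize v ^ (2 * i) = V
  field_simp
  ring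

theorem constantCoeff_ins {f : MvPolynomial ℕ ℂ} {N : ℕ} (hf : ∀ i ∈ f.vars, i < N) (z : ℂ) :
    constantCoeff (ins z f) = ∑ i ∈ range N, constantCoeff (pderiv i f) * z⁻¹ ^ (2 * i + 3) := by
  rw [constantCoeff_derivation hf]
  exact Finset.sum_congr rfl fun i _ => by rw [ins_X, constantCoeff_C, mul_comm]

/-- The derivative term of the Schwinger-Dyson equation. -/
theorem exists_hasDerivAt_ins (f : MvPolynomial ℕ ℂ) {z w : ℂ} (hz : z ≠ 0) (hw : w ≠ 0)
    (hzw : z ^ 2 - w ^ 2 ≠ 0) : ∃ d, HasDerivAt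
      (fun w => (constantCoeff (ins z f) - constantCoeff (ins w f)) / (z ^ 2 - w ^ 2)) d w ∧
      1 / w * d + (z * w * (z + w) ^ 2)⁻¹ * constantCoeff (ins z f) = constantCoeff (insK z w f) := by
  obtain ⟨N, hN⟩ := exists_vars_lt f
  have hd : HasDerivAt (fun w => constantCoeff (ins w f)) (∑ i ∈ range N,
      constantCoeff (pderiv i f) * (-((2 * i + 3 : ℕ) : ℂ) * w⁻¹ ^ (2 * i + 3 + 1))) w := by
    simp only [constantCoeff_ins hN]
    exact HasDerivAt.fun_sum fun i _ => (hasDerivAt_inv_pow _ hw).const_mul _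
  refine ⟨_, hasDerivAt_divided_difference hd hzw, ?_⟩
  rw [constantCoeff_ins hN, constantCoeff_ins hN, constantCoeff_derivation hN]
  simp only [insK_X, constantCoeff_C]
  rw [← Finset.sum_neg_distrib, ← Finset.sum_sub_distrib, Finset.sum_mul, Finset.sum_mul,
    ← Finset.sum_add_distrib, Finset.sum_div, Finset.mul_sum, Finset.mul_sum,
    ← Finset.sum_add_distrib]
  refine Finset.sum_congr rfl fun i _ => ?_
  rw [← insertion_kernel_eq i hz hw hzw]
  ring

/-- The planar two-point function at coupling `1/2`; it vanishes for other `(g, b)`. -/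
def bergman (g : ℕ) (s : Multiset ℂ) : ℂ :=
  if g = 0 ∧ Multiset.card s = 2 then (s.prod * s.sum ^ 2)⁻¹ else 0

theorem bergman_pair (z w : ℂ) : bergman 0 (z ::ₘ {w}) = (z * w * (z + w) ^ 2)⁻¹ := by
  simp [bergman]

theorem bergman_eq_zero {g : ℕ} {s : Multiset ℂ} (h : ¬(g = 0 ∧ Multiset.card s = 2)) :
    bergman g s = 0 := if_neg h

/-- The quadratic term of the Schwinger-Dyson equations. -/
def quadTerm (A B : ℕ → Multiset ℂ → ℂ) (g : ℕ) (z : ℂ) (J : Finset ℂ) : ℂ :=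
  ∑ h ∈ range (g + 1), ∑ I ∈ J.powerset, A h (z ::ₘ I.val) * B (g - h) (z ::ₘ (J \ I).val)

theorem quadTerm_comm (A B : ℕ → Multiset ℂ → ℂ) (g : ℕ) (z : ℂ) (J : Finset ℂ) :
    quadTerm A B g z J = quadTerm B A g z J := by
  rw [quadTerm, quadTerm, ← Finset.sum_range_reflect]
  refine Finset.sum_congr rfl fun h hh => ?_
  rw [Finset.mem_range] at hh
  refine Finset.sum_bij' (fun I _ => J \ I) (fun I _ => J \ I)
    (fun I _ => Finset.mem_powerset.2 Finset.sdiff_subset)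
    (fun I _ => Finset.mem_powerset.2 Finset.sdiff_subset) (fun I hI => ?_) (fun I hI => ?_)
    (fun I hI => ?_) <;> rw [Finset.mem_powerset] at hI
  · exact Finset.sdiff_sdiff_eq_self hI
  · exact Finset.sdiff_sdiff_eq_self hI
  · rw [Finset.sdiff_sdiff_eq_self hI, show g + 1 - 1 - h = g - h by omega,
      show g - (g - h) = h by omega, mul_comm]

theorem quadTerm_add_left (A A' B : ℕ → Multiset ℂ → ℂ) (g : ℕ) (z : ℂ) (J : Finset ℂ) :
    quadTerm (fun g s => A g s + A' g s) B g z J = quadTerm A B g z J + quadTerm A' B g z J := by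
  simp only [quadTerm, add_mul, Finset.sum_add_distrib]

theorem quadTerm_bergman (B : ℕ → Multiset ℂ → ℂ) (g : ℕ) (z : ℂ) (J : Finset ℂ) :
    quadTerm bergman B g z J
      = ∑ w ∈ J, (z * w * (z + w) ^ 2)⁻¹ * B g (z ::ₘ (J.erase w).val) := by
  rw [quadTerm, Finset.sum_eq_single 0]
  · rw [← Finset.sum_subset (s₁ := J.powersetCard 1) fun I hI =>
      Finset.mem_powerset.2 (Finset.mem_powersetCard.1 hI).1, Finset.powersetCard_one,
      Finset.sum_map]
    · refine Finset.sum_congr rfl fun w _ => ?_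
      rw [Nat.sub_zero, Finset.erase_eq]
      exact congrArg (· * _) (bergman_pair z w)
    · intro I hI hI'
      rw [bergman_eq_zero, zero_mul]
      rintro ⟨-, h⟩
      rw [Multiset.card_cons, Finset.card_val] at h
      exact hI' (Finset.mem_powersetCard.2 ⟨Finset.mem_powerset.1 hI, by omega⟩)
  · intro h _ hh
    exact Finset.sum_eq_zero fun I _ => by rw [bergman_eq_zero (fun h' => hh h'.1), zero_mul]
  · simp

/-- The cross terms with the two-point function single out one argument w; they merge with the
derivative terms through `insertion_kernel_eq`. -/
theorem quadTerm_add_bergman (A : ℕ → Multiset ℂ → ℂ) (g : ℕ) (z : ℂ) (J : Finset ℂ) :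
    quadTerm (fun g s => A g s + bergman g s) (fun g s => A g s + bergman g s) g z J
      = quadTerm A A g z J + ∑ w ∈ J, (z * w * (z + w) ^ 2)⁻¹ *
        (2 * A g (z ::ₘ (J.erase w).val) + bergman g (z ::ₘ (J.erase w).val)) := by
  rw [quadTerm_add_left, quadTerm_comm A, quadTerm_add_left, quadTerm_comm bergman A,
    quadTerm_comm A bergman, quadTerm_bergman, quadTerm_bergman, add_assoc, ← Finset.sum_add_distrib]
  congr 1
  exact Finset.sum_congr rfl fun w _ => by ring

theorem hasDerivAt_bergman (g : ℕ) {z w : ℂ} {s : Multiset ℂ} (hw : w ≠ 0)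
    (hs0 : ∀ v ∈ s, v ≠ 0) (hs : ∀ v ∈ s, w + v ≠ 0) (hzw : z ^ 2 - w ^ 2 ≠ 0) :
    ∃ d, HasDerivAt (fun w => (bergman g (z ::ₘ s) - bergman g (w ::ₘ s)) / (z ^ 2 - w ^ 2)) d w ∧
      (¬(g = 0 ∧ Multiset.card s = 1) → d = 0) ∧ (g = 0 → ∀ v, s = {v} →
        d = (((w * v * (w + v) ^ 2)⁻¹ * (w⁻¹ + 2 * (w + v)⁻¹)) * (z ^ 2 - w ^ 2) +
          ((z * v * (z + v) ^ 2)⁻¹ - (w * v * (w + v) ^ 2)⁻¹) * (2 * w)) / (z ^ 2 - w ^ 2) ^ 2) := by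
  by_cases h : g = 0 ∧ Multiset.card s = 1
  · obtain ⟨rfl, h1⟩ := h
    obtain ⟨v, rfl⟩ := Multiset.card_eq_one.1 h1
    have hv := hs0 v (by simp)
    have hwv := hs v (by simp)
    simp only [bergman_pair]
    have hd : HasDerivAt (fun w : ℂ => (w * v * (w + v) ^ 2)⁻¹)
        (-((w * v * (w + v) ^ 2)⁻¹ * (w⁻¹ + 2 * (w + v)⁻¹))) w := by
      have h1 : HasDerivAt (fun w : ℂ => w * v * (w + v) ^ 2)
          (1 * v * (w + v) ^ 2 + w * v * (2 * (w + v))) w :=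
        ((hasDerivAt_id w).mul_const v).mul ((((hasDerivAt_id w).add_const v).fun_pow 2).congr_deriv
          (by simp))
      refine (h1.inv (by positivity)).congr_deriv ?_
      field_simp
    refine ⟨_, hasDerivAt_divided_difference hd hzw, fun h => absurd ⟨trivial, Multiset.card_singleton v⟩ h, ?_⟩
    intro _ v' hv'
    rw [← Multiset.singleton_inj.1 hv', neg_neg]
  · have h0 : ∀ w, bergman g (w ::ₘ s) = 0 := fun w => bergman_eq_zero (by
      rw [Multiset.card_cons]; omega)
    simp only [h0]
    refine ⟨0, by simpa using hasDerivAt_const w (0 : ℂ), fun _ => rfl, ?_⟩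
    rintro rfl v rfl
    exact absurd ⟨rfl, rfl⟩ h

/-- The algebraic identity behind the planar three-point function. -/
theorem planar_three_point {z a b : ℂ} (hz : z ≠ 0) (ha : a ≠ 0) (hb : b ≠ 0)
    (hza : z ^ 2 - a ^ 2 ≠ 0) (hzb : z ^ 2 - b ^ 2 ≠ 0) (hab : a + b ≠ 0) :
    z⁻¹ ^ 2 * (a⁻¹ ^ 3 * b⁻¹ ^ 3) =
      (z * a * (z + a) ^ 2)⁻¹ * (z * b * (z + b) ^ 2)⁻¹
      + 1 / a * ((((a * b * (a + b) ^ 2)⁻¹ * (a⁻¹ + 2 * (a + b)⁻¹)) * (z ^ 2 - a ^ 2) +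
          ((z * b * (z + b) ^ 2)⁻¹ - (a * b * (a + b) ^ 2)⁻¹) * (2 * a)) / (z ^ 2 - a ^ 2) ^ 2)
      + 1 / b * ((((b * a * (b + a) ^ 2)⁻¹ * (b⁻¹ + 2 * (b + a)⁻¹)) * (z ^ 2 - b ^ 2) +
          ((z * a * (z + a) ^ 2)⁻¹ - (b * a * (b + a) ^ 2)⁻¹) * (2 * b)) / (z ^ 2 - b ^ 2) ^ 2) := by
  rw [show z ^ 2 - a ^ 2 = (z - a) * (z + a) by ring] at *
  rw [show z ^ 2 - b ^ 2 = (z - b) * (z + b) by ring] at *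
  have h1 := left_ne_zero_of_mul hza
  have h2 := right_ne_zero_of_mul hza
  have h3 := left_ne_zero_of_mul hzb
  have h4 := right_ne_zero_of_mul hzb
  rw [add_comm b a]
  field_simp
  ring

end Airy


/-! ### The Schwinger-Dyson equations at coupling 1/2 -/

namespace Airy

open MvPolynomial Finset

/-- The correlation functions at coupling `1/2`. -/
def fullCor (F : ℕ → MvPolynomial ℕ ℂ) (g : ℕ) (s : Multiset ℂ) : ℂ := corF F g s + bergman g s

theorem corF_eq_zero {F : ℕ → MvPolynomial ℕ ℂ} (hF0 : F 0 = 0) {g : ℕ} {s : Multiset ℂ}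
    (h : 2 * g + Multiset.card s ≤ 2) : corF F g s = 0 := by
  rw [corF, show 2 * g + Multiset.card s - 2 = 0 by omega, hF0, insM_map_zero, map_zero]

theorem fullCor_eq_corF {F : ℕ → MvPolynomial ℕ ℂ} {g : ℕ} {s : Multiset ℂ}
    (h : 2 < 2 * g + Multiset.card s) : fullCor F g s = corF F g s := by
  rw [fullCor, bergman_eq_zero (by omega), add_zero]

theorem fullCor_pair {F : ℕ → MvPolynomial ℕ ℂ} (hF0 : F 0 = 0) (z w : ℂ) :
    fullCor F 0 (z ::ₘ {w}) = (z * w * (z + w) ^ 2)⁻¹ := by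
  rw [fullCor, corF_eq_zero hF0 (by simp), bergman_pair, zero_add]

theorem fullCor_singleton {F : ℕ → MvPolynomial ℕ ℂ} (hF0 : F 0 = 0) (z : ℂ) :
    fullCor F 0 {z} = 0 := by
  rw [fullCor, corF_eq_zero hF0 (by simp), bergman_eq_zero (by simp), zero_add]

theorem differentiableAt_fullCor {F : ℕ → MvPolynomial ℕ ℂ}
    {g k : ℕ} {z : ℂ} {J : Finset ℂ} (hk : k + 2 = 2 * g + J.card) (hz : z ≠ 0)
    (hJ0 : ∀ w ∈ J, w ≠ 0) (hJ : ∀ w ∈ J, ∀ v ∈ J, w ≠ v → w + v ≠ 0)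
    (hzJ : ∀ w ∈ J, z ^ 2 - w ^ 2 ≠ 0) {w : ℂ} (hw : w ∈ J) :
    ∃ d d', HasDerivAt (fun v => (fullCor F g (z ::ₘ (J.erase w).val)
        - fullCor F g (v ::ₘ (J.erase w).val)) / (z ^ 2 - v ^ 2)) (d + d') w ∧
      1 / w * d + (z * w * (z + w) ^ 2)⁻¹ * corF F g (z ::ₘ (J.erase w).val)
        = constantCoeff (insK z w (insM (J.erase w).val (F k))) ∧
      (¬(g = 0 ∧ J.card = 2) → d' = 0) ∧ (g = 0 → ∀ v, J.erase w = {v} →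
        d' = (((w * v * (w + v) ^ 2)⁻¹ * (w⁻¹ + 2 * (w + v)⁻¹)) * (z ^ 2 - w ^ 2) +
          ((z * v * (z + v) ^ 2)⁻¹ - (w * v * (w + v) ^ 2)⁻¹) * (2 * w)) / (z ^ 2 - w ^ 2) ^ 2) := by
  have hc : (J.erase w).card + 1 = J.card := Finset.card_erase_add_one hw
  have hcor : ∀ v, corF F g (v ::ₘ (J.erase w).val)
      = constantCoeff (ins v (insM (J.erase w).val (F k))) := by
    intro v
    rw [corF, Multiset.card_cons, Finset.card_val, insM_cons,
      show 2 * g + ((J.erase w).card + 1) - 2 = k by omega]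
  obtain ⟨d, hd, hd'⟩ := exists_hasDerivAt_ins (insM (J.erase w).val (F k)) hz (hJ0 w hw) (hzJ w hw)
  obtain ⟨d', hb, hb', hb''⟩ := hasDerivAt_bergman g (z := z) (s := (J.erase w).val) (hJ0 w hw)
    (fun v hv => hJ0 v (Finset.mem_of_mem_erase hv))
    (fun v hv => hJ w hw v (Finset.mem_of_mem_erase hv) (Finset.ne_of_mem_erase hv).symm) (hzJ w hw)
  refine ⟨d, d', ?_, by rw [hcor]; exact hd', fun h => hb' fun h' => h ⟨h'.1, ?_⟩,
    fun hg v hv => hb'' hg v (by rw [hv]; rfl)⟩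
  · refine (hd.add hb).congr_of_eventuallyEq (Filter.Eventually.of_forall fun v => ?_)
    simp only [fullCor, hcor, Pi.add_apply]
    ring
  · rw [← hc, ← Finset.card_val, h'.2]

/-- The restriction on the sum is automatic, because the value at (0, 1) is zero in this
normalisation. -/
theorem quadTerm_ite {F : ℕ → MvPolynomial ℕ ℂ} (hF0 : F 0 = 0) (g : ℕ) (z : ℂ) (J : Finset ℂ) :
    (∑ h ∈ Finset.range (g + 1), ∑ I ∈ J.powerset,
      if (h = 0 ∧ I = ∅) ∨ (h = g ∧ I = J) then 0
      else fullCor F h (z ::ₘ I.val) * fullCor F (g - h) (z ::ₘ (J \ I).val))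
      = quadTerm (fullCor F) (fullCor F) g z J := by
  rw [quadTerm]
  refine Finset.sum_congr rfl fun h _ => Finset.sum_congr rfl fun I _ => ?_
  split_ifs with hI
  · rcases hI with ⟨rfl, rfl⟩ | ⟨rfl, rfl⟩
    · rw [show (z ::ₘ (∅ : Finset ℂ).val) = {z} from rfl, fullCor_singleton hF0, zero_mul]
    · rw [Nat.sub_self, Finset.sdiff_self, show (z ::ₘ (∅ : Finset ℂ).val) = {z} from rfl,
        fullCor_singleton hF0, mul_zero]
  · rfl

theorem constantCoeff_insM_pair (a b : ℂ) :
    constantCoeff (insM (a ::ₘ {b}) (X 0 ^ 2)) = 2 * (a⁻¹ ^ 3 * b⁻¹ ^ 3) := by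
  rw [show ({b} : Multiset ℂ) = b ::ₘ 0 from rfl, insM_cons, insM_cons, insM_zero,
    Derivation.leibniz_pow, ins_X, nsmul_eq_mul, smul_eq_mul]
  have : ((2 : ℕ) : MvPolynomial ℕ ℂ) * (X 0 ^ (2 - 1) * C (b⁻¹ ^ (2 * 0 + 3)))
      = C (2 * b⁻¹ ^ 3) * X 0 := by
    rw [C_mul, map_ofNat]; push_cast; ring
  rw [this, derivation_C_mul', ins_X, map_mul, constantCoeff_C, constantCoeff_C]
  ring

/-- The Schwinger-Dyson equations at coupling `1/2`, with the linear term in algebraic form. -/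
theorem IsVirasoroSolution.schwinger_dyson {a : ℕ → ℂ} {y : ℂ} {F : ℕ → MvPolynomial ℕ ℂ}
    (hF : IsVirasoroSolution a y (1 / 8) F) (hF0 : F 0 = 0) (hd : ∀ k : ℕ, HasDeg (k + 2) (F k))
    {g k : ℕ} {z : ℂ} {J : Finset ℂ} (hk : k + 2 = 2 * g + J.card) (hz : z ≠ 0)
    (hJ0 : ∀ w ∈ J, w ≠ 0) (hJ : ∀ w ∈ J, ∀ v ∈ J, w ≠ v → w + v ≠ 0)
    (hzJ : ∀ w ∈ J, z ^ 2 - w ^ 2 ≠ 0) :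
    ∃ K₀, ∀ K, K₀ ≤ K →
      ∑ m ∈ range K, z⁻¹ ^ (2 * m + 2) * constantCoeff (insM J.val (opK a m (F (k + 1))))
      + y * (1 / 2 * (if g = 0 then 0 else fullCor F (g - 1) (z ::ₘ z ::ₘ J.val))
        + 1 / 2 * (∑ h ∈ Finset.range (g + 1), ∑ I ∈ J.powerset,
          if (h = 0 ∧ I = ∅) ∨ (h = g ∧ I = J) then 0
          else fullCor F h (z ::ₘ I.val) * fullCor F (g - h) (z ::ₘ (J \ I).val))
        + ∑ w ∈ J, 1 / w * deriv (fun v => (fullCor F g (z ::ₘ (J.erase w).val)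
          - fullCor F g (v ::ₘ (J.erase w).val)) / (z ^ 2 - v ^ 2)) w) = 0 := by
  obtain ⟨K₀, hK₀⟩ := hF.loop hF0 hd z J hk
  refine ⟨K₀, fun K hK => ?_⟩
  refine Eq.trans ?_ (hK₀ K hK)
  rw [quadTerm_ite hF0, add_right_inj]
  congr 1
  change _ = _ + 1 / 2 * (_ + quadTerm (corF F) (corF F) g z J) + _
  rw [show quadTerm (fullCor F) (fullCor F) g z J = _ from quadTerm_add_bergman (corF F) g z J]
  have hder : ∀ w : ℂ, ∃ d d' : ℂ, w ∈ J → (HasDerivAt (fun v => (fullCor F g (z ::ₘ (J.erase w).val)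
        - fullCor F g (v ::ₘ (J.erase w).val)) / (z ^ 2 - v ^ 2)) (d + d') w ∧
      1 / w * d + (z * w * (z + w) ^ 2)⁻¹ * corF F g (z ::ₘ (J.erase w).val)
        = constantCoeff (insK z w (insM (J.erase w).val (F k))) ∧
      (¬(g = 0 ∧ J.card = 2) → d' = 0) ∧ (g = 0 → ∀ v, J.erase w = {v} →
        d' = (((w * v * (w + v) ^ 2)⁻¹ * (w⁻¹ + 2 * (w + v)⁻¹)) * (z ^ 2 - w ^ 2) +
          ((z * v * (z + v) ^ 2)⁻¹ - (w * v * (w + v) ^ 2)⁻¹) * (2 * w)) / (z ^ 2 - w ^ 2) ^ 2)) := by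
    intro w
    by_cases hw : w ∈ J
    · obtain ⟨d, d', h⟩ := differentiableAt_fullCor (F := F) hk hz hJ0 hJ hzJ hw
      exact ⟨d, d', fun _ => h⟩
    · exact ⟨0, 0, fun h => absurd h hw⟩
  choose d d' h using hder
  have e1 : ∑ w ∈ J, 1 / w * deriv (fun v => (fullCor F g (z ::ₘ (J.erase w).val)
          - fullCor F g (v ::ₘ (J.erase w).val)) / (z ^ 2 - v ^ 2)) w
      = ∑ w ∈ J, (1 / w * d w + 1 / w * d' w) :=
    Finset.sum_congr rfl fun w hw => by rw [(h w hw).1.deriv, mul_add]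
  have e2 : ∑ w ∈ J, constantCoeff (insK z w (insM (J.erase w).val (F k)))
      = ∑ w ∈ J, (1 / w * d w + (z * w * (z + w) ^ 2)⁻¹ * corF F g (z ::ₘ (J.erase w).val)) :=
    Finset.sum_congr rfl fun w hw => ((h w hw).2.1).symm
  have e3 : ∑ w ∈ J, (z * w * (z + w) ^ 2)⁻¹ *
        (2 * corF F g (z ::ₘ (J.erase w).val) + bergman g (z ::ₘ (J.erase w).val))
      = 2 * ∑ w ∈ J, (z * w * (z + w) ^ 2)⁻¹ * corF F g (z ::ₘ (J.erase w).val)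
        + ∑ w ∈ J, (z * w * (z + w) ^ 2)⁻¹ * bergman g (z ::ₘ (J.erase w).val) := by
    rw [Finset.mul_sum, ← Finset.sum_add_distrib]
    exact Finset.sum_congr rfl fun w _ => by ring
  rw [e1, e2, e3, Finset.sum_add_distrib, Finset.sum_add_distrib]
  -- The terms made of the two-point function alone reproduce the inhomogeneities of the Virasoro
  -- operators: x_0²/2 corresponds to (g, b) = (0, 3), by `planar_three_point`, and 1/8 to (1, 1),
  -- where half of the two-point function at (z, z) is z⁻⁴/8.
  have key : 1 / 2 * (if g = 0 then 0 else bergman (g - 1) (z ::ₘ z ::ₘ J.val))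
      + 1 / 2 * ∑ w ∈ J, (z * w * (z + w) ^ 2)⁻¹ * bergman g (z ::ₘ (J.erase w).val)
      + ∑ w ∈ J, 1 / w * d' w = if k = 0 then 1 / 2 * z⁻¹ ^ 2 * constantCoeff (insM J.val (X 0 ^ 2))
          + constantCoeff (insM J.val (C (1 / 8 * z⁻¹ ^ 4))) else 0 := by
    by_cases h02 : g = 0 ∧ J.card = 2
    · obtain ⟨rfl, hJ2⟩ := h02
      obtain ⟨a, b, hab, rfl⟩ := Finset.card_eq_two.1 hJ2
      have hk0 : k = 0 := by omega
      have ha : a ∈ ({a, b} : Finset ℂ) := by simp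
      have hb : b ∈ ({a, b} : Finset ℂ) := by simp
      have hea : ({a, b} : Finset ℂ).erase a = {b} := by
        rw [Finset.erase_insert (by simpa using hab)]
      have heb : ({a, b} : Finset ℂ).erase b = {a} := by
        rw [Finset.pair_comm, Finset.erase_insert (by simpa using hab.symm)]
      rw [if_pos rfl, if_pos hk0, Finset.sum_pair hab, Finset.sum_pair hab, hea, heb,
        Finset.singleton_val, Finset.singleton_val, bergman_pair, bergman_pair,
        (h a ha).2.2.2 rfl b hea, (h b hb).2.2.2 rfl a heb,
        Finset.insert_val_of_notMem (by simpa using hab), Finset.singleton_val,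
        constantCoeff_insM_pair]
      have hC : insM (a ::ₘ {b}) (C (1 / 8 * z⁻¹ ^ 4)) = 0 := by
        rw [insM_cons, ← insM_ins, show ins a (C _) = 0 from derivation_C _ _, insM_map_zero]
      rw [hC, map_zero]
      linear_combination -planar_three_point hz (hJ0 a ha) (hJ0 b hb) (hzJ a ha) (hzJ b hb)
        (hJ a ha b hb hab)
    · have e4 : ∑ w ∈ J, 1 / w * d' w = 0 :=
        Finset.sum_eq_zero fun w hw => by rw [(h w hw).2.2.1 h02, mul_zero]
      have e5 : ∑ w ∈ J, (z * w * (z + w) ^ 2)⁻¹ * bergman g (z ::ₘ (J.erase w).val) = 0 :=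
        Finset.sum_eq_zero fun w hw => by
          rw [bergman_eq_zero, mul_zero]
          rintro ⟨hg, hc⟩
          rw [Multiset.card_cons, Finset.card_val, Finset.card_erase_add_one hw] at hc
          exact h02 ⟨hg, hc⟩
      rw [e4, e5]
      by_cases hJe : J = ∅
      · subst hJe
        rw [Finset.card_empty] at hk
        by_cases hg : g = 1
        · subst hg
          have hk0 : k = 0 := by omega
          rw [if_neg one_ne_zero, if_pos hk0, Finset.empty_val, insM_zero, insM_zero,
            show (z ::ₘ z ::ₘ 0) = z ::ₘ {z} from rfl, Nat.sub_self, bergman_pair]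
          simp
          field_simp
          ring
        · rw [if_neg (by omega), if_neg (by omega), bergman_eq_zero (by omega)]
          simp
      · have hc := Finset.card_pos.2 (Finset.nonempty_iff_ne_empty.2 hJe)
        rw [if_neg (show k ≠ 0 by omega)]
        split_ifs
        · simp
        · rw [bergman_eq_zero]
          · simp
          · rintro ⟨-, hc'⟩
            rw [Multiset.card_cons, Multiset.card_cons, Finset.card_val] at hc'
            omega
  rw [← key]
  by_cases hg : g = 0
  · rw [if_pos hg, if_pos hg, if_pos hg]
    ring
  · rw [if_neg hg, if_neg hg, if_neg hg, fullCor]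
    ring

end Airy


namespace CubicModel

variable {lam : ℂ} (M : CubicModel lam)

/-! ## The equation for the planar two-point function -/

/-- Differentiation under the integral: up to the cut-off t stays in a compact set at distance at
least 2δ from -w, so the derivative is dominated by a constant on a set of finite measure. -/
theorem hasDerivAt_cutIntegral (L : ℝ) {w : ℂ} (hw : M.OffCut w) :
    HasDerivAt (fun w => M.cutIntegral L (fun t => 1 / ((w + t) * t)))
      (M.cutIntegral L (fun t => -1 / ((w + t) ^ 2 * t))) w := by
  obtain ⟨K, hK, hKc, hKp⟩ := M.exists_isCompact L
  obtain ⟨B, hB⟩ := hK.exists_bound_of_continuousOn (f := fun t : ℂ => 8 * lam ^ 2 * (-1 / t))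
    (continuousOn_const.mul (continuousOn_const.div continuousOn_id fun t ht =>
      M.ne_zero_of_mem_cut (hKc ht)))
  obtain ⟨δ, hδ, hδK⟩ : ∃ δ : ℝ, 0 < δ ∧ ∀ t ∈ K, 2 * δ ≤ ‖w + t‖ := by
    rcases K.eq_empty_or_nonempty with rfl | hne
    · exact ⟨1, one_pos, by simp⟩
    obtain ⟨t₀, ht₀, hmin⟩ := hK.exists_isMinOn hne
      (f := fun t : ℂ => ‖w + t‖) (by fun_prop)
    have h0 : 0 < ‖w + t₀‖ := norm_pos_iff.2 (hw.add_ne_zero (hKc ht₀))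
    refine ⟨‖w + t₀‖ / 2, by positivity, fun t ht => ?_⟩
    have : ‖w + t₀‖ ≤ ‖w + t‖ := hmin ht
    linarith
  have hp := M.aemeasurable_pt L
  have hlow : ∀ w' ∈ Metric.ball w δ, ∀ t ∈ K, δ ≤ ‖w' + t‖ := by
    intro w' hw' t ht
    have h1 := hδK t ht
    have h2 : ‖w + t‖ ≤ ‖w' + t‖ + ‖w' - w‖ := by
      have := norm_sub_le (w' + t) (w' - w)
      rwa [show w' + t - (w' - w) = w + t by ring] at this
    rw [Metric.mem_ball, dist_eq_norm] at hw'
    linarith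
  have hB0 : ∀ t ∈ K, 0 ≤ B := fun t ht => (norm_nonneg _).trans (hB t ht)
  unfold cutIntegral
  refine (hasDerivAt_integral_of_dominated_loc_of_deriv_le (μ := M.r.restrict (Set.Icc 0 L))
    (F := fun w x => 8 * lam ^ 2 * (1 / ((w + M.pt x) * M.pt x)))
    (F' := fun w x => 8 * lam ^ 2 * (-1 / ((w + M.pt x) ^ 2 * M.pt x)))
    (bound := fun _ => B / δ ^ 2) (Metric.ball_mem_nhds w hδ) ?_ ?_ ?_ ?_ ?_ ?_).2
  · refine Filter.Eventually.of_forall fun w' => AEMeasurable.aestronglyMeasurable ?_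
    fun_prop
  · exact (M.integrableOn (φ := fun t => 1 / ((w + t) * t)) (continuousOn_const.div (by fun_prop)
      fun t ht => mul_ne_zero (hw.add_ne_zero ht) (M.ne_zero_of_mem_cut ht)) L).const_mul _
  · refine AEMeasurable.aestronglyMeasurable ?_
    fun_prop
  · refine (ae_restrict_iff' measurableSet_Icc).2 (Filter.Eventually.of_forall fun x hx w' hw' => ?_)
    have hx' := hKp x hx
    have h1 := hlow w' hw' _ hx'
    rw [show 8 * lam ^ 2 * (-1 / ((w' + M.pt x) ^ 2 * M.pt x))
      = 8 * lam ^ 2 * (-1 / M.pt x) / (w' + M.pt x) ^ 2 by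
        simp only [div_eq_mul_inv, mul_inv]; ring, norm_div, norm_pow]
    exact div_le_div₀ (hB0 _ hx') (hB _ hx') (by positivity) (pow_le_pow_left₀ hδ.le h1 2)
  · exact integrableOn_const (M.measure_Icc_lt_top L).ne
  · refine (ae_restrict_iff' measurableSet_Icc).2 (Filter.Eventually.of_forall fun x hx w' hw' => ?_)
    have hx' := hKp x hx
    have h1 : w' + M.pt x ≠ 0 := norm_pos_iff.1 (hδ.trans_le (hlow w' hw' _ hx'))
    have h2 := M.ne_zero_of_mem_cut (hKc hx')
    have h3 : HasDerivAt (fun w => (w + M.pt x) * M.pt x) (1 * M.pt x) w' :=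
      ((hasDerivAt_id w').add_const _).mul_const _
    have h4 := (h3.inv (mul_ne_zero h1 h2)).const_mul (8 * lam ^ 2)
    simp only [one_div]
    refine h4.congr_deriv ?_
    field_simp

/-- The planar two-point equation holds exactly at every cut-off. After the partial fraction
decomposition of the integrand only the integrals already present in 𝒢₀ and its derivative occur,
and they cancel. -/
theorem schwinger_dyson_zero_two_at (hlam : lam ≠ 0) (L : ℝ) {z w : ℂ} (hz : M.OffCut z)
    (hw : M.OffCut w) (hz0 : z ≠ 0) (hw0 : w ≠ 0) (hzw : z ^ 2 - w ^ 2 ≠ 0) :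
    M.khat L (fun z => (2 * lam) ^ 2 * (z * w * (z + w) ^ 2)⁻¹) z + (2 * lam) ^ 3 * (1 / w *
      deriv (fun w => (M.planar L z - M.planar L w) / (z ^ 2 - w ^ 2)) w) = 0 := by
  have hzw' : z + w ≠ 0 := fun h => hzw (by linear_combination (z - w) * h)
  have hI : HasDerivAt (M.planar L) (1 / (2 * lam) * (1 / M.sqrtZ L
      + 1 / 2 * M.cutIntegral L (fun t => -1 / ((w + t) ^ 2 * t)))) w := by
    unfold planar
    exact ((((hasDerivAt_id w).div_const _).sub_const _).add
      ((M.hasDerivAt_cutIntegral L hw).const_mul _)).const_mul _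
  rw [(Airy.hasDerivAt_divided_difference hI hzw).deriv]
  have hc1 : ContinuousOn (fun t : ℂ => 1 / ((z + t) * t)) M.cut := continuousOn_const.div
    (by fun_prop) fun t ht => mul_ne_zero (hz.add_ne_zero ht) (M.ne_zero_of_mem_cut ht)
  have hc2 : ContinuousOn (fun t : ℂ => 1 / ((w + t) * t)) M.cut := continuousOn_const.div
    (by fun_prop) fun t ht => mul_ne_zero (hw.add_ne_zero ht) (M.ne_zero_of_mem_cut ht)
  have hc3 : ContinuousOn (fun t : ℂ => -1 / ((w + t) ^ 2 * t)) M.cut := continuousOn_const.div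
    (by fun_prop) fun t ht => mul_ne_zero (pow_ne_zero 2 (hw.add_ne_zero ht))
      (M.ne_zero_of_mem_cut ht)
  have hf : ContinuousOn (fun z => (2 * lam) ^ 2 * (z * w * (z + w) ^ 2)⁻¹) M.cut := by
    refine continuousOn_const.mul (ContinuousOn.inv₀ (by fun_prop) fun t ht => ?_)
    have := hw.add_ne_zero ht
    rw [add_comm] at this
    exact mul_ne_zero (mul_ne_zero (M.ne_zero_of_mem_cut ht) hw0) (pow_ne_zero 2 this)
  rw [M.khat_eq hlam L hf hz]
  have hint : M.cutIntegral L (fun t => (z * ((2 * lam) ^ 2 * (z * w * (z + w) ^ 2)⁻¹)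
      - t * ((2 * lam) ^ 2 * (t * w * (t + w) ^ 2)⁻¹)) / (t * (z ^ 2 - t ^ 2)))
      = (2 * lam) ^ 2 / (w * (z ^ 2 - w ^ 2) ^ 2) * ((z ^ 2 - w ^ 2) *
        M.cutIntegral L (fun t => -1 / ((w + t) ^ 2 * t))
        - 2 * w * (M.cutIntegral L (fun t => 1 / ((z + t) * t))
          - M.cutIntegral L (fun t => 1 / ((w + t) * t)))) := by
    rw [← M.cutIntegral_sub hc1 hc2, ← M.cutIntegral_const_mul, ← M.cutIntegral_const_mul,
      ← M.cutIntegral_sub (φ := fun t => (z ^ 2 - w ^ 2) * (-1 / ((w + t) ^ 2 * t)))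
        (ψ := fun t => 2 * w * (1 / ((z + t) * t) - 1 / ((w + t) * t))) (continuousOn_const.mul hc3) (continuousOn_const.mul (hc1.sub hc2)),
      ← M.cutIntegral_const_mul]
    refine M.cutIntegral_congr (fun t ht => ?_) L
    have h1 := M.ne_zero_of_mem_cut ht
    have h2 := hw.add_ne_zero ht
    have h3 := hz.add_ne_zero ht
    have h4 := hz.sq_sub_ne_zero ht
    have h5 : t + w ≠ 0 := by rwa [add_comm]
    have h6 : z - t ≠ 0 := fun h => h4 (by linear_combination (z + t) * h)
    have h7 : z - w ≠ 0 := fun h => hzw (by linear_combination (z + w) * h)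
    rw [show z ^ 2 - w ^ 2 = (z - w) * (z + w) by ring,
      show z ^ 2 - t ^ 2 = (z - t) * (z + t) by ring, add_comm t w]
    field_simp
    ring
  rw [hint, planar, planar]
  have h7 : z - w ≠ 0 := fun h => hzw (by linear_combination (z + w) * h)
  generalize M.cutIntegral L (fun t => -1 / ((w + t) ^ 2 * t)) = I3
  generalize M.cutIntegral L (fun t => 1 / ((w + t) * t)) = I2
  generalize M.cutIntegral L (fun t => 1 / ((z + t) * t)) = I1
  simp only [div_eq_mul_inv]
  generalize (M.sqrtZ L)⁻¹ = q
  rw [show z ^ 2 - w ^ 2 = (z - w) * (z + w) by ring]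
  field_simp
  ring

end CubicModel


/-! ### Existence of the correlation functions of a model -/

namespace Kontsevich

open MvPolynomial Finset Airy

/-- The solution of the Virasoro constraints at given values of the Kontsevich times. -/
def numSol (ρ : ℕ → ℂ) (k : ℕ) : MvPolynomial ℕ ℂ := MvPolynomial.map (evT ρ) (sol k)

theorem numSol_zero (ρ : ℕ → ℂ) : numSol ρ 0 = 0 := by rw [numSol, sol_zero, map_zero]

theorem hasDeg_numSol (ρ : ℕ → ℂ) (k : ℕ) : HasDeg (k + 2) (numSol ρ k) := (hasDeg_sol k).map _

theorem isVirasoroSolution_numSol {ρ : ℕ → ℂ} (h : ρ 0 ≠ 0) :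
    IsVirasoroSolution (fun j => ρ j / ρ 0) (ρ 0)⁻¹ (1 / 8) (numSol ρ) := by
  have := isVirasoroSolution_sol.map (evT ρ)
  simp only [evT_ratT h, evT_invT, evT_C] at this
  exact this

theorem ins_opK (a : ℕ → ℂ) (m : ℕ) (z : ℂ) (f : MvPolynomial ℕ ℂ) :
    ins z (opK a m f) = opK a m (ins z f) :=
  bracket_zero_of_X (fun k => by
    rw [ins_X, opK_X]
    split_ifs
    · exact (derivation_C _ _).trans (derivation_C _ _).symm
    · rw [map_zero]; exact (derivation_C _ _).symm) f

theorem insM_opK (a : ℕ → ℂ) (m : ℕ) (s : Multiset ℂ) (f : MvPolynomial ℕ ℂ) :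
    insM s (opK a m f) = opK a m (insM s f) := by
  induction s using Multiset.induction_on with
  | empty => simp
  | cons w s ih => rw [insM_cons, insM_cons, ih, ins_opK]

/-- The coefficients of the Laurent polynomial `K̂ f`. -/
theorem sum_opK_eq {ρ : ℕ → ℂ} (h0 : ρ 0 ≠ 0) {f : MvPolynomial ℕ ℂ} {N K : ℕ}
    (hf : ∀ i ∈ f.vars, i < N) (hK : N ≤ K) (u : ℂ) :
    ∑ n ∈ range N, constantCoeff (pderiv n f) * ∑ j ∈ range (n + 1), ρ j * u ^ (2 * (n + 1 - j))
      = ρ 0 * ∑ m ∈ range K, u ^ (2 * m + 2) * constantCoeff (opK (fun j => ρ j / ρ 0) m f) := by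
  have h := fun m => constantCoeff_derivation (D := opK (fun j => ρ j / ρ 0) m) hf
  simp only [h, Finset.mul_sum]
  rw [Finset.sum_comm (s := range K)]
  refine Finset.sum_congr rfl fun n hn => ?_
  rw [Finset.mem_range] at hn
  rw [← Finset.sum_flip, ← Finset.sum_subset (Finset.range_mono (show n + 1 ≤ K by omega))]
  · refine Finset.sum_congr rfl fun m hm => ?_
    rw [Finset.mem_range] at hm
    rw [opK_X, if_pos (by omega), constantCoeff_C, show 2 * (n + 1 - (n - m)) = 2 * m + 2 by omega]
    field_simp
  · intro m _ hm
    rw [Finset.mem_range] at hm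
    rw [opK_X, if_neg (by omega), map_zero]
    ring

/-- The correlation functions of a model with Kontsevich times `ρ`. -/
def corrFun (lam : ℂ) (ρ : ℕ → ℂ) (g : ℕ) (s : Multiset ℂ) : ℂ :=
  (2 * lam) ^ (4 * g + 3 * Multiset.card s - 4) * fullCor (numSol ρ) g s

theorem corrFun_of_stable (lam : ℂ) (ρ : ℕ → ℂ) {g : ℕ} {s : Multiset ℂ}
    (h : 2 < 2 * g + Multiset.card s) : corrFun lam ρ g s =
      (2 * lam) ^ (4 * g + 3 * Multiset.card s - 4) * corF (numSol ρ) g s := by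
  rw [corrFun, fullCor_eq_corF h]

theorem corrFun_cons (lam : ℂ) (ρ : ℕ → ℂ) {g k : ℕ} {s : Multiset ℂ}
    (h : k + 2 = 2 * g + Multiset.card s) (z : ℂ) : corrFun lam ρ g (z ::ₘ s) =
      (2 * lam) ^ (4 * g + 3 * Multiset.card s - 1) *
        constantCoeff (ins z (insM s (numSol ρ (k + 1)))) := by
  rw [corrFun_of_stable _ _ (by rw [Multiset.card_cons]; omega), corF, Multiset.card_cons,
    insM_cons, show 2 * g + (Multiset.card s + 1) - 2 = k + 1 by omega,
    show 4 * g + 3 * (Multiset.card s + 1) - 4 = 4 * g + 3 * Multiset.card s - 1 by omega]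

theorem corrFun_pair (lam : ℂ) (ρ : ℕ → ℂ) (z w : ℂ) :
    corrFun lam ρ 0 {z, w} = (2 * lam) ^ 2 * (z * w * (z + w) ^ 2)⁻¹ :=
  congrArg (_ * ·) (fullCor_pair (numSol_zero ρ) z w)

/-- The limit of K̂ on the candidate is ρ_0 times the linear part of the generating series of
constraints (`sum_opK_eq`), so the equation is the one at coupling 1/2 with the powers of 2λ
restored. -/
theorem isCorrelationFamily_corrFun {lam : ℂ} (hlam : lam ≠ 0) (M : CubicModel lam) {ρ : ℕ → ℂ}
    (hρ : M.HasKontsevichTimes ρ) (h0 : ρ 0 ≠ 0) : M.IsCorrelationFamily (corrFun lam ρ) where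
  laurent g b hb hgb := by
    obtain ⟨P, hP⟩ := insM_laurent b (numSol ρ (2 * g + b - 2))
    refine ⟨C ((2 * lam) ^ (4 * g + 3 * b - 4)) * P, fun z _ => ?_⟩
    have hc : Multiset.card (Multiset.map z univ.val) = b := by simp
    rw [corrFun_of_stable _ _ (by rw [hc]; exact hgb), corF, hc, hP, map_mul, eval_C]
  odd g z s h _ _ := by
    rw [corrFun_of_stable _ _ (by rwa [Multiset.card_cons]),
      corrFun_of_stable _ _ (by rwa [Multiset.card_cons]), corF, corF, insM_cons, insM_cons, ins_neg,
      Multiset.card_cons, Multiset.card_cons, map_neg, mul_neg]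
  rational_zero_two := by
    refine ⟨2, C ((2 * lam) ^ 2) * (X 0 ^ 3 * X 1 ^ 3), fun z w hz hw hzw => ?_⟩
    rw [corrFun_pair]
    simp only [map_mul, map_pow, eval_C, eval_X, Matrix.cons_val_zero, Matrix.cons_val_one]
    field_simp
    ring
  schwinger_dyson_zero_two z w hne hadm := by
    have hz := hadm.1 z (by simp)
    have hw := hadm.1 w (by simp)
    have hsum := hadm.2 z (by simp) w (by simp) hne
    have hzw : z ^ 2 - w ^ 2 ≠ 0 := by
      rw [show z ^ 2 - w ^ 2 = (z - w) * (z + w) by ring]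
      exact mul_ne_zero (sub_ne_zero.2 hne) hsum
    simp only [corrFun_pair]
    simp only [M.schwinger_dyson_zero_two_at hlam _ hz.2 hw.2 hz.1 hw.1 hzw]
    exact tendsto_const_nhds
  schwinger_dyson g z J hgJ hzJ hadm := by
    obtain ⟨k, hk⟩ : ∃ k, k + 2 = 2 * g + J.card := ⟨2 * g + J.card - 2, by omega⟩
    have hz := hadm.1 z (Finset.mem_insert_self _ _)
    have hJ0 : ∀ w ∈ J, w ≠ 0 := fun w hw => (hadm.1 w (Finset.mem_insert_of_mem hw)).1
    have hJ : ∀ w ∈ J, ∀ v ∈ J, w ≠ v → w + v ≠ 0 := fun w hw v hv =>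
      hadm.2 w (Finset.mem_insert_of_mem hw) v (Finset.mem_insert_of_mem hv)
    have hzJ' : ∀ w ∈ J, z ^ 2 - w ^ 2 ≠ 0 := fun w hw => by
      have hne : z ≠ w := fun h => hzJ (h ▸ hw)
      rw [show z ^ 2 - w ^ 2 = (z - w) * (z + w) by ring]
      exact mul_ne_zero (sub_ne_zero.2 hne)
        (hadm.2 z (Finset.mem_insert_self _ _) w (Finset.mem_insert_of_mem hw) hne)
    obtain ⟨N, hN⟩ := exists_vars_lt (insM J.val (numSol ρ (k + 1)))
    obtain ⟨K₀, hK₀⟩ := (isVirasoroSolution_numSol h0).schwinger_dyson (numSol_zero ρ)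
      (hasDeg_numSol ρ) hk hz.1 hJ0 hJ hzJ'
    have hSD := hK₀ (max K₀ N) (le_max_left _ _)
    set E := 4 * g + 3 * J.card - 1 with hE
    have hlim := M.tendsto_khat_odd hlam hρ N
      (fun n => (2 * lam) ^ E * constantCoeff (pderiv n (insM J.val (numSol ρ (k + 1))))) hz.2 hz.1
    have hfun : (fun v => corrFun lam ρ g (v ::ₘ J.val)) = fun v => ∑ n ∈ range N,
        ((2 * lam) ^ E * constantCoeff (pderiv n (insM J.val (numSol ρ (k + 1))))) *
          v⁻¹ ^ (2 * n + 3) := by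
      funext v
      rw [corrFun_cons lam ρ (by rwa [Finset.card_val]), constantCoeff_ins hN, Finset.mul_sum,
        Finset.card_val]
      exact Finset.sum_congr rfl fun n _ => (mul_assoc _ _ _).symm
    rw [← hfun] at hlim
    have hval : ∑ n ∈ range N, (2 * lam) ^ E *
        constantCoeff (pderiv n (insM J.val (numSol ρ (k + 1)))) *
          ∑ j ∈ range (n + 1), ρ j * z⁻¹ ^ (2 * (n + 1 - j))
        = (2 * lam) ^ E * (ρ 0 * ∑ m ∈ range (max K₀ N), z⁻¹ ^ (2 * m + 2) *
          constantCoeff (insM J.val (opK (fun j => ρ j / ρ 0) m (numSol ρ (k + 1))))) := by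
      simp only [insM_opK]
      rw [← sum_opK_eq h0 hN (le_max_right _ _), Finset.mul_sum]
      exact Finset.sum_congr rfl fun n _ => mul_assoc _ _ _
    rw [hval] at hlim
    -- The exponent 4g + 3b - 4 is chosen such that all terms of the equation scale with the same
    -- power `E`; the factor λ = (2λ)/2 gives the coefficient 1/2.
    have e1 : lam * (if g = 0 then 0 else corrFun lam ρ (g - 1) (z ::ₘ z ::ₘ J.val))
        = (2 * lam) ^ E * (1 / 2 *
          (if g = 0 then 0 else fullCor (numSol ρ) (g - 1) (z ::ₘ z ::ₘ J.val))) := by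
      split_ifs with hg
      · ring
      · rw [corrFun, Multiset.card_cons, Multiset.card_cons, Finset.card_val,
          show E = 4 * (g - 1) + 3 * (J.card + 1 + 1) - 4 + 1 by omega, pow_succ]
        ring
    have e2 : lam * (∑ h ∈ Finset.range (g + 1), ∑ I ∈ J.powerset,
          if (h = 0 ∧ I = ∅) ∨ (h = g ∧ I = J) then 0
          else corrFun lam ρ h (z ::ₘ I.val) * corrFun lam ρ (g - h) (z ::ₘ (J \ I).val))
        = (2 * lam) ^ E * (1 / 2 * (∑ h ∈ Finset.range (g + 1), ∑ I ∈ J.powerset,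
          if (h = 0 ∧ I = ∅) ∨ (h = g ∧ I = J) then 0
          else fullCor (numSol ρ) h (z ::ₘ I.val) *
            fullCor (numSol ρ) (g - h) (z ::ₘ (J \ I).val))) := by
      simp only [Finset.mul_sum]
      refine Finset.sum_congr rfl fun h hh => Finset.sum_congr rfl fun I hI => ?_
      rw [Finset.mem_range] at hh
      rw [Finset.mem_powerset] at hI
      split_ifs with hc
      · ring
      · push Not at hc
        have hcard := Finset.card_sdiff_add_card_eq_card hI
        have h1 : h = 0 → I.card ≠ 0 := fun hh => (hc.1 hh).card_pos.ne'
        have h2 : h = g → (J \ I).card ≠ 0 := fun hh h' => hc.2 hh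
          (hI.antisymm (Finset.sdiff_eq_empty_iff_subset.1 (Finset.card_eq_zero.1 h')))
        rw [corrFun, corrFun, Multiset.card_cons, Multiset.card_cons, Finset.card_val,
          Finset.card_val, show E = (4 * h + 3 * (I.card + 1) - 4)
            + (4 * (g - h) + 3 * ((J \ I).card + 1) - 4) + 1 by omega, pow_succ, pow_add]
        ring
    have e3 : (2 * lam) ^ 3 * ∑ ζ ∈ J, 1 / ζ *
          deriv (fun w => (corrFun lam ρ g (z ::ₘ (J.erase ζ).val)
            - corrFun lam ρ g (w ::ₘ (J.erase ζ).val)) / (z ^ 2 - w ^ 2)) ζ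
        = (2 * lam) ^ E * ∑ ζ ∈ J, 1 / ζ *
          deriv (fun w => (fullCor (numSol ρ) g (z ::ₘ (J.erase ζ).val)
            - fullCor (numSol ρ) g (w ::ₘ (J.erase ζ).val)) / (z ^ 2 - w ^ 2)) ζ := by
      simp only [Finset.mul_sum]
      refine Finset.sum_congr rfl fun ζ hζ => ?_
      have hcard := Finset.card_erase_add_one hζ
      have hd : (fun w => (corrFun lam ρ g (z ::ₘ (J.erase ζ).val)
            - corrFun lam ρ g (w ::ₘ (J.erase ζ).val)) / (z ^ 2 - w ^ 2))
          = fun w => (2 * lam) ^ (4 * g + 3 * ((J.erase ζ).card + 1) - 4) *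
            ((fullCor (numSol ρ) g (z ::ₘ (J.erase ζ).val)
            - fullCor (numSol ρ) g (w ::ₘ (J.erase ζ).val)) / (z ^ 2 - w ^ 2)) := by
        funext w
        rw [corrFun, corrFun, Multiset.card_cons, Multiset.card_cons, Finset.card_val]
        ring
      rw [hd, deriv_const_mul_field,
        show E = 4 * g + 3 * ((J.erase ζ).card + 1) - 4 + 3 by omega, pow_add]
      ring
    rw [e1, e2, e3]
    simp only [add_assoc]
    have := hlim.add (tendsto_const_nhds (x := (2 * lam) ^ E * (1 / 2 *
          (if g = 0 then 0 else fullCor (numSol ρ) (g - 1) (z ::ₘ z ::ₘ J.val)))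
        + ((2 * lam) ^ E * (1 / 2 * (∑ h ∈ Finset.range (g + 1), ∑ I ∈ J.powerset,
          if (h = 0 ∧ I = ∅) ∨ (h = g ∧ I = J) then 0
          else fullCor (numSol ρ) h (z ::ₘ I.val) *
            fullCor (numSol ρ) (g - h) (z ::ₘ (J \ I).val)))
        + (2 * lam) ^ E * ∑ ζ ∈ J, 1 / ζ *
          deriv (fun w => (fullCor (numSol ρ) g (z ::ₘ (J.erase ζ).val)
            - fullCor (numSol ρ) g (w ::ₘ (J.erase ζ).val)) / (z ^ 2 - w ^ 2)) ζ)))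
    convert this using 2
    rw [inv_mul_eq_div, add_div', div_eq_zero_iff] at hSD
    rcases hSD with hSD | hSD
    · linear_combination -(2 * lam) ^ E * hSD
    · exact absurd hSD h0
    · exact h0

end Kontsevich


namespace Kontsevich

open MvPolynomial Finset Airy

/-! ## The free energies -/

theorem exists_laurent (p : TimeRing) : ∃ (q : MvPolynomial ℕ ℂ) (n : ℕ), ∀ ρ : ℕ → ℂ, ρ 0 ≠ 0 →
    evT ρ p = MvPolynomial.eval ρ q / ρ 0 ^ n := by
  induction p using MvPolynomial.induction_on with
  | C r => exact ⟨C r, 0, fun ρ _ => by rw [evT_C, eval_C, pow_zero, div_one]⟩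
  | add p p' hp hp' =>
    obtain ⟨q, n, h⟩ := hp
    obtain ⟨q', n', h'⟩ := hp'
    refine ⟨q * X 0 ^ n' + q' * X 0 ^ n, n + n', fun ρ h0 => ?_⟩
    rw [map_add, h ρ h0, h' ρ h0]
    simp only [map_add, map_mul, map_pow, eval_X]
    rw [div_add_div _ _ (pow_ne_zero n h0) (pow_ne_zero n' h0), pow_add, mul_comm (ρ 0 ^ n)]
  | mul_X p k hp =>
    obtain ⟨q, n, h⟩ := hp
    refine ⟨q * if k = 0 then 1 else X k, n + 1, fun ρ h0 => ?_⟩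
    rw [map_mul, h ρ h0, evT, eval_X, map_mul, pow_succ]
    split_ifs
    · rw [map_one, mul_one, div_mul_eq_div_div, div_eq_mul_inv _ (ρ 0)]
    · rw [eval_X, div_mul_div_comm]

theorem constantCoeff_pderiv_numSol (ρ : ℕ → ℂ) (k i : ℕ) :
    constantCoeff (pderiv i (numSol ρ k)) = evT ρ (cor₁ k (i + 1)) := by
  rw [cor₁, ← shiftD_succ, numSol, ← map_shiftD, constantCoeff_map]

theorem corrFun_singleton (lam : ℂ) (ρ : ℕ → ℂ) {g : ℕ} (hg : 2 ≤ g) {N : ℕ}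
    (hN : varBound (2 * g - 1) ≤ N) (z : ℂ) : corrFun lam ρ g {z} =
      (2 * lam) ^ (4 * g - 1) * ∑ k ∈ range N, evT ρ (cor₁ (2 * g - 1) (k + 1)) *
        z⁻¹ ^ (2 * k + 3) := by
  have hv : ∀ i ∈ (numSol ρ (2 * g - 1)).vars, i < N := fun i hi =>
    (lt_varBound' (vars_map _ _ hi)).trans_le hN
  rw [← Multiset.cons_zero, corrFun_cons lam ρ (k := 2 * g - 2) (by simp; omega), insM_zero,
    show 2 * g - 2 + 1 = 2 * g - 1 by omega, constantCoeff_ins hv, Multiset.card_zero]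
  simp only [constantCoeff_pderiv_numSol]
  rfl

theorem isTimeFun_freeEnergyFun (lam : ℂ) (g : ℕ) :
    IsTimeFun (freeEnergyFun lam g) (C ((2 * lam) ^ (4 * (g - 1))) * freeEnergy g) := fun ρ _ => by
  rw [freeEnergyFun, map_mul, evT_C]

theorem creationOp_freeEnergyFun (lam : ℂ) {ρ : ℕ → ℂ} (h0 : ρ 0 ≠ 0) {g : ℕ} (hg : 2 ≤ g) (z : ℂ) :
    (2 * lam) ^ 3 * creationOp z (freeEnergyFun lam g) ρ = corrFun lam ρ g {z} := by
  obtain ⟨N', hN'⟩ := exists_vars_lt (freeEnergy g)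
  set N := max (max N' 1) (varBound (2 * g - 1)) with hNdef
  have hN : ∀ i ∈ (freeEnergy g).vars, i < N := fun i hi => by have := hN' i hi; omega
  have hpd : ∀ l, pd l (freeEnergyFun lam g) ρ
      = (2 * lam) ^ (4 * (g - 1)) * evT ρ (derT l (freeEnergy g)) := fun l => by
    rw [(isTimeFun_freeEnergyFun lam g).pd l ρ h0, derivation_C_mul' (derT l), map_mul, evT_C]
  have hfs : creationOp z (freeEnergyFun lam g) ρ = ∑ l ∈ range N,
      (-((3 + 2 * (l : ℂ)) * ρ (l + 1) / (ρ 0 * z ^ 3)) + (3 + 2 * (l : ℂ)) / z ^ (5 + 2 * l))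
        * pd l (freeEnergyFun lam g) ρ := by
    refine finsum_eq_sum_of_support_subset _ fun l hl => ?_
    rw [Finset.coe_range, Set.mem_Iio]
    by_contra hcon
    refine hl ?_
    obtain ⟨j, rfl⟩ : ∃ j, l = j + 1 := ⟨l - 1, by omega⟩
    beta_reduce
    rw [hpd, derT_eq_zero hN (by omega), map_zero, mul_zero, mul_zero]
  have h1 : evT ρ (cor₁ (2 * g - 1) 1) = -∑ l ∈ range N,
      (3 + 2 * (l : ℂ)) * (ρ (l + 1) / ρ 0) * evT ρ (derT l (freeEnergy g)) := by
    rw [← creD_freeEnergy hg, creD_one_eq_sum hN (by omega), map_neg, map_sum]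
    congr 1
    refine Finset.sum_congr rfl fun l _ => ?_
    rw [map_mul, map_mul, evT_ratT h0, map_add, map_mul, map_natCast, map_ofNat, map_ofNat, add_comm]
  have h2 : ∀ l : ℕ, (3 + 2 * (l : ℂ)) * evT ρ (derT l (freeEnergy g))
      = evT ρ (cor₁ (2 * g - 1) (l + 1 + 1)) := fun l => by
    rw [show l + 1 + 1 = l + 2 from rfl, ← derT_freeEnergy hg, map_mul, map_add, map_mul, map_natCast, map_ofNat, map_ofNat,
      add_comm]
  rw [hfs, corrFun_singleton lam ρ hg (N := N + 1) (by omega), Finset.sum_range_succ', h1]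
  simp only [hpd, ← h2]
  rw [← Finset.sum_neg_distrib, Finset.sum_mul, ← Finset.sum_add_distrib, Finset.mul_sum,
    Finset.mul_sum, show 4 * g - 1 = 4 * (g - 1) + 3 by omega, pow_add]
  refine Finset.sum_congr rfl fun l _ => ?_
  simp only [div_eq_mul_inv, mul_inv, ← inv_pow]
  ring

/-- The integrand is a combination of the powers z^{2l+1-2k}; the residue picks k = l + 1. -/
theorem annihilationOp_laurent (ρ : ℕ → ℂ) (N : ℕ) (c : ℕ → ℂ) {f : ℂ → ℂ}
    (hf : ∀ z : ℂ, z ≠ 0 → f z = ∑ k ∈ range (N + 1), c k * z⁻¹ ^ (2 * k + 3)) :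
    annihilationOp ρ f = -∑ l ∈ range N, ρ l / (3 + 2 * (l : ℂ)) * c (l + 1) := by
  have hint : ∀ l, (2 * (Real.pi : ℂ) * Complex.I)⁻¹ *
      ∮ z in C(0, 1), z ^ (4 + 2 * l) * ρ l / (3 + 2 * (l : ℂ)) * f z
      = if l < N then ρ l / (3 + 2 * (l : ℂ)) * c (l + 1) else 0 := by
    intro l
    have h1 : (∮ z in C(0, 1), z ^ (4 + 2 * l) * ρ l / (3 + 2 * (l : ℂ)) * f z)
        = ∮ z in C(0, 1), ∑ k ∈ range (N + 1), (ρ l / (3 + 2 * (l : ℂ)) * c k) *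
          (z - 0) ^ (2 * (l : ℤ) + 1 - 2 * k) := by
      refine circleIntegral.integral_congr zero_le_one fun z hz => ?_
      have hz0 : z ≠ 0 := by
        rintro rfl
        simp at hz
      rw [hf z hz0, Finset.mul_sum]
      refine Finset.sum_congr rfl fun k _ => ?_
      have : (z - 0) ^ (2 * (l : ℤ) + 1 - 2 * k) = z ^ (4 + 2 * l) * z⁻¹ ^ (2 * k + 3) := by
        rw [sub_zero, inv_pow, ← div_eq_mul_inv, ← zpow_natCast, ← zpow_natCast, ← zpow_sub₀ hz0]
        congr 1
        push_cast
        ring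
      rw [this]
      ring
    have hmem : ∀ n : ℤ, CircleIntegrable (fun z : ℂ => (z - 0) ^ n) 0 1 := fun n =>
      (circleIntegrable_sub_zpow_iff).2 (by simp)
    rw [h1, circleIntegral.integral_fun_sum (f := fun k (z : ℂ) => ρ l / (3 + 2 * (l : ℂ)) * c k *
      (z - 0) ^ (2 * (l : ℤ) + 1 - 2 * k)) fun k _ => (hmem _).const_smul (a := ρ l / (3 + 2 * (l : ℂ)) * c k)]
    simp only [circleIntegral.integral_const_mul]
    have h2 : ∀ k : ℕ, (∮ z in C(0, 1), (z - 0 : ℂ) ^ (2 * (l : ℤ) + 1 - 2 * k))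
        = if k = l + 1 then 2 * (Real.pi : ℂ) * Complex.I else 0 := by
      intro k
      split_ifs with hk
      · rw [← circleIntegral.integral_sub_center_inv (0 : ℂ) one_ne_zero,
          show 2 * (l : ℤ) + 1 - 2 * k = -1 by rw [hk]; push_cast; ring]
        simp only [zpow_neg_one]
      · exact circleIntegral.integral_sub_zpow_of_ne (by omega) _ _ _
    simp only [h2, mul_ite, mul_zero, Finset.sum_ite_eq', Finset.mem_range]
    simp only [Nat.add_lt_add_iff_right]
    split_ifs
    · rw [mul_comm, mul_assoc, mul_inv_cancel₀ Complex.two_pi_I_ne_zero, mul_one]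
    · rfl
  rw [annihilationOp]
  simp only [hint]
  rw [finsum_eq_sum_of_support_subset (s := range N)]
  · congr 1
    exact Finset.sum_congr rfl fun l hl => if_pos (Finset.mem_range.1 hl)
  · intro l hl
    rw [Finset.coe_range, Set.mem_Iio]
    by_contra hcon
    exact hl (if_neg hcon)

/-- `invT_mul_freeEnergy` is the annihilation formula in the normalisation 2λ = 1; the residues of
the one-point function are its left-out coefficients with index at least 2. -/
theorem freeEnergyFun_eq_annihilationOp {lam : ℂ} (hlam : lam ≠ 0) {ρ : ℕ → ℂ} (h0 : ρ 0 ≠ 0)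
    {g : ℕ} (hg : 2 ≤ g) {f : ℂ → ℂ} (hf : ∀ z, z ≠ 0 → f z = corrFun lam ρ g {z}) :
    freeEnergyFun lam g ρ = 1 / ((2 * (g : ℂ) - 2) * (2 * lam) ^ 3) * annihilationOp ρ f := by
  set N := varBound (2 * g - 1)
  have h := congrArg (evT ρ) (invT_mul_freeEnergy hg (N := N) le_rfl)
  rw [annihilationOp_laurent ρ N
    (fun k => (2 * lam) ^ (4 * g - 1) * evT ρ (cor₁ (2 * g - 1) (k + 1))) (fun z hz => by
      rw [hf z hz, corrFun_singleton lam ρ hg (N := N + 1) (by omega), Finset.mul_sum]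
      exact Finset.sum_congr rfl fun k _ => (mul_assoc _ _ _).symm)]
  have hg2 : (2 * (g : ℂ) - 2) ≠ 0 := by
    have : ((2 * g - 2 : ℕ) : ℂ) ≠ 0 := Nat.cast_ne_zero.2 (by omega)
    rw [Nat.cast_sub (by omega)] at this
    push_cast at this
    exact this
  rw [freeEnergyFun, eq_comm, one_div, inv_mul_eq_iff_eq_mul₀ (mul_ne_zero hg2
    (pow_ne_zero 3 (mul_ne_zero two_ne_zero hlam)))]
  simp only [map_mul, map_neg, map_sum, evT_C, evT_invT, evT_ratT h0] at h
  have hs : ∑ l ∈ range N, ρ l / (3 + 2 * (l : ℂ)) *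
      ((2 * lam) ^ (4 * g - 1) * evT ρ (cor₁ (2 * g - 1) (l + 1 + 1)))
      = (2 * lam) ^ (4 * g - 1) * ρ 0 * ∑ l ∈ range N, 1 / (2 * (l : ℂ) + 3) * (ρ l / ρ 0) *
        evT ρ (cor₁ (2 * g - 1) (l + 2)) := by
    rw [Finset.mul_sum]
    refine Finset.sum_congr rfl fun l _ => ?_
    rw [add_comm (3 : ℂ)]
    field_simp
  rw [hs, show 4 * g - 1 = 4 * (g - 1) + 3 by omega, pow_add]
  have h' := congrArg (ρ 0 * ·) h
  rw [mul_left_comm, mul_inv_cancel_left₀ h0] at h'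
  linear_combination -(2 * lam) ^ (4 * (g - 1)) * (2 * lam) ^ 3 * h'

theorem isFreeEnergy_freeEnergyFun {lam : ℂ} (hlam : lam ≠ 0) {g : ℕ} (hg : 2 ≤ g) :
    IsFreeEnergy lam g (freeEnergyFun lam g) where
  laurent := by
    obtain ⟨q, n, h⟩ := exists_laurent (C ((2 * lam) ^ (4 * (g - 1))) * freeEnergy g)
    exact ⟨q, n, fun ρ h0 => by rw [← h ρ h0, isTimeFun_freeEnergyFun lam g ρ h0]⟩
  creation M ρ hρ h0 G hG z hz := by
    rw [creationOp_freeEnergyFun lam h0 hg z]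
    exact CubicModel.IsCorrelationFamily.unique hlam hρ h0 hG
      (isCorrelationFamily_corrFun hlam M hρ h0) g {z} (by simpa using hz) (by simp) (by simp; omega)
  annihilation M ρ hρ h0 G hG := freeEnergyFun_eq_annihilationOp hlam h0 hg fun z hz =>
    CubicModel.IsCorrelationFamily.unique hlam hρ h0 hG
      (isCorrelationFamily_corrFun hlam M hρ h0) g {z} (by simpa using hz) (by simp) (by simp; omega)

/-- The free energies are determined at the Kontsevich times of a model. -/
theorem _root_.IsFreeEnergy.eq_at_model {lam : ℂ} (hlam : lam ≠ 0) {g : ℕ} (hg : 2 ≤ g)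
    {f : (ℕ → ℂ) → ℂ} (hf : IsFreeEnergy lam g f) (M : CubicModel lam) {ρ : ℕ → ℂ}
    (hρ : M.HasKontsevichTimes ρ) (h0 : ρ 0 ≠ 0) : f ρ = freeEnergyFun lam g ρ := by
  have hG := isCorrelationFamily_corrFun hlam M hρ h0
  rw [hf.annihilation M ρ hρ h0 _ hG,
    (isFreeEnergy_freeEnergyFun hlam hg).annihilation M ρ hρ h0 _ hG]

end Kontsevich


/-! ## The Kontsevich times of finite matrices -/

namespace CubicModel

/-- The model of finite matrices with eigenvalues `1 + 2i`, `i < N`, of (real) multiplicities `m`. -/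
def finiteModel (lam : ℂ) {N : ℕ} (m : Fin N → ℝ) : CubicModel lam where
  e x := x
  r := ∑ i, ENNReal.ofReal (m i) • Measure.dirac (i : ℝ)
  c := 0
  Z _ := 1
  nu _ := 0
  e_zero := rfl
  e_mono := monotone_id.monotoneOn _
  integrable := (integrable_finsetSum_measure.2 fun _ _ =>
    (integrable_dirac enorm_lt_top).smul_measure ENNReal.ofReal_ne_top).integrableOn
  c_mem := by simp
  Z_ne_zero _ := one_ne_zero
  Z_bounded := ⟨1, fun _ => by simp⟩

theorem finiteModel_pt (lam : ℂ) {N : ℕ} (m : Fin N → ℝ) (i : ℕ) :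
    (finiteModel lam m).pt (i : ℝ) = 1 + 2 * i := by
  have h : 0 < (1 + 2 * (i : ℂ)).re := by
    have : (1 + 2 * (i : ℂ)) = ((1 + 2 * i : ℝ) : ℂ) := by push_cast; rfl
    rw [this, Complex.ofReal_re]
    positivity
  simp only [pt, finiteModel, add_zero, one_div, Complex.ofReal_natCast]
  exact Complex.sq_cpow_two_inv h

theorem finiteModel_cutIntegral (lam : ℂ) {N : ℕ} {m : Fin N → ℝ} (hm : ∀ i, 0 ≤ m i) {L : ℝ}
    (hL : N ≤ L) (φ : ℂ → ℂ) : (finiteModel lam m).cutIntegral L φ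
      = ∑ i, (m i : ℂ) * (8 * lam ^ 2 * φ (1 + 2 * (i : ℕ))) := by
  have hr : (finiteModel lam m).r.restrict (Set.Icc 0 L) = (finiteModel lam m).r := by
    refine Measure.restrict_eq_self_of_ae_mem ?_
    rw [ae_iff]
    change (∑ i, ENNReal.ofReal (m i) • Measure.dirac ((i : ℕ) : ℝ)) {a | a ∉ Set.Icc 0 L} = 0
    rw [Measure.finsetSum_apply]
    refine Finset.sum_eq_zero fun i _ => ?_
    have hi : ((i : ℕ) : ℝ) ∈ Set.Icc 0 L :=
      ⟨Nat.cast_nonneg _, (Nat.cast_le.2 i.2.le).trans hL⟩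
    rw [Measure.smul_apply, show {a | a ∉ Set.Icc 0 L} = (Set.Icc 0 L)ᶜ from rfl,
      Measure.dirac_apply, Set.indicator_of_notMem (Set.notMem_compl_iff.2 hi), smul_zero]
  rw [cutIntegral, hr]
  change ∫ x, _ ∂(∑ i, ENNReal.ofReal (m i) • Measure.dirac ((i : ℕ) : ℝ)) = _
  rw [integral_finsetSum_measure fun _ _ =>
    (integrable_dirac enorm_lt_top).smul_measure ENNReal.ofReal_ne_top]
  refine Finset.sum_congr rfl fun i _ => ?_
  rw [integral_smul_measure, integral_dirac, ENNReal.toReal_ofReal (hm i), finiteModel_pt,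
    Complex.real_smul]

theorem finiteModel_hasKontsevichTimes (lam : ℂ) {N : ℕ} {m : Fin N → ℝ} (hm : ∀ i, 0 ≤ m i) :
    (finiteModel lam m).HasKontsevichTimes fun l => (if l = 0 then 1 else 0)
      - ∑ i : Fin N, 4 * lam ^ 2 / (1 + 2 * ((i : ℕ) : ℂ)) ^ (3 + 2 * l) * m i := by
  intro l
  refine tendsto_const_nhds.congr' ?_
  filter_upwards [eventually_ge_atTop (N : ℝ)] with L hL
  rw [finiteModel_cutIntegral lam hm hL, Finset.mul_sum]
  have h1 : (finiteModel lam m).sqrtZ L = 1 := by simp [sqrtZ, finiteModel]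
  rw [h1, div_one]
  congr 1
  refine Finset.sum_congr rfl fun i _ => ?_
  ring

end CubicModel

/-! ### Density of the times of finite matrices and uniqueness of the free energies -/

namespace Kontsevich

open MvPolynomial Finset

/-- The first N times are linear in the multiplicities with a Vandermonde matrix in the distinct
numbers (1+2i)⁻², up to a nonzero scaling, so complex multiplicities attain any values. -/
theorem exists_multiplicities {lam : ℂ} (hlam : lam ≠ 0) (N : ℕ) (b : ℕ → ℂ) :
    ∃ m : Fin N → ℂ, ∀ l < N, ∑ i : Fin N, 4 * lam ^ 2 / (1 + 2 * ((i : ℕ) : ℂ)) ^ (3 + 2 * l) * m i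
      = b l := by
  set v : Fin N → ℂ := fun i => ((1 + 2 * ((i : ℕ) : ℂ)) ^ 2)⁻¹ with hv
  have ht : ∀ i : ℕ, (1 + 2 * (i : ℂ)) ≠ 0 := fun i => by
    have : ((1 + 2 * i : ℕ) : ℂ) ≠ 0 := Nat.cast_ne_zero.2 (by omega)
    push_cast at this
    exact this
  have hinj : Function.Injective v := by
    intro i j hij
    have h1 := inv_injective hij
    have h2 : (((1 + 2 * (i : ℕ)) ^ 2 : ℕ) : ℂ) = (((1 + 2 * (j : ℕ)) ^ 2 : ℕ) : ℂ) := by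
      push_cast; exact h1
    have h3 := Nat.pow_left_injective (n := 2) two_ne_zero (Nat.cast_injective h2)
    beta_reduce at h3
    exact Fin.ext (by omega)
  obtain ⟨x, hx⟩ := Matrix.vecMul_surjective_iff_isUnit.2
    ((Matrix.isUnit_iff_isUnit_det _).2 (Matrix.det_vandermonde_ne_zero_iff.2 hinj).isUnit)
    fun l : Fin N => b l
  refine ⟨fun i => x i * (1 + 2 * ((i : ℕ) : ℂ)) ^ 3 / (4 * lam ^ 2), fun l hl => ?_⟩
  rw [show b l = ∑ i, x i * Matrix.vandermonde v i ⟨l, hl⟩ from (congrFun hx ⟨l, hl⟩).symm]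
  refine Finset.sum_congr rfl fun i _ => ?_
  have := ht i
  rw [Matrix.vandermonde_apply, hv, pow_add, pow_mul, inv_pow]
  field_simp

/-- A polynomial in the Kontsevich times that vanishes for all finite matrices vanishes. -/
theorem eval_eq_zero_of_finiteModel {lam : ℂ} (hlam : lam ≠ 0) {D : MvPolynomial ℕ ℂ}
    (hD : ∀ (N : ℕ) (m : Fin N → ℝ), (∀ i, 0 ≤ m i) →
      MvPolynomial.eval (fun l => (if l = 0 then 1 else 0)
        - ∑ i : Fin N, 4 * lam ^ 2 / (1 + 2 * ((i : ℕ) : ℂ)) ^ (3 + 2 * l) * m i) D = 0) (ρ : ℕ → ℂ) :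
    MvPolynomial.eval ρ D = 0 := by
  obtain ⟨N, hN⟩ := Airy.exists_vars_lt D
  set σ : MvPolynomial ℕ ℂ →ₐ[ℂ] MvPolynomial (Fin N) ℂ := aeval fun l => C (if l = 0 then 1 else 0)
    - ∑ i : Fin N, C (4 * lam ^ 2 / (1 + 2 * ((i : ℕ) : ℂ)) ^ (3 + 2 * l)) * X i with hσ
  have hev : ∀ m : Fin N → ℂ, MvPolynomial.eval m (σ D)
      = MvPolynomial.eval (fun l => (if l = 0 then 1 else 0)
        - ∑ i : Fin N, 4 * lam ^ 2 / (1 + 2 * ((i : ℕ) : ℂ)) ^ (3 + 2 * l) * m i) D := by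
    intro m
    have : (MvPolynomial.eval m).comp (σ : MvPolynomial ℕ ℂ →+* MvPolynomial (Fin N) ℂ)
        = MvPolynomial.eval (fun l => (if l = 0 then 1 else 0)
        - ∑ i : Fin N, 4 * lam ^ 2 / (1 + 2 * ((i : ℕ) : ℂ)) ^ (3 + 2 * l) * m i) := by
      refine MvPolynomial.ringHom_ext (fun r => ?_) fun l => ?_
      · simp
      · simp [hσ]
    exact DFunLike.congr_fun this D
  -- Actual models have nonnegative real multiplicities. A polynomial in the multiplicities
  -- vanishing on such a product of infinite sets is zero, and can then be evaluated at complex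
  -- multiplicities.
  have hz : σ D = 0 := by
    refine MvPolynomial.funext_set (fun _ => (fun x : ℝ => (x : ℂ)) '' Set.Ici 0) (fun _ => ?_)
      fun x hx => ?_
    · exact (Set.Ici_infinite 0).image Complex.ofReal_injective.injOn
    · choose m hm hmx using fun i => hx i (Set.mem_univ i)
      obtain rfl : (fun i => (m i : ℂ)) = x := funext hmx
      rw [hev, hD N m hm, map_zero]
  obtain ⟨m, hm⟩ := exists_multiplicities hlam N fun l => (if l = 0 then 1 else 0) - ρ l
  have h := hev m
  rw [hz, map_zero] at h
  rw [h]
  refine MvPolynomial.eval₂Hom_congr' rfl (fun l hl _ => ?_) rfl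
  rw [hm l (hN l hl)]
  ring

/-- The free energies are unique. -/
theorem _root_.IsFreeEnergy.eq_freeEnergyFun {lam : ℂ} (hlam : lam ≠ 0) {g : ℕ} (hg : 2 ≤ g)
    {f : (ℕ → ℂ) → ℂ} (hf : IsFreeEnergy lam g f) {ρ : ℕ → ℂ} (h0 : ρ 0 ≠ 0) :
    f ρ = freeEnergyFun lam g ρ := by
  obtain ⟨p, n, hp⟩ := hf.laurent
  obtain ⟨q, n', hq⟩ := (isFreeEnergy_freeEnergyFun hlam hg).laurent
  -- The additional factor x_0 makes the polynomial vanish also at those finite models whose ρ_0 is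
  -- zero, where the free energies are not compared.
  have h := eval_eq_zero_of_finiteModel hlam (D := (p * X 0 ^ n' - q * X 0 ^ n) * X 0)
    (fun N m hm => ?_) ρ
  · rw [map_mul, eval_X, mul_eq_zero, or_iff_left h0, map_sub, map_mul, map_mul, map_pow, map_pow,
      eval_X, sub_eq_zero] at h
    rw [hp ρ h0, hq ρ h0, div_eq_div_iff (pow_ne_zero _ h0) (pow_ne_zero _ h0), h]
  · set τ : ℕ → ℂ := fun l => (if l = 0 then 1 else 0)
        - ∑ i : Fin N, 4 * lam ^ 2 / (1 + 2 * ((i : ℕ) : ℂ)) ^ (3 + 2 * l) * m i with hτ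
    rw [map_mul, eval_X]
    by_cases ht : τ 0 = 0
    · rw [ht, mul_zero]
    · have he := hf.eq_at_model hlam hg (CubicModel.finiteModel lam m)
        (CubicModel.finiteModel_hasKontsevichTimes lam hm) ht
      rw [hp τ ht, hq τ ht, div_eq_div_iff (pow_ne_zero _ ht) (pow_ne_zero _ ht)] at he
      rw [map_sub, map_mul, map_mul, map_pow, map_pow, eval_X, he, sub_self, zero_mul]

end Kontsevich

end

theorem theorem3p3 (lam : ℂ) (hlam : lam ≠ 0) :
    (∀ (M : CubicModel lam) (ρ : ℕ → ℂ), M.HasKontsevichTimes ρ → ρ 0 ≠ 0 →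
      ∃ G : ℕ → Multiset ℂ → ℂ, M.IsCorrelationFamily G) ∧
    (∃ F : ℕ → (ℕ → ℂ) → ℂ, ∀ g, 2 ≤ g → IsFreeEnergy lam g (F g)) ∧
    ∀ F : ℕ → (ℕ → ℂ) → ℂ, (∀ g, 2 ≤ g → IsFreeEnergy lam g (F g)) →
      ∀ ρ : ℕ → ℂ, ρ 0 ≠ 0 → stablePartitionFunction F ρ = expOperatorOne lam ρ :=
  ⟨fun M _ hρ h0 => ⟨_, Kontsevich.isCorrelationFamily_corrFun hlam M hρ h0⟩,
    ⟨Kontsevich.freeEnergyFun lam, fun _ hg => Kontsevich.isFreeEnergy_freeEnergyFun hlam hg⟩,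
    fun _ hF _ h0 => Kontsevich.stablePartitionFunction_eq h0 fun g hg =>
      (hF g hg).eq_freeEnergyFun hlam hg h0⟩
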